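/- Let $S_n$ be the symmetric group on $\{1,\dots,n\}$ and $S=\{(i,i+1) : 1\le i\le n-1\}$ the set of adjacent transpositions. The Kendall $\tau$-distance of $\rho,\pi\in S_n$ is the least number of adjacent transpositions needed to transform $\rho$ into $\pi$, where applying $(i,i+1)$ to $[\rho(1),\dots,\rho(n)]$ exchanges the entries in positions $i$ and $i+1$. Let $P(n,3)$ be the maximum size of a non-empty subset of $S_n$ any two distinct elements of which have Kendall $\tau$-distance at least $3$. For a subgroup $H\le S_n$ with set of right cosets $\mathcal Z=\{Hg : g\in S_n\}$, let $\mathrm{IP}(H)$ be the integer program: maximize $\sum_{z\in\mathcal Z}x_z$ over integers $x_z\ge 0$ $(z\in\mathcal Z)$ subject to $Mx\le |H|\,\mathbf 1$, where $M=\sum_{s\in S\cup\{1\}}\rho(s)$ and $\rho(s)$ is the $\mathcal Z\times\mathcal Z$ matrix whose $(z,w)$ entry is $1$ if $zs=w$ and $0$ otherwise. For a partition $\lambda=(\lambda_1,\dots,\lambda_m)$ of $n$, the Young subgroup of shape $\lambda$ consists of the permutations that preserve each of the blocks $\{1,\dots,\lambda_1\},\{\lambda_1+1,\dots,\lambda_1+\lambda_2\},\dots,\{n-\lambda_m+1,\dots,n\}$.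 Theorem. $P(6,3)\le 116$, $P(7,3)\le 716$, $P(11,3)\le 10!-10$, $P(13,3)\le 12!-12$ and $P(17,3)\le 16!-5$. Moreover, these five bounds are exactly the optimal values of $\mathrm{IP}(H)$ for $H$ the Young subgroup of $S_6,S_7,S_{11},S_{13},S_{17}$ of shape $(2,2,2)$, $(5,1,1)$, $(9,2)$, $(11,2)$ and $(16,1)$, respectively. -/

import Mathlib

namespace KendallCode

section Codes

/-- The adjacent transpositions `(i, i+1)` of `S_n`. -/
def adjSwaps (n : ℕ) : Finset (Equiv.Perm (Fin n)) :=
  Finset.univ.filter fun s => ∃ i j : Fin n, (i : ℕ) + 1 = (j : ℕ) ∧ s = Equiv.swap i j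

/-- The Kendall `τ`-distance: the least number of adjacent transpositions that transform `ρ`
into `π`. Applying `(i, i+1)` to `ρ = [ρ(1), …, ρ(n)]` exchanges the entries in the positions `i`
and `i+1`, which is the product `ρ * (i, i+1)` in Mathlib's convention `(ρ * s) k = ρ (s k)`.
The set is never empty, since the adjacent transpositions generate `S_n`. -/
noncomputable def kendallDist {n : ℕ} (ρ π : Equiv.Perm (Fin n)) : ℕ :=
  sInf {k : ℕ | ∃ l : List (Equiv.Perm (Fin n)),
    (∀ s ∈ l, s ∈ adjSwaps n) ∧ l.length = k ∧ ρ * l.prod = π}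

/-- A permutation code of length `n` whose distinct elements have Kendall `τ`-distance at
least `d`. -/
def IsCode (n d : ℕ) (C : Finset (Equiv.Perm (Fin n))) : Prop :=
  C.Nonempty ∧ ∀ ρ ∈ C, ∀ π ∈ C, ρ ≠ π → d ≤ kendallDist ρ π

open Classical in
/-- `P(n, d)`, the maximum size of a permutation code of length `n` and minimum Kendall
`τ`-distance `d`: a maximum over the finitely many subsets of `S_n`. -/
noncomputable def P (n d : ℕ) : ℕ :=
  (Finset.univ.filter fun C : Finset (Equiv.Perm (Fin n)) => IsCode n d C).sup Finset.card

end Codes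

section Program

/-- The set of right cosets `H g` of a subgroup `H`. -/
def RightCosets {G : Type*} [Group G] (H : Subgroup G) : Type _ :=
  Quotient (QuotientGroup.rightRel H)

noncomputable instance {G : Type*} [Group G] [Finite G] (H : Subgroup G) :
    Fintype (RightCosets H) :=
  have : Finite (RightCosets H) := Quotient.finite _
  Fintype.ofFinite _

/-- The right action `(H g) · g₀ = H (g g₀)` on right cosets. -/
def RightCosets.act {G : Type*} [Group G] {H : Subgroup G} (z : RightCosets H) (g₀ : G) :
    RightCosets H :=
  Quotient.map' (s₁ := QuotientGroup.rightRel H) (s₂ := QuotientGroup.rightRel H) (· * g₀)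
    (by
      intro a b h
      rw [QuotientGroup.rightRel_apply] at h ⊢
      simpa [mul_assoc] using h) z

open Classical in
/-- The permutation matrix of `g` on the right cosets of `H`: its `(z, w)` entry is `1` if
`z · g = w` and `0` otherwise. -/
noncomputable def cosetRep {G : Type*} [Group G] (H : Subgroup G) (g : G) :
    Matrix (RightCosets H) (RightCosets H) ℤ :=
  Matrix.of fun z w => if z.act g = w then 1 else 0

/-- The feasible points of the integer program of `H` and `S`: nonnegative integer vectors `x`
indexed by the right cosets of `H` such that `(∑ s ∈ S ∪ {1}, cosetRep H s) x ≤ |H| 𝟏`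
in every coordinate. -/
def IsFeasible {G : Type*} [Group G] [Finite G] [DecidableEq G] (S : Finset G) (H : Subgroup G)
    (x : RightCosets H → ℤ) : Prop :=
  (∀ z, 0 ≤ x z) ∧
    ∀ z, Matrix.mulVec (∑ s ∈ insert 1 S, cosetRep H s) x z ≤ (Nat.card H : ℤ)

/-- `v` is the optimal value of the integer program: the maximum of `∑ z, x z` over the feasible
points `x`. -/
def IsOptimalValue {G : Type*} [Group G] [Finite G] [DecidableEq G] (S : Finset G)
    (H : Subgroup G) (v : ℤ) : Prop :=
  IsGreatest {w : ℤ | ∃ x : RightCosets H → ℤ, IsFeasible S H x ∧ ∑ z, x z = w} v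

end Program

section Young

/-- The `k`-th block (counted from `0`) of the standard Young tabloid of shape `lam`: the
`lam_k` consecutive points that follow the first `lam_0 + ⋯ + lam_(k-1)` points. -/
def youngBlock (n : ℕ) (lam : List ℕ) (k : ℕ) : Set (Fin n) :=
  {i | (lam.take k).sum ≤ (i : ℕ) ∧ (i : ℕ) < (lam.take (k + 1)).sum}

/-- The Young subgroup of `S_n` of shape `lam`: the permutations that map each block of the
standard tabloid to itself. -/
def youngSubgroup (n : ℕ) (lam : List ℕ) : Subgroup (Equiv.Perm (Fin n)) where
  carrier := {σ | ∀ k i, σ i ∈ youngBlock n lam k ↔ i ∈ youngBlock n lam k}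
  mul_mem' := by
    intro a b ha hb k i
    rw [Equiv.Perm.mul_apply, ha, hb]
  one_mem' := by
    intro k i
    rfl
  inv_mem' := by
    intro a ha k i
    have h : a (a⁻¹ i) = i := a.apply_symm_apply i
    rw [← ha k (a⁻¹ i), h]

end Young

end KendallCode

/-! In a code of minimum distance `3` the balls of radius one are disjoint. Fix a subgroup `H` and
put `x_z = |C ∩ z|` for every right coset `z`. The pairs `(s, g)` with `s ∈ S ∪ {1}` and `g` a
codeword in `z s` inject into `z` by `g s⁻¹`, so `∑_s x_{zs} ≤ |H|`: the vector `x` is feasible, and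
its entries add up to `|C|`. Hence `P(n, 3)` is at most the optimal value of the program for every
`H` (`P_le_of_isOptimalValue`), and five optimal values remain to be found.

A Young subgroup is the stabilizer of a labelling, so its right cosets are words with prescribed
letters, on which `(i, i+1)` exchanges two neighbouring letters. All rows of the symmetric matrix
`M` have sum `n`, so averaging bounds the objective by `(n-1)!`, which the constant vector `|H| / n`
attains. In all five cases `n` does not divide `|H|`, and the task is to measure what integrality
costs.

For `n = 11` and `13`, Wilson's theorem gives `|H| = 2 (n-2)! = n c + 2`. The constant `c` is
feasible with value `(n-1)! - (n-1)`. It is optimal by a charging argument (`mul_sum_max_le`): at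
most four transpositions move a given word, so a point with `x > c` occurs in its own row with large
multiplicity and has to be compensated by values below `c` at its neighbours. Summing up, the excess
over `c` never outweighs the deficit (`isOptimalValue_of_card_eq_mul_add_two`).

For `n = 17` the cosets are the points of a path and `|H| = 16! = 17 c - 1`. Now the deficit `c - x`
must have row sums at least `1`. If it is nonnegative, it dominates the path, so its sum is at least
the domination number `6`; if it is negative somewhere, the charging argument makes its sum even
larger. This gives `17 c - 6 = 16! - 5` (`isOptimalValue_of_card_add_one_eq_mul`).

For `n = 6` and `7` the programs have `90` and `42` variables and averaging gives `120` and `720`.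
Explicit points attain `116` and `716`. That `117` and `717` are impossible is certified by
branch-and-bound trees whose leaves are contradictory nonnegative integer combinations of the rows,
the assumed objective and the cuts on the branch (`BranchTree.sum_lt_of_refutes`). The symmetries of
the set of words, permutations of labels and reversal, carry a cut proved for one set of words to
its whole orbit (`forall_maskSum_of_symmetry`), which is then assumed in the next tree. -/

namespace KendallCode

/-! ### Right cosets, the right action on them, and the rows of the program -/

section Cosets

variable {G : Type*} [Group G] {H : Subgroup G}

/-- The right coset `H g`. -/
def RightCosets.mk (H : Subgroup G) (g : G) : RightCosets H :=
  Quotient.mk (QuotientGroup.rightRel H) g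

theorem RightCosets.ind {motive : RightCosets H → Prop} (h : ∀ g, motive (RightCosets.mk H g))
    (z : RightCosets H) : motive z :=
  Quotient.inductionOn z h

theorem RightCosets.mk_eq_mk {a b : G} :
    RightCosets.mk H a = RightCosets.mk H b ↔ b * a⁻¹ ∈ H :=
  Quotient.eq.trans QuotientGroup.rightRel_apply

@[simp]
theorem RightCosets.act_mk (g g₀ : G) :
    (RightCosets.mk H g).act g₀ = RightCosets.mk H (g * g₀) :=
  rfl

theorem RightCosets.act_one (z : RightCosets H) : z.act 1 = z := by
  induction z using RightCosets.ind with
  | h g => rw [act_mk, mul_one]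

theorem RightCosets.act_act (z : RightCosets H) (a b : G) : (z.act a).act b = z.act (a * b) := by
  induction z using RightCosets.ind with
  | h g => simp [mul_assoc]

theorem RightCosets.act_bijective (a : G) :
    Function.Bijective fun z : RightCosets H => z.act a := by
  refine Function.bijective_iff_has_inverse.2 ⟨fun z => z.act a⁻¹, fun z => ?_, fun z => ?_⟩
  · simp only [act_act, mul_inv_cancel, act_one]
  · simp only [act_act, inv_mul_cancel, act_one]

/-- Inversion exchanges right and left cosets, so Lagrange's theorem applies. The number of cosets
is always read off from this equation and never counted directly. -/
theorem card_rightCosets_mul [Finite G] (H : Subgroup G) :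
    Fintype.card (RightCosets H) * Nat.card H = Nat.card G := by
  have h : Nat.card (RightCosets H) = Nat.card (G ⧸ H) :=
    Nat.card_congr (QuotientGroup.quotientRightRelEquivQuotientLeftRel H)
  rw [← Nat.card_eq_fintype_card, h]
  exact (Subgroup.card_eq_card_quotient_mul_card_subgroup H).symm

/-- The elements of a right coset are as many as those of the subgroup. -/
theorem card_filter_mk_eq [Fintype G] [DecidableEq (RightCosets H)] (z : RightCosets H) :
    (Finset.univ.filter fun g : G => RightCosets.mk H g = z).card = Nat.card H := by
  induction z using RightCosets.ind with
  | h a =>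
    rw [← Fintype.card_subtype, ← Nat.card_eq_fintype_card]
    -- The bijection from `H a` to `H` is `g ↦ a g⁻¹`, with inverse `h ↦ h⁻¹ a`. This orientation
    -- fits `mk_eq_mk`, which puts exactly `a * g⁻¹` into `H`.
    refine Nat.card_congr ⟨fun g => ⟨a * (g : G)⁻¹, RightCosets.mk_eq_mk.1 g.2⟩,
      fun h => ⟨(h : G)⁻¹ * a, RightCosets.mk_eq_mk.2 (by simp)⟩, fun g => ?_, fun h => ?_⟩
    · simp
    · simp

variable [Finite G]

/-- Row `z` of `cosetRep H s` has its single `1` in column `z · s`. So a constraint is a sum of `x`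
over the images of `z`, and a coset fixed by several `s` is counted once for each of them. -/
theorem mulVec_sum_cosetRep (T : Finset G) (x : RightCosets H → ℤ) (z : RightCosets H) :
    Matrix.mulVec (∑ s ∈ T, cosetRep H s) x z = ∑ s ∈ T, x (z.act s) := by
  classical
  rw [Matrix.sum_mulVec, Finset.sum_apply]
  refine Finset.sum_congr rfl fun s _ => ?_
  simp [Matrix.mulVec, dotProduct, cosetRep]

theorem isFeasible_iff [DecidableEq G] {S : Finset G} {x : RightCosets H → ℤ} :
    IsFeasible S H x ↔
      (∀ z, 0 ≤ x z) ∧ ∀ z : RightCosets H, ∑ s ∈ insert 1 S, x (z.act s) ≤ (Nat.card H : ℤ) := by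
  simp only [IsFeasible, mulVec_sum_cosetRep]

end Cosets

/-! ### Codes give feasible points -/

section Codes

variable {n : ℕ}

theorem mul_self_of_mem_adjSwaps {s : Equiv.Perm (Fin n)} (hs : s ∈ adjSwaps n) : s * s = 1 := by
  obtain ⟨i, j, -, rfl⟩ := (Finset.mem_filter.1 hs).2
  exact Equiv.swap_mul_self i j

/-- The distance is an infimum, so every product of adjacent transpositions bounds it from above.
This is the only property of the distance that is needed: short products between codewords have to
be excluded. -/
theorem kendallDist_mul_prod_le (ρ : Equiv.Perm (Fin n)) (l : List (Equiv.Perm (Fin n)))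
    (hl : ∀ s ∈ l, s ∈ adjSwaps n) : kendallDist ρ (ρ * l.prod) ≤ l.length :=
  Nat.sInf_le ⟨l, hl, rfl, rfl⟩

/-- Balls of radius one around the elements of a code of minimum distance three are disjoint. -/
theorem IsCode.eq_of_mul_eq_mul {C : Finset (Equiv.Perm (Fin n))} (hC : IsCode n 3 C)
    {ρ π : Equiv.Perm (Fin n)} (hρ : ρ ∈ C) (hπ : π ∈ C) {s t : Equiv.Perm (Fin n)}
    (hs : s ∈ insert 1 (adjSwaps n)) (ht : t ∈ insert 1 (adjSwaps n)) (h : ρ * s = π * t) :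
    ρ = π := by
  by_contra hne
  -- Distinct codewords are never joined by at most two adjacent transpositions, since their
  -- distance would then be below `3`.
  have key : ∀ l : List (Equiv.Perm (Fin n)), (∀ s ∈ l, s ∈ adjSwaps n) → l.length ≤ 2 →
      ρ * l.prod ≠ π := by
    rintro l hl h2 rfl
    have h1 := hC.2 _ hρ _ hπ hne
    have h3 := kendallDist_mul_prod_le ρ l hl
    omega
  -- Adjacent transpositions are involutions, so `ρ s = π t` says `π = ρ s t`. As `s` and `t` are
  -- each `1` or a transposition, this is a product of length at most two.
  rw [Finset.mem_insert] at hs ht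
  rcases hs with rfl | hs <;> rcases ht with rfl | ht
  · exact hne (by simpa using h)
  · refine key [t] (by simpa using ht) (by simp) ?_
    rw [mul_one] at h
    simp [h, mul_assoc, mul_self_of_mem_adjSwaps ht]
  · refine key [s] (by simpa using hs) (by simp) ?_
    simpa using h
  · refine key [s, t] (by simp [hs, ht]) (by simp) ?_
    simp [← mul_assoc, h]
    simp [mul_assoc, mul_self_of_mem_adjSwaps ht]

/-- The numbers of elements of a code in the right cosets of `H` form a feasible point. -/
theorem IsCode.isFeasible {C : Finset (Equiv.Perm (Fin n))} (hC : IsCode n 3 C)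
    (H : Subgroup (Equiv.Perm (Fin n))) [DecidableEq (RightCosets H)] :
    IsFeasible (adjSwaps n) H fun z =>
      ((C.filter fun g => RightCosets.mk H g = z).card : ℤ) := by
  classical
  refine isFeasible_iff.2 ⟨fun z => by positivity, fun z => ?_⟩
  -- Double counting. The right-hand side becomes the number of elements of the coset `z`, the
  -- left-hand side the number of pairs `(s, g)` with `g` a codeword in `z · s`. Such a pair is sent
  -- to `g s⁻¹`, a point of `z` in the ball around `g`.
  rw [← card_filter_mk_eq z, ← Nat.cast_sum, Nat.cast_le, ← Finset.card_sigma]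
  refine Finset.card_le_card_of_injOn (fun p => p.2 * p.1⁻¹) ?_ ?_
  · rintro ⟨s, g⟩ hp
    simp only [Finset.coe_sigma, Set.mem_sigma_iff, Finset.mem_coe, Finset.mem_filter] at hp
    simp only [Finset.coe_filter, Finset.mem_univ, true_and, Set.mem_ofPred_eq]
    rw [← RightCosets.act_mk, hp.2.2, RightCosets.act_act, mul_inv_cancel, RightCosets.act_one]
  · rintro ⟨s, g⟩ hp ⟨t, g'⟩ hq heq
    simp only [Finset.coe_sigma, Set.mem_sigma_iff, Finset.mem_coe, Finset.mem_filter] at hp hq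
    -- The ball is closed under inversion, so the disjointness statement for `ρ s` also applies to
    -- `g s⁻¹`. It yields the same codeword, and then the same `s` by cancellation.
    have inv_mem : ∀ s ∈ insert 1 (adjSwaps n), s⁻¹ ∈ insert 1 (adjSwaps n) := by
      intro s hs
      rcases Finset.mem_insert.1 hs with rfl | h
      · simp
      · rwa [inv_eq_of_mul_eq_one_left (mul_self_of_mem_adjSwaps h)]
    have hg : g = g' :=
      hC.eq_of_mul_eq_mul hp.2.1 hq.2.1 (inv_mem s hp.1) (inv_mem t hq.1) heq
    subst hg
    have : s = t := by simpa using heq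
    subst this
    rfl

/-- The cosets partition the group, so the entries of the feasible point attached to `C` add up to
`|C|`. One optimal value thus bounds all codes at once, and the choice of `H` is free. -/
theorem P_le_of_isOptimalValue {H : Subgroup (Equiv.Perm (Fin n))} {v : ℤ}
    (hv : IsOptimalValue (adjSwaps n) H v) : (P n 3 : ℤ) ≤ v := by
  classical
  -- The optimum is attained at a nonnegative point, so `v` may be replaced by a natural number, as
  -- is needed for a comparison with the supremum that defines `P`.
  have h0 : 0 ≤ v := by
    obtain ⟨x, hx, rfl⟩ := hv.1
    exact Finset.sum_nonneg fun z _ => hx.1 z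
  lift v to ℕ using h0
  rw [Nat.cast_le, P, Finset.sup_le_iff]
  intro C hC
  have hC := (Finset.mem_filter.1 hC).2
  have h := hv.2 ⟨_, hC.isFeasible H, rfl⟩
  rw [← Nat.cast_sum, Nat.cast_le] at h
  rwa [Finset.card_eq_sum_card_fiberwise (f := RightCosets.mk H) (t := Finset.univ)
    (fun _ _ => Finset.mem_coe.2 (Finset.mem_univ _))]

end Codes

/-! ### Adjacent transpositions indexed by their left position -/

section Swaps

variable {m : ℕ}

/-- The adjacent transposition of the positions `i` and `i + 1`. -/
def adjSwap (i : Fin m) : Equiv.Perm (Fin (m + 1)) := Equiv.swap i.castSucc i.succ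

/-- The condition `i + 1 = j` is solved by the left position `i`, which runs over `Fin m` when `n =
m + 1`. From here on sums over `S` are sums over `Fin m`. -/
theorem adjSwaps_eq_image : adjSwaps (m + 1) = Finset.univ.image (adjSwap (m := m)) := by
  ext s
  simp only [adjSwaps, Finset.mem_filter, Finset.mem_univ, true_and, Finset.mem_image]
  constructor
  · rintro ⟨i, j, hij, rfl⟩
    have hi : (i : ℕ) < m := by omega
    refine ⟨⟨i, hi⟩, ?_⟩
    rw [adjSwap]
    congr 1
    ext
    simpa using hij
  · rintro ⟨i, rfl⟩
    exact ⟨i.castSucc, i.succ, by simp, rfl⟩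

theorem adjSwap_injective : Function.Injective (adjSwap (m := m)) := by
  intro i j h
  -- One value determines the transposition: `adjSwap j` moves position `i` one step to the right
  -- only if `j = i`. If `i` were its right end it would move to the left, and otherwise it would
  -- stay fixed.
  have h1 : adjSwap j i.castSucc = i.succ := by
    rw [← h, adjSwap, Equiv.swap_apply_left]
  rw [adjSwap, Equiv.swap_apply_def] at h1
  split_ifs at h1 with h2 h3
  · exact Fin.castSucc_injective _ h2
  · have := congrArg Fin.val h1
    have := congrArg Fin.val h3
    simp at *
    omega
  · have := congrArg Fin.val h1
    simp at this

/-- The identity is a generator of its own in `S ∪ {1}`, so it adds a separate term to each row: the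
diagonal entry of `M` is one more than the number of transpositions that fix the coset. -/
theorem one_notMem_adjSwaps : (1 : Equiv.Perm (Fin (m + 1))) ∉ adjSwaps (m + 1) := by
  rw [adjSwaps_eq_image]
  simp only [Finset.mem_image, Finset.mem_univ, true_and, not_exists]
  intro i h
  have h1 : adjSwap i i.castSucc = i.succ := by rw [adjSwap, Equiv.swap_apply_left]
  rw [h] at h1
  have := congrArg Fin.val h1
  simp at this

theorem sum_insert_adjSwaps (f : Equiv.Perm (Fin (m + 1)) → ℤ) :
    ∑ s ∈ insert 1 (adjSwaps (m + 1)), f s = f 1 + ∑ i : Fin m, f (adjSwap i) := by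
  rw [Finset.sum_insert one_notMem_adjSwaps, adjSwaps_eq_image,
    Finset.sum_image adjSwap_injective.injOn]

theorem adjSwap_mul_self (i : Fin m) : adjSwap i * adjSwap i = 1 :=
  Equiv.swap_mul_self _ _

end Swaps

/-! ### Cosets of a label stabilizer as words -/

section Labels

variable {n : ℕ} {L : Type*}

/-- `H` is the group of the permutations that preserve the labelling `w`. -/
def IsLabelStabilizer (H : Subgroup (Equiv.Perm (Fin n))) (w : Fin n → L) : Prop :=
  ∀ σ, σ ∈ H ↔ w ∘ σ = w

variable {H : Subgroup (Equiv.Perm (Fin n))} {w : Fin n → L}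

/-- A permutation that preserves the labelling permutes each fibre independently, so the stabilizer
is a product of the symmetric groups of the fibres. -/
theorem IsLabelStabilizer.card_eq [Fintype L] [DecidableEq L] (h : IsLabelStabilizer H w) :
    Nat.card H = ∏ k, (Fintype.card {i // w i = k}).factorial := by
  rw [← DomMulAct.stabilizer_card, ← Nat.card_eq_fintype_card]
  exact Nat.card_congr (Equiv.subtypeEquivRight h)

/-- The blocks are the fibres of `w`. The hypothesis ranges over all natural numbers `k`, so it also
contains that the blocks with index `K` or more are empty. -/
theorem isLabelStabilizer_youngSubgroup {K : ℕ} {lam : List ℕ} {w : Fin n → Fin K}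
    (hw : ∀ k i, i ∈ youngBlock n lam k ↔ (w i : ℕ) = k) :
    IsLabelStabilizer (youngSubgroup n lam) w := by
  intro σ
  change (∀ k i, σ i ∈ youngBlock n lam k ↔ i ∈ youngBlock n lam k) ↔ _
  simp only [hw, funext_iff, Function.comp_apply, Fin.ext_iff]
  exact ⟨fun h i => (h _ i).2 rfl, fun h k i => by rw [h]⟩

/-- The word of a right coset `H g`, the labels of `g(1), …, g(n)`. -/
def cosetWord (h : IsLabelStabilizer H w) (z : RightCosets H) : Fin n → L :=
  Quotient.lift (fun g : Equiv.Perm (Fin n) => w ∘ g) (by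
    intro a b hab
    have h1 := (h _).1 (QuotientGroup.rightRel_apply.1 hab)
    funext i
    simpa using (congrFun h1 (a i)).symm) z

@[simp]
theorem cosetWord_mk (h : IsLabelStabilizer H w) (g : Equiv.Perm (Fin n)) :
    cosetWord h (RightCosets.mk H g) = w ∘ g :=
  rfl

/-- Left multiplication by `H` is invisible to the labels, while right multiplication permutes the
positions. For `s = (i, i+1)` two neighbouring letters are exchanged. -/
theorem cosetWord_act (h : IsLabelStabilizer H w) (z : RightCosets H)
    (s : Equiv.Perm (Fin n)) : cosetWord h (z.act s) = cosetWord h z ∘ s := by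
  induction z using RightCosets.ind with
  | h g => rfl

/-- If `w ∘ a = w ∘ b`, then `b a⁻¹` preserves the labelling and hence lies in `H`. In particular a
coset is fixed by `(i, i+1)` as soon as its letters at these two positions agree. -/
theorem cosetWord_injective (h : IsLabelStabilizer H w) :
    Function.Injective (cosetWord h) := by
  intro y z
  induction y using RightCosets.ind with
  | h a =>
    induction z using RightCosets.ind with
    | h b =>
      intro hab
      rw [cosetWord_mk, cosetWord_mk] at hab
      refine RightCosets.mk_eq_mk.2 ((h _).2 (funext fun i => ?_))
      simpa using (congrFun hab (a⁻¹ i)).symm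

end Labels

/-! ### Enumeration of the cosets by a list of words -/

section Index

variable {m N : ℕ} {L : Type*} {H : Subgroup (Equiv.Perm (Fin (m + 1)))} {w : Fin (m + 1) → L}

/-- If a list of `N = |S_n : H|` words holds the word of `H` and is closed under adjacent
transpositions, then it enumerates the right cosets of `H`. -/
theorem exists_equiv_rightCosets (h : IsLabelStabilizer H w)
    (wd : Fin N → Fin (m + 1) → L) (nb : Fin m → Fin N → Fin N) (j₀ : Fin N) (h₀ : wd j₀ = w)
    (hnb : ∀ i j, wd (nb i j) = wd j ∘ adjSwap i)
    (hN : N * Nat.card H = (m + 1).factorial) :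
    ∃ e : RightCosets H ≃ Fin N, (∀ z, wd (e z) = cosetWord h z) ∧
      ∀ i z, e (z.act (adjSwap i)) = nb i (e z) := by
  -- The adjacent transpositions generate the symmetric group even as a monoid. So every word `w ∘
  -- g` is reached from `w` by exchanges of neighbours, and closure of the list under `nb` keeps it
  -- in the list.
  have mem : ∀ g : Equiv.Perm (Fin (m + 1)), ∃ j, wd j = w ∘ g := by
    intro g
    have hg : g ∈ Submonoid.closure (Set.range fun i : Fin m => adjSwap i) := by
      have := Equiv.Perm.mclosure_swap_castSucc_succ m
      simp only [adjSwap]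
      rw [this]
      trivial
    induction hg using Submonoid.closure_induction_right with
    | one => exact ⟨j₀, by simpa using h₀⟩
    | mul_right x hx y hy ih =>
      obtain ⟨j, hj⟩ := ih
      obtain ⟨i, rfl⟩ := hy
      refine ⟨nb i j, ?_⟩
      rw [hnb, hj]
      rfl
  have mem' : ∀ z : RightCosets H, ∃ j, wd j = cosetWord h z := by
    intro z
    induction z using RightCosets.ind with
    | h g => exact mem g
  choose idx hidx using mem'
  have inj : Function.Injective idx := by
    intro y z hyz
    apply cosetWord_injective h
    rw [← hidx, ← hidx, hyz]
  -- Lagrange's theorem and `hN` force exactly `N` cosets. The injective index map is then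
  -- bijective, so it need not be checked that the list is free of repetitions: this comes out as
  -- `wd_inj`.
  have hcard : Fintype.card (RightCosets H) = Fintype.card (Fin N) := by
    have h1 := card_rightCosets_mul H
    rw [Nat.card_perm, Nat.card_fin, ← hN] at h1
    rw [Fintype.card_fin]
    exact Nat.eq_of_mul_eq_mul_right Nat.card_pos h1
  have bij : Function.Bijective idx := (Fintype.bijective_iff_injective_and_card idx).2 ⟨inj, hcard⟩
  have wd_inj : Function.Injective wd := by
    intro a b hab
    obtain ⟨y, rfl⟩ := bij.2 a
    obtain ⟨z, rfl⟩ := bij.2 b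
    rw [hidx, hidx] at hab
    rw [cosetWord_injective h hab]
  refine ⟨Equiv.ofBijective idx bij, hidx, fun i z => wd_inj ?_⟩
  simp only [Equiv.ofBijective_apply]
  rw [hidx, hnb, hidx, cosetWord_act]

end Index

/-! ### Charging the positive mass of a weight to its negative mass -/

section Mass

/-- Let `u` be an integer weight on a finite set with involutions `s i`, each point being moved by
at most `d` of them. If `u z + ∑ i, u (s i z) ≤ r` for all `z`, then the positive mass of `u` is
controlled by its negative mass. -/
theorem mul_sum_max_le {Z : Type*} [Fintype Z] {m d : ℕ} (s : Fin m → Z → Z)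
    (hs : ∀ i, Function.Involutive (s i)) (u : Z → ℤ) {r : ℤ} (hr : 0 ≤ r)
    (hd : ∀ z, {i | s i z ≠ z}.ncard ≤ d) (hu : ∀ z, u z + ∑ i, u (s i z) ≤ r) :
    ((m : ℤ) + 1 - d - r) * ∑ z, max (u z) 0 ≤ d * ∑ z, max (-u z) 0 := by
  classical
  have card_le : ∀ z, ((Finset.univ.filter fun i => s i z ≠ z).card : ℤ) ≤ d := by
    intro z
    have := hd z
    rw [Set.ncard_eq_toFinset_card'] at this
    simpa using this
  -- The local inequality. Where `u z > 0`, every `s i` that fixes `z` contributes another copy of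
  -- `u z` to the row, so there are at least `m + 1 - d` copies. Since the row is at most `r`, the
  -- moved images of `z` must carry negative parts of total size at least `(m + 1 - d - r) * u z`.
  have pointwise : ∀ z, ((m : ℤ) + 1 - d - r) * max (u z) 0 ≤
      ∑ i, if s i z ≠ z then max (-u (s i z)) 0 else 0 := by
    intro z
    rcases le_or_gt (u z) 0 with hz | hz
    · rw [max_eq_right hz, mul_zero]
      exact Finset.sum_nonneg fun i _ => by split_ifs <;> simp
    · rw [max_eq_left hz.le]
      -- A fixed index contributes exactly `u z`; a moved one contributes at least minus the
      -- negative part at its image.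
      have h1 : ∑ i, u (s i z) ≥ ∑ i, ((u z - if s i z ≠ z then u z else 0) -
          if s i z ≠ z then max (-u (s i z)) 0 else 0) := by
        refine Finset.sum_le_sum fun i _ => ?_
        split_ifs with h
        · have := le_max_left (-u (s i z)) 0
          linarith
        · rw [not_not] at h
          simp [h]
      rw [Finset.sum_sub_distrib, Finset.sum_sub_distrib, Finset.sum_const, Finset.card_univ,
        Fintype.card_fin, ← Finset.sum_filter, Finset.sum_const, nsmul_eq_mul, nsmul_eq_mul] at h1
      have h2 := hu z
      have h3 := mul_le_mul_of_nonneg_right (card_le z) hz.le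
      -- Here integrality enters: `u z > 0` means `u z ≥ 1`, so the constant `r` is absorbed into a
      -- multiple of `u z`.
      have h4 : r ≤ r * u z := by nlinarith
      nlinarith
  calc ((m : ℤ) + 1 - d - r) * ∑ z, max (u z) 0
      = ∑ z, ((m : ℤ) + 1 - d - r) * max (u z) 0 := Finset.mul_sum _ _ _
    _ ≤ ∑ z, ∑ i, if s i z ≠ z then max (-u (s i z)) 0 else 0 :=
        Finset.sum_le_sum fun z _ => pointwise z
    _ = ∑ i, ∑ z, if s i z ≠ z then max (-u (s i z)) 0 else 0 := Finset.sum_comm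
    -- For fixed `i` the involution `s i` is used as a substitution; being moved by `s i` is
    -- invariant under it. Afterwards the negative part at a point is charged once for each index
    -- that moves the point, so at most `d` times.
    _ = ∑ i, ∑ z, if s i z ≠ z then max (-u z) 0 else 0 := by
        refine Finset.sum_congr rfl fun i _ => ?_
        rw [← Equiv.sum_comp (hs i).toPerm]
        refine Finset.sum_congr rfl fun z _ => ?_
        simp only [Function.Involutive.coe_toPerm, (hs i) z]
        simp only [ne_comm]
    _ = ∑ z, ∑ i, if s i z ≠ z then max (-u z) 0 else 0 := Finset.sum_comm
    _ ≤ ∑ z, d * max (-u z) 0 := by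
        refine Finset.sum_le_sum fun z _ => ?_
        rw [← Finset.sum_filter, Finset.sum_const, nsmul_eq_mul]
        exact mul_le_mul_of_nonneg_right (card_le z) (le_max_right _ _)
    _ = d * ∑ z, max (-u z) 0 := (Finset.mul_sum _ _ _).symm

/-- Pointwise `u = u⁺ - u⁻`. This turns a comparison of the two masses into a bound on the sum of
`u`, that is, on the objective. -/
theorem sum_max_sub_sum_max {Z : Type*} [Fintype Z] (u : Z → ℤ) :
    ∑ z, max (u z) 0 - ∑ z, max (-u z) 0 = ∑ z, u z := by
  rw [← Finset.sum_sub_distrib]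
  refine Finset.sum_congr rfl fun z _ => ?_
  omega

end Mass

/-! ### Words with few exceptional letters, and the case of remainder two -/

section Moves

variable {m : ℕ} {L : Type*} {H : Subgroup (Equiv.Perm (Fin (m + 1)))} {w : Fin (m + 1) → L}

theorem act_adjSwap_involutive (i : Fin m) :
    Function.Involutive fun z : RightCosets H => z.act (adjSwap i) := by
  intro z
  simp only [RightCosets.act_act, adjSwap_mul_self, RightCosets.act_one]

theorem isFeasible_adjSwaps_iff {x : RightCosets H → ℤ} :
    IsFeasible (adjSwaps (m + 1)) H x ↔ (∀ z, 0 ≤ x z) ∧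
      ∀ z : RightCosets H, x z + ∑ i : Fin m, x (z.act (adjSwap i)) ≤ (Nat.card H : ℤ) := by
  simp only [isFeasible_iff, sum_insert_adjSwaps, RightCosets.act_one]

/-- An adjacent transposition moves a right coset only if one of its positions bears a label
other than `k`. -/
theorem ncard_act_adjSwap_ne_le (h : IsLabelStabilizer H w) (k : L) (z : RightCosets H) :
    {i : Fin m | z.act (adjSwap i) ≠ z}.ncard ≤ 2 * {p | w p ≠ k}.ncard := by
  -- The word of `H g` is a rearrangement of `w`, so it has as many letters different from `k`.
  have hcard : {p | cosetWord h z p ≠ k}.ncard = {p | w p ≠ k}.ncard := by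
    induction z using RightCosets.ind with
    | h g =>
      exact Set.ncard_congr (fun p _ => g p) (fun p hp => hp) (fun p q _ _ hpq => g.injective hpq)
        fun q hq => ⟨g⁻¹ q, by simpa using hq, by simp⟩
  -- If both exchanged letters are `k`, the word and hence the coset do not change. A position
  -- belongs to at most two adjacent pairs, once as left and once as right end; this is the factor
  -- `2`.
  have hsub : {i : Fin m | z.act (adjSwap i) ≠ z} ⊆
      Fin.castSucc ⁻¹' {p | cosetWord h z p ≠ k} ∪ Fin.succ ⁻¹' {p | cosetWord h z p ≠ k} := by
    intro i hi
    by_contra hcon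
    simp only [Set.mem_union, Set.mem_preimage, Set.mem_ofPred_eq, not_or, not_not] at hcon
    refine hi (cosetWord_injective h ?_)
    rw [cosetWord_act]
    funext p
    rw [Function.comp_apply, adjSwap, Equiv.swap_apply_def]
    split_ifs with h1 h2
    · rw [h1, hcon.1, hcon.2]
    · rw [h2, hcon.1, hcon.2]
    · rfl
  calc _ ≤ _ := Set.ncard_le_ncard hsub
    _ ≤ _ := Set.ncard_union_le _ _
    _ ≤ {p | cosetWord h z p ≠ k}.ncard + {p | cosetWord h z p ≠ k}.ncard := by
        gcongr
        · exact Set.ncard_le_ncard_of_injOn _ (fun _ hi => hi) (Fin.castSucc_injective m).injOn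
        · exact Set.ncard_le_ncard_of_injOn _ (fun _ hi => hi) (Fin.succ_injective m).injOn
    _ = _ := by rw [hcard, two_mul]

/-- If at most two points bear a label other than `k` and `|H| = n c + 2`, then the constant
point `c` is optimal. -/
theorem isOptimalValue_of_card_eq_mul_add_two (h : IsLabelStabilizer H w) (k : L)
    (hk : {p | w p ≠ k}.ncard ≤ 2) (hm : 9 ≤ m) {c : ℤ} (hc : 0 ≤ c)
    (hH : (Nat.card H : ℤ) = (m + 1) * c + 2) :
    IsOptimalValue (adjSwaps (m + 1)) H (Fintype.card (RightCosets H) * c) := by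
  constructor
  -- All rows of `M` have sum `m + 1`, so the constant `c` fills each row up to `(m + 1) c = |H| -
  -- 2`.
  · refine ⟨fun _ => c, isFeasible_adjSwaps_iff.2 ⟨fun _ => hc, fun z => ?_⟩, by simp⟩
    simp [hH]
    linarith
  · rintro _ ⟨x, hx, rfl⟩
    rw [isFeasible_adjSwaps_iff] at hx
    have hd : ∀ z : RightCosets H, {i : Fin m | z.act (adjSwap i) ≠ z}.ncard ≤ 4 := fun z =>
      (ncard_act_adjSwap_ne_le h k z).trans (by omega)
    -- The excess `x - c` has row sums at most `|H| - (m + 1) c = 2`. With `d = 4` and `r = 2` the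
    -- factor `m + 1 - d - r = m - 5` is at least `d = 4` precisely for `m ≥ 9`. Then the positive
    -- mass of the excess is at most its negative mass, so its sum is at most `0`.
    have key := mul_sum_max_le (fun i (z : RightCosets H) => z.act (adjSwap i))
      act_adjSwap_involutive (fun z => x z - c) (r := 2) (by norm_num) hd (fun z => by
        have := hx.2 z
        simp only [Finset.sum_sub_distrib, Finset.sum_const, Finset.card_univ, Fintype.card_fin,
          nsmul_eq_mul]
        linarith)
    have hsum := sum_max_sub_sum_max fun z => x z - c
    have hA : 0 ≤ ∑ z, max (x z - c) 0 := Finset.sum_nonneg fun z _ => le_max_right _ _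
    have hm' : (9 : ℤ) ≤ m := by exact_mod_cast hm
    simp only [Finset.sum_sub_distrib, Finset.sum_const, Finset.card_univ, nsmul_eq_mul] at hsum
    push_cast at key
    nlinarith

end Moves

/-! ### One exceptional letter: domination on a path -/

section Path

/-- A nonnegative integer weight on a path that is positive on every closed neighbourhood
dominates. -/
theorem le_sum_of_dominating {k : ℕ} (v : Fin (3 * k + 2) → ℤ) (h0 : ∀ p, 0 ≤ v p)
    (hv : ∀ p, 1 ≤ v p + ∑ i, v (adjSwap i p)) : (k : ℤ) + 1 ≤ ∑ p, v p := by
  -- The positions are cut into `k + 1` blocks of equal quotient by `3`; the last block has only two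
  -- points. The closed neighbourhood of `3 t + 1` is exactly block `t`, also at the end of the
  -- path, so each block contains a positive value. The blocks are disjoint, which gives the bound.
  have ex : ∀ t : Fin (k + 1), ∃ q : Fin (3 * k + 2), (q : ℕ) / 3 = t ∧ 1 ≤ v q := by
    intro t
    have ht := t.2
    by_contra! hcon
    have zero : ∀ q : Fin (3 * k + 2), (q : ℕ) / 3 = t → v q = 0 := by
      intro q hq
      have := hcon q hq
      have := h0 q
      omega
    have hp : 3 * (t : ℕ) + 1 < 3 * k + 2 := by omega
    -- A transposition takes `3 t + 1` to `3 t`, to `3 t + 2` or to itself. If `v` vanished on the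
    -- block, this whole row would be zero.
    have h1 := hv ⟨3 * t + 1, hp⟩
    rw [zero _ (by simp; omega), Finset.sum_eq_zero] at h1
    · simp at h1
    · intro i _
      apply zero
      rw [adjSwap, Equiv.swap_apply_def]
      split_ifs with h2 h3
      · have := congrArg Fin.val h2
        simp at this ⊢
        omega
      · have := congrArg Fin.val h3
        simp at this ⊢
        omega
      · simp
        omega
  choose q hq1 hq2 using ex
  have inj : Function.Injective q := by
    intro a b hab
    ext
    rw [← hq1, ← hq1, hab]
  calc (k : ℤ) + 1 = ∑ _t : Fin (k + 1), (1 : ℤ) := by simp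
    _ ≤ ∑ t, v (q t) := Finset.sum_le_sum fun t _ => hq2 t
    _ = ∑ p ∈ Finset.univ.map ⟨q, inj⟩, v p := by simp
    _ ≤ ∑ p, v p := Finset.sum_le_sum_of_subset_of_nonneg (Finset.subset_univ _) fun p _ _ => h0 p

/-- If one point bears the label `1`, all others bear the label `0`, and `|H| + 1 = n c` with
`n = 3 k + 2`, then the optimal value is `n c - (k + 1)`. -/
theorem isOptimalValue_of_card_add_one_eq_mul {k : ℕ}
    {H : Subgroup (Equiv.Perm (Fin (3 * k + 2)))} {p₀ : Fin (3 * k + 2)}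
    (h : IsLabelStabilizer H fun p => if p = p₀ then (1 : Fin 2) else 0)
    (hN : (3 * k + 2) * Nat.card H = (3 * k + 2).factorial) {c : ℤ} (hc : 1 ≤ c)
    (hk : 4 ≤ k) (hH : (Nat.card H : ℤ) + 1 = (3 * k + 2) * c) :
    IsOptimalValue (adjSwaps (3 * k + 2)) H ((3 * k + 2) * c - (k + 1)) := by
  -- A word with a single letter `1` is the position of that letter. So the cosets are the `3 k + 2`
  -- points of a path, and `adjSwap i` acts on them as on positions.
  obtain ⟨e, -, he⟩ := exists_equiv_rightCosets h
    (fun q p => if p = q then (1 : Fin 2) else 0) (fun i => adjSwap i) p₀ rfl (by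
      intro i q
      funext p
      simp only [Function.comp_apply]
      congr 1
      rw [eq_iff_iff, adjSwap, ← Equiv.swap_apply_eq_iff]) hN
  constructor
  -- The positions with remainder `1` modulo `3` dominate the path. Lowering the constant `c` by one
  -- at these `k + 1` points lowers every row from `(3 k + 2) c = |H| + 1` to at most `|H|`.
  · have row : ∀ q : Fin (3 * k + 2), (1 : ℤ) ≤ (if (q : ℕ) % 3 = 1 then 1 else 0) +
        ∑ i : Fin (3 * k + 1), if (adjSwap i q : ℕ) % 3 = 1 then 1 else 0 := by
      intro q
      have hq := q.2
      by_cases h1 : (q : ℕ) % 3 = 1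
      · rw [if_pos h1]
        have : (0 : ℤ) ≤ ∑ i : Fin (3 * k + 1), if (adjSwap i q : ℕ) % 3 = 1 then 1 else 0 :=
          Finset.sum_nonneg fun i _ => by split_ifs <;> simp
        linarith
      · rw [if_neg h1, zero_add]
        -- Remainder `0` is dominated from the right, which is possible because the last position `3
        -- k + 1` has remainder `1`; remainder `2` is dominated from the left.
        obtain ⟨i, hi⟩ : ∃ i : Fin (3 * k + 1), (adjSwap i q : ℕ) % 3 = 1 := by
          by_cases h0 : (q : ℕ) % 3 = 0
          · refine ⟨⟨q, by omega⟩, ?_⟩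
            have : q = Fin.castSucc ⟨q, by omega⟩ := rfl
            rw [adjSwap, ← this, Equiv.swap_apply_left]
            simp
            omega
          · refine ⟨⟨q - 1, by omega⟩, ?_⟩
            have : q = Fin.succ ⟨q - 1, by omega⟩ := by
              ext
              simp
              omega
            rw [adjSwap, ← this, Equiv.swap_apply_right]
            simp
            omega
        refine le_trans (by rw [if_pos hi]) (Finset.single_le_sum (f := fun i =>
          if (adjSwap i q : ℕ) % 3 = 1 then (1 : ℤ) else 0) (fun i _ => ?_) (Finset.mem_univ i))
        split_ifs <;> simp
    refine ⟨fun z => c - if (e z : ℕ) % 3 = 1 then 1 else 0,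
      isFeasible_adjSwaps_iff.2 ⟨fun z => ?_, fun z => ?_⟩, ?_⟩
    · split_ifs <;> linarith
    · have := row (e z)
      simp only [he, Finset.sum_sub_distrib, Finset.sum_const, Finset.card_univ, Fintype.card_fin,
        nsmul_eq_mul]
      push_cast
      linarith
    · rw [Equiv.sum_comp e fun q : Fin (3 * k + 2) => c - if (q : ℕ) % 3 = 1 then 1 else 0]
      have hcard : ∑ q : Fin (3 * k + 2), (if (q : ℕ) % 3 = 1 then (1 : ℤ) else 0) = k + 1 := by
        rw [Fin.sum_univ_eq_sum_range (fun q => if q % 3 = 1 then (1 : ℤ) else 0)]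
        clear * -
        induction k with
        | zero => decide
        | succ k ih =>
          rw [show 3 * (k + 1) + 2 = 3 * k + 2 + 1 + 1 + 1 by ring, Finset.sum_range_succ,
            Finset.sum_range_succ, Finset.sum_range_succ, ih, if_neg (by omega),
            if_neg (by omega), if_pos (by omega)]
          push_cast
          ring
      rw [Finset.sum_sub_distrib, hcard, Finset.sum_const, Finset.card_univ, Fintype.card_fin,
        nsmul_eq_mul]
      push_cast
      ring
  · rintro _ ⟨x, hx, rfl⟩
    rw [isFeasible_adjSwaps_iff] at hx
    -- The constant `c` overshoots every row by one, so the deficits `c - x` along a row add up to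
    -- at least `1`. It remains to show that all deficits together are at least `k + 1`.
    have hrow : ∀ z : RightCosets H,
        (1 : ℤ) ≤ (c - x z) + ∑ i : Fin (3 * k + 1), (c - x (z.act (adjSwap i))) := by
      intro z
      have := hx.2 z
      simp only [Finset.sum_sub_distrib, Finset.sum_const, Finset.card_univ, Fintype.card_fin,
        nsmul_eq_mul]
      push_cast
      linarith
    have hcard : Fintype.card (RightCosets H) = 3 * k + 2 := by
      rw [Fintype.card_congr e, Fintype.card_fin]
    suffices hu : (k : ℤ) + 1 ≤ ∑ z, (c - x z) by
      rw [Finset.sum_sub_distrib, Finset.sum_const, Finset.card_univ, hcard, nsmul_eq_mul] at hu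
      push_cast at hu
      linarith
    -- Nonnegative deficits form a dominating weight on the path. If instead `x` exceeds `c`
    -- somewhere, the charging argument shows that the deficits elsewhere are large.
    by_cases hneg : ∀ z, 0 ≤ c - x z
    · rw [← Equiv.sum_comp e.symm]
      refine le_sum_of_dominating _ (fun p => hneg _) fun p => ?_
      have h1 := hrow (e.symm p)
      have h2 : ∀ i : Fin (3 * k + 1), e.symm (adjSwap i p) = (e.symm p).act (adjSwap i) := by
        intro i
        rw [Equiv.symm_apply_eq, he, Equiv.apply_symm_apply]
      simpa only [h2] using h1
    · push Not at hneg
      obtain ⟨z₀, hz₀⟩ := hneg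
      have hd : ∀ z : RightCosets H,
          {i : Fin (3 * k + 1) | z.act (adjSwap i) ≠ z}.ncard ≤ 2 := by
        intro z
        refine (ncard_act_adjSwap_ne_le h 0 z).trans ?_
        have : {p | (if p = p₀ then (1 : Fin 2) else 0) ≠ 0} = {p₀} := by
          ext p
          simp
        rw [this, Set.ncard_singleton]
      -- Let `A` be the mass by which `x` exceeds `c` and `B` the mass of the deficits. With `m = 3
      -- k + 1`, `d = 2` and `r = 0` the inequality is `3 k A ≤ 2 B`. Since `A ≥ 1`, `2 (B - A) ≥ (3
      -- k - 2) A ≥ 3 k - 2`, and this is at least `2 (k + 1)` because `k ≥ 4`.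
      have key := mul_sum_max_le (fun i (z : RightCosets H) => z.act (adjSwap i))
        act_adjSwap_involutive (fun z => -(c - x z)) (r := 0) le_rfl hd (fun z => by
          have := hrow z
          rw [Finset.sum_neg_distrib]
          linarith)
      have hsum := sum_max_sub_sum_max fun z => -(c - x z)
      have hA : 1 ≤ ∑ z, max (-(c - x z)) 0 := by
        refine le_trans ?_ (Finset.single_le_sum (f := fun z => max (-(c - x z)) 0)
          (fun z _ => le_max_right _ _) (Finset.mem_univ z₀))
        exact le_max_of_le_left (by linarith)
      rw [Finset.sum_neg_distrib] at hsum
      have hk' : (4 : ℤ) ≤ k := by exact_mod_cast hk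
      have hprod := mul_nonneg (sub_nonneg.2 hA) (show (0 : ℤ) ≤ 3 * k - 2 by linarith)
      push_cast at key
      nlinarith

end Path

/-! ### The shapes (9,2), (11,2) and (16,1) -/

section Large

theorem isLabelStabilizer_youngSubgroup_pair (a b : ℕ) :
    IsLabelStabilizer (youngSubgroup (a + b) [a, b])
      fun p => if (p : ℕ) < a then (0 : Fin 2) else 1 := by
  refine isLabelStabilizer_youngSubgroup fun k i => ?_
  have hi := i.2
  by_cases h : (i : ℕ) < a
  · rcases k with _ | _ | k <;> simp [youngBlock, h]
  · rcases k with _ | _ | k <;> simp [youngBlock, h]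
    omega

/-- Only the last `b` positions bear the label `1`. For `b = 2` this is the count behind the bound
of four moving transpositions. -/
theorem ncard_label_ne_zero_le (a b : ℕ) :
    {p : Fin (a + b) | (if (p : ℕ) < a then (0 : Fin 2) else 1) ≠ 0}.ncard ≤ b := by
  have hsub : {p : Fin (a + b) | (if (p : ℕ) < a then (0 : Fin 2) else 1) ≠ 0} ⊆
      Fin.natAdd a '' (Set.univ : Set (Fin b)) := by
    intro p hp
    have hp' : ¬(p : ℕ) < a := fun h => hp (if_pos h)
    exact ⟨⟨p - a, by omega⟩, trivial, by ext; simp; omega⟩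
  refine (Set.ncard_le_ncard hsub).trans ((Set.ncard_image_le).trans ?_)
  rw [Set.ncard_univ, Nat.card_fin]

/-- Modulo a prime `p` Wilson's theorem gives `(p - 2)! ≡ 1`. So `|H| = 2 · 9!` leaves remainder `2`
modulo `11`, and `c = (|H| - 2) / 11 = 65978`. There are `11 · 10 / 2 = 55` cosets, and `55 c = (55
|H| - 110) / 11 = 10! - 10`. -/
theorem isOptimalValue_nine_two :
    IsOptimalValue (adjSwaps 11) (youngSubgroup 11 [9, 2]) ((Nat.factorial 10 : ℤ) - 10) := by
  have h := isLabelStabilizer_youngSubgroup_pair 9 2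
  have hcard : Nat.card (youngSubgroup 11 [9, 2]) = 725760 := by
    rw [h.card_eq, Fin.prod_univ_two]
    rfl
  have hindex := card_rightCosets_mul (youngSubgroup 11 [9, 2])
  rw [hcard, Nat.card_perm, Nat.card_fin] at hindex
  have hN : Fintype.card (RightCosets (youngSubgroup 11 [9, 2])) = 55 := by
    simp only [Nat.factorial_succ, Nat.factorial_zero] at hindex
    refine Nat.eq_of_mul_eq_mul_right (by norm_num) (hindex.trans ?_)
    norm_num
  have hopt := isOptimalValue_of_card_eq_mul_add_two h 0
    (ncard_label_ne_zero_le 9 2) (by norm_num) (c := 65978) (by norm_num) (by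
    rw [hcard]
    norm_num)
  rw [hN] at hopt
  convert hopt using 1
  norm_num [Nat.factorial]

/-- The same computation modulo the prime `13`: `|H| = 2 · 11! = 13 · 6141046 + 2`, there are `78`
cosets, and the loss against `12!` is `2 · 78 / 13 = 12`. -/
theorem isOptimalValue_eleven_two :
    IsOptimalValue (adjSwaps 13) (youngSubgroup 13 [11, 2]) ((Nat.factorial 12 : ℤ) - 12) := by
  have h := isLabelStabilizer_youngSubgroup_pair 11 2
  have hcard : Nat.card (youngSubgroup 13 [11, 2]) = 79833600 := by
    rw [h.card_eq, Fin.prod_univ_two]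
    rfl
  have hindex := card_rightCosets_mul (youngSubgroup 13 [11, 2])
  rw [hcard, Nat.card_perm, Nat.card_fin] at hindex
  have hN : Fintype.card (RightCosets (youngSubgroup 13 [11, 2])) = 78 := by
    simp only [Nat.factorial_succ, Nat.factorial_zero] at hindex
    refine Nat.eq_of_mul_eq_mul_right (by norm_num) (hindex.trans ?_)
    norm_num
  have hopt := isOptimalValue_of_card_eq_mul_add_two h 0
    (ncard_label_ne_zero_le 11 2) (by norm_num) (c := 6141046) (by norm_num) (by
    rw [hcard]
    norm_num)
  rw [hN] at hopt
  convert hopt using 1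
  norm_num [Nat.factorial]

/-- Wilson's theorem in the form `16! ≡ -1` modulo `17` makes `c = (16! + 1) / 17` an integer, and
`17 = 3 · 5 + 2`. The path with `17` points has domination number `6`, so the value is `17 c - 6 =
16! - 5`. -/
theorem isOptimalValue_sixteen_one :
    IsOptimalValue (adjSwaps 17) (youngSubgroup 17 [16, 1]) ((Nat.factorial 16 : ℤ) - 5) := by
  have h : IsLabelStabilizer (youngSubgroup 17 [16, 1])
      fun p => if p = Fin.last 16 then (1 : Fin 2) else 0 := by
    convert isLabelStabilizer_youngSubgroup_pair 16 1 using 1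
    decide
  have hcard : Nat.card (youngSubgroup 17 [16, 1]) = Nat.factorial 16 := by
    rw [h.card_eq, Fin.prod_univ_two]
    rfl
  have hopt := isOptimalValue_of_card_add_one_eq_mul (k := 5) h
    (by rw [hcard]; rfl) (c := 1230752346353) (by norm_num) (by norm_num) (by
      rw [hcard]
      norm_num [Nat.factorial])
  convert hopt using 1
  norm_num [Nat.factorial]

end Large

/-! ### Vectors packed into single natural numbers -/

section Digits

/-- The `j`-th digit of `a` in base `2 ^ w`. -/
def digit (w a j : ℕ) : ℕ := Nat.mod (Nat.shiftRight a (Nat.mul w j)) (Nat.pow 2 w)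

/-- `digit` and its companions are written with the primitive operations and the recursor of the
natural numbers, so that they evaluate on large numerals. Lemmas of this kind translate them into
ordinary notation. -/
theorem digit_eq (w a j : ℕ) : digit w a j = a / 2 ^ (w * j) % 2 ^ w := by
  rw [← Nat.shiftRight_eq_div_pow]
  rfl

/-- `∑ j < n, f j`, by recursion. -/
def sumBelow (n : ℕ) (f : ℕ → ℕ) : ℕ :=
  Nat.rec 0 (fun k s => Nat.add s (f k)) n

/-- Whether `f j` holds for all `j < n`. -/
def allBelow (n : ℕ) (f : ℕ → Bool) : Bool :=
  Nat.rec true (fun k s => f k && s) n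

/-- Application of `f` to `n`, forcing the evaluation of `n`. -/
def applyNat (n : ℕ) (f : ℕ → Bool) : Bool :=
  Nat.rec (f 0) (fun k _ => f (Nat.succ k)) n

theorem sumBelow_eq (n : ℕ) (f : ℕ → ℕ) : sumBelow n f = ∑ j ∈ Finset.range n, f j := by
  induction n with
  | zero => rfl
  | succ n ih => rw [Finset.sum_range_succ, ← ih]; rfl

theorem allBelow_iff (n : ℕ) (f : ℕ → Bool) : allBelow n f = true ↔ ∀ j < n, f j = true := by
  induction n with
  | zero => simp [allBelow]
  | succ n ih =>
    have h : allBelow (n + 1) f = (f n && allBelow n f) := rfl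
    rw [h, Bool.and_eq_true, ih]
    constructor
    · rintro ⟨h1, h2⟩ j hj
      rcases Nat.lt_succ_iff_lt_or_eq.1 hj with h | rfl
      exacts [h2 j h, h1]
    · exact fun h => ⟨h n (by omega), fun j hj => h j (by omega)⟩

/-- `applyNat` has the value of plain application. The case distinction inside it only makes the
argument a numeral before it is used many times. -/
theorem applyNat_eq (n : ℕ) (f : ℕ → Bool) : applyNat n f = f n := by
  cases n <;> rfl

/-- The number with the digits `f 0, …, f (N - 1)` in base `2 ^ 32`, if they are that small. -/
def pack (N : ℕ) (f : ℕ → ℕ) : ℕ := ∑ j ∈ Finset.range N, f j * 2 ^ (32 * j)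

/-- `pack` is linear whatever the size of the digits, so a combination of packed vectors is the
packed combination. Small digits matter only when they are read off again, in `digit_pack`. -/
theorem pack_add (N : ℕ) (f g : ℕ → ℕ) : pack N (fun j => f j + g j) = pack N f + pack N g := by
  simp only [pack, add_mul, Finset.sum_add_distrib]

theorem pack_mul (N c : ℕ) (f : ℕ → ℕ) : pack N (fun j => c * f j) = c * pack N f := by
  simp only [pack, mul_assoc, Finset.mul_sum]

/-- The digits below position `N` do not carry into it. This is the induction step for reading off
digits. -/
theorem pack_lt {N : ℕ} {f : ℕ → ℕ} (hf : ∀ j < N, f j < 2 ^ 32) : pack N f < 2 ^ (32 * N) := by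
  induction N with
  | zero => simp [pack]
  | succ N ih =>
    have h1 := ih fun j hj => hf j (by omega)
    have h2 : (f N + 1) * 2 ^ (32 * N) ≤ 2 ^ 32 * 2 ^ (32 * N) :=
      Nat.mul_le_mul_right _ (hf N (by omega))
    rw [pack, Finset.sum_range_succ, ← pack, show 32 * (N + 1) = 32 + 32 * N by ring, pow_add]
    linarith

theorem digit_pack {N : ℕ} {f : ℕ → ℕ} (hf : ∀ j < N, f j < 2 ^ 32) {j : ℕ} (hj : j < N) :
    digit 32 (pack N f) j = f j := by
  induction N with
  | zero => omega
  | succ N ih =>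
    have hlt := pack_lt fun j (hj : j < N) => hf j (by omega)
    rw [digit_eq, pack, Finset.sum_range_succ, ← pack]
    rcases Nat.lt_succ_iff_lt_or_eq.1 hj with h | rfl
    · rw [← ih (fun j hj => hf j (by omega)) h, digit_eq]
      -- The top term is a multiple of `2 ^ 32 * 2 ^ (32 * j)` for `j < N`, so it disappears from
      -- digit `j` when the quotient is reduced modulo `2 ^ 32`.
      have h1 : f N * 2 ^ (32 * N) = 2 ^ 32 * (f N * 2 ^ (32 * (N - j - 1))) * 2 ^ (32 * j) := by
        rw [show 32 * N = 32 + 32 * (N - j - 1) + 32 * j by omega, pow_add, pow_add]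
        ring
      rw [h1, Nat.add_mul_div_right _ _ (by positivity), Nat.add_mul_mod_self_left]
    · rw [Nat.add_mul_div_right _ _ (by positivity), Nat.div_eq_of_lt hlt, zero_add,
        Nat.mod_eq_of_lt (hf j (by omega))]

end Digits

/-! ### Branch-and-bound trees with Farkas multipliers -/

section Certificates

/-- A bound on the sum of the `x j` over the set bits `j` of `mask`. -/
structure Cut where
  mask : ℕ
  bound : ℕ

/-- The sum of the `x j`, `j < N`, over the set bits `j` of `mask`. -/
def maskSum (N mask : ℕ) (x : ℕ → ℕ) : ℕ := ∑ j ∈ Finset.range N, digit 1 mask j * x j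

/-- The bits of `mask`, spread to digits in base `2 ^ 32`. -/
def spread (N mask : ℕ) : ℕ :=
  sumBelow N fun j => Nat.mul (digit 1 mask j) (Nat.pow 2 (Nat.mul 32 j))

/-- The coefficients of the `x j` in the combination of cuts with the given multipliers. -/
def cutCoeffs (N : ℕ) : List Cut → List ℕ → ℕ
  | c :: cs, v :: vs => Nat.add (Nat.mul v (spread N c.mask)) (cutCoeffs N cs vs)
  -- Cuts without a multiplier count with multiplier `0`, so a list of multipliers may be shorter
  -- than the list of cuts.
  | _, _ => 0

/-- The right-hand side of the combination of cuts with the given multipliers. -/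
def cutBound : List Cut → List ℕ → ℕ
  | c :: cs, v :: vs => Nat.add (Nat.mul v c.bound) (cutBound cs vs)
  | _, _ => 0

/-- The coefficients of the row `x j + ∑ i < m, x (nb i j)`. -/
def rowCoeffs (m : ℕ) (nb : ℕ → ℕ → ℕ) (j : ℕ) : ℕ :=
  Nat.add (Nat.pow 2 (Nat.mul 32 j)) (sumBelow m fun i => Nat.pow 2 (Nat.mul 32 (nb i j)))

/-- A branch-and-bound tree for the program with the rows `x j + ∑ i < m, x (nb i j) ≤ b`.
A node splits on the sum over `mask` being at most, or more than, `k`. A leaf holds nonnegative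
multipliers `scale` of the objective, `row` (packed in digits of `width` bits) of the rows, and
`upper`, `lower` of the upper and lower bounds on the branch, that combine to a contradiction. -/
inductive BranchTree
  | leaf (scale width row : ℕ) (upper lower : List ℕ)
  | node (mask k : ℕ) (le gt : BranchTree)

/-- Whether the multipliers of a leaf refute that the objective is at least `goal`. -/
def leafRefutes (m N b goal : ℕ) (nb : ℕ → ℕ → ℕ) (les ges : List Cut)
    (scale width row : ℕ) (upper lower : List ℕ) : Bool :=
  applyNat (sumBelow N (digit width row)) fun total =>
    -- The numerical half of the contradiction: the rows and upper cuts bound a combination from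
    -- above by strictly less than what the objective and the lower cuts demand.
    Nat.blt (Nat.add (Nat.mul b total) (cutBound les upper))
      (Nat.add (Nat.mul goal scale) (cutBound ges lower)) &&
    -- These two tests exclude carries. A coefficient on the left is at most `scale + lower.sum`. On
    -- the right a variable occurs `m + 1` times in the rows, counted with multiplicity, each time
    -- with a multiplier at most `total`.
    Nat.blt (Nat.add scale lower.sum) (Nat.pow 2 32) &&
    Nat.blt (Nat.add (Nat.mul (Nat.succ m) total) upper.sum) (Nat.pow 2 32) &&
    applyNat (Nat.add (Nat.mul scale (sumBelow N fun j => Nat.pow 2 (Nat.mul 32 j)))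
      (cutCoeffs N ges lower)) fun lhs =>
    applyNat (Nat.add (sumBelow N fun j => Nat.mul (digit width row j) (rowCoeffs m nb j))
      (cutCoeffs N les upper)) fun rhs =>
    -- The other half: coefficient by coefficient the objective with the lower cuts is at most the
    -- rows with the upper cuts. As the variables are nonnegative, this orders the two combinations.
    allBelow N fun j => Nat.ble (digit 32 lhs j) (digit 32 rhs j)

/-- Whether all leaves of a tree are refutations. -/
def BranchTree.refutes (m N b goal : ℕ) (nb : ℕ → ℕ → ℕ) :
    BranchTree → List Cut → List Cut → Bool
  | leaf scale width row upper lower, les, ges =>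
      leafRefutes m N b goal nb les ges scale width row upper lower
  -- A new cut is put in front, so the multipliers of a leaf are listed from the deepest node up to
  -- the root and then over the cuts assumed from the start. The second branch has `k + 1` because
  -- sums over a mask are integers.
  | node mask k le gt, les, ges =>
      le.refutes m N b goal nb (⟨mask, k⟩ :: les) ges &&
        gt.refutes m N b goal nb les (⟨mask, Nat.succ k⟩ :: ges)

/-- The rows of the integer program in terms of a neighbour table. -/
def RowsLE (m N b : ℕ) (nb : ℕ → ℕ → ℕ) (x : ℕ → ℕ) : Prop :=
  ∀ j < N, x j + ∑ i ∈ Finset.range m, x (nb i j) ≤ b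

/-- Every `nb i` with `i < m` is an involution of `{0, …, N - 1}`. -/
def IsInvolutionTable (m N : ℕ) (nb : ℕ → ℕ → ℕ) : Prop :=
  ∀ i < m, ∀ j < N, nb i j < N ∧ nb i (nb i j) = j

variable {m N b goal : ℕ} {nb : ℕ → ℕ → ℕ} {x : ℕ → ℕ}

theorem IsInvolutionTable.sum_comp (hnb : IsInvolutionTable m N nb) {i : ℕ} (hi : i < m)
    (f : ℕ → ℕ) : ∑ j ∈ Finset.range N, f (nb i j) = ∑ j ∈ Finset.range N, f j := by
  refine Finset.sum_nbij' (nb i) (nb i) ?_ ?_ ?_ ?_ fun _ _ => rfl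
  all_goals
    intro j hj
    rw [Finset.mem_range] at hj
  · exact Finset.mem_range.2 (hnb i hi j hj).1
  · exact Finset.mem_range.2 (hnb i hi j hj).1
  · exact (hnb i hi j hj).2
  · exact (hnb i hi j hj).2

/-- The program matrix of an involution table is symmetric. -/
theorem IsInvolutionTable.sum_mul_row (hnb : IsInvolutionTable m N nb) (f g : ℕ → ℕ) :
    ∑ j ∈ Finset.range N, f j * (g j + ∑ i ∈ Finset.range m, g (nb i j)) =
      ∑ j ∈ Finset.range N, g j * (f j + ∑ i ∈ Finset.range m, f (nb i j)) := by
  simp only [mul_add, Finset.sum_add_distrib, Finset.mul_sum]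
  congr 1
  · exact Finset.sum_congr rfl fun j _ => mul_comm _ _
  -- For each `i` the substitution `j ↦ nb i j` exchanges the roles of `f` and `g`, because `nb i`
  -- is an involution.
  · rw [Finset.sum_comm, Finset.sum_comm (s := Finset.range N)]
    refine Finset.sum_congr rfl fun i hi => ?_
    rw [Finset.mem_range] at hi
    rw [← hnb.sum_comp hi]
    refine Finset.sum_congr rfl fun j hj => ?_
    rw [(hnb i hi j (Finset.mem_range.1 hj)).2, mul_comm]

/-- The coefficient of `x j` in the combination of cuts with the given multipliers. -/
def cutCoeff : List Cut → List ℕ → ℕ → ℕ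
  | c :: cs, v :: vs, j => v * digit 1 c.mask j + cutCoeff cs vs j
  | _, _, _ => 0

/-- By linearity of `pack`, the number that the checker accumulates has the coefficients `cutCoeff`
as its entries. No bound on the multipliers is needed at this point. -/
theorem cutCoeffs_eq_pack (N : ℕ) (cs : List Cut) (vs : List ℕ) :
    cutCoeffs N cs vs = pack N (cutCoeff cs vs) := by
  induction cs generalizing vs with
  | nil => simp [cutCoeffs, cutCoeff, pack]
  | cons c cs ih =>
    cases vs with
    | nil => simp [cutCoeffs, cutCoeff, pack]
    | cons v vs =>
      have h : cutCoeff (c :: cs) (v :: vs) =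
          fun j => v * digit 1 c.mask j + cutCoeff cs vs j := rfl
      rw [h, pack_add, pack_mul, ← ih, cutCoeffs, spread, sumBelow_eq]
      rfl

/-- A bit of a mask is at most `1`. This justifies the sums of multipliers in the tests against
carries. -/
theorem cutCoeff_le_sum (cs : List Cut) (vs : List ℕ) (j : ℕ) : cutCoeff cs vs j ≤ vs.sum := by
  induction cs generalizing vs with
  | nil => simp [cutCoeff]
  | cons c cs ih =>
    cases vs with
    | nil => simp [cutCoeff]
    | cons v vs =>
      have h : digit 1 c.mask j ≤ 1 := by
        rw [digit_eq]
        omega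
      have := Nat.mul_le_mul_left v h
      have := ih vs
      rw [cutCoeff, List.sum_cons]
      omega

/-- Each cut is multiplied by its nonnegative multiplier and the results are added;
`le_sum_cutCoeff_mul` does the same for lower bounds. Surplus cuts or multipliers contribute nothing
to either side. -/
theorem sum_cutCoeff_mul_le (cs : List Cut) (vs : List ℕ)
    (h : ∀ c ∈ cs, maskSum N c.mask x ≤ c.bound) :
    ∑ j ∈ Finset.range N, cutCoeff cs vs j * x j ≤ cutBound cs vs := by
  induction cs generalizing vs with
  | nil => simp [cutCoeff]
  | cons c cs ih =>
    cases vs with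
    | nil => simp [cutCoeff]
    | cons v vs =>
      have h1 := Nat.mul_le_mul_left v (h c (by simp))
      have h2 := ih vs fun c hc => h c (by simp [hc])
      simp only [cutCoeff, cutBound, Nat.add_eq, Nat.mul_eq, add_mul, Finset.sum_add_distrib,
        mul_assoc, ← Finset.mul_sum]
      exact add_le_add h1 h2

theorem le_sum_cutCoeff_mul (cs : List Cut) (vs : List ℕ)
    (h : ∀ c ∈ cs, c.bound ≤ maskSum N c.mask x) :
    cutBound cs vs ≤ ∑ j ∈ Finset.range N, cutCoeff cs vs j * x j := by
  induction cs generalizing vs with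
  | nil => simp [cutBound]
  | cons c cs ih =>
    cases vs with
    | nil => simp [cutBound]
    | cons v vs =>
      have h1 := Nat.mul_le_mul_left v (h c (by simp))
      have h2 := ih vs fun c hc => h c (by simp [hc])
      simp only [cutCoeff, cutBound, Nat.add_eq, Nat.mul_eq, add_mul, Finset.sum_add_distrib,
        mul_assoc, ← Finset.mul_sum]
      exact add_le_add h1 h2

/-- The coefficient comparison that a refuting leaf establishes. -/
theorem coeff_le_of_leafRefutes (hnb : IsInvolutionTable m N nb) {les ges : List Cut}
    {scale width row : ℕ} {upper lower : List ℕ}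
    (h : leafRefutes m N b goal nb les ges scale width row upper lower = true) :
    (b * ∑ j ∈ Finset.range N, digit width row j + cutBound les upper <
      goal * scale + cutBound ges lower) ∧
    ∀ j < N, scale + cutCoeff ges lower j ≤ digit width row j +
      ∑ i ∈ Finset.range m, digit width row (nb i j) + cutCoeff les upper j := by
  simp only [leafRefutes, applyNat_eq, Bool.and_eq_true, allBelow_iff, Nat.blt_eq, Nat.ble_eq,
    Nat.add_eq, Nat.mul_eq, sumBelow_eq, Nat.pow_eq, Nat.succ_eq_add_one] at h
  obtain ⟨⟨⟨hlt, hlow⟩, hupp⟩, hcov⟩ := h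
  refine ⟨hlt, fun j hj => ?_⟩
  have hl : scale * ∑ j ∈ Finset.range N, 2 ^ (32 * j) + cutCoeffs N ges lower =
      pack N fun j => scale + cutCoeff ges lower j := by
    rw [pack_add, cutCoeffs_eq_pack, Finset.mul_sum]
    rfl
  -- With `y` for the row multipliers, the checker adds the packed rows with weights `y_j`. The
  -- symmetry of the matrix, applied to `y` and the weights `2 ^ (32 * j)`, identifies the result as
  -- the packed vector `M y`.
  have hr : ∑ j ∈ Finset.range N, digit width row j * rowCoeffs m nb j + cutCoeffs N les upper =
      pack N fun j => digit width row j + ∑ i ∈ Finset.range m, digit width row (nb i j) +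
        cutCoeff les upper j := by
    rw [pack_add, cutCoeffs_eq_pack]
    congr 1
    simp only [rowCoeffs, Nat.add_eq, Nat.mul_eq, Nat.pow_eq, sumBelow_eq]
    rw [hnb.sum_mul_row (digit width row) fun j => 2 ^ (32 * j)]
    exact Finset.sum_congr rfl fun j _ => mul_comm _ _
  have hle : ∀ j < N, digit width row j ≤ ∑ j ∈ Finset.range N, digit width row j :=
    fun j hj => Finset.single_le_sum (fun _ _ => Nat.zero_le _) (Finset.mem_range.2 hj)
  have hcov := hcov j hj
  rw [hl, hr, digit_pack _ hj, digit_pack _ hj] at hcov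
  · exact hcov
  · intro j hj
    have h1 : ∑ i ∈ Finset.range m, digit width row (nb i j) ≤
        m * ∑ j ∈ Finset.range N, digit width row j := by
      rw [← smul_eq_mul, ← Finset.card_range m, ← Finset.sum_const, Finset.card_range]
      exact Finset.sum_le_sum fun i hi => hle _ (hnb i (Finset.mem_range.1 hi) j hj).1
    have h2 := cutCoeff_le_sum les upper j
    have h3 := hle j hj
    rw [add_mul, one_mul] at hupp
    omega
  · intro j hj
    have := cutCoeff_le_sum ges lower j
    omega

/-- Weak linear programming duality. With `y` the row multipliers, `goal * scale` plus the lower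
bounds is at most the combination of objective and lower cuts. By the coefficient comparison and `x
≥ 0` this is at most `∑ (M y)_j x_j` plus the upper cuts. By symmetry that equals `∑ y_j (M x)_j`
plus the upper cuts, hence is at most `b ∑ y_j` plus the upper bounds, against the strict inequality
of the leaf. -/
theorem not_leafRefutes (hnb : IsInvolutionTable m N nb) (hx : RowsLE m N b nb x)
    (hgoal : goal ≤ ∑ j ∈ Finset.range N, x j) {les ges : List Cut}
    (hles : ∀ c ∈ les, maskSum N c.mask x ≤ c.bound)
    (hges : ∀ c ∈ ges, c.bound ≤ maskSum N c.mask x)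
    (scale width row : ℕ) (upper lower : List ℕ) :
    ¬leafRefutes m N b goal nb les ges scale width row upper lower = true := by
  intro h
  obtain ⟨hlt, hcov⟩ := coeff_le_of_leafRefutes hnb h
  have h1 : ∑ j ∈ Finset.range N, (scale + cutCoeff ges lower j) * x j ≤
      ∑ j ∈ Finset.range N, (digit width row j +
        ∑ i ∈ Finset.range m, digit width row (nb i j) + cutCoeff les upper j) * x j :=
    Finset.sum_le_sum fun j hj => Nat.mul_le_mul_right _ (hcov j (Finset.mem_range.1 hj))
  simp only [add_mul _ (cutCoeff _ _ _), Finset.sum_add_distrib, ← Finset.mul_sum] at h1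
  have h2 := sum_cutCoeff_mul_le (N := N) les upper hles
  have h3 := le_sum_cutCoeff_mul (N := N) ges lower hges
  have h4 := Nat.mul_le_mul_left scale hgoal
  -- The multipliers are moved from the columns to the rows by the symmetry of the matrix; then each
  -- row is bounded by `b`.
  have h5 : ∑ j ∈ Finset.range N, (digit width row j +
      ∑ i ∈ Finset.range m, digit width row (nb i j)) * x j ≤
        b * ∑ j ∈ Finset.range N, digit width row j := by
    simp only [mul_comm _ (x _)]
    rw [hnb.sum_mul_row, mul_comm b, Finset.sum_mul]
    exact Finset.sum_le_sum fun j hj => Nat.mul_le_mul_left _ (hx j (Finset.mem_range.1 hj))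
  rw [mul_comm scale] at h4
  omega

/-- A tree of refutations bounds the objective. -/
theorem BranchTree.sum_lt_of_refutes (hnb : IsInvolutionTable m N nb) (hx : RowsLE m N b nb x)
    (T : BranchTree) {les ges : List Cut} (hT : T.refutes m N b goal nb les ges = true)
    (hles : ∀ c ∈ les, maskSum N c.mask x ≤ c.bound)
    (hges : ∀ c ∈ ges, c.bound ≤ maskSum N c.mask x) :
    ∑ j ∈ Finset.range N, x j < goal := by
  by_contra! hgoal
  induction T generalizing les ges with
  | leaf scale width row upper lower =>
    exact not_leafRefutes hnb hx hgoal hles hges scale width row upper lower hT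
  | node mask k le gt ih1 ih2 =>
    rw [refutes, Bool.and_eq_true] at hT
    -- The point `x` satisfies the new cut of one of the two branches, so it descends to a leaf
    -- together with all its cuts and is refuted there.
    rcases Nat.lt_or_ge k (maskSum N mask x) with h | h
    · refine ih2 hT.2 hles fun c hc => ?_
      rcases List.mem_cons.1 hc with rfl | hc
      exacts [h, hges c hc]
    · refine ih1 hT.1 (fun c hc => ?_) hges
      rcases List.mem_cons.1 hc with rfl | hc
      exacts [h, hles c hc]

end Certificates

/-! ### Transport of cuts along symmetries of the table -/

section Symmetry

variable {m N b : ℕ} {nb : ℕ → ℕ → ℕ} {x : ℕ → ℕ}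

/-- `σ` is a permutation of `{0, …, N - 1}` that intertwines `nb i` with `nb (τ i)`, where `τ` is
an involution of `{0, …, m - 1}`. -/
structure IsTableSymmetry (m N : ℕ) (nb : ℕ → ℕ → ℕ) (τ σ σ' : ℕ → ℕ) : Prop where
  lt : ∀ j < N, σ j < N
  lt' : ∀ j < N, σ' j < N
  left_inv : ∀ j < N, σ' (σ j) = j
  right_inv : ∀ j < N, σ (σ' j) = j
  lt_index : ∀ i < m, τ i < m
  invol_index : ∀ i < m, τ (τ i) = i
  comm : ∀ i < m, ∀ j < N, σ (nb i j) = nb (τ i) (σ j)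

variable {τ σ σ' : ℕ → ℕ}

theorem IsTableSymmetry.sum_comp (hσ : IsTableSymmetry m N nb τ σ σ') (f : ℕ → ℕ) :
    ∑ j ∈ Finset.range N, f (σ j) = ∑ j ∈ Finset.range N, f j := by
  refine Finset.sum_nbij' σ σ' ?_ ?_ ?_ ?_ fun _ _ => rfl
  all_goals
    intro j hj
    rw [Finset.mem_range] at hj
  · exact Finset.mem_range.2 (hσ.lt j hj)
  · exact Finset.mem_range.2 (hσ.lt' j hj)
  · exact hσ.left_inv j hj
  · exact hσ.right_inv j hj

/-- Row `j` of `x ∘ σ` is row `σ j` of `x` with the transpositions renamed by `τ`. -/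
theorem IsTableSymmetry.rowsLE (hσ : IsTableSymmetry m N nb τ σ σ') (hx : RowsLE m N b nb x) :
    RowsLE m N b nb (x ∘ σ) := by
  intro j hj
  refine le_trans (le_of_eq ?_) (hx (σ j) (hσ.lt j hj))
  rw [Function.comp_apply]
  congr 1
  refine Finset.sum_nbij' τ τ ?_ ?_ ?_ ?_ ?_
  all_goals
    intro i hi
    rw [Finset.mem_range] at hi
  · exact Finset.mem_range.2 (hσ.lt_index i hi)
  · exact Finset.mem_range.2 (hσ.lt_index i hi)
  · exact hσ.invol_index i hi
  · exact hσ.invol_index i hi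
  · rw [Function.comp_apply, hσ.comm i hi j hj]

/-- The hypothesis says that `M'` is the image of `M` under `σ`, so reindexing along `σ` turns one
sum into the other. -/
theorem IsTableSymmetry.maskSum_comp (hσ : IsTableSymmetry m N nb τ σ σ') {M M' : ℕ}
    (h : ∀ j < N, digit 1 M' (σ j) = digit 1 M j) :
    maskSum N M (x ∘ σ) = maskSum N M' x := by
  rw [maskSum, maskSum, ← hσ.sum_comp fun j => digit 1 M' j * x j]
  refine Finset.sum_congr rfl fun j hj => ?_
  rw [h j (Finset.mem_range.1 hj), Function.comp_apply]

/-- A property that the sum over `M` has at all feasible points of objective at least `goal` also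
holds for the images of `M` under the symmetries `σ k`. -/
theorem forall_maskSum_of_symmetry {r goal M : ℕ} {τ σ σ' : ℕ → ℕ → ℕ}
    (hσ : ∀ k < r, IsTableSymmetry m N nb (τ k) (σ k) (σ' k)) {Q : ℕ → Prop}
    (hM : ∀ x, RowsLE m N b nb x → goal ≤ ∑ j ∈ Finset.range N, x j → Q (maskSum N M x))
    {M' : ℕ} (hM' : ∃ k < r, ∀ j < N, digit 1 M' (σ k j) = digit 1 M j)
    (hx : RowsLE m N b nb x) (hgoal : goal ≤ ∑ j ∈ Finset.range N, x j) :
    Q (maskSum N M' x) := by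
  obtain ⟨k, hk, h⟩ := hM'
  -- The sum of `x` over the image mask is the sum of `x ∘ σ k` over `M`. As `x ∘ σ k` is feasible
  -- with the same objective, the property known for `M` applies to it.
  rw [← (hσ k hk).maskSum_comp h]
  refine hM _ ((hσ k hk).rowsLE hx) (hgoal.trans_eq ?_)
  exact ((hσ k hk).sum_comp x).symm

end Symmetry

/-! ### From neighbour tables on natural numbers to the program on cosets -/

section Table

variable {m N b : ℕ} {K : ℕ} {H : Subgroup (Equiv.Perm (Fin (m + 1)))}
  {w : Fin (m + 1) → Fin K} {nb : ℕ → ℕ → ℕ}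

/-- The optimal value of the integer program from a table of the words of the right cosets and
of their images under adjacent transpositions. -/
theorem isOptimalValue_of_table (h : IsLabelStabilizer H w) (hnb : IsInvolutionTable m N nb)
    (wd : ℕ → Fin (m + 1) → Fin K) (hN0 : 0 < N) (h0 : wd 0 = w)
    (hwd : ∀ i : Fin m, ∀ j : Fin N, wd (nb i j) = wd j ∘ adjSwap i)
    (hN : N * Nat.card H = (m + 1).factorial) {v : ℕ}
    (hv : ∃ x, RowsLE m N (Nat.card H) nb x ∧ ∑ j ∈ Finset.range N, x j = v)
    (hle : ∀ x, RowsLE m N (Nat.card H) nb x → ∑ j ∈ Finset.range N, x j ≤ v) :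
    IsOptimalValue (adjSwaps (m + 1)) H v := by
  -- The enumeration turns the action of the transpositions into the table `nb`. The words are
  -- needed only here; from now on the program is a statement about `nb`.
  obtain ⟨e, -, he⟩ := exists_equiv_rightCosets h (fun j : Fin N => wd j)
    (fun i j => ⟨nb i j, (hnb i i.2 j j.2).1⟩) ⟨0, hN0⟩ h0 hwd hN
  constructor
  · obtain ⟨x, hx, hsum⟩ := hv
    refine ⟨fun z => x (e z), isFeasible_adjSwaps_iff.2 ⟨fun z => by positivity, fun z => ?_⟩, ?_⟩
    · have := hx (e z) (e z).2
      rw [← Fin.sum_univ_eq_sum_range (fun i => x (nb i (e z)))] at this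
      simp only [he]
      exact_mod_cast this
    · rw [Equiv.sum_comp e fun j : Fin N => (x j : ℤ), ← hsum, ← Nat.cast_sum,
        Fin.sum_univ_eq_sum_range]
  · rintro _ ⟨x, hx, rfl⟩
    rw [isFeasible_adjSwaps_iff] at hx
    have hy : ∀ z, ((x z).toNat : ℤ) = x z := fun z => Int.toNat_of_nonneg (hx.1 z)
    -- Nonnegative integers become natural numbers without loss. The value `0` at indices from `N`
    -- on never matters, since `nb` does not leave `{0, …, N - 1}`.
    let y : ℕ → ℕ := fun j => if hj : j < N then (x (e.symm ⟨j, hj⟩)).toNat else 0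
    have hye : ∀ z, (y (e z) : ℤ) = x z := by
      intro z
      simp only [y, Fin.is_lt, dif_pos, Fin.eta, Equiv.symm_apply_apply, hy]
    have hrows : RowsLE m N (Nat.card H) nb y := by
      intro j hj
      obtain ⟨z, hz⟩ := e.surjective ⟨j, hj⟩
      have hz' : j = e z := by rw [hz]
      subst hz'
      have h1 := hx.2 z
      rw [← Fin.sum_univ_eq_sum_range (fun i => y (nb i (e z)))]
      have h2 : ∀ i : Fin m, (y (nb i (e z)) : ℤ) = x (z.act (adjSwap i)) := by
        intro i
        rw [← hye, he]
      rw [← hye z] at h1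
      simp only [← h2] at h1
      exact_mod_cast h1
    have h1 := hle y hrows
    rw [← Fin.sum_univ_eq_sum_range, ← Equiv.sum_comp e] at h1
    simp only [← hye]
    exact_mod_cast h1

end Table

/-! ### The shape (5,1,1) -/

section FiveOneOne

/-- The index of the image of the `j`-th word of shape `[5, 1, 1]` under the `i`-th adjacent
transposition. -/
def nextFiveOneOne (i j : ℕ) : ℕ :=
  digit 6
    93460603779402571303241589345232703605917046477240012504341725484588571376307241295343134140725459396843004220873335638480656581997216485796951637859566778096550016077153361955561466041648503259862787727638384515447212168861544970773828730782450847202138916162972012282986837183277007326183383561472690629688715602854476217295454062893775907660310241505516853083267286338660425300126970825325023936348481764954338736167505130308571139702675046128696434752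
    (Nat.add (Nat.mul 42 i) j)

/-- The `j`-th word of shape `[5, 1, 1]`, in lexicographic order. -/
def wordFiveOneOne (j : ℕ) (p : Fin 7) : Fin 3 :=
  Fin.ofNat 3 (digit 2
    371063548739661213227243414294646254968807871011048822322880058265794208036568029254881370286797273971472484196157187494524719932464568354110027667881070681543888221033735168
    (7 * j + p))

/-- An optimal point of the integer program of shape `[5, 1, 1]`. -/
def optimumFiveOneOne (j : ℕ) : ℕ :=
  digit 5
    900911095308217720325671183919590895581360862496401303318087217 j

/-- A finite check on `6 · 42` entries. Involutions make the matrix of the program symmetric, on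
which the leaf certificates rest. -/
theorem isInvolutionTable_nextFiveOneOne : IsInvolutionTable 6 42 nextFiveOneOne := by
  unfold IsInvolutionTable
  decide +kernel

theorem isLabelStabilizer_fiveOneOne :
    IsLabelStabilizer (youngSubgroup 7 [5, 1, 1]) (![0, 0, 0, 0, 0, 1, 2] : Fin 7 → Fin 3) := by
  refine isLabelStabilizer_youngSubgroup fun k i => ?_
  rcases k with _ | _ | _ | k
  · fin_cases i <;> simp [youngBlock]
  · fin_cases i <;> simp [youngBlock]
  · fin_cases i <;> simp [youngBlock]
  · fin_cases i <;> simp [youngBlock]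

theorem card_youngSubgroup_fiveOneOne : Nat.card (youngSubgroup 7 [5, 1, 1]) = 120 := by
  rw [isLabelStabilizer_fiveOneOne.card_eq, Fin.prod_univ_three]
  rfl

/-- The action of the exchange of the two single labels and of the reversal on the words of shape `[5, 1, 1]`. -/
def symmFiveOneOne (k j : ℕ) : ℕ :=
  digit 6
    45635972658320716553464350923167520090335446244589294303004021990126205711226751750777077092716491096740427297393712816807863389448059826804335929966758232256036095989493417760719196215594171998056555843915671679934255455618822260734652193427664270742571777641995188054100405908552119587181159647027264
    (Nat.add (Nat.mul 42 k) j)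

/-- The inverses of the permutations `symmFiveOneOne k`. -/
def symmInvFiveOneOne (k j : ℕ) : ℕ :=
  digit 6
    45635972658320716553464350923167520090335446244589294303004021990126205711226751750777077092716491096740427297393712816807863389448059826804335929966758232256036095989493417760719196215594171998056555843915671679934255455618822260734652193427664270742571777641995188054100405908552119587181159647027264
    (Nat.add (Nat.mul 42 k) j)

/-- Exchanging the labels `1` and `2` commutes with every permutation of positions, so it keeps the
index of each transposition. Reversing a word turns the exchange at `i` into the exchange at `5 -
i`. The four symmetries are involutions, so the table of inverses is the same numeral. -/
theorem isTableSymmetry_symmFiveOneOne : ∀ k < 4,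
    IsTableSymmetry 6 42 nextFiveOneOne (fun i => if k < 2 then i else 5 - i) (symmFiveOneOne k) (symmInvFiveOneOne k) := by
  have h : ∀ k < 4, (∀ j < 42, symmFiveOneOne k j < 42) ∧ (∀ j < 42, symmInvFiveOneOne k j < 42) ∧
      (∀ j < 42, symmInvFiveOneOne k (symmFiveOneOne k j) = j) ∧
      (∀ j < 42, symmFiveOneOne k (symmInvFiveOneOne k j) = j) ∧
      (∀ i < 6, (fun i => if k < 2 then i else 5 - i) i < 6) ∧ (∀ i < 6, (fun i => if k < 2 then i else 5 - i) ((fun i => if k < 2 then i else 5 - i) i) = i) ∧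
      ∀ i < 6, ∀ j < 42, symmFiveOneOne k (nextFiveOneOne i j) = nextFiveOneOne ((fun i => if k < 2 then i else 5 - i) i) (symmFiveOneOne k j) := by
    decide +kernel
  intro k hk
  obtain ⟨h1, h2, h3, h4, h5, h6, h7⟩ := h k hk
  exact ⟨h1, h2, h3, h4, h5, h6, h7⟩

/-- The images of the mask `2130303778816` under the symmetries, with the lower bound `86`. -/
def orbitCutsFiveOneOne : List Cut :=
  [⟨1074794564, 86⟩, ⟨68753097232, 86⟩, ⟨33285996544, 86⟩, ⟨2130303778816, 86⟩]

/-- Refutes that the sum over the mask `2130303778816` is at most `85`. -/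
noncomputable def orbitTreeFiveOneOne : BranchTree :=
  -- The first mask has the bits `35` and `41`, the words `1200000` and `2100000` with both single
  -- labels in front. The constant point `120 / 7` puts `240 / 7` on them, between `34` and `35`,
  -- and the tree splits there. The last upper multiplier of a full list belongs to the assumption
  -- that is to be refuted.
  .node 2233382993920 34 (.node 1074794565 102 (.node 4299178288 102 (.node 2 17 (.node
  17197629440 102 (.node 1040187392 86 (.node 2149589130 103 (.node 8598359552 103 (.node
  824633720832 36 (.node 68753097232 86 (.node 4118734943939 511 (.leaf 2700 10
  135160124421561260711930090131468046759175989862308701440794938468881060283969447541996204665749217232582860743450244139712539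
  [2024, 0, 0, 18, 114, 0, 63, 387, 1993, 1, 251, 30] []) (.node 553648128 31 (.leaf 10000 11
  9826859552753465989079987552535027148770716938649747523098715236624520156351315706836571633139025870834051101605944960230743423369364131881
  [2558, 1129, 97, 7571, 9292, 5959, 6316, 0, 8591, 9629, 1, 8267] [21]) (.node 978344 199 (.leaf
  14000 13
  16786572248417437790549037979454253481866382608774737529804799380119724896837231062858441620082340511743034774191022837295857329846138550919094086794982360276943987
  [5046, 1716, 1, 5643, 1, 8265, 1877, 9070, 4610, 8328, 12432, 12516] [4789, 1417]) (.node
  67645734912 103 (.node 488552529983 208 (.node 2199023255552 17 (.node 796356671 335 (.leaf 3600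
  10
  71140565293767880838036933087596071709835458773287699414658320302583200583270680112869726902020559466575436571862021233
  [2376, 2951, 0, 0, 411, 58, 2479, 200, 2, 618, 0, 183, 487, 0, 2549] [0, 4444]) (.node 2 16
  (.leaf 960 8
  10389441138274760915261771641720036938939158880301901045713111151337697863244442349328273586163548209 [826, 19,
  0, 23, 40, 14, 746, 0, 101, 649, 0, 564, 715, 846, 769] []) (.node 24576 32 (.leaf 2700 10
  2404907633877438026925403216297975661881018453495863852776908297776272247190946597657202792043021811730414412936
  [927, 13, 0, 1, 0, 0, 2486, 0, 2686, 2647, 604, 1576, 1498, 2687, 2697] [0, 0, 1]) (.node 18 35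
  (.node 40 31 (.leaf 7000 12
  54874486236027319147204278073380149228376798015987933527972020421767018705170163263826304891072029069958695914982477114696887930147877978899084
  [3853, 1048, 5937, 0, 1, 460, 0, 4478, 129, 5906, 5201, 4516, 1165, 3437, 1, 6928] [0, 0, 0, 0,
  857, 422]) (.node 3560111812611 335 (.leaf 2000 10
  921039133364142448687312263860146587309081697417453017535924739808225730487043711398026592594139436651670189324114205725
  [1669, 0, 186, 1, 2, 0, 1, 1579, 0, 676, 551, 367, 1179, 745, 603, 468] [2730, 1, 0, 239, 0, 0,
  502]) (.node 35399925760 103 (.node 3839423377471 510 (.leaf 2000 9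
  43934260767310792843663156052310248508937205712813308984111979331121176238838274992506851864378440706485662812
  [1408, 0, 0, 76, 1, 1, 0, 0, 1500, 2, 1, 98, 320, 272, 105, 498, 131] [0, 0, 1]) (.node
  1074794564 84 (.leaf 1200 8
  10679936581061855575321873721832568724065625684970230098787940988567139435978871666925609242605295 [899, 0, 0,
  51, 1, 0, 2, 0, 1099, 1056, 581, 1024, 0, 1164, 0, 1192, 1089] [48, 0, 1, 1, 318]) (.node
  1052672 33 (.leaf 10000 13
  18435736153420100794450782023205884554186031945852126104936826649932909489541695694572424876407222793553279023251870435967800853741614927998600574509514752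
  [18751, 0, 2267, 841, 0, 0, 0, 0, 7631, 1, 863, 6636, 7600, 6176, 4902, 9159, 8102] [21830, 0, 0,
  0, 0, 0, 0, 0, 1]) (.node 1074794560 66 (.leaf 7000 11
  522430670093659182454473771539610479832986760264664351380773890037341048254540593768433839845583363755107220956782059885435563001513165
  [4011, 0, 0, 5872, 0, 0, 3, 0, 5978, 0, 4796, 5248, 5917, 5214, 365, 0, 6473] [3, 0, 0, 0, 478,
  0, 0, 0, 0, 3, 570]) (.node 1052677 69 (.node 1052672 34 (.node 1074794564 85 (.node
  4188562835712 340 (.leaf 3600 10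
  169297466508053430587077057689064294878692853868383486393406753996577797079451038395554647690637226672262548732547539642875904
  [2317, 0, 61, 0, 0, 75, 2, 0, 95, 1, 0, 416, 3036, 1, 638, 43, 978, 3547, 910, 901] [1, 0, 159,
  0, 0, 1, 0, 0, 0, 0, 2]) (.node 41875931136 70 (.node 64424509440 70 (.node 8421376 36 (.node
  6291456 32 (.leaf 7000 11
  33272036331547859964620880383397502582099918280742747369592428756780221302751800474537329941997744253400597985093133102370284109824
  [3177, 1230, 0, 0, 0, 0, 1, 0, 0, 94, 0, 0, 0, 0, 4187, 0, 6658, 6213, 5855, 1523, 6854, 6911,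
  6909] [0, 0, 388, 2014, 0, 0, 2, 1, 0, 0, 0, 0, 5]) (.node 4210688 32 (.leaf 3600 10
  7746764410013049549044320067216307234030170854099497744216704083632704111491797478677050530137967817215028672341053800448
  [2336, 529, 1, 1, 0, 0, 0, 0, 879, 57, 1, 0, 0, 2, 2493, 2281, 3529, 3375, 0, 0, 3600, 3553,
  3586] [123, 12, 1, 843, 146, 1, 0, 0, 0, 20, 0, 0, 1]) (.node 12 33 (.leaf 5000 11
  31235518562175398201330735089811692989358390495432380728172422570115218452829732811897301839489535715539449913832491397492959340396544
  [1998, 229, 60, 140, 0, 1691, 0, 0, 0, 188, 0, 0, 0, 0, 4611, 0, 4917, 4816, 4739, 3883, 5000,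
  4801, 4950] [0, 0, 0, 172, 1, 3030]) (.node 6442450944 34 (.node 33285996544 85 (.node 33619968
  33 (.leaf 10000 12
  1058376459673200889394873577776239764621246452013802580595620880420178282105454599425663339873678331442529732355713156761933947501361185792072876032
  [4767, 1098, 2, 0, 0, 0, 0, 671, 0, 0, 0, 717, 0, 0, 0, 0, 8139, 0, 3680, 4561, 10136, 7031,
  10776, 9720, 8181] [0, 0, 0, 0, 0, 1, 2948, 0, 0, 0, 0, 0, 0, 0, 1, 776]) (.node 24576 34 (.node
  4095 205 (.node 412316860416 34 (.node 3909251268608 204 (.leaf 5000 11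
  101257951550520582809857106900155482919226906644442337551546409620591663386882945045591857622313560128525300935202680752064568492032
  [6222, 3267, 1, 0, 985, 2078, 0, 0, 1, 0, 0, 0, 0, 0, 0, 0, 0, 2, 2, 0, 2207, 109, 335, 4419,
  2502, 7008, 1407, 1031] [0, 547, 0, 0, 620, 0, 338, 1946, 0, 0, 0, 0, 0, 0, 0, 1, 2009]) (.node
  412316860416 33 (.leaf 2700 10
  1331235550920543551178759026968959482314450253791796574902104416733551328944367894612944922610921749343737383868341897134080
  [1927, 0, 253, 128, 392, 38, 1, 1, 0, 0, 201, 0, 515, 0, 0, 0, 0, 2, 1, 2205, 2113, 1229, 2244,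
  275, 2210, 2390, 2185] [0, 0, 195, 1, 0, 0, 1, 0, 81]) (.node 134479872 34 (.node 4210688 34
  (.node 33619968 34 (.node 2105344 34 (.leaf 10000 12
  2843913105360763817801529530965720290588552170194900604637765116071211898644306326814608139639924990753411067546529631735044463666344795774925144064
  [6940, 3948, 4219, 0, 0, 7395, 0, 8077, 0, 0, 1, 0, 0, 7320, 0, 910, 0, 0, 0, 0, 0, 0, 461, 1355,
  0, 5151, 983, 1125, 2392, 14241, 9424] [3208, 5152, 0, 456, 0, 0, 0, 0, 0, 468]) (.node
  865702464 204 (.leaf 1500 10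
  222143210262182485242329758609903151820211804513307104385825965793192866982702050466063121797167951833279915353818408937324544
  [696, 25, 0, 320, 1, 0, 0, 1095, 0, 0, 0, 0, 0, 0, 1, 348, 932, 1, 0, 0, 0, 0, 991, 0, 1, 1127,
  1073, 406, 1884, 1803, 1897] [1311, 397, 230, 0, 0, 1, 0, 0, 0, 477, 1093, 0, 0, 0, 1, 0, 0, 0,
  0, 505]) (.leaf 7000 11
  325725960209143573102852790903361016872971278168376844463662183519327237352575176855189992914003232448704652679015836884290474617648185344
  [361, 0, 0, 1, 1386, 1653, 1800, 378, 0, 1, 0, 0, 489, 0, 262, 1, 2, 0, 0, 1, 0, 4584, 3354, 0,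
  5491, 2156, 4822, 5614, 6974, 5597] [601, 893, 7, 292, 1, 0, 197, 0, 0, 1, 2, 414]))) (.leaf 768
  10
  55740612302458182386727283596200649339818182481969401306880466431981625810627811315044024875128787758378351987294343026180096
  [0, 530, 448, 0, 83, 443, 102, 0, 1, 0, 0, 79, 0, 105, 498, 0, 0, 0, 0, 0, 17, 0, 1, 1, 321, 253,
  736, 632, 305] [1985, 0, 0, 0, 3, 45, 0, 0, 0, 0, 360, 51])) (.leaf 1500 10
  129178061305281617171404767471405491637706290343722267608024257393926857142280658060141374226383486353918588513008322871296
  [0, 1, 832, 192, 248, 0, 0, 0, 0, 0, 772, 0, 50, 1, 0, 0, 0, 0, 0, 527, 521, 0, 1213, 62, 84,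
  697, 1722, 1238] [1357, 22, 243, 0, 0, 0, 0, 0, 0, 0, 29, 0, 1, 0, 0, 0, 0, 0, 1, 28])) (.leaf
  2700 11
  349618399594112953240213714050628474909152502771243084088532182096699266420267166843649371882467751630744948429145627521431655965261824
  [0, 372, 353, 797, 0, 2, 0, 0, 0, 186, 0, 60, 165, 0, 1, 0, 0, 0, 1747, 1515, 0, 1896, 647, 2053,
  2248, 2823, 1519] [2200, 901, 94, 0, 0, 0, 0, 152, 0, 0, 370, 0, 0, 1])))) (.leaf 7000 11
  7250943114260412391568752937778220530773451655122500566923619420062942916357036904403200449595937508364744850526297578863288166068003012608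
  [411, 328, 906, 66, 1, 0, 0, 0, 258, 0, 4988, 261, 0, 0, 0, 0, 0, 6237, 5996, 0, 6533, 786, 6054,
  7043, 1245, 5789] [3942, 1, 0, 0, 0, 26, 0, 0, 495, 0, 0, 0, 0, 0, 0, 0, 2, 454])) (.leaf 7000 12
  49947976805373867644372262489029417723532865935576757942378932666966605568020413671522721173786442468683310415240465567131361573283079165610819584
  [21, 0, 555, 0, 0, 0, 0, 0, 1, 0, 0, 570, 0, 0, 0, 0, 6332, 0, 736, 5049, 9788, 5605, 10269,
  6857, 6000] [3584, 0, 0, 0, 0, 139, 0, 335, 4248, 304])) (.leaf 2700 11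
  11356855067779913633625913160875007063459336292141882092089125616561357549393359433512284030659885863812514139452889620053242469679104
  [221, 158, 0, 0, 0, 0, 0, 0, 4, 0, 0, 0, 0, 1, 1, 1727, 0, 2495, 2487, 2536, 1644, 2655, 2835,
  2739] [2496, 0, 86, 0, 0, 44, 0, 969, 1283, 95, 0, 1]))) (.leaf 1500 11
  56831410720394342217128276721007514227563687173876904005529451537367465775992737474502054906679281551835420742454940193944619796398080
  [3238, 0, 0, 1, 0, 0, 0, 0, 58, 1028, 0, 0, 0, 0, 0, 876, 1519, 713, 710, 1134, 1509, 778, 1646]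
  [4357, 2, 0, 0, 181, 0, 769, 615, 0, 0, 1, 0, 0, 0, 0, 1, 145])) (.leaf 2700 11
  5695063551725648556809086272944170295117870664771191684573484220943640249400208930310564990565820774088197684145825002351203796910080
  [394, 0, 0, 0, 1320, 0, 0, 2, 2196, 0, 0, 2, 0, 0, 1625, 2615, 2000, 959, 1609, 2189, 2, 2688]
  [8990, 874, 0, 1949, 0, 0, 0, 1543, 0, 0, 0, 0, 0, 0, 0, 0, 37]))))) (.leaf 7000 12
  7032675163924483940998458203726214032457986417460311496199096713507361057840663446821853679688634405058760894287420687657004528106910004469106212864000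
  [3711, 2, 0, 0, 0, 0, 596, 1511, 0, 0, 1035, 1, 0, 6431, 4200, 3370, 0, 3035, 7077, 2820, 5908]
  [5006, 0, 0, 128, 104, 0, 0, 2, 1, 140, 0, 0, 207, 81])) (.leaf 10000 12
  9365245650948005135670766263852939617129406927931227385165383620904550270891490830171629655952299969403276003640607352540491456111023321855819776
  [1430, 0, 321, 0, 0, 0, 7692, 0, 0, 2, 0, 9068, 6887, 9973, 9839, 2659, 7772, 10007, 0, 9995]
  [2982, 0, 665, 0, 765, 0, 7, 186, 1, 0, 0, 0, 16])) (.node 2097152 28 (.leaf 10000 13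
  2014838263729449268933446152084007421626480599427625685756349440753207613562525356763696433590023519595867920702789302409668671332982002610846955151326592368640
  [1618, 0, 0, 0, 0, 0, 4969, 0, 0, 1, 0, 6004, 3579, 5045, 4199, 6347, 6665, 10982, 0, 7206]
  [13360, 0, 0, 473, 1662, 285, 0, 0, 1, 0, 697]) (.leaf 10000 12
  927159389964652258101092329274689049447671589297659601149257267294178513843147822309286945421448049362025248939526613621091441551604335055478980608
  [0, 504, 0, 1, 0, 7653, 0, 0, 270, 1, 8354, 9354, 6915, 6972, 514, 9181, 10000, 0, 8485] [530,
  251, 0, 881, 0, 471, 0, 0, 22, 0, 0, 0, 0, 1])))) (.leaf 576 9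
  4697085165616018953540447238005185366583418712542651993297512321117151799599897824596615726420656607034867712
  [1013, 0, 0, 86, 15, 0, 10, 1, 0, 514, 0, 541, 553, 495, 401, 163, 575, 576] [1734, 0, 3, 0, 0,
  0, 0, 0, 0, 0, 0, 2, 16])) (.leaf 576 9
  2348542582808075775153801011915295269326248349682961392844525082872185485885444665541254627050233321138159616
  [516, 1, 0, 4, 0, 0, 0, 0, 491, 0, 568, 551, 526, 349, 63, 573, 575] [1830, 0, 0, 134, 0, 3, 0,
  19, 0, 0, 0, 2])) (.leaf 10000 13
  356974093551815264621940237165053140449171105254081676579924457524765119242177981338495801912405823669045121748586167184362694937700417283203990314795604640183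
  [0, 0, 2300, 0, 1, 0, 1, 8359, 0, 9056, 8712, 8617, 5997, 28387, 6995, 9496] [20582, 27007, 0, 0,
  0, 0, 0, 0, 0, 0, 0, 1])))))) (.leaf 1 1 35399925760 [0, 0, 0, 0, 0, 0, 1, 1, 0, 0, 0, 1, 1]
  [4])))) (.leaf 2700 12
  127866829004545105723008899855556522582912057423112592968625455075458362786289937676985298541450447577190918132697435581570357571037974763598711930880
  [33, 0, 2, 17, 1, 2073, 1074, 2598, 2431, 2, 1414, 1, 2664, 2690] [2784, 1, 6916, 0, 1, 7,
  47]))))) (.leaf 960 10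
  1835091889197693844384029218832421313133654590366857691010491228207204268227229797715780968658802287920473512582503634695094338
  [0, 0, 0, 2, 717, 0, 647, 702, 794, 485, 644, 231, 2] [2727, 0, 0, 14])) (.leaf 768 10
  892166190555880953238470283428633531075252366478328342831528429840453630932650250939373596265493542999474196136113431
  [0, 1, 2, 612, 507, 2, 728, 2, 272, 691, 1105, 562] [1533, 1, 1605, 337])) (.leaf 192 8
  45014260718148539464826689828333864444134718947766687148936988398663801443051068874274596534433057 [88, 0, 21,
  0, 3, 37, 0, 0, 75, 77, 140] [981, 0, 4, 105]))))) (.leaf 336 9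
  4870927773648804423582003916246198420090517242870514321979694266903073347282341453214963861368906570493507665947
  [75, 94, 28, 1, 148, 0, 0, 186, 290, 151] [975])) (.leaf 1500 10
  653192568625173701182758306916988163243114869307108165177784684097956117360197938877850352653396214486262000056808098257526816
  [1089, 928, 258, 1008, 0, 871, 1209, 0, 1] [2761])) (.leaf 1 1 8598359552 [1, 1, 0, 0, 0, 1, 1,
  1] [4])) (.leaf 5 3 673439381998436205444449962016 [5, 4, 0, 0, 1, 5, 5] [15])) (.leaf 3600 12
  3068803729981056039339877061643848032358764089540825399035515052598795663876095896365135362940264293272748326008427320083498003714789729799087293726929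
  [0, 3043, 1676, 2557, 2353, 1282] [6559])) (.node 4329327034368 102 (.node 2149589130 103 (.node
  2 16 (.leaf 2000 11
  424473878760051273778600495271413523687259707482922882192803528338976512147892843112524271276969277784723521384204350497752987933024976996
  [1729, 1, 1489, 0, 1274, 1500, 146, 326] [6871]) (.node 1 17 (.node 134479872 35 (.node 4095
  205 (.node 3839423377471 510 (.leaf 2000 9
  29783374096540022181983082771337648855935871317839427720509909996089760055586065858437469751959274573063520256
  [1397, 19, 1, 357, 16, 193, 516, 1, 227, 387] [0, 542]) (.node 4299178272 83 (.leaf 10000 14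
  39634696857260045247261475677129130277578882109392882791487140924258786302571596296500918517647420494327410149334428884251645385608531224891605144964513647700755436489813082112
  [8349, 2, 0, 0, 7182, 5844, 0, 1, 1582, 951, 3092] [0, 31247, 32054]) (.node 1099511681024 64
  (.node 2233382993920 33 (.leaf 3600 10
  257216525000834638380468955810447734695501438877982187268921004408099031828760973225368221511838374012571555779602022400
  [2934, 155, 267, 1, 127, 3105, 666, 227, 2722, 3191, 0, 2007] [0, 0, 0, 1]) (.node 4188562835712
  340 (.leaf 2700 10
  222293336320004347265439809035352778978243938982483896902772310674523012670795035910871583405888945203397846885791716616437760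
  [2065, 85, 0, 45, 168, 2088, 1, 284, 663, 2476, 145, 1] [0, 238, 0, 0, 1401]) (.node 67645734912
  102 (.node 2199023255552 17 (.node 17197039616 68 (.leaf 2700 11
  436799088128665555862907429519524505311470494840067838316896516269269577665124284924976174715938577660754010996146258344824891506688
  [2282, 285, 1099, 549, 866, 943, 640, 828, 1286, 818, 1082, 1111, 1129, 1] [0, 0, 0, 0, 0, 3192])
  (.node 8598323200 33 (.node 1052741 85 (.leaf 2700 11
  280061356129477530902461217931422667281128630708729536888347698866141061515248594184879980620345156445527880119425407073814965168128
  [1910, 1, 542, 780, 410, 467, 1, 287, 1133, 1919, 966, 1975, 0, 322] [1, 83, 0, 0, 0, 0, 6471])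
  (.node 1073745988 66 (.node 1074794561 85 (.leaf 14000 14
  18657895327344030879651937691650115527955246543557410915074732799183118940472556927594033167061606977221957645711107551664131331706625910334065311771830622667663212544
  [8493, 1702, 0, 0, 0, 140, 0, 2, 5053, 3817, 13456, 9595, 11377, 0, 742, 353] [3178, 1, 198, 0,
  0, 0, 0, 53273]) (.node 35399925760 102 (.node 2147483786 67 (.leaf 3600 12
  652120785171648532828529764827324208612775068349195551316726960756001766572928683354702258901516546231295123109453517752030850087028419856595085688832
  [1398, 1471, 0, 0, 438, 1046, 0, 726, 536, 320, 0, 3524, 1530, 2399, 2609, 0, 1] [0, 0, 1, 0,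
  562, 778, 55, 0, 5840]) (.node 8589938176 70 (.node 25769803776 35 (.leaf 3600 10
  16834353336351094717690790607372463661835910783368084701153867931496564598959994586626193011863874606504786001920
  [1843, 0, 2943, 0, 0, 301, 919, 38, 179, 21, 2242, 3095, 3607, 740, 2890, 3797] [378, 1599, 983,
  0, 9, 263, 164, 36, 0, 1]) (.leaf 7000 11
  31905342119667373390827507593843082769001110226598928901004023006049165013735156887511285702782545698364735076980203369106000314368
  [3385, 5515, 0, 0, 3184, 2615, 0, 1381, 1, 1258, 4212, 6829, 2034, 5000, 3998, 0, 2] [4497, 627,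
  0, 0, 0, 0, 3013, 1122, 0, 0, 1])) (.leaf 2700 11
  1023406115756181689268149076968207211333116706904903713942053737168777155366755022486818174201790738297896845964033130122942149689595658240
  [1, 0, 1, 2, 229, 1, 0, 1562, 313, 2063, 486, 543, 1123, 2285, 1326, 1572] [1775, 0, 0, 0, 1, 0,
  0, 0, 0, 0, 3429]))) (.leaf 2000 11
  2884962823343267703323348401464575921835973199440908224253762166237323622467727631058669254125344645513490077309884197823567391358976
  [0, 0, 2, 1, 32, 0, 40, 308, 1821, 0, 179, 1950, 2083, 2063, 1535] [1956, 191, 200, 0, 67, 0, 2,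
  0, 0, 7526]))) (.leaf 1200 10
  461535758044218880194322040764143103236646528644134525204713424152511123931359582208694542204186711510749089901999816704
  [799, 0, 198, 384, 300, 0, 0, 0, 490, 900, 655, 3319, 852, 36] [2491, 3109, 0, 142, 0, 1, 0, 0,
  298]))) (.leaf 7000 13
  37298496753102440393550065339317250631183703901001304482791342093871873815628239693991627517950643416257224312895361980970215351402013891212033275233042432
  [481, 1107, 624, 1067, 1, 1437, 3, 6008, 5564, 4341, 4463, 511, 2] [2327, 1880, 0, 0, 0, 0, 0,
  19580]))) (.leaf 1200 10
  2493503800697212918976837681142476305432423369240053120678296548284009407948395474677144956619960746342705960875674511089860608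
  [280, 90, 419, 2, 260, 1, 168, 953, 694, 781, 1] [2959, 265, 200, 0, 260, 0, 2167])) (.leaf 5000
  13
  61594879869980263229520592654125250010139116067881562709660320985829380028490219089473642017725155681576821376045926423422101330274866376138535819097128960
  [242, 272, 0, 661, 2971, 0, 910, 4296, 3812, 5444, 4762] [5942, 444, 0, 0, 0, 0, 17674]))))
  (.node 1052677 66 (.leaf 10000 14
  55711195577434100331208894576955057093184946237659671394860628157045158573714990626940077487597400045472629262983798659453742882787824838337503755820881234579468187856514777088
  [6401, 0, 0, 1411, 4933, 5489, 0, 7169, 0, 0, 4275] [912, 0, 0, 5873, 35334]) (.node 32212254720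
  69 (.node 5 32 (.leaf 192 8
  1651118206917380643416505265928041163412345674433653972828558770174759466328513816701789848429658112 [609, 1, 0,
  0, 39, 0, 139, 178, 120, 0, 38, 30] [451, 0, 0, 5, 0, 593]) (.node 1099511656448 65 (.leaf 5000
  13
  11809648911391612209884839930540625605978837766414320352181506677557126861477035342266453382894905552228854534402298110812530087322437300419971386999696227162914816
  [2104, 1, 0, 0, 1503, 0, 2742, 4628, 3451, 3275, 158] [0, 0, 896, 80, 0, 0, 17155]) (.node
  137439084577 59 (.node 3298534883328 33 (.leaf 2000 11
  578327808936174379074925422342420186719416403395824611973031360354501026607348240464238114719397833514271931382173724346977951416320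
  [1465, 131, 0, 1, 0, 0, 1824, 0, 187, 1934, 1853, 547] [25, 2, 0, 0, 279, 12, 0, 5318]) (.node
  137439085601 80 (.node 40 34 (.node 553648128 34 (.node 206158430208 33 (.node 4165 66
  (.leaf 1200 10
  608171493808764322329995586591596858763536052524569731533301351485650042362610124382898399647055310868090734880084733484698624
  [1092, 2, 0, 0, 0, 0, 205, 0, 0, 0, 776, 51, 1, 1020, 1, 0, 1103] [0, 1, 0, 0, 219, 54, 0, 73,
  3903]) (.node 393216 34 (.node 528 33 (.node 65536 19 (.leaf 3600 12
  1496766228363468496213982673275577818807662471534026248225029208902824249277094663054403428374752592183337809041928451099140565417979674699778322595840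
  [4649, 1868, 229, 1, 0, 0, 1, 1004, 2, 0, 1, 0, 1, 2162, 3599, 1733, 2497, 623] [0, 0, 0, 1, 0,
  0, 0, 0, 0, 10609]) (.node 549755813888 15 (.node 132096 32 (.node 66048 34 (.leaf 2700 10
  284047860908780861235894051217023691043078740021347245142084224946773497847090366795693550135075906730295623082337855602688
  [2332, 1057, 5, 0, 0, 1, 1, 0, 1, 0, 0, 0, 1, 10, 2659, 420, 41, 2665, 2688, 2171, 1432] [2, 2,
  1, 0, 0, 0, 0, 474, 0, 0, 212]) (.node 67239936 33 (.leaf 3600 12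
  345240448448808826820975831492028953595711890278516637558249515111387413071729130664758495218394272558727818916223025949215575898648438601224034451456
  [2444, 1, 1, 0, 2798, 0, 0, 0, 0, 0, 614, 0, 0, 746, 2002, 2208, 1598, 3542, 2825, 1258, 1039]
  [827, 0, 0, 0, 0, 4, 133, 0, 1602, 0, 0, 8561]) (.node 17196843008 65 (.node 33619968 33 (.leaf
  5000 11
  1130007409516001337652717087995541570760999990373761043417486695443242869137843879811572919966831352223998502039347984567310942421909516
  [3152, 178, 0, 294, 0, 0, 0, 0, 1, 0, 0, 0, 0, 0, 3, 4870, 466, 118, 3919, 4930, 4136, 2220] [0,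
  0, 0, 2, 0, 0, 0, 1, 0, 2]) (.node 4191888080896 87 (.leaf 5000 13
  902720892314448851642402757597751543939069078407541386311133043174428647671245089557969309374116916468495113340337566032199328787830861964059848463903090802688
  [3835, 855, 143, 660, 65, 0, 1, 1, 0, 0, 0, 0, 1, 0, 0, 4903, 0, 0, 4902, 4968, 902] [0, 1155, 0,
  2018, 0, 0, 0, 0, 0, 0, 199, 0, 64, 16454]) (.node 4123168604160 69 (.leaf 288 9
  1204802345283512101414198420844847443375858393126012221423460615637460376967069838624663660589750987012041372160
  [815, 0, 0, 0, 2, 0, 0, 0, 0, 0, 0, 1, 0, 1, 2, 150, 0, 0, 198, 217, 0, 1] [546, 200, 123, 0, 1,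
  0, 0, 0, 3, 0, 0, 45, 0, 147, 843]) (.node 51539607552 33 (.leaf 3600 11
  1279344410875805411933385540394089594583694958980758841677740933397179099936898732552030729230125314475452053343981084133775082670275571712
  [2656, 0, 0, 0, 0, 4277, 0, 0, 0, 0, 0, 2, 0, 0, 1, 2796, 2463, 2, 3003, 3203, 0, 1] [0, 0, 1,
  257, 0, 0, 1, 1, 0, 0, 0, 0, 587, 0, 828, 4069]) (.node 33619986 69 (.node 3710851743744 68
  (.leaf 10000 14
  13418678485391950293662761405694368805880374945830171620062028332633897276056666932644573930249141348292581554209191834286305189208422049286566354496252092536447884317972725760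
  [6765, 477, 0, 0, 3590, 0, 0, 0, 0, 0, 0, 0, 1, 0, 1, 1, 9772, 0, 2, 9190, 9875, 1883] [3, 0, 0,
  1669, 0, 1, 0, 0, 0, 0, 0, 2, 0, 0, 0, 801, 29633]) (.node 68719477266 68 (.node 275012124672 30
  (.node 1052740 68 (.node 275012388864 68 (.node 40 33 (.node 5 33 (.leaf 1200 10
  587017700285740755870814872526240874149359596046881960604865722473607454551880117028971052139872172252376545633216422836590592
  [1296, 1128, 365, 0, 0, 206, 833, 0, 0, 0, 1, 0, 1, 0, 0, 0, 0, 1, 0, 0, 0, 0, 0, 0, 158, 0, 546,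
  1238] [53, 0, 159, 0, 98, 0, 0, 1, 2, 0, 0, 0, 0, 0, 0, 244, 345, 1806]) (.node 17197432832 72
  (.leaf 768 10
  222419510999137784638692215940117653173767851477097342895029991317424853305863784576365308253789217223842895030586091655659520
  [1084, 3, 617, 0, 0, 0, 0, 0, 1, 346, 0, 0, 0, 0, 0, 0, 0, 0, 0, 0, 9, 732, 768, 9, 643, 759] [1,
  38, 0, 577, 0, 0, 1, 12, 808, 0, 0, 0, 0, 0, 0, 1, 0, 0, 1980]) (.node 65536 20 (.leaf 960 10
  319953772079985157034040659954981923722802073236463864252611539493655000767553980098406299570776099692122340889001561058967554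
  [2014, 0, 50, 1, 1, 0, 0, 0, 0, 1, 0, 861, 0, 1, 0, 0, 0, 2, 0, 0, 61, 803, 355, 155, 763, 879,
  1, 408] [1470, 2, 0, 0, 1, 1, 2, 0, 1, 0, 0, 2, 0, 0, 0, 0, 0, 0, 0, 1699]) (.node 66048 35
  (.leaf 7000 13
  31014386971132160064144957549223778745508855866682695150624014617161612963574405078927277994511486847893550951712520799734171462224515273594982894290626677003255808
  [4147, 2, 1851, 0, 0, 0, 2857, 0, 0, 0, 0, 0, 0, 0, 0, 0, 0, 2, 0, 0, 1192, 4111, 0, 32, 3477,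
  5518, 2388, 6052] [2869, 1, 0, 902, 0, 0, 0, 0, 2213, 0, 0, 0, 0, 0, 0, 0, 0, 1, 0, 0, 10540])
  (.node 137506063393 96 (.leaf 10000 13
  34950936698480206077974180854250149436345720411700745023319992532220563688945343092536824323012081748909221743453040078977812477615425039510755242038033487761506304
  [1011, 1, 2318, 0, 2, 2695, 453, 0, 0, 1, 0, 0, 0, 0, 0, 0, 0, 0, 0, 0, 2332, 2806, 0, 4046,
  2332, 6310, 3786, 7305] [12718, 0, 0, 520, 0, 491, 0, 0, 0, 2, 0, 0, 1, 0, 0, 0, 1, 0, 0, 0, 0,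
  16166]) (.leaf 5000 12
  1432108390954562068130772326141543284922901251409986731848750527379459368970996728651443020484948672193474032429321354382520238501229336515558834524160
  [1, 622, 0, 0, 623, 1426, 0, 0, 0, 0, 0, 0, 1, 0, 0, 0, 1, 0, 0, 1541, 0, 2326, 0, 13, 2455,
  2114, 2052] [748, 2, 0, 1, 0, 0, 0, 0, 0, 0, 1158, 0, 0, 0, 0, 0, 0, 0, 0, 0, 0, 3234,
  8494])))))) (.leaf 960 10
  457585007396512549722762704562886125116826107538475197121729951629930348737622849832953993019790167236573541900946614679240704
  [0, 850, 473, 0, 1, 17, 0, 0, 0, 1655, 1, 0, 0, 0, 0, 0, 0, 0, 1568, 0, 0, 960, 228, 0, 534, 960]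
  [2553, 362, 360, 127, 0, 0, 152, 2, 1, 0, 1, 0, 92, 515, 0, 0, 1, 0, 1547])) (.leaf 2700 12
  7109476392063402474305079331298464627542900100231897466017602438026963162620018423762585530722001769023100813156530981688476090795800510055209559392305
  [0, 327, 356, 177, 0, 1, 0, 0, 1, 1, 0, 0, 0, 0, 0, 0, 0, 0, 2114, 0, 4, 2066, 2413, 0, 2053]
  [1257, 103, 1, 0, 0, 0, 1, 0, 0, 0, 3, 0, 0, 1, 0, 0, 0, 0, 8046])) (.leaf 3600 12
  2838762044229847535606857055211104810313304319923049108322391441393262643785703321653095743304454438309276410140909704688344503852194712898867728220160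
  [139, 0, 1124, 204, 0, 0, 0, 4091, 0, 0, 1, 0, 0, 1, 0, 0, 480, 936, 0, 1540, 1702, 1303, 3433,
  3600] [6168, 941, 2496, 38, 0, 0, 798, 0, 0, 0, 2, 0, 0, 0, 0, 0, 0, 0, 5011])) (.leaf 5000 13
  82311896402655789108054716022201722344686838432026536215953515532383458084237092801241983757827592589624375472338593564951066808094604842166514743556709710838104064
  [1445, 0, 4061, 1047, 0, 0, 1, 0, 0, 0, 0, 0, 1, 0, 0, 278, 4407, 492, 0, 3555, 4686, 1, 3063]
  [11104, 5522, 1, 7488, 0, 0, 0, 1719, 3334, 1, 0, 0, 0, 0, 0, 0, 0, 852, 9832])) (.leaf 2700 11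
  3514268071839640095527591478312008383840640794932575216014724124471973454842617598088190360156620769701318613767075506931003706126266007552
  [1821, 0, 0, 0, 1141, 1236, 0, 0, 0, 0, 0, 0, 0, 0, 304, 1970, 1, 5653, 1638, 2336, 0, 250]
  [7691, 1430, 1, 1, 0, 2315, 0, 1, 0, 1, 2, 0, 0, 1]))) (.leaf 672 10
  272515259776511092076192168824201828364004799269149221717894211353751924134379216134485733740160804946405636230710107685519360
  [0, 0, 1, 0, 221, 0, 1, 1, 0, 0, 1, 0, 0, 18, 632, 0, 2266, 2898, 653, 2, 189] [2226, 1, 0, 0, 0,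
  1050, 61, 0, 0, 0, 0, 2, 1, 0, 2375])))))) (.leaf 1500 11
  1197923911693463886685225339529115672502138061155020075529255124392722004369265262358229622790399150508112064834362871060164844928720961536
  [0, 254, 15, 0, 429, 0, 2, 0, 0, 132, 0, 0, 45, 1310, 0, 190, 1380, 1442, 437, 1056] [2239, 0, 0,
  2403, 0, 0, 0, 0, 0, 0, 307, 0, 0, 818])))) (.leaf 2000 11
  825771127999046039382124860790941938372007500424762565788111119626204877937602300628771557568242341584203609146045123670705491543555309568
  [495, 0, 353, 344, 1, 0, 287, 0, 2, 0, 0, 274, 714, 0, 1286, 2000, 1338, 1262, 1369] [2981, 1872,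
  0, 1, 0, 0, 0, 0, 1663, 0, 0, 905])) (.leaf 10000 13
  1881283050170643026948692833830386813171150033658845105773655555804882973039899448319345874158459845995299850593498834402653651507791716605785737212639313920
  [610, 0, 1730, 971, 1, 1, 0, 1, 0, 0, 470, 9023, 4025, 977, 9390, 9472, 6703, 491] [12476, 8579,
  0, 727, 0, 0, 0, 0, 2754, 0, 0, 6409]))) (.leaf 10000 14
  34570918922775484326235386203267407050152248077310922840448015895852472150835193114407149144969143798941101795885083497814277377453130907980471281282831396475535077336256872448
  [6393, 0, 1, 0, 0, 3843, 2, 0, 0, 0, 363, 0, 1241, 0, 5519, 5486] [31149, 0, 2, 0, 0, 1, 0, 3978,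
  0, 0, 9098])) (.node 17197563904 83 (.leaf 10000 13
  34135508416116196679726178464059492357473066727798869028517728165569095149880123566980171121771841411573975428717295013470319509081913062020187483396377576017494016
  [324, 2, 1, 1696, 0, 0, 419, 1, 0, 1077, 7135, 0, 2820, 8260, 8889, 3930, 7883] [9120, 326, 0, 0,
  0, 0, 0, 1, 0, 0, 15745]) (.leaf 2000 11
  907157190682678707270323261735814806529265431241268574901209924509883339515768378180656930808694064462719385146755901450003508493954318336
  [0, 0, 0, 0, 376, 159, 0, 1, 1, 1294, 0, 706, 1500, 1701, 1198, 1507] [1299, 1724, 149, 0, 1, 0,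
  0, 0, 0, 0, 0, 265])))) (.leaf 288 9
  199795844201617729612111286481969705437072684475981415916656603981905972682716856884713796376240457552830922752
  [0, 1, 164, 154, 1, 0, 82, 0, 243, 51, 272, 485, 106, 380, 4] [1538, 1, 0, 0, 0, 1, 352, 227, 0,
  119])) (.leaf 2000 10
  428693827576473161942199527993698629107309891374447756929672279798005391101169782733281304155526976754588083125900804096
  [1, 307, 0, 22, 0, 0, 88, 1323, 288, 578, 1252, 1507, 1852, 1033] [2843, 140, 0, 1, 1, 330]))
  (.leaf 2000 10
  74136520086295030436710800052524120083989254691936822941251105725404380636252760126437237968555432477282369475925155338256384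
  [0, 228, 1069, 0, 1, 640, 424, 0, 1576, 854, 1735, 1823, 1496] [2729, 1, 1, 233, 370, 83]))
  (.leaf 1200 10
  232649619363028971292551384598894453083646333392735982550646499076196856716014508705713750990287586247985447632483518724096
  [1335, 55, 0, 575, 756, 1116, 164, 2, 948, 1197, 948, 390] [2279, 2, 0, 0, 18, 0, 0, 0, 948,
  217]))) (.node 67240961 71 (.node 68753096706 69 (.node 1536 36 (.node 550024249344 36 (.node
  550024773888 70 (.node 8 18 (.node 275012388872 86 (.node 2199023255552 17 (.node 550024774080
  103 (.node 8598356480 69 (.node 33285996544 86 (.node 3072 33 (.node 33620482 69 (.node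
  268960064 65 (.leaf 7000 12
  140490129787732157573549884321391762276987492429314420492155892827898972935305416950944642516618709816881913347325401385552126507432136809962803200
  [58, 566, 4157, 0, 2835, 0, 0, 0, 0, 1, 0, 0, 0, 0, 0, 0, 0, 1415, 1, 2830, 6013, 5175, 5583,
  4125, 3095] [0, 0, 1, 0, 0, 0, 0, 0, 7246]) (.leaf 14000 12
  149843947161532644498588369376338153738873653743912390619077845672311251906726315004370898363791960533176853538042881953136410496495134626407251968
  [540, 11304, 0, 9090, 0, 0, 0, 0, 0, 0, 0, 1, 1, 2, 0, 1, 2994, 0, 2884, 12631, 10338, 10989,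
  11068, 8543] [85, 0, 0, 1])) (.leaf 10000 14
  309478509576040810072296573411686786222897629158286895699987916605146043984408145373232820218492710675040277345793792343245525712730191202352566797159614164498846033379328
  [684, 0, 627, 128, 0, 0, 0, 0, 1, 0, 1, 0, 0, 0, 0, 2030, 1, 9361, 10406, 7336, 7969, 508, 93]
  [1050, 0, 0, 1, 0, 0, 0, 0, 0, 36223])) (.node 865702464 206 (.node 274878171140 69 (.node
  2061584302080 67 (.leaf 10000 13
  1441779715160529856888694202149907753596798316765024179351723818440673660389260406308958445830461675503797609725359501253256039196052703471440982326642519048192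
  [7899, 1355, 0, 3, 0, 0, 7535, 0, 222, 0, 1, 0, 0, 0, 0, 0, 0, 1931, 9133, 0, 1325, 9653, 8674,
  2649] [1, 0, 0, 1, 0, 0, 1, 604, 0, 29264]) (.node 824633720832 34 (.node 68753096706 68 (.node
  4123168604160 68 (.node 1855425871872 67 (.leaf 2700 12
  505723342757669286178521883308264947815755140184390112258518148656704028612287446692591778663019926909658137477041844808474673161061162980489560064
  [1935, 1079, 435, 0, 409, 241, 0, 3, 1, 997, 186, 0, 0, 0, 0, 0, 0, 1, 0, 0, 429, 2431, 0, 0,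
  2566, 2271, 462] [972, 0, 0, 0, 0, 0, 0, 0, 0, 175, 8529]) (.node 412316860416 34 (.node 66048
  34 (.node 33619968 34 (.node 4210688 32 (.leaf 2000 11
  150478379054580653835763344866069254604195628305545938385775004731070166475776277192878983391227098482567635986401434308251672006098944
  [1090, 265, 217, 14, 1, 334, 0, 1, 0, 0, 0, 0, 142, 0, 1, 0, 0, 0, 0, 0, 0, 37, 1, 324, 937,
  1666, 276, 0, 1618, 2] [0, 0, 96, 0, 0, 1, 0, 0, 1, 0, 0, 4664]) (.node 275012388864 69 (.node
  35399925760 102 (.node 8422912 67 (.leaf 5000 11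
  56813388367385946110688750220740636393449639099781564614894969184917107270431412773036970768230893456944955950281524257694443202674688
  [1689, 3890, 0, 0, 114, 0, 0, 0, 2, 1, 1, 0, 0, 0, 0, 8, 1, 0, 0, 0, 0, 0, 1, 252, 343, 293,
  3454, 4585, 856, 2905, 4455, 395, 310] [2, 0, 1, 2675, 0, 0, 0, 0, 0, 0, 0, 0, 1]) (.node 132096
  35 (.node 6291456 33 (.leaf 7000 11
  8517641300339950332943504488742986861324217622264545053714561709212601796052077107664987909635025506415421124003485618131714709651456
  [334, 1528, 5631, 2, 1344, 5180, 0, 1, 0, 22, 0, 0, 3, 0, 0, 18, 0, 0, 0, 0, 0, 0, 0, 2, 0, 1,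
  1432, 1, 6975, 6191, 3768, 5568, 2] [0, 1, 0, 0, 0, 0, 0, 0, 0, 0, 0, 0, 0, 833]) (.node
  1074794501 87 (.leaf 10000 12
  18730491301895953406014729646293249988783536205148560056919983808160841914022925737286691285092189942788808051266100579286736286253795026432688128
  [130, 2865, 7749, 25, 2218, 8342, 0, 1, 25, 0, 0, 0, 0, 0, 0, 11, 0, 1, 0, 0, 0, 0, 0, 0, 0, 0,
  655, 6990, 9992, 2435, 7748, 9234, 1] [192, 0, 0, 0, 0, 0, 0, 0, 2, 0, 0, 0, 17, 0, 2762]) (.leaf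
  10000 12
  46826228254740016638781288487251829414071167275504464071430518657055219865577036114982590573253660754354814475699350656680829327840952447381012762
  [2418, 7753, 51, 2196, 7915, 9, 0, 0, 0, 0, 0, 0, 0, 0, 14, 0, 1, 0, 1, 0, 0, 1, 1, 0, 0, 0,
  4382, 9941, 4532, 6785, 8811, 1] [222, 675, 0, 0, 1, 0, 1, 0, 0, 0, 0, 0, 0, 0, 0, 2240])))
  (.node 17196843008 70 (.leaf 2000 11
  13863355744963378494053831833987355152654495177837793297968876117980318744672093628216387229036014858227613275683774937133228228608
  [935, 1544, 0, 439, 0, 0, 0, 0, 20, 0, 0, 0, 0, 45, 0, 53, 0, 2, 0, 0, 0, 1, 2, 0, 0, 240, 1179,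
  1727, 430, 245, 1760, 274, 168] [1811, 335, 0, 0, 0, 0, 0, 0, 1]) (.leaf 10000 14
  105670947895023753198488635905494240452032471798479027674795852829353589572056358387824954336670994620768981323151300097625330674775537981124757322378429735748025014288384
  [627, 20, 0, 0, 0, 1, 0, 0, 0, 0, 1, 0, 1, 82, 0, 1, 0, 0, 0, 0, 0, 0, 0, 1, 2091, 0, 9887, 9174,
  6673, 7910] [1092, 0, 741, 2, 1, 0, 1, 0, 0, 1, 0, 0, 1, 0, 0, 35631])))) (.leaf 3600 13
  1263182266611721856775482677536648192270244378948604194076191734013613621395922776894664571359527334097021541482405938332870643259738932106196320371669240643593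
  [1722, 9108, 1, 1, 0, 0, 292, 1, 0, 4, 0, 42, 1090, 0, 2, 1, 0, 0, 0, 0, 1, 0, 0, 691, 0, 0,
  3505, 2755, 2864] [10584, 1, 0, 1, 1101, 0, 0, 0, 0, 0, 0, 0, 0, 16015])) (.leaf 960 10
  611994541074260801421943643361929123923400798417110322679717371531905859546935684992940768004237896128786371284372658585657
  [0, 0, 0, 0, 0, 0, 0, 0, 56, 97, 0, 614, 0, 1, 0, 0, 0, 0, 1, 0, 0, 0, 0, 0, 0, 779, 440, 683]
  [1305, 4, 0, 0, 48, 0, 0, 0, 0, 0, 0, 8, 0, 1300]))) (.leaf 768 10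
  343817493283130082943423095166967927198712403460373847099251494436321076933785955154903489560828066457781063453345499316224
  [0, 373, 0, 321, 0, 0, 0, 2, 0, 0, 156, 0, 1, 0, 0, 0, 0, 1, 1, 0, 24, 16, 715, 0, 0, 520, 751,
  479] [1477, 0, 1, 0, 0, 0, 0, 0, 0, 1, 0, 330, 725])) (.leaf 768 10
  38743835303736498709253131376797021445533872213570319531457018541681890732565000990683616445061360261055582711681535442944
  [1, 362, 0, 0, 5, 0, 0, 1, 0, 0, 0, 0, 0, 1, 0, 0, 0, 0, 0, 1, 148, 0, 0, 768, 406, 620, 391,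
  677] [1161, 0, 408, 1, 0, 1, 0, 0, 0, 0, 0, 0, 1161])) (.leaf 5000 12
  3618107051128338523099967141736247171065121778801013145375673473293432826790583409641457479917572491501031070622303581885951721606658359840353550336
  [0, 1299, 0, 0, 0, 0, 798, 1, 0, 0, 0, 0, 0, 0, 0, 0, 0, 0, 0, 147, 4278, 0, 0, 4055, 4853, 3841,
  1021] [9297, 1042, 0, 1, 0, 0, 1, 0, 0, 0, 0, 635, 1259]))) (.leaf 1200 10
  1297668511538377014713788233661059484298784337595960558347699903130482759692984630105899053312118653410180451168056462949744640
  [0, 2357, 548, 1, 0, 0, 0, 0, 361, 1, 0, 0, 1, 0, 0, 2, 0, 0, 640, 904, 1033, 432, 1114, 696,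
  422] [3343, 0, 0, 0, 0, 0, 0, 0, 0, 136, 0, 936])) (.leaf 10000 13
  2505977961274381130864373685035404310808973590724980215228420535144359189413955678051837317947973414507875296648471067995330873154152615454746545809002543972352
  [0, 922, 0, 0, 0, 592, 0, 0, 1133, 0, 0, 0, 1, 0, 1, 0, 2, 922, 8741, 1547, 23482, 10000, 9078,
  7723, 23018] [22224, 19957, 0, 0, 0, 0, 0, 1, 3015, 0, 0, 2021])) (.leaf 3600 12
  1660323489722829370080216053850733666205728454347665738441325849046035960409570310019368655151486380483901313411258583124877835494259856521560064
  [555, 1, 0, 0, 0, 0, 0, 106, 0, 0, 0, 2, 0, 2, 0, 0, 817, 3138, 689, 308, 2497, 2784, 2912, 2397]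
  [7708, 2479, 2, 0, 0, 1]))) (.node 40 34 (.node 528 34 (.node 68753097218 85 (.node
  4188562835712 340 (.leaf 7000 11
  533772188518497633451433599382782047801485623928957307740348826550221363220682728155739743852076798292196468584773715549408032880328758
  [4892, 3640, 0, 0, 0, 1, 1, 0, 0, 0, 0, 0, 644, 0, 1164, 0, 0, 0, 0, 0, 6072, 778, 0, 1505, 6660,
  985, 230] [1, 0, 0, 0, 0, 1, 0, 0, 0, 5138]) (.node 206158430208 34 (.node 132096 34 (.node
  66048 33 (.leaf 1200 8
  29904405678790377957747625403317950256733543529071267627227735267281948514064192560532454507544832 [994, 373, 0,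
  0, 0, 1, 0, 0, 0, 0, 2, 0, 0, 0, 0, 0, 0, 1, 0, 0, 0, 0, 1196, 762, 2, 1040, 1200, 280, 189] [0,
  0, 1, 1, 0, 0, 1, 0, 47, 0, 43, 168]) (.node 68753031186 68 (.node 2233382993920 33 (.leaf 10000
  12
  761706712332296223283589052562003030527525617392137688414968933391651966937092397960606143002324463692405681514494963121236183452180809419361091584
  [8203, 666, 0, 0, 576, 0, 1, 0, 104, 0, 0, 0, 0, 0, 0, 0, 1, 142, 0, 0, 0, 0, 102, 9674, 1553, 1,
  7855, 9897, 0, 5831] [0, 0, 0, 0, 0, 0, 1, 0, 0, 1, 0, 1059]) (.node 1100048498688 34 (.node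
  1040187392 85 (.node 17197039616 67 (.leaf 5000 13
  3587432439982530049188193345574278166153909058968135985686181347197413223019196312112701095175006523182713564640095820994032880513960169221621459931564605440
  [5188, 347, 637, 0, 0, 0, 0, 1, 0, 0, 48, 0, 0, 16942, 0, 0, 0, 0, 0, 0, 33, 2, 0, 0, 107, 4349,
  3405, 160, 3035, 4860] [20435, 0, 0, 0, 1, 0, 1, 0, 0, 0, 0, 0, 0, 8057]) (.node 33619968 33
  (.leaf 1500 10
  27110643205406109511434535352678532759643473339824314708442178921096802476224586704274141868592740675703953420189722
  [1285, 0, 106, 0, 0, 0, 0, 0, 0, 0, 0, 0, 0, 0, 0, 1, 0, 0, 0, 0, 0, 2, 0, 1, 54, 615, 567, 859,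
  1052, 1317, 933, 671] [524, 0, 0, 0, 0, 0, 1, 0, 0, 0, 0, 0, 0, 0, 948]) (.node 4328218619304 512
  (.leaf 1200 8 449090126786484122141875476491861991660935005698597068856526333038457921094017286144 [880, 265,
  0, 358, 1, 0, 166, 0, 0, 0, 0, 1, 0, 0, 0, 0, 0, 0, 0, 356, 4, 0, 1, 0, 31, 239, 59, 0, 194,
  1158, 261, 261] [68, 17, 0, 0, 0, 0, 2, 0, 0, 1, 0, 0, 0, 0, 32]) (.node 549755814336 68 (.node
  66048 34 (.leaf 1200 8
  66383225549412902958799186686541124113085643957267501026321470195203338150629528137935431787347968 [984, 1,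
  1007, 0, 0, 336, 0, 0, 0, 0, 1, 1, 0, 0, 0, 0, 0, 1, 0, 0, 0, 0, 1, 0, 0, 1, 1262, 182, 0, 1048,
  1199, 1052, 940] [65, 0, 0, 0, 1, 0, 0, 0, 0, 1, 0, 0, 0, 0, 0, 100, 10]) (.node 4210688 32
  (.leaf 2000 11
  31815301665986721868118074190152277798593001828220815525765051707088930828813229656289111218197825656679550892787912075561140224
  [1139, 0, 676, 190, 0, 0, 0, 0, 0, 1, 0, 120, 0, 1, 0, 1, 0, 0, 0, 0, 0, 248, 0, 0, 0, 0, 1142,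
  1290, 530, 0, 1762, 931, 742] [494, 57, 0, 111, 0, 0, 133, 0, 2, 0, 0, 0, 0, 0, 0, 31, 0, 4192])
  (.node 3161095929856 67 (.node 196608 31 (.leaf 2000 11
  1418999291706812248546599087577710860823783318608573774381849388612235415305981313020053288725540808064238421037651077042635110795968512000
  [3131, 1, 0, 591, 0, 0, 0, 1, 1, 0, 0, 0, 0, 0, 0, 0, 0, 0, 1, 484, 451, 0, 1003, 2, 0, 1, 0,
  163, 0, 1836, 1499, 1515, 829, 1471] [0, 0, 123, 0, 0, 0, 0, 0, 0, 1, 559, 0, 0, 0, 0, 0, 0, 0,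
  3299]) (.node 18 34 (.node 57982058496 69 (.node 536870912 16 (.node 17196646400 34 (.leaf
  1200 10
  77467715516266725134646241187298276873532666470359824648621847784495065285468775562746204178137432735758237720008661663898
  [3129, 766, 868, 417, 0, 0, 1, 236, 0, 1, 0, 0, 1, 1, 0, 0, 1, 0, 0, 0, 0, 0, 1, 0, 0, 0, 0, 0,
  0, 0, 0, 838, 629, 378, 306, 688, 362] [0, 0, 641, 356, 69, 0, 0, 0, 0, 0, 1, 0, 0, 0, 0, 0, 0,
  0, 0, 3037]) (.leaf 3600 12
  1956905539748188791729083556208013428087874104086020856964939157835805992431731952074262300934920894261547080783750625585494131382146392247556584243200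
  [0, 0, 0, 0, 0, 862, 0, 0, 1, 0, 64, 0, 2504, 0, 3, 1, 1, 0, 1, 0, 1, 0, 0, 0, 0, 1, 0, 1, 1581,
  0, 1650, 3536, 1765, 1493, 1680, 1770] [8428, 2767, 0, 6095, 669, 1, 0, 0, 0, 0, 0, 1, 0, 0, 1]))
  (.leaf 672 11
  165054400436322277649937581918609857385905353775565733880565187439293018176615360433375454934192824523175081102158736849729216315392
  [217, 0, 837, 0, 0, 472, 0, 0, 0, 672, 0, 1, 0, 0, 0, 0, 0, 0, 1, 0, 0, 1, 0, 1, 1, 0, 2, 392, 0,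
  0, 0, 672, 250, 585] [2726, 0, 0, 1671, 760, 1672, 113, 0, 0, 0, 0, 0, 0, 0, 0, 0, 0, 0, 0, 0,
  1437])) (.leaf 5000 13
  565482219949607128442476515508936883199714841286316909920200499125916283165299019815321165869007815101463127821497015092296438122254503510104
  [2200, 0, 0, 3562, 0, 0, 0, 0, 0, 1, 0, 0, 0, 0, 0, 16029, 0, 0, 0, 0, 1, 0, 0, 1, 0, 0, 649,
  1943, 5000, 769, 1, 3645] [4456, 0, 3, 3602, 0, 762, 477, 22107, 0, 0, 0, 0, 0, 0, 0, 0, 0, 0, 0,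
  0, 2474])) (.leaf 6 13
  1798577004856473695858943773591309370026992862013507885111235994696120059665189940632173647242231477705753043497356735451534225880251764411001157355876628037660
  [621, 0, 0, 0, 0, 0, 0, 0, 1, 1, 0, 1, 1, 0, 0, 60, 0, 0, 1, 0, 0, 0, 0, 0, 2, 0, 1756, 0, 3392,
  1438, 0, 875] [5716, 4653, 1, 12928, 2080, 6041, 0, 0, 0, 0, 1, 0, 0, 0, 0, 0, 57, 0, 138])))
  (.leaf 3600 12
  573231055353756459926536433813041949338418604098681328338540667278574215512840621490635539381775217855850180975715328599129865904124350653530119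
  [1, 0, 0, 0, 0, 0, 318, 0, 1, 0, 4, 1, 0, 3204, 0, 1, 0, 0, 0, 0, 1, 1, 0, 1, 686, 0, 2597, 3281,
  2665, 2884, 171] [2530, 0, 4213, 0, 693, 0, 0, 0, 0, 0, 0, 0, 0, 0, 0, 0, 0, 6, 0, 9792]))))
  (.leaf 960 11
  1457113125987497802747866618882683525135498489310126588627037740824559753711621178772267597963240921833291622611783061359293043310592
  [346, 0, 0, 0, 0, 0, 0, 519, 0, 0, 0, 0, 0, 215, 0, 0, 0, 0, 0, 0, 2, 0, 0, 417, 1, 399, 959,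
  960, 374, 1755, 371] [2930, 1194, 176, 0, 0, 0, 0, 614, 0, 0, 2, 0, 0, 56, 1]))))) (.leaf 3600 12
  22941216469652036620549168718813070436264270902882377220583734643880275310899336747534145950355573914689447866852287548108161459335156224491520
  [1417, 634, 1, 0, 415, 0, 1, 0, 88, 1, 30, 2979, 1, 0, 0, 0, 0, 522, 0, 0, 0, 0, 102, 3266, 0, 0,
  2910, 3497, 621] [11633, 0, 1, 0, 0, 0, 0, 0, 0, 0, 0, 0, 0, 1237, 10567])) (.leaf 768 10
  1487376402602273644785266153017797113966704748642694824190556349737339595338738197167081903810178795313317695629456006184960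
  [15, 167, 287, 171, 149, 1, 0, 6, 1, 0, 1957, 0, 1, 0, 0, 0, 0, 2, 1, 0, 1, 10, 730, 0, 0, 604,
  756, 1] [2058, 2366, 0, 0, 0, 1, 0, 0, 0, 0, 0, 0, 0, 148, 651]))) (.leaf 576 11
  11356855067131446143762846815669724149668080318755330990626530153093969256606876280678333422653125532472651926046957927190190905903104
  [304, 0, 2710, 0, 0, 0, 1, 0, 0, 0, 145, 48, 0, 0, 0, 1629, 1, 0, 0, 0, 0, 280, 276, 1, 0, 536,
  296, 223] [4921, 3506, 0, 102, 0, 0, 0, 0, 0, 0, 814, 0, 540, 797]))) (.leaf 7000 13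
  3837422007758057070267003114773936646172574307865080962153878494862808721082745827564426868473310600915172927539451585800492119565064453922818997649890563063931
  [2295, 0, 0, 0, 1, 2, 0, 0, 2859, 0, 0, 2, 0, 0, 0, 0, 0, 0, 1, 0, 5298, 1801, 0, 336, 4852]
  [12936, 0, 4111, 0, 0, 1, 0, 0, 0, 0, 0, 87])) (.leaf 336 8
  89713144428475880431035373844608602695236082428068437616888009145202558975327297763466760507949072 [0, 136, 0,
  1, 54, 0, 0, 96, 1, 0, 0, 1, 0, 0, 1, 0, 0, 1, 0, 0, 212, 320, 201, 182, 0, 1] [986, 86, 204, 0,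
  0, 0, 0, 0, 0, 0, 0, 0, 117]))) (.leaf 7000 13
  734580288214010839325973286391068797517182189864545849263849218200076555756345759010640176394479920628100107137820265213089627581687758639953969173391822815240
  [894, 0, 0, 1, 0, 0, 369, 0, 0, 1, 1, 0, 0, 0, 0, 0, 0, 1363, 0, 6011, 10465, 5490, 5597, 406]
  [3473, 1, 104, 0, 1, 1, 0, 0, 2, 0, 0, 26049])) (.node 40 32 (.leaf 10000 14
  335882658016412209577723024066389179169938481224061980469918112291016453121732634892354692961829345873787851118823078206623367810793413298219842143871392367746260314096020
  [706, 0, 0, 112, 0, 0, 219, 0, 0, 0, 0, 0, 1, 0, 0, 0, 0, 1, 0, 9566, 7908, 5777, 7979, 1] [3048,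
  212, 1, 0, 0, 0, 0, 0, 0, 0, 0, 37140]) (.leaf 3600 12
  206035431674204735193841044153598576299679701888035012718275693062834640377325045292402886334926187722324091723471013839650362946021498133460025487
  [0, 0, 19, 0, 0, 172, 0, 0, 0, 1, 0, 0, 0, 2, 0, 1, 1, 0, 3311, 2652, 2505, 2884] [591, 2703,
  320, 727, 0, 0, 0, 0, 0, 1, 0, 0, 13234]))) (.leaf 336 9
  4697085183045702499978642340850808192994938558643031702213649447903663485167631443966404327848408985630670848
  [13, 0, 1, 0, 0, 113, 302, 1, 0, 0, 1, 1, 37, 0, 0, 73, 0, 230, 335, 0, 289, 104, 83] [1067, 91,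
  377, 0, 1, 1, 26, 2, 0, 0, 0, 858]))) (.leaf 10000 13
  2639514711479958536027999511656323986773013019851737423242797507628308284658173970584403261151742862754536458501038499846750340707312261030383211967089297326080
  [0, 3, 0, 0, 4035, 0, 0, 2, 0, 1, 0, 280, 1602, 0, 5101, 0, 2599, 8890, 3897, 3790, 7125, 1427]
  [14177, 4424, 0, 0, 0, 0, 0, 1, 493, 0, 8651]))) (.leaf 192 8
  68352922350205466163609175478361633433746393035535722702543199664836110724201740119665809808556065 [0, 0, 135,
  0, 0, 0, 0, 0, 2, 1, 3, 0, 0, 2, 1, 73, 168, 71, 54, 0, 1] [801, 0, 0, 1, 0, 0, 0, 51, 0, 32]))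
  (.leaf 14000 14
  343430580658798020593348284698335432792648737791085463987025137363399031922555139917058220386168089633709646298273382711070582792929092101664590672424058642621282597732352
  [0, 1, 242, 0, 2, 0, 0, 2, 0, 7, 1, 0, 2787, 2, 13262, 13233, 10490, 11200, 646, 439] [1909, 0,
  0, 0, 1, 153, 0, 0, 0, 53284])) (.leaf 288 9
  12655525871502066621575756822830840649531087201815055521043013265424389079937086524846964229057866958523858944 [5,
  0, 2, 3, 0, 0, 1, 0, 4, 0, 1, 218, 0, 138, 331, 180, 149, 198, 1] [905, 0, 0, 0, 0, 5, 1, 79, 0,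
  1])) (.leaf 3600 12
  24435349524410040202501848822376103578024420820578236711998134883480755853755344607727013156019840411663135994189516459063019708728275291219363557801984
  [1, 0, 0, 0, 0, 1, 1, 2, 300, 0, 930, 1, 1965, 3424, 1747, 3047, 646] [7888, 0, 249, 0, 0, 1, 0,
  678, 0, 4648])) (.leaf 5000 13
  11307293115297715486057033945239987750932202846159523491363749848313234988142975378932152617128828628363891785433076436122434913037532235571187733561783174096224256
  [7800, 0, 1, 3, 0, 0, 630, 0, 0, 2821, 900, 0, 3454, 2112, 2685, 1891, 1] [12668, 0, 0, 506, 0,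
  0, 0, 0, 0, 9836])) (.leaf 3600 12
  1258064665794788998630144654548373525499551668600826310038980790891064842789020809147402624092486851408008766082332561684553713815514688720780394496
  [1148, 0, 820, 453, 48, 1989, 0, 1, 3315, 1, 0, 3146, 2975, 2710, 3197, 2050] [9853, 0, 1, 0,
  2473, 721, 2737, 0, 0, 552])) (.leaf 3600 12
  1889507665348136518675650191315039584075047439999827490050005078584641594723137012377940632664487740619392275109106829242037357516501025127334412288
  [2635, 1, 752, 0, 0, 0, 2221, 1297, 2, 1262, 2719, 2539, 2757, 1733, 872] [7356, 0, 0, 0, 600,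
  2070, 1, 0, 0, 6093])) (.leaf 5000 12
  2199531807857560796673438415257598998216737346696283385670844675359581333163495463470283577350422079142009692608115591568895360203645024071501232472064
  [0, 163, 1563, 1009, 0, 0, 0, 3235, 0, 1602, 3331, 3969, 4069, 3387] [6238, 764, 0, 0, 0, 111, 0,
  0, 0, 650])) (.leaf 768 10
  16004837806956664262614024406950947021941070415275450131969615833411662531462006400505112541788803614726260209679973937577984
  [1, 416, 343, 0, 500, 226, 66, 0, 701, 128, 443, 684, 415] [2196, 330, 1, 1, 56, 0, 0, 0, 0, 6]))
  (.leaf 576 9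
  16481098981044936002588040514302755406563573300723576303001039798200003952593845458915745438611321996694519808
  [136, 0, 0, 2, 1, 531, 364, 1496, 547, 557, 142, 82] [1451, 122, 0, 1, 0, 1, 77, 0, 0, 160]))
  (.leaf 1200 11
  98850066508987922091335126471587860278238464854789058936236233606868250595132790476954094870688502148596070349474167059487356236834275453
  [0, 0, 0, 4877, 933, 967, 90, 793, 1067, 1, 63] [3928, 1440, 0, 1, 0, 0, 0, 0, 0, 1286])))))
  (.leaf 672 10
  39807964120628673294516595167716012556379794374629908398315733672562236049605975539612529422760967951537935220552161545945088
  [186, 0, 350, 0, 540, 404, 0, 36, 1] [1841, 0, 215, 70, 0, 0, 568])))))) (.leaf 10000 14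
  83041455386970968443791557005269912471142077518651014917167417993807778229673667264473867995320154060034881223716284466167763596661658050223836389257461150229166586593280
  [1994, 9243, 1, 9392, 16020, 7375, 7160, 586, 290] [8059, 0, 37005])) (.leaf 14000 13
  5894524460543249426327863582753686895449112379006063479813759152054196120466607426801328364393550668095315588600463238254469939770965496446362028374179834757120
  [328, 13063, 873, 676, 10687, 13667, 11410, 952] [10945])) (.leaf 2000 11
  298373917528659419139496430015514922430183771014423076924273895203476781018565563834398940179360805137547917953880062315072934157972930
  [1392, 626, 0, 1090, 0, 1269, 457] [5736, 2696, 1687]))) (.leaf 1 1 19347218570 [1] [4, 4]))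
  (.node 2149589128 85 (.leaf 5000 12
  52246383786933377737778071400230277133464260812946747923655693109184696641312267009331248258131470017190192908235930188321488084277058651561575118274642
  [4260, 4715, 3488, 4578, 1, 14238] [15431, 1]) (.leaf 3600 12
  37759075921158722800668976368562815188983012850015192712367068459641834484631024737503351711315839815307636867316896232020252968842925587821060144759307
  [2302, 172, 985, 0, 10235] [4940, 11166])))) (.node 68753097216 70 (.node 67645734912 102 (.node
  1073741823 512 (.node 824633720832 32 (.leaf 2000 9
  394052565800260671577903237078961949171652774370037721251953005942875949503564659604381135345767577262664173726720
  [1250, 1322, 1637, 487, 1, 120, 3, 225] [1694]) (.leaf 20000 13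
  112472845406268641110373451305636395185517756069636854407089769414031206397490979713427682631288260130001370946106465421136204501927695241443112446483625691704041472
  [10810, 15494, 5204, 0, 642, 0, 13305] [2215, 26703])) (.leaf 7000 14
  4090975287078772645326132803290132401580044849726251866142783707338549764124128319031934872366677591380667357554959139241830710189066581884437043305117975423489826116845568
  [372, 3931, 0, 1372, 5916, 1129] [6211, 36304])) (.node 1074794564 86 (.node 4328218619304 513
  (.node 35198599168 68 (.node 1052672 34 (.leaf 10000 13
  29093035547688594212546571137204732180222956901498813708353218190149732580841950927880522675537741840178005008785312117868331800234379596693412373306050688000000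
  [5484, 1, 3858, 1, 5361, 608, 510, 3175, 3929] [13776, 29165]) (.node 2147483786 70 (.node 8 14
  (.leaf 20000 14
  7415872133323375835940069530944585867653572068520659787215334198790808514060062841546237631690627310149218891610598441808918505015774512410099441100292643182761610439376896
  [1099, 7224, 0, 0, 13762, 9566, 1, 4139, 14349, 9492] [15544, 19366, 66529]) (.leaf 14000 14
  4838219851818896440835159656360289571882102964172105322395511227812005729442540730494547782201299396477292995101691739276739879150417318726137234743079606946873352007467008
  [5254, 71, 0, 8391, 6169, 0, 2631, 12292, 7218] [492, 15316, 3473, 46459])) (.leaf 2000 11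
  522425199902097108972548007627977095828223791187080087057193457781738360075625660116716179907573067709328673422321744646078255445288960
  [1, 0, 844, 916, 405, 603, 1409, 1004] [889, 2, 2121, 4096]))) (.leaf 3600 12
  880333158184701372278750056512914432939548019474132102589653568379134994663348308651847528191639624211471621056055963446579589964025574196451254272
  [1699, 1799, 3, 1, 1162, 461, 217] [1808, 3277, 8290])) (.leaf 3600 12
  1264308262428488753705406665690758622370053206772281328249876305915830086449453656931560763170800552826048010731785900318645386960798635501389246464
  [24, 0, 3, 987, 4191, 3208] [1983, 5380, 8115])) (.leaf 768 10
  157530055627240988457437104554648752751993952129685489889607659737888687604693319618570962651385392462218886058575297401857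
  [323, 506, 0, 492, 408] [2161, 1131]))) (.node 1099511627776 14 (.node 100663296 25 (.leaf 20000
  14
  52372213225357442973698377007360256640480299453453752091829329432651604384146378558526488137501470850826018066916242921928155630129881282143956988985103623359352837073274225654
  [7646, 12812, 2, 10257, 15764] [39552]) (.leaf 14000 14
  36357569499849351139737813738545048327924292706691858538073167684829932236299781012737202309742058026524272169671992683457553914740371032711123414390120740048102868397193691858
  [9034, 1, 7088, 11061, 1] [5879, 26370, 2])) (.node 3 34 (.leaf 10000 13
  12037422808078618592344070438202618228894171130673395483171081943877632924121596909244384361818264186723868223989437034101292764201289575895871948141872299843584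
  [2677, 2, 5282, 5969, 1264] [5658, 20513, 2]) (.node 3161095929856 72 (.leaf 5000 12
  3343464471375088915493310715773384337392637767241631682706466251390284467048829724133643174945080333437292444458010794127011197694727201152436081804
  [1470, 0, 2324, 1992, 170] [4888, 1, 5993, 1]) (.leaf 3600 11
  964770516848539478678341920316538426579697203108782817508092532670310054745022926630071238542925251690449656962026204716357322098826771274
  [2, 1682, 2881, 2023] [1988, 3555, 6116, 3911, 3])))))) (.node 4329327034368 102 (.node 2 17
  (.node 8598359552 102 (.node 3 34 (.node 2149589128 85 (.node 4299178288 103 (.node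
  41875931136 70 (.node 51539607552 35 (.node 137506194464 84 (.leaf 10000 12
  2148035224629354656729310840427010833861008015082851988156778692354644468563425501438485789954427894339563306616154377819550553812043084074451992576
  [1789, 2, 1, 7359, 9112, 287, 7046, 9082, 1432, 9713, 7880, 3955] []) (.node 66571993088 85
  (.node 17197236224 68 (.leaf 7000 11
  971011377039583278638469449603120955290005894014669637239376906945802774078224966918092263074209164383120326780088528614964173389955072
  [3134, 860, 0, 0, 5260, 5929, 508, 4913, 6243, 1649, 6421, 4867, 2879] [1]) (.node 8598323200 36
  (.node 68719477266 68 (.node 68753097232 85 (.node 25769803776 33 (.node 32 17 (.leaf 7000 12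
  1982310481845658424529400749416269308379147374799829533986475031014725866952987903407465199813984839985519943219492338535302647898027468188125495296
  [707, 3768, 3093, 0, 159, 1, 801, 0, 3778, 5985, 300, 1199, 6700, 3657, 6695, 1855, 1] [2, 0, 1])
  (.leaf 14000 12
  1073889952826575565559076970912043033474565569630692212860045684321874593592403630792264783375040842164001519640356129045907364394787069006859730944
  [4516, 1642, 0, 0, 0, 6756, 0, 11921, 13541, 89, 8698, 13911, 10680, 13890, 1909] [642, 1690]))
  (.leaf 7000 11
  54036559684260379242643559778637831569272192628407306571060134731159490337164291153237864165195375217907596150577806241499074674032640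
  [0, 1, 0, 144, 0, 0, 6579, 6850, 34, 5643, 6878, 1908, 6962, 5073, 3742] [1210, 303])) (.leaf
  2700 10
  134855417697258262836820570043540072750708039985338405459860630750301403147053430929021019251073641590529112153137911632716800
  [1455, 0, 70, 1, 0, 2271, 2394, 0, 1839, 4, 427, 2438, 2018, 1764] [1864, 0, 1, 1])) (.leaf 5000
  11
  1510920971037405978976644262488420037400688664349405937544944994650958272867760713235807311192069081675491048866178488225724133263015936
  [86, 0, 1128, 0, 3999, 4775, 72, 3033, 8755, 1980, 4928, 2488] [5134, 3343, 774])) (.leaf 10000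
  12
  680548850640493190153610505302322815064402351210608811477140765112770368433319899071313375010143716370414322477480807206981579720932474604392284177
  [0, 6864, 0, 8651, 9683, 2, 7515, 9687, 7656, 9906, 1873, 1] [2328, 288, 1]))) (.leaf 20000 13
  43156382255280210610744377649609173995080913729706541503227774773016998761354273099553766617303270596136123683574571702104257222733913183363279841218527232
  [0, 0, 19096, 17345, 1638, 16410, 18144, 1249, 18087, 18751, 15144] [3952]))) (.leaf 7000 12
  1888704517705833544055091730836934781655506886423809470418080311507151347186492938634844082328227579920109551617348030059949210892404900970541089042
  [784, 4109, 4621, 1, 2879, 6067, 3555, 5562, 1334, 2] [5024])) (.leaf 3600 11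
  965359321620306296089605090752238626616892725416455243308514690886542009230801485091364623356382568873849719670925248666661478861897787
  [2513, 2816, 45, 1602, 3244, 1793, 3260, 723, 1] [1356])) (.leaf 6 3
  46031739269059096693518526238720 [1, 0, 0, 1, 5, 6] [19])) (.node 6442450944 34 (.node 1040187392
  85 (.node 17197629440 103 (.node 519049215 339 (.leaf 10000 12
  53609324495740833964191680432590085752744763588574480841797434441070497518761812739005169967131677318057254962169849763353719251981122150999261184
  [3477, 6398, 1471, 2, 4988, 4448, 0, 597, 1016, 9386, 6555] [11022, 1]) (.node 528 32 (.leaf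
  7000 12
  159336454394263898705843335086746875791738934087969409812990080884755336745792278916257764833928315475088564918262076164575983909691231311653953536
  [2514, 4873, 5557, 1, 1997, 2861, 1, 431, 3443, 6518, 5850] [0, 0, 113]) (.node 6442450944 33
  (.leaf 1500 10
  18569062264297882333941751136479513266632125574257034734384312598459737742052053641198593690074524491518796007679270212075520
  [1820, 1092, 1141, 0, 977, 914, 0, 0, 350, 1443, 1299] [151, 0, 1257, 833]) (.node 137438953472
  17 (.node 33285996544 85 (.node 1052677 65 (.leaf 7000 13
  466937386012175491685035765658202819628920211475472892484615607973253874452081397055038695706565144135432872304495423499822938541728365377339950999109175828480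
  [3800, 1, 0, 3848, 4729, 1, 2708, 1, 0, 648, 0, 6216, 4965] [8126, 0, 0, 1, 6099]) (.node
  2105344 35 (.node 48 33 (.leaf 2000 11
  20795025680657976505397011781129634780270754185659310740659293817889079844104258612721514654734911845641090809300993035010631008256
  [3645, 1887, 0, 0, 1380, 1773, 0, 1311, 352, 0, 143, 542, 1857, 1797] [1, 1622, 1405, 0, 2478,
  3506]) (.leaf 5000 12
  90536805124301243739492407223517126835635739779821506735978793020804920449215974463295174799467379358666219027633023481743420939353319698474205184
  [0, 1958, 112, 1920, 4137, 4336, 2252, 1658, 0, 0, 2499, 4965, 4876] [4232, 0, 0, 0, 0, 5548,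
  4003])) (.leaf 672 9
  20444145749294065053674002673206734006529206195246666936935650366869969251519924534146828675615157756937091940352
  [0, 0, 396, 532, 1, 411, 95, 0, 0, 582, 586, 599] [1173, 406, 321, 199, 0, 195, 441]))) (.leaf
  5000 12
  12500715055671724329900418961706436019828618653232125411092658361692067650070927868660699907164158267990331053502481005479529227777539875782262784
  [0, 2686, 4784, 4296, 4173, 3452, 0, 2257, 345, 2739, 2657] [8284, 0, 4, 346, 3189])) (.leaf 7000
  13
  875392846793155906660384114457302978614548810951040752426692741595515189329847934200710756285548846111916828027157632079366911056156218671966370661071339913216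
  [5962, 5294, 0, 5092, 4073, 0, 0, 1879, 6723, 5343] [1760, 1148, 1, 0, 17059, 629]))))) (.leaf 6
  3 25442143711088801491661420007944 [1, 0, 0, 0, 0, 5, 5, 1, 1] [19])) (.node 17179869184 17 (.node
  4 16 (.leaf 10000 14
  1607674044818326633571018269304157628706343489586320325887614221092600996198743181690644230365282306969342100034621289614756371441476003879677929355941111908808871242363404288
  [1461, 5121, 6700, 2253, 7932, 1, 1075, 6558, 8788] [33802]) (.node 17180786688 65 (.node 1056
  36 (.leaf 7000 13
  562412284606600801867008521337189939425197153315330689431248461381132176915426211211196504155006692315443853882817871001392912846116007272378439833184042391437312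
  [1057, 693, 1835, 9489, 4339, 4068, 0, 905, 1763, 5983, 1] [723, 23018, 6869, 5228]) (.leaf 14000
  14
  18875110044999026360167846744880931853173894570155847742215444174308956084124797110202356281209639038914750586424418400349748911206690903729183731844273035866136762368000
  [0, 12229, 11937, 4401, 10830, 2, 248, 6032, 13747, 76] [399, 3220, 54145, 4305, 1080])) (.node
  132096 33 (.leaf 10000 14
  1236674662657290938467095423155360738977680360594113952234818684992046597062902329700179244334429525538346167087802420020686250476746715806716140522587342675615613858833498112
  [565, 9247, 13271, 6434, 6404, 0, 0, 1118, 9896] [464, 3623, 39424, 10627, 6925]) (.leaf 14000 14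
  61832600598620519796156279161901661286363728309621273300458244401181805510256410123130460644575929897534228018857134213073877973275536363032760337290131909645618746744635392
  [10216, 19029, 8507, 7267, 0, 557, 2511, 13439, 1] [818, 0, 4823, 53199, 16306, 11651])))) (.node
  1074794497 68 (.leaf 7000 13
  760877057201215670936960286040386875320227302518598916040767934196107837216892697583074358021889628492893838017644805950660564968304004443753152159668856560812032
  [3776, 8486, 2258, 1705, 2443, 3713, 0, 2661] [10431, 1, 4710, 3388]) (.leaf 10000 14
  2449331341041269518124873557866993307711159375978446668028011519854108631921079344717226951056629277358499821595605783867152672121118101662220041520636333400871942912035464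
  [21965, 0, 0, 1, 4974, 0, 3964, 2] [4165, 8202, 3451, 23426, 17390])))) (.node 6291456 33 (.node
  67239936 34 (.leaf 14000 13
  12158804826198181889135304741807509135195729968937284528055720761506125509989465611124948577621860176764674024702447010671366482920486602189041228138414695
  [2642, 11001, 5694, 2, 0, 10043, 5231, 2141, 1293] [474, 28875, 20973]) (.leaf 10000 13
  1747365759477332241247895340290631738106746691685615831021318244923114955811659576079091892563427072723723721523223842799829148254272105887990647934654002594055658
  [9448, 2429, 1, 0, 3431, 1, 4397] [3524, 1, 30439, 17206])) (.node 33619968 34 (.node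
  4048907052160 341 (.leaf 14000 14
  26650696219157322433378523571120524179949375407230852076941012955056436476173542069475953858252077478676593967363343528326044822121780993783503426954357035483685587030531637248
  [5618, 8050, 11245, 1, 0, 0, 2653, 6004, 4858] [5495, 14302, 37480]) (.leaf 5000 13
  6383904885880323321070730530168012553076752586115604619255344540200831458082384955414524470046911366247488368222377098081068950467434369466284935136499745765195796
  [2362, 3941, 0, 0, 3937] [1389, 9839, 19259, 2620])) (.node 1056 37 (.leaf 7000 13
  3164983897941084719304454747151046973999027706982064753387996322718772462418806530989536687263985332933424936426885532584938235114899102532005021617131843371009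
  [2569, 4857, 1, 2, 556, 1098, 5522, 1019] [13931, 14596, 24097, 2043]) (.leaf 20000 14
  68386856034732947630436976424476350464010090092774933158773186369234376448877585920410966502756632867301900538963818906907393927345047008343591467429197230952912412887866834944
  [4265, 0, 0, 3015, 11935, 10700, 12109] [2619, 9634, 7468, 28544])))))) (.leaf 14000 14
  698243629165889303879996177343690686093898802127455204492359253717852257171585814883031895751618426909973276914324646950149316544458536805887386990779049034947016868618747
  [3584, 1137, 2569, 0, 11246, 8063] [37102, 13381])) (.node 35399925760 103 (.node 2233382993920
  33 (.leaf 2000 11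
  184557272418848619789215614959186964062306948882250308095386122467374831919200457155679015916973181167884399016642563487233296004284442
  [1782, 1, 140, 153, 1868, 0, 1230] [5239, 8138]) (.node 68 30 (.leaf 10000 13
  2402694311373157742950633263726276071080880084056390789449574011206497689750087363129936745112397925005933471812380154113207309492753175631839003954609188243408
  [7477, 2767, 0, 6324, 0, 2205, 2] [0, 14941, 32278]) (.node 2130303778816 84 (.leaf 2700 12
  613773232076916911405375182257816693774626149127853011037403819070030477780215160932364646026705903852538614601802367779938662893536139766142133600285
  [2092, 0, 166, 0, 2548, 2457] [2, 0, 9626, 11732]) (.node 1074794564 84 (.leaf 14000 14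
  343478722635675690317475763148916310860245860207907681535653159782068465468951363601595123737099430842677715247117252474241588748991264934882824422554160477562107861142256
  [9789, 5130, 0, 5864, 0, 8045, 5737] [0, 1, 0, 52202, 52818]) (.node 68753097232 86 (.node
  3839423377471 510 (.leaf 1200 9
  5619072065149104091294988591048400052420995503960135251463169084960284562640556099078247406644923850180005888
  [839, 1, 8, 217, 39, 345, 320, 96] [234, 0, 0, 0, 0, 364]) (.node 1048575 340 (.node 6442450944
  34 (.leaf 7000 12
  4078951577814595962802453654918542195998412800053657999649318672206880105264803863316585534040756817846326023865925562426882265489099873005613386297344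
  [3231, 4697, 9, 3166, 1, 2885, 1771, 2520, 3240] [0, 180, 0, 0, 0, 5448, 59]) (.leaf 672 10
  108454568804160276170950081641934479092444121299430062949805904845531638757183369432888220136425873138570391405611065540620
  [628, 1, 525, 60, 2639, 1, 0, 1] [1313, 58, 112, 2078, 1, 2490, 247, 97])) (.node 6291456 32
  (.node 68753031186 69 (.leaf 14000 14
  2404014073778155600271089165644486762293231379644166036753825450748673469351063035872406242338955279414629903733790105303691471302709009228079643257377276787160334741799618
  [3270, 9284, 2, 9882, 8023, 25081, 11976, 0, 2] [0, 1631, 0, 13068, 0, 14046, 51001, 18017])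
  (.leaf 2000 12
  193574333305318437843562808467203344641448594669630376491877075401601725347617855969089918304901545300122833267024889071940661019602241806351204352
  [1, 0, 1179, 3296, 1132, 2224, 802, 453] [2007, 331, 0, 1076, 0, 2, 0, 7481, 1564])) (.node
  1100048498688 35 (.node 68753097216 69 (.node 412316860416 33 (.leaf 3600 12
  5879983353187194678335162991160683573046536740085280401268625574875700924039304421909016584797107453227327471631124576850089093450560968301029097472
  [7722, 186, 1067, 0, 0, 0, 0, 3607, 1279, 1] [1, 7, 0, 20, 7368, 0, 0, 11909, 16600]) (.node
  68719477266 68 (.node 4188562835712 342 (.node 68753031186 68 (.node 3909251268608 205 (.node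
  865702464 206 (.node 68753097234 101 (.leaf 3600 11
  479929786604472795112480559040138747340689104369172217033492017759719556021608588184575720212096549062376483965027686442497352635777024
  [2425, 0, 0, 0, 1989, 1, 0, 1, 0, 46, 0, 0, 3614, 1442, 623] [0, 0, 93, 0, 585, 0, 0, 0, 5309,
  6389]) (.node 4188562835712 341 (.leaf 7000 13
  284889102900515460952562856308783553348031277924707253829218126124918575785358898232230465641393985850324838701707874524893304935399046823129486484952464752640
  [4601, 0, 0, 0, 0, 493, 1, 0, 0, 0, 0, 110, 6966, 2206, 1544] [0, 70, 0, 154, 0, 563, 0, 1, 0,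
  11965, 28608]) (.node 134479872 34 (.node 4 15 (.leaf 1500 11
  348973442608062027385826826017445986572902647718926750408013762682777650932196672243268280106803962279262002272105889769502523792413937664
  [2006, 179, 0, 905, 0, 0, 0, 1, 0, 1, 0, 2, 1, 2022, 1807, 1425] [1018, 0, 0, 3, 245, 527, 2462,
  0, 0, 0, 5557, 4539]) (.node 1052737 69 (.node 824633720832 33 (.leaf 2700 12
  5669095391437887462851822308584267712170469792233448601853633881939401754360984821229689728035308981301993953116725269021119602404943755026188206080
  [5536, 1, 0, 0, 1, 3388, 0, 0, 0, 1305, 0, 0, 0, 0, 2736, 3269, 1] [0, 2775, 1172, 0, 2, 36, 0,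
  235, 3278, 0, 0, 14980, 7040]) (.node 40 34 (.node 275012388872 86 (.node 4210688 34 (.node
  201326592 33 (.leaf 5000 13
  16955281363198634867817318129346308148871029058601832938473218084135299213980772605299143999792794549557609656024042852275619129608925945927040970906793445020688384
  [1437, 0, 27, 2, 0, 195, 0, 1, 0, 0, 0, 1, 0, 1, 2107, 0, 0, 4955, 2426, 4253] [1, 1, 442, 1, 0,
  2, 0, 0, 20, 0, 1, 0, 20659, 23383]) (.node 3917010173952 67 (.leaf 8 4
  23390092046266848922043176031195138191798458384384 [4, 0, 0, 0, 0, 0, 0, 0, 0, 0, 0, 0, 0, 0, 8, 0, 0,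
  8, 0, 3] [1, 0, 0, 0, 0, 0, 0, 0, 0, 0, 0, 0, 1, 40, 40]) (.node 33620498 85 (.node 68719477266
  67 (.leaf 2700 12
  5779387749688753559876128915877111471690490856950488754131380071735086513913456251393565010435976963035451523935615437771770516723881097960066383872
  [15545, 0, 0, 0, 1, 0, 4576, 0, 0, 0, 0, 0, 0, 1, 0, 0, 0, 9617, 6333, 1598] [8229, 0, 0, 0, 455,
  8742, 0, 2, 2816, 2319, 5292, 5496, 0, 0, 9256, 5009]) (.node 3909251268608 204 (.leaf 3600 12
  4296553060626572386987245110794176735613141155702238035887933952901000785569356977016397245689799520561560194362311830366968540802930058013970530304000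
  [3797, 1, 2, 2, 0, 0, 0, 0, 0, 0, 0, 1265, 0, 0, 1419, 949, 0, 1580, 3600, 1, 696] [0, 1360, 0,
  0, 0, 1823, 0, 0, 2, 0, 0, 172, 0, 0, 455, 2964, 11267]) (.node 33620482 67 (.node 68753097218
  84 (.leaf 10000 14
  69291132500386111425025573983486686185236116848704748413399774874031961173420002785354770119427458209564801322963167654210682932411737787584899707016577024
  [4520, 0, 0, 0, 92, 0, 0, 47, 0, 0, 0, 3994, 0, 0, 0, 1, 0, 0, 576, 9978, 6567, 5139] [1137,
  6890, 0, 3278, 0, 0, 0, 0, 1038, 0, 0, 0, 83, 0, 2, 0, 27765, 47918]) (.leaf 768 10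
  645190625539282632580547252186375428200292649693710053682706962687619804948704232640448714489133710089802048847782252456706067
  [1989, 0, 134, 0, 0, 0, 0, 0, 0, 0, 0, 2436, 0, 0, 0, 43, 1285, 0, 816, 2438, 2864] [4795, 2335,
  0, 403, 0, 0, 0, 59, 0, 2002, 0, 72, 94, 0, 0, 1, 0, 2284, 3051])) (.leaf 2700 12
  59313231945610240197839220334086510269047859852054585623089459294694251118834221809567879096443100690386867007771715923925356411928923374270545920
  [8218, 2588, 0, 0, 0, 1, 0, 0, 1, 953, 2148, 0, 0, 0, 0, 0, 4999, 2592, 2] [5183, 1606, 0, 0, 1,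
  320, 0, 0, 2483, 831, 1, 0, 0, 430, 2305, 2, 2922, 9144, 9585])))) (.leaf 5000 13
  283658936805049008340229654627168449875240733036651613645594011511015660488506083599740114034403108232339432679834344417892605212656922578423155704509497394
  [1523, 0, 0, 0, 0, 0, 1328, 4297, 2744, 0, 2, 0, 0, 72, 809, 6471, 4704, 1] [5135, 3312, 0, 1851,
  0, 0, 0, 0, 0, 0, 0, 0, 3087, 1, 3004, 4026, 20622])))) (.leaf 5000 12
  43545407674172762555946724899232289246097515416010790061561340008504630986333283467717895473113717966904848340826452172399930307082721427456
  [0, 553, 1, 473, 0, 0, 1671, 1570, 0, 0, 0, 1, 0, 2118, 0, 4446, 3430, 2864] [6355, 586, 0, 0, 0,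
  1, 0, 0, 0, 1919, 0, 1, 0, 11565, 5922])) (.leaf 1500 11
  302364909557436657203620022353758465722378411505060850764760323561998687252305852680641999730158710928467046360921439329410606832904527872
  [1, 394, 290, 0, 0, 0, 0, 23, 0, 1, 0, 0, 2, 0, 940, 1250, 1092] [1917, 1, 0, 9, 0, 2, 1, 0, 0,
  384, 0, 1, 0, 3405, 4114])) (.leaf 5000 13
  114108350722129573737832214091062216569914140107854375976166944488719395356105189075553991131350160710759036131655404792947684205932227176006606705917952
  [36, 3956, 1, 6598, 3440, 0, 1, 0, 1, 0, 0, 0, 285, 4964, 1675, 1276] [6050, 2194, 855, 3558, 1,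
  0, 1, 0, 0, 774, 0, 0, 0, 6962, 12174]))) (.leaf 14000 14
  970078286948376952331424307019597444211229627935114639197636921859793993877182213681681159439120683347197314429967000548517774478826834409509611806904488004943872
  [1029, 385, 0, 0, 185, 264, 1, 0, 0, 0, 197, 1190, 15831, 12625, 9926] [1831, 40, 0, 0, 0, 0, 0,
  0, 2314, 0, 2, 0, 46764, 63199]))) (.leaf 3600 12
  62660566142431185567788058710302423876431597132625567596045457699382796544117286218106883161018637857672895431153911630372254601521552466601050112
  [0, 1028, 53, 0, 0, 0, 0, 1, 0, 232, 318, 3600, 2993, 1809] [3346, 759, 0, 818, 0, 0, 0, 111, 0,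
  0, 0, 10606, 15075])))) (.leaf 2700 11
  513898026404404927397713037438908083024855667173782065302245296019624077267276344376334597798352379511420705677671561613050149852938240
  [1838, 1713, 0, 1, 1, 1, 0, 97, 0, 0, 2710, 681] [2734, 1, 0, 10, 0, 965, 432, 0, 0, 2797,
  6680])) (.leaf 3600 12
  1498744162411904696279776844970501056338432391943959358408996545740786366561886020404091970147367545573127910818376236778168077102085495661021626368
  [555, 225, 0, 1, 0, 0, 0, 1, 120, 3767, 5149, 2349] [2352, 0, 0, 186, 22, 277, 0, 1, 0, 13682,
  15970])) (.leaf 7000 13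
  54918381291228021490986986256440556443196300450673400216749587379618458654593882602121613420696936570288827783640355241852973904204979470779877824600333090816
  [4709, 6955, 1, 0, 0, 235, 0, 307, 6784, 1968, 1556] [6501, 1660, 559, 0, 0, 1320, 0, 0, 0,
  10806, 25047])) (.leaf 10000 14
  26705477307254442966837985204300422434079834774306109298970121350419702639796540114523013432353308716764223758675494131306579160583045492151503376359561648954928632789204992
  [1, 0, 0, 1, 0, 8891, 1199, 11187, 39142, 6991] [36742, 5686, 2, 495, 692, 2480, 0, 3, 0, 19505,
  6472])) (.leaf 10000 14
  1754892560088846496473297778546488733591336194913252729824443470777331854992885295733695330602362443229064960627546181034900634206752219657627283262489559165788912932093952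
  [0, 2766, 0, 3049, 18173, 4158, 10000, 5377, 1156] [22546, 4580, 1, 0, 0, 209, 0, 3, 0, 12107,
  41840]))) (.leaf 1200 11
  110971772309559608835519931950913722967684444782664805147865073010549233407565769313299978628323870885862933010762992392364055593033
  [627, 1, 1, 910, 1, 995, 1199, 492] [3160, 1648, 193, 0, 67, 0, 0, 0, 2830, 2529])) (.leaf 1200
  11
  2061269316561645953854369097005949117138333980914597490827673850834419700443775768597138632564929106036350683847178897095282576156786764
  [1, 408, 615, 983, 817, 2, 1] [2658, 1504, 0, 0, 0, 690, 0, 835, 2363, 1780]))))) (.leaf 288 9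
  2475506312097553144072200444935904916385051466989230100467265746346691936729237323436295890278217543535464286208
  [1, 2, 2, 260, 246, 77] [924, 119, 0, 2, 0, 526, 152])))))) (.leaf 1 1 39699104048 [0, 0, 1] [4,
  0, 4]))) (.node 1074794564 86 (.node 68753031186 70 (.leaf 10000 14
  3551298658417224685141907424462436747738684456692995526099075487356309929292358832948057259895414804535213460063769630700619005140766931864298623582882330734466900524777472
  [4689, 5922, 5127, 0, 2767] [41884, 10544]) (.leaf 960 10
  136922402492695653366070006391152579947193511245217440046796245403572718188560519130725974711214847617837822409233975351296
  [399, 107, 0, 800, 473] [1913, 2137, 125])) (.leaf 2700 12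
  780441770925835217791779539828965113894876012962314053239635559831465491485859864817682726805802908785570012572005949961100417436207124868954394624
  [1372, 104, 768, 2] [7462, 0, 1]))) (.node 412316860416 33 (.node 2 17 (.leaf 2700 12
  28733561249253777093250884137201435506810640608885542140739538457121290934928578308675285692444680267600606597517707754831494531105947520904205527154990
  [1767, 4415, 1097, 0, 5291] [9139, 290]) (.leaf 20000 15
  2268428806470767957497086431739390605743300096183317483022587029203173323513758672484796296358549329429978702414544001880390298355334493186465512134799770391417567338909299912690041897877504
  [32508, 8806, 0, 39176] [31102, 68035, 2332])) (.leaf 7000 13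
  155493708205937973074033878083986280045317080982937091133061860066879011876507077340155043206408636017621015184598310500230042735041561869294738828435710055874551867
  [6346, 0, 20585] [12440, 20649, 20287])))) (.node 8598359552 102 (.node 4329327034368 102 (.node
  4299178288 103 (.node 3 34 (.node 1040187392 86 (.node 1 17 (.node 1073741893 68 (.node 1
  16 (.leaf 672 10
  165269240052387074738763622956635250418134207439891374226954413697803905067507486763556145551682834413684081545565146580992
  [2066, 0, 0, 3, 0, 375, 337, 299, 197, 1] [2114]) (.node 2149589130 101 (.node 1052672 35 (.node
  61203283968 68 (.node 3 33 (.leaf 10000 12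
  664932489037572382965133975003460365838210575315744853991923299376387873053455070553721371450321548754788390336673878604378718300676811391395430400
  [2365, 1309, 2179, 7414, 6464, 391, 6377, 0, 9090, 8302, 7424, 0, 668] []) (.node 969722112 209
  (.node 2105344 31 (.leaf 5000 11
  261228544150853581059205051853988152854824803070110565248884734602820658893402710733928304352500406393790589543481680487682482502633027
  [3375, 1, 540, 4482, 1, 2002, 0, 0, 2969, 3277, 1366, 3371, 3542, 2449] [0, 7986]) (.node 192 35
  (.leaf 960 11
  1386335177588399174311147442189643605576072395739393945011209181847908226394928425131608889337990426702057425187169578028191711232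
  [763, 0, 44, 2, 0, 5561, 1711, 0, 915, 729, 234, 725, 726, 564] [1038, 0, 0, 8102]) (.node
  1100048510976 68 (.node 12582912 34 (.node 2149589000 63 (.node 17196646400 33 (.leaf 10000 11
  8318687326396804700080001249895549283727444544277327027974500857589326031694772352354386078332930317450596642362571154848948945601
  [992, 283, 50, 0, 0, 847, 9624, 9700, 9060, 0, 7964, 0, 9934, 8399, 7986, 0, 1576] [0, 124, 418,
  2167]) (.node 1100048498688 34 (.leaf 10000 12
  48080858420930572553978379475286352519262495899609539559832905931336778415138278736156076013884306900176585882463425394369639898320615659724800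
  [1313, 0, 0, 0, 0, 226, 8182, 9856, 9399, 1077, 1, 1, 9477, 2268, 7354, 7732, 5095] [0, 0, 260,
  795]) (.node 35097935872 69 (.leaf 3600 12
  6465141368673510893345662423391058421560201642055144816278577471680568823829599883209159854272000894679197602935276116115568151110183397583122071618
  [1152, 41, 1, 0, 0, 1, 3427, 3493, 3534, 2, 712, 39, 3328, 492, 2016, 1037] [6331, 3034, 0, 0, 0,
  305]) (.leaf 10000 13
  3003348976307141857005025448038359347249761447079104072461909696808050632296339204765147972131457742911157788050299078676809367475819494156379941966462966563797
  [1090, 0, 0, 0, 819, 9259, 8236, 8917, 0, 0, 650, 8530, 3176, 4193, 5949, 4576] [1516, 3313,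
  14155, 0, 1, 0, 4472])))) (.leaf 10000 13
  33519520349331589303976754166319230381564555827755970238169759010280166242398896879062988423049130411851314033661228262370154948498313445122317627812741120
  [550, 181, 0, 0, 0, 19427, 14760, 13800, 2, 0, 9307, 2111, 7748, 7889, 5964] [10088, 15798, 4156,
  9531, 0, 9029])) (.leaf 7000 13
  102659412729789666745538313096312126592144849064666845342927407449751531904633856789659863365241526781528210330097573106521231321579717159499185617025105920
  [919, 0, 1, 0, 2967, 25094, 2582, 4889, 3138, 2342, 5835, 4247, 1, 3] [5065, 1467, 7427, 0, 0,
  25721])) (.leaf 2700 11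
  1572925813148987886151029139905152449608669505907755906093891179869828665459097512361928489371235819793708208741594819524576234832920576
  [765, 273, 1808, 1407, 2112, 0, 0, 796, 51, 303, 1347, 1843, 1841] [2643, 2947, 603, 0, 208]))))
  (.leaf 10000 12
  421565619064821001390915071971422331103594014472390035507628682737073839862095745403885743514015110763144086158998989750225926338471538287613837312
  [286, 7269, 5268, 7868, 0, 0, 4129, 7305, 2094, 7750, 7771, 5265] [1629, 0, 2186]))) (.leaf 5000
  11
  249864759440262884673695002969555500087990625956206850686693568542037079451113646730854952154737679014676122495561768418886842287390976
  [3677, 4588, 4629, 0, 2, 0, 4175, 0, 3215, 4768, 3819] [1844, 922])) (.leaf 336 9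
  1228292492172974990357140224904632990602136481214708373747392994130451541602042412218758748049927204124521136396
  [2, 1, 0, 5, 36, 206, 162, 214, 131, 78] [770, 1040, 1])) (.node 17179869184 17 (.leaf 5000 13
  1067478150095735231091368875457938042116686671297526864303414309928545827144887217627696873265800549295891857054837981319621334952479716697979409490273969903559
  [2893, 24771, 0, 1, 5062, 1, 0, 1276, 4611, 3143] [7281, 24684, 31526]) (.leaf 14000 16
  4918319759087351666134209999846825312684913950899895415638524023830481042346239946960949980995002198332587958107902478050513524247734650864250962924829982897235942352387986737250708247686850578854
  [87220, 3, 0, 0, 0, 2468, 4633, 10454, 5201] [3533, 24707, 131442, 117972])))) (.node 2105344 35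
  (.node 41875931136 69 (.node 61203283968 67 (.leaf 1200 11
  46517678354918840995157300882657510772028544816897594349479292465759575376567076767270446789347871371448756238003162174978746016222674944
  [920, 252, 846, 3497, 785, 1186, 931, 1155, 0, 5] [3690, 979]) (.node 1052741 85 (.node 1052737
  67 (.node 1073741824 18 (.leaf 1200 11
  110541955753875571748464297658232524923913885007342802018093815444074524114779041820680437030013191987202196837501159582856568012403638272
  [1488, 1026, 0, 64, 0, 2022, 2, 1106, 736, 224, 771, 859, 669] [0, 3152, 926]) (.node 24576 33
  (.leaf 7000 12
  2038535497971488786147373648465662314855583671468623743304440015333887618734298150928926452362488865506904672901146283413828608877103773034194403733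
  [2451, 1, 1, 0, 0, 4561, 139, 5717, 3121, 3511, 2908, 2098] [3709, 1, 7883, 312]) (.leaf 10000 14
  415135868558053282184612947895249559886684105022588394248162625783141927158226130481609104128823850005321826485478277639180685640000915511278103242145451207035862099427669
  [0, 2, 0, 9350, 26497, 7181, 9540, 9524, 8190, 7681, 3, 1290] [865, 2139, 1, 37009]))) (.leaf
  2000 11
  529138614880617230884745565324207913876279650111312510903899963753024300493721369691298755241075384665757155523517994496144615596729571328
  [6277, 1, 1543, 5327, 1, 2, 1339, 0, 1379, 1545, 1549] [3648, 91, 3788, 2621])) (.leaf 7000 13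
  9217868064224580500448100019059750402856856960666964311037913851115276285826703172356218097073786347461981107073767264093880595897161402514176509311188992
  [1, 5657, 20464, 0, 6903, 6505, 1207, 5709, 5793, 4567] [1590, 377, 23701, 1977]))) (.leaf 14000
  14
  313238882455218776598905179215845302840079760030790468687495091925342414629810127629961971776549249472928238569848129552023656232813478371567933428964493174405973445443584
  [12838, 41000, 10702, 13659, 12314, 11078, 10756, 0, 2574] [2228, 53779, 563])) (.leaf 10000 13
  12152871805664802395771641568561117247705743795732636646362146327695673861737639212990445104209100203866715043461184055799778297955814007140818323552542720
  [15146, 0, 1604, 1778, 2207, 4424, 7793, 5974] [8312, 3, 12636]))) (.node 6442450944 33 (.leaf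
  2000 11
  477073399771080164793233384143973619983578189399091544466343012286504712219564783448504645613424398076519933572243792652733378222050248374
  [820, 0, 1, 412, 0, 632, 1497, 917] [6105, 486]) (.leaf 3600 12
  2097525017963337324408447927173448304448768110120956711651467572190544904497206889430923245604913939642593723202684104637082328859424037166752487967634
  [0, 0, 81, 0, 973, 2617, 1631] [1245, 10441, 769]))) (.leaf 1500 11
  29175773183026489965221056585531038127094475265092919628627993870274633861084369894241763691000721862590225971226639809219672390582142015
  [319, 1040, 319, 962, 1120, 1] [3679, 5397])) (.leaf 1500 11
  79552052546717968790002188841917538758774269433533573472561556240604841055921732004170321735287641049570553139683397695842368320662723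
  [0, 259, 577, 1213, 838] [4743, 974])) (.leaf 6 3 46032977209099534995366751948865 [5] [19])) (.node
  412316860416 33 (.node 2 17 (.leaf 20000 15
  2227771491855067596521343341751398467068325340676070085396515913206616649128595354667101680228338028723690911358630551867709089321165562852947518804298284042854506179855685088962737485123062
  [11954, 30553, 5629, 0, 39754] [66083]) (.leaf 10000 13
  230042580988939017623483502308056717846586104667435593764924387049216503329305404007321256114681789621642889186102623685933038921115609738677946211112954551265469262
  [15053, 2975, 0, 19739] [27851, 33088, 3954])) (.node 17197629440 103 (.leaf 2700 12
  31493598066349335422949464221774679778711809166296525411971950212107568682991171562478860542522218911270632528287425401140269942155673114184847102003083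
  [1678, 1873, 1, 9169] [5550, 9616, 8927]) (.leaf 576 9
  141889590699892883487487749263155946711462592095967039859544699363901328045033821671092335088657678074946301200322
  [1, 0, 438] [1710, 267, 12, 2124])))) (.node 1040187392 86 (.node 275012388876 103 (.node
  68753097234 103 (.node 1100048560128 103 (.node 1 16 (.leaf 2000 11
  81624556652226758006295183849274427226570236026769918353553363874842860653836012500038932281844957699506918369773324462541297360216801280
  [6033, 0, 1, 0, 1152, 1853, 1580] [4722, 6151]) (.node 33285996544 86 (.node 2 17 (.node 3 34
  (.node 1 17 (.node 1073741893 68 (.node 2149589130 101 (.node 1074794565 103 (.node 35399925760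
  102 (.leaf 14000 14
  173131281229047198678055751761305058441448756656578523790428025289406902203080288847592290414565799922328281771264296977926554298932061317497430468424269090559702933150147543629
  [11142, 12753, 13268, 281, 0, 0, 0, 358, 1, 1, 0, 1379, 0, 9981] [1979, 53306]) (.node
  17197629440 102 (.node 17196646400 34 (.node 3839423377471 510 (.leaf 2000 9
  1302761494234260725107118370172191367615124763988155532741078749483975626185691562565200199139967231324061938
  [1202, 239, 83, 56, 461, 127, 0, 0, 0, 0, 0, 0, 0, 202, 798, 460] [24, 595]) (.node 275012388872
  85 (.node 61203283968 68 (.node 35399925760 103 (.node 59055800320 88 (.node 17197039616 65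
  (.leaf 2700 10
  209303457071572340309669660192899759405748992349388759464047662586389935049971784995336145580740305101460821284204052579
  [1129, 243, 0, 1, 1, 0, 2, 2237, 2091, 115, 0, 0, 0, 0, 103, 0, 99, 4308, 2124, 2370] [0, 2548,
  163]) (.node 2199049469952 68 (.leaf 10000 13
  4472154813295104476916552406140415144812776506021851705371228176491713977443497140684466758599935700410849631306742638673206252379291450805439150803495528755347456
  [8083, 0, 2092, 7023, 668, 0, 0, 0, 4994, 7255, 7005, 0, 1067, 0, 1, 2666, 0, 2, 726, 6902] [0,
  0, 0, 0, 10296, 6518]) (.node 4299178240 68 (.node 68753097234 102 (.node 983040 69 (.node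
  61203283968 67 (.leaf 1500 9
  124473169280013814566504927146283361703845418877824028929892216165142062554220193367624031706204118952736456901
  [1312, 689, 182, 1, 0, 0, 0, 0, 2, 0, 0, 938, 0, 438, 1, 0, 0, 2, 0, 0, 1175, 1454, 1047] [0, 0,
  7, 1259, 0, 619, 233]) (.node 2105344 31 (.leaf 14000 14
  245307558653774860983522727713586583280265901777529502191442312732376606953232171476482713107156396818301429771742532071134237640963981499871472888211293295954904708289710
  [7733, 0, 323, 1108, 0, 0, 359, 1, 1, 5133, 5302, 0, 0, 0, 0, 7018, 1, 1, 0, 0, 13524, 13935,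
  13676] [0, 0, 0, 0, 294, 17772, 27100]) (.node 4294967600 68 (.node 48 35 (.node 67645734912
  102 (.leaf 7000 12
  643087096404040242110200006094116183715972467787249634038526962134002385326562891169753019428551055061585757913441887160532848595903390566951422213
  [4113, 1, 216, 1, 777, 0, 0, 0, 0, 0, 1, 4871, 0, 2900, 7768, 0, 1, 0, 0, 0, 0, 0, 7930, 9089,
  6179] [0, 3977, 2282, 2, 12, 2213, 8673, 1, 3629]) (.leaf 5000 12
  41160704105530464159188534609928998696671199970366355915283448071499893068942753248351297336264461723071924299249418660696791550120947697582080
  [3037, 817, 0, 206, 1, 0, 0, 6179, 1, 0, 3758, 0, 4482, 5751, 1500, 0, 312, 0, 146, 0, 0, 10393,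
  3557, 4759] [7099, 2403, 0, 169, 0, 0, 5702, 0, 0, 2751])) (.leaf 5000 12
  209157152874215123196907381403326107483097567267551394415236698224069269715770625958985857873436772180098082746095310602620521361559838592749011037
  [0, 580, 21, 1, 0, 0, 0, 0, 0, 2844, 3313, 2948, 1591, 0, 1, 0, 0, 1, 0, 0, 10974, 2519, 4731]
  [5581, 1194, 2805, 0, 0, 0, 6784, 370, 497])) (.leaf 5000 12
  886576646346802590388806724596805810132021737214542361253282787058087396355588786397072109672046407073894457500211774087474775263014616372434961026
  [0, 1186, 2435, 2345, 0, 1, 0, 0, 2759, 0, 1459, 10717, 334, 0, 1, 0, 1, 0, 0, 4858, 6658, 3687]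
  [5283, 0, 1802, 1941, 0, 0, 2202, 1, 0, 10227])))) (.leaf 14000 13
  1527475788695132941545621210355073409962609078049082608831875336754513612394814733760858537573363051582177054985066043698533933593263604562100023357292421320489
  [5200, 2, 1019, 0, 0, 0, 0, 10198, 5226, 3142, 492, 0, 0, 0, 1, 1576, 0, 0, 1151, 13555, 8453]
  [12932, 0, 0, 0, 574, 11123, 1])) (.leaf 960 10
  198994788839069505213310865497971866607017372648152414975990426264185764789164477393924681761891283976998526110137646579994
  [715, 64, 0, 219, 7, 0, 496, 601, 883, 0, 0, 0, 1239, 0, 1, 0, 0, 599, 870, 482] [2059, 0, 0, 0,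
  258, 1051])) (.leaf 960 11
  941982986687106530151923656815314811740136642051696264091073162669867415530376525024335353851153031138376336754130647612715916662160031770
  [161, 0, 0, 0, 359, 1, 0, 29, 70, 737, 0, 0, 0, 0, 129, 162, 2811, 3007, 877] [2522, 2777, 13,
  79, 2291, 0, 1970, 203])))) (.leaf 14000 14
  2441771671678752046377015565571104541359410603130804414945581960383611304445256868299148063765654735817095986708542863495981438475630548976833701138367524119301550956872385
  [0, 0, 0, 0, 0, 12337, 11413, 300, 0, 0, 0, 2, 1253, 2, 0, 50767, 0, 9383] [6848, 0, 45917, 2162,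
  16996])) (.leaf 6 3 203538033715709418616429998018560 [0, 0, 0, 0, 6, 5, 0, 0, 0, 0, 0, 0, 0, 0, 1,
  1, 1] [20])) (.leaf 1500 10
  52943869297205770408864055465084446751097423910957450703672059554097414742375048293671811863077274804769060746187594341120000
  [158, 334, 716, 0, 677, 1384, 605, 0, 0, 1, 2, 172, 0, 793, 838, 1266] [2380, 0, 0, 0, 378,
  816])) (.leaf 960 10
  22163628485473272533876968726180363485991595585482095745287484114729352268736137849166918831011756799808670489705472
  [13, 318, 0, 0, 2124, 1089, 0, 578, 1, 1, 1, 892, 805, 961, 928] [946, 1, 0, 1, 2161, 2314])))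
  (.leaf 5000 12
  11418507081450213815393684045660723017518057706946866815470439090059272975695909106574366932705069281440944323229133037540001614704936271474532841959424
  [15, 0, 41, 9749, 3733, 0, 0, 1, 1, 1, 1005, 2, 2, 3620] [6058, 0, 0, 11156, 10600])) (.leaf 1 1
  25795988992 [1, 1, 0, 0, 0, 0, 0, 0, 0, 0, 1, 1, 1] [5, 1, 0, 5]))) (.leaf 1 1 9673154117 [0, 0,
  0, 0, 0, 0, 0, 0, 0, 1, 1, 1] [5, 0, 4])) (.node 4299178288 101 (.node 17197629440 102 (.leaf 9
  4 10900998793442009474333089689025860602121 [7, 7, 0, 0, 0, 0, 0, 0, 0, 0, 9, 9, 9] [0, 0, 1, 45])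
  (.leaf 10000 14
  123665200891348812586086906268445368347395371420847289113877084915924419948563341436881990903250477153017525242171841638052588233973198547119843528439224968234635741814155388365
  [8320, 3948, 0, 0, 0, 1, 0, 1, 0, 535, 0, 6948] [30385, 0, 11085, 0, 37797])) (.node 4160 35
  (.leaf 960 14
  64159203977056447881357613764378811081262193240584643193098037107130961351467660908709116078143383662618481562128681358685706672582010009065210673778304348324586921670450
  [2603, 40619, 0, 2441, 1, 1, 0, 90, 28, 2, 940, 744] [6567, 17381, 53930, 2175, 59491]) (.leaf
  480 13
  590482446427638530759500766715497516832497151249517542642759889872120805889826750206992437380899318478754758761790141424682698476385693382740108095056926295989028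
  [10342, 0, 1, 0, 2, 0, 81, 32, 243, 377, 375] [2687, 1964, 7131, 24474, 760, 20129])))) (.node
  2105344 35 (.node 4294967600 70 (.node 48 35 (.node 4210688 32 (.leaf 7000 13
  8407345170315529250019335554395577071791310769806381569316123949071935308439082353588652984291370694801743093305006621744051948240690613487386554391553541796790272
  [5441, 258, 4594, 6907, 19814, 6767, 0, 89, 0, 0, 296, 4585, 5505, 6418] [26134]) (.node
  35399925760 102 (.leaf 5000 13
  28118211359614779285469389703210168968421194561896396005871338378615546720645696089321135748808491206787721046973870128337741741547307991194074793170412333086801920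
  [3981, 466, 1, 4073, 13108, 4960, 0, 508, 0, 2, 472, 400, 0, 3533] [1, 17414, 0, 17092, 1])
  (.node 12 34 (.node 4299178240 67 (.leaf 6 3 5711855346575571579668457324928 [5, 0, 5, 0, 6, 18,
  6, 0, 0, 0, 0, 0, 6, 6, 6] [1, 0, 24]) (.node 4299178288 102 (.leaf 6 3
  5711855346575571579668457324928 [5, 0, 0, 0, 6, 18, 6, 0, 0, 0, 0, 0, 6, 6, 6] [0, 1, 0, 24]) (.node
  4095 204 (.leaf 10000 14
  3916177945078569599942383888627137090092394928006568445101384461633539190715122232065946059269129906404941462435871727855315192602669438179182395641340652307689242624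
  [6464, 220, 0, 0, 0, 7943, 3050, 0, 1643, 0, 0, 0, 9503, 10000, 9870] [6795, 0, 0, 0, 10254, 0,
  36611, 1]) (.node 3917010173952 68 (.node 48 34 (.node 824633720832 33 (.leaf 1500 11
  729677938833539706202932725631700792301457375963878562307419891506308172795697504856926741852877553718284032525621403437072676393320448
  [924, 922, 1, 376, 0, 0, 1109, 4105, 1696, 0, 0, 391, 0, 2, 158, 1193] [202, 466, 0, 0, 1, 4918,
  1, 4432, 504]) (.node 24576 33 (.leaf 2700 12
  15625207645401557687999683429679617390921437569443718227071978625058103834955307931451574676541593002786866909586394596769792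
  [1108, 85, 0, 912, 0, 0, 0, 6505, 0, 2723, 0, 0, 0, 0, 2723, 2700, 2700] [0, 365, 1430, 0, 23,
  158, 4822, 0, 10777, 2]) (.node 528 33 (.leaf 2700 12
  74690274749972030734712216126977847355278650439178897700834518210194135369848772243231848939984069396247307139450321119911033593444924523442176
  [3879, 0, 48, 1986, 0, 1, 0, 8617, 0, 1, 2, 0, 0, 0, 1880, 2652, 2260] [5145, 0, 2462, 2767, 0,
  356, 1, 3792, 0, 5132, 2404]) (.leaf 5000 13
  37766023992667999674070558555312706467824742138087285074054566830712714810693962773926260108375510610873852406836798939222825248791081941755836555934404968448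
  [6623, 8, 6992, 0, 0, 0, 15755, 10832, 0, 0, 0, 0, 0, 3379, 4981, 4589] [1583, 3179, 0, 6308,
  233, 0, 402, 1, 13632, 0, 10415, 5963])))) (.leaf 5000 13
  102971965618044567833261326694181785205538712592732915069952740693650241046744546450117463789857853102071441958968646662342323249375842634333964722943209504768
  [0, 2, 0, 1, 0, 11718, 6302, 0, 0, 0, 0, 0, 4710, 4970, 4880] [3308, 3797, 4970, 0, 50, 0, 11838,
  0, 17859, 1707])) (.leaf 5000 13
  10840920811215447996796188833623166962751857966601394695902240040541080797639245761689905880257187367805355724599953598502373818908497705421712986194180088791040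
  [2391, 0, 1, 0, 11386, 6351, 0, 0, 2, 0, 0, 14483, 11633] [11574, 2806, 2160, 0, 15553, 2, 12040,
  1, 8568, 1485]))))) (.leaf 3600 13
  1321559364573821976483927092607314640356444601475625892817959156501662548483739552758477838697915802954946387395517650945958409732122379836819482130888102723878912
  [1, 0, 428, 12808, 0, 0, 1, 0, 124, 155, 1136, 3364, 3040] [4160, 47, 1, 2182, 1, 10352,
  12410])))) (.leaf 3600 12
  690480831356442425452729868987673184778405654945937564011562992683305571139184292719683554107261565175873519919975492046093659462954233772511254808401
  [1, 0, 319, 22, 0, 236, 1, 1, 0, 3166, 3331, 3513] [7140, 7912, 0, 8726])) (.leaf 1500 10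
  676991081060305753657451759562413081784007316232727992765971806583052660855568920957156895753098962765289526344329195399706865
  [1048, 1233, 0, 0, 1, 0, 561, 3, 80, 2, 895] [1883, 1490, 0, 194, 1])) (.node 33619968 34 (.leaf
  10000 13
  9138418735249577182263754859784286539587113218644403317750510102424960727428698558896738461724567221481105895020882842959744771016376500288199332019410616811782144
  [4622, 13676, 8858, 0, 177, 998, 0, 2034, 2899, 8375, 7521] [8027, 0, 0, 13472, 17641]) (.leaf
  10000 13
  7816862729331641837083792890855835499098822030574382069796630758542921580719441090081957118245075665335994174017756264561002254679848137679651563706822043732959232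
  [24699, 0, 1, 0, 326, 0, 1249, 5137, 8610, 8698] [3188, 6952, 0, 0, 17508, 23091])))) (.node
  1052672 33 (.leaf 7000 13
  8239669352131587375527666026688002213634033068746452102409394558436340528899472154763328018103798722444237257611355210581768093301966346308287198980754038004389557
  [11489, 0, 0, 0, 2, 1, 0, 2, 5234, 3318] [13582, 0, 2, 10067]) (.leaf 960 10
  55528744247797306787063677053880963776094727312947569524836829973226720749105458386733239182077568221073402530842412895437681
  [0, 0, 0, 0, 4, 0, 0, 856, 725] [1513, 3228, 0, 2312, 217]))) (.leaf 240 10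
  26457797815881729852345060126885080530592025955668497926518332567223049204746522156380378182824546791461938044757380645892978
  [2142, 0, 23, 2, 1, 1, 184, 116] [3335, 2, 1, 941])) (.node 134479872 34 (.leaf 5000 13
  6101651833870231418354645521105884741739150729920927249872630307845726518569781640493548863078589978222084683051819527958512501371366018275701092904052458620637973
  [2297, 4, 910, 0, 0, 0, 3916, 3353] [14875, 16218, 0, 7252]) (.leaf 20000 14
  6707110023280960666810155940202120909173294056892096239797716347312553177330631171822650075867255600619950886407184306729085295623851019799441993763420375987784354406986334
  [7537, 2571, 1, 0, 1, 18223, 4033] [13043, 54850, 35739, 1, 26681]))) (.leaf 576 9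
  138282412377625167585211158380959439538041122125663629613135852930885440527297852137755397764677458970988337179510
  [41, 0, 0, 411, 1, 341] [1657, 1263, 231, 52]))) (.leaf 960 10
  1967674407417511834355777950954771307955866709614183302908833678181826124341764757124153327494900069313696663776415018260639
  [0, 620, 136, 49, 197] [3066, 10])) (.leaf 168 8
  13172874017889262504335052897030170444951122455451808878251765625501079322376139252970190726487910400 [139, 0,
  1] [840])) (.leaf 960 10
  539692069055825388051770149143991870149189031539471730840086437926470272728689267825852260621646691089269868161038624619687
  [131, 741] [2739, 174, 893])) (.node 1 16 (.leaf 1200 10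
  116565480683247890242731745020559108822364343977587462992806558157841858388981639029877749182893687304603197298536640838585344
  [3139, 895] [2726, 0, 3053]) (.node 8598359552 103 (.leaf 14000 14
  152170029656061580710575467825261161696262626459268622438534146576441546156421655727074118020835681785201919188443940448482346871544680509561261684056088537847834203417835744028
  [7224, 3, 1141] [27517, 34530, 1, 16553]) (.leaf 480 9
  96196419009041252571377571502876666317175979425702790555476694544182673870667608917425981744488409311329164200376
  [1, 277] [1458, 186, 0, 0, 1922])))))) (.node 3 34 (.node 4328218619304 512 (.node 4095 205
  (.node 1046898282495 343 (.node 553648128 35 (.leaf 14000 14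
  839068387054655441880937504240642700699047891594247342990668484600085589596040705292987204131107966739206592882143689477275875743490769227589865167243729499785534991950034239488
  [8942, 7237, 600, 0, 4775] [67420]) (.node 3629939703808 201 (.leaf 20000 14
  887235982779526471692557005680659295225106843424943209934283625079149991994093339288952476940782032720863778085908874192179203560553337920119434801452358190088882833536399196160
  [2549, 14345, 1378, 0, 3375] [2, 68643]) (.leaf 3600 12
  34421748236930508106162394979120351920212281201130133014595469896247736012380998905311506755151229957706598219297033821931440048697912224433393513791488
  [2841, 2, 0, 599] [1000, 4115, 11552]))) (.node 553648128 36 (.leaf 768 9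
  319855017087329846501675509866987983292611389851706822141147662080057717526527812701776883311080423268618767958016
  [759, 2049, 0, 245] [1581, 828]) (.leaf 14000 13
  186508096355975462932156120319174144022521387214326746882477677580520370021986992667388445831698560363598169826210234366696273171511438840159210570166112434398429184
  [6436, 0, 6278] [6595, 0, 25798]))) (.node 1073741823 513 (.node 1046898282495 345 (.node
  2199055761408 103 (.node 33620496 70 (.node 4188562835712 340 (.leaf 7000 11
  11449164465583121611218596750105229729147085389582203470058762873505099401174800430216742957500576162806177875182138610096456202523787657216
  [4178, 5, 21, 48, 1735, 0, 4223, 1] [0, 9017]) (.node 550024774080 103 (.node 17197236224 68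
  (.node 6442450944 34 (.node 3909251268608 204 (.leaf 1500 11
  5494900809838646882222156537297063726717738191063456955341664577020711289935208201156840319641056466406305065793625886627944045934958084096
  [1010, 0, 0, 0, 0, 0, 931, 0, 385, 5300] [1125, 5873, 4440]) (.node 1 17 (.node 865702464 207
  (.node 3420456030208 202 (.node 2199023255552 17 (.leaf 7000 13
  18501783226427676569611200309086302957796970115608017483308955290701687749389166006363928493426263647999570012149940803474162959778139595240076867303770355708116992
  [14414, 965, 637, 3200, 0, 0, 826, 2, 1770, 0, 1836, 0, 0, 4528] [0, 712, 0, 17431]) (.leaf 10000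
  13
  143487232665636816821976977045085278864892881326173097862505651785135806079722302146299398206966868914465499776991468985678914847429168040787986787912723543028252672
  [2680, 0, 1, 4527, 0, 1921, 0, 418, 0, 2356, 0, 7259, 2] [8529, 0, 1021, 1118, 12028])) (.leaf
  480 11
  10396701693198680761473297896311858718185456590328892277954594820088140548895754075111705849551157287641301793708247672383641365963780128768
  [243, 0, 0, 0, 1, 0, 0, 2, 0, 0, 723] [1018, 962, 237, 452, 8031])) (.leaf 3600 12
  30879837310301973333060681718697580125353698922892451078220028116321308587178224721259616570928881897583507467848996243688472952061229611312739799531520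
  [0, 1, 0, 0, 0, 0, 1802, 0, 0, 3499, 1] [2491, 0, 0, 2196, 10890])) (.leaf 576 11
  3471381788838726748165214938286805588122338756993068779653288432714468552520847752301624521574273877873313395688384728341669106569246147667
  [0, 0, 230, 1, 84, 429, 0, 109, 386, 4] [4096, 0, 335, 1678, 2885]))) (.leaf 2000 11
  8972097265489982875688214007170565853213753398609081612848533405335875720359454045810789869379717777652240383601529796652712894470555820032
  [0, 935, 953, 0, 760, 1, 0, 4917, 1] [2411, 0, 4846, 7255])) (.leaf 7000 14
  513334248526938295556771628924736116031808684696978364322159168118114436630586345549197106552847379569911854551247474741689083435158095359111871259697345505633947146713747685441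
  [1547, 1, 0, 4820, 0, 0, 19040, 2] [5270, 4538, 21256, 38003])) (.leaf 384 9
  105817654734506314644199459578193454203630274131602503146203510132167777293146914935931681732987645918191650078736
  [0, 279, 30, 0, 0, 371, 1] [1414, 102, 115, 376]))) (.leaf 10000 13
  179422306276045902040878592938383336016749273141893740042914951768189389123807362815075178489689197794184465123661320316678667060883755527725828013412637371300578133
  [325, 2924, 0, 0, 2865, 682] [12931, 1053, 28691])) (.leaf 960 10
  2057206624070788856167376195128085153588646566523127920356189958626136550497340133393766697655522273016610982273592430709178369
  [0, 197, 0, 622, 2] [2406, 0, 695])) (.node 978344 209 (.leaf 7000 12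
  39792156473677162814168741333040699557127813460558618160930852171235628291051041967948713232907977210711195941906669591906683652684848989907416537628672
  [760, 0, 0, 9151] [4141, 0, 11672]) (.leaf 14000 13
  195056032990922354447842057128052633245942038564999901035812210554233213023405046941725786096638011687316761693291191623425887880642391336594694143814455277140312064
  [0, 0, 15546] [798, 4762, 0, 27622]))) (.node 3420456030208 202 (.leaf 5000 13
  15183834438286825616500328986699817928341102954999474728735571482193665150319813373187655477301787749055144076837043603941180557600873331793783090957679037759094784
  [1758, 1, 22754] [7066, 15519]) (.leaf 768 11
  7320719866782292844817171730806051049825165933703409046022926681113474185543037921856701515384111166668222816893879960049269109500560801792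
  [0, 5460] [1309, 1249, 4674, 5477])))) (.leaf 1500 12
  34869282705922124407986828618117559537724446796470761268219898572579698595167267551286803738002315927401898519518107322521990759179301805205042348687360
  [1362] [3016, 11846])) (.leaf 768 9
  536295189889650211833473073507448478550525350166354129984941341781894302912579932219895262870216950049369596591550
  [1] [1908, 1908]))

/-- Refutes the cuts `orbitCutsFiveOneOne`. -/
noncomputable def mainTreeFiveOneOne : BranchTree :=
  -- The same two words are split first, now between `33` and `34`. All four orbit cuts are lower
  -- cuts from the root on, so the lists of lower multipliers end with theirs.
  .node 2233382993920 33 (.node 3839423377471 511 (.node 4328218619304 511 (.node 3 33 (.leaf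
  1500 9
  735990822445884215253478356282244701370691986895413921495240932926630370073562538424036051277608931155492732928
  [1187, 789, 0, 398] [2, 2, 791, 791]) (.node 4188562835712 341 (.node 33619968 34 (.leaf 5000 12
  5017756059983798348322636394356347560705921713251044644744707587616380164015741205170963466373631261307125419442087859615206778143807910832660021748
  [8040, 659, 0, 1674, 742] [174, 2659, 12010, 0, 5212]) (.leaf 7000 13
  1644460940299464135895624347804859369875286928068715968382190791790501426941191207841156505376194783694259577262838685472235315536552761230674814217290006647514
  [4708, 0, 1277, 536] [12430, 28373, 20095, 1988, 1573, 1772])) (.node 488552529983 207 (.leaf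
  7000 13
  16429301633655337859015608045669819180170737919253867908278943867745868344000484623247976980235452588638081148780953281306197330294582452920832502204459751891207
  [1107, 0, 4004, 1422] [3212, 2, 1146, 1146, 17328, 17328]) (.leaf 1500 11
  4470350166666441010595348038177781077690998192719562022133154170225245394524622947319323362044598067315083248615736901208170590346516402
  [0, 568, 1444] [1327, 2085, 9561, 624, 623, 4463, 4464])))) (.node 3909251268608 204 (.leaf 14000
  13
  677600886306310577485634688338277034985789052589876022873462084859740372202859256658568811088490732910108804426433718863601135809432852621327605817485285130240
  [1816, 13970, 3976] [5959, 3718, 3720]) (.leaf 84 11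
  3689607151683272765762675287812243378958791088732482065246447176794327095749500103262951279654976056632685854918349887555599847363969024
  [0, 2949] [2980, 1184, 550, 550, 2463, 2461]))) (.node 1073741823 512 (.node 4328218619304 511
  (.node 4258390727508 513 (.node 2652349923368 201 (.leaf 14000 12
  4176912726872583633082730284352538898019284418469332246843298581257492258349169033529880334884690142421615180111918732537449889849807224359135222018
  [1512, 0, 11785, 0, 2366] [3001, 1, 1, 827, 827]) (.node 66048 35 (.leaf 10000 15
  63272679616900788289652046901386559433734005826750447242910143116648763000045998150589201375122581858646936647326871774431057614283919741236879217013461686737407633291265246495953356208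
  [10583, 1900, 0, 0, 5135] [1, 12837, 51019, 66840, 38826, 47900]) (.leaf 20000 15
  106248421400985002171474347451436379216724138178531540212927740089928062938906045607892276912370747844826996801866352298044235045142451275160587220503042241821646221825496327419349355858781
  [3543, 7133, 0, 13151] [21102, 5723, 15218, 39938, 0, 48939, 35813]))) (.leaf 960 12
  11242894154715661963259635271863016131207036083915060326717794941940923370823513075997474300537156942379246760960265643003981174821120804740465312038
  [0, 0, 1445] [2256, 1830, 0, 0, 11535, 11535])) (.leaf 336 10
  1769425218369853839950286560352384727714080506286934013676162053685204243927912048049212896545275200738659635397541145608192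
  [457, 1044] [587, 806, 2394, 2394, 1349, 1349])) (.leaf 672 13
  13544836328229466166350621508383468811809690908964701748251571970696628090946052902429914412098535376843006248749763040314428121413047794305859245312677496422904
  [1168] [1793, 4442, 11241, 11241, 12638, 12638]))) (.node 1073741823 511 (.node 2163590823935 514
  (.node 488552529983 208 (.node 1040187392 83 (.leaf 5000 11
  5059263578000991422233837715364717207484394714946887581858934598720293960270691339886676560928717079311734961220333204485586483543141351694
  [4131, 1, 3168] [4, 828, 4382, 7263]) (.node 16106127360 67 (.leaf 1 3
  48611784087913726481913878730753703936 [5, 0, 0, 1] [4, 28, 0, 0, 4, 23]) (.node 3909251268608 205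
  (.node 33619968 34 (.node 550024773696 66 (.leaf 3600 12
  5310487944013862444731679482540775153127992014959228491441450419543915547525991320809806002736475822129379055604277289038780118124277801885857677836654
  [1563, 6695, 2] [3856, 1, 0, 4715, 12174, 7525, 2781]) (.leaf 10000 14
  32911372122656514629108447279494593291188094605985253473193309312789633616286767182179208222884039075173194457731795282127794256253544902319267315168810779244836313799464059438
  [15035, 3224] [995, 5760, 0, 237, 25275, 35671, 25110, 14362])) (.node 1048575 341 (.node
  412316860416 34 (.leaf 2700 12
  59214992013956318934572883535700140802278822652939079188792758592167377680842391728746283522453613361978202825456698140690597281925749281980647559205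
  [4172, 1334] [228, 2449, 0, 1, 3200, 287, 8649, 9824]) (.leaf 7000 13
  163788580497048273157534444700601575335487638251244715267405679800802073136768836509809908847390286441124472185008601266353072432845358604824828148023801285995454536
  [3621] [13918, 5457, 1041, 0, 26617, 8248, 0, 24036, 525])) (.leaf 10000 15
  56303623428547229584359830289325232879354880269427305837200881944814842284797066665923648692526941271501142722111826741709336938207411648269514943695254872456184657842433398988933665981047
  [4440] [14914, 30868, 2889, 192, 3, 58465, 0, 3928, 8288]))) (.leaf 672 10
  620482582790442995946661948807303737431239415802497714948482883525288057991934483543983490541275310220415840680882346155573248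
  [1, 256] [1400, 1, 0, 3, 1548, 1550, 1916, 1913])))) (.leaf 7000 14
  977697077896032687979857357643596153424601840924865863739436175895782447727100726241586659349905712638555281853328571292583007239585008177076575508991545274405056950616995677409
  [1782] [8413, 87872, 16598, 16598, 15704, 15704])) (.leaf 2000 12
  8415641417628914391244561025025719894439354301183742961420636837281218646340620931750018792662982431328948860896662124597504681911199189031784727376048
  [] [2058, 2590, 10351, 10350, 1, 1])) (.leaf 672 14
  382952531763823566617015690728377884792138540930820207948584253751929574387804147169978341283769451355465014717483610315984788329452316070448295396512748958067990818501897208207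
  [] [8583, 42643, 23618, 23618, 36739, 36739]))

/-- The checker is evaluated with right-hand side `120 = |H|` and objective at least `717`. The only
cut at the root is that the sum over the first mask is at most `85`. -/
theorem refutes_orbitTreeFiveOneOne :
    orbitTreeFiveOneOne.refutes 6 42 120 717 nextFiveOneOne [⟨2130303778816, 85⟩] [] = true := by
  decide +kernel

/-- Here the consequence of the first tree is used in all its images: each of the four masks has sum
at least `86`. -/
theorem refutes_mainTreeFiveOneOne :
    mainTreeFiveOneOne.refutes 6 42 120 717 nextFiveOneOne [] orbitCutsFiveOneOne = true := by
  decide +kernel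

/-- Averaging gives only `720`, attained by `120 / 7` in every coordinate. The mask `2130303778816 =
31 · 2 ^ 36` consists of the five words with `2` in front and `1` not next to it; that point puts
`600 / 7` on them, between `85` and `86`. One tree excludes `85` or less, symmetry gives three more
such bounds, and a second tree refutes all four together. -/
theorem sum_lt_fiveOneOne {x : ℕ → ℕ} (hx : RowsLE 6 42 120 nextFiveOneOne x) :
    ∑ j ∈ Finset.range 42, x j < 717 := by
  by_contra! hgoal
  have hM : ∀ x, RowsLE 6 42 120 nextFiveOneOne x → 717 ≤ ∑ j ∈ Finset.range 42, x j →
      86 ≤ maskSum 42 2130303778816 x := by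
    intro x hx hgoal
    by_contra! hlt
    exact hgoal.not_gt (orbitTreeFiveOneOne.sum_lt_of_refutes isInvolutionTable_nextFiveOneOne hx
      refutes_orbitTreeFiveOneOne (by simpa using Nat.le_of_lt_succ hlt) (by simp))
  -- Every cut of the list is an image of the first mask under one of the four symmetries, which is
  -- a finite check on bits.
  have horbit : ∀ c ∈ orbitCutsFiveOneOne, c.bound = 86 ∧
      ∃ k < 4, ∀ j < 42, digit 1 c.mask (symmFiveOneOne k j) = digit 1 2130303778816 j := by
    simp only [orbitCutsFiveOneOne, List.forall_mem_cons]
    decide +kernel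
  refine hgoal.not_gt (mainTreeFiveOneOne.sum_lt_of_refutes isInvolutionTable_nextFiveOneOne hx
    refutes_mainTreeFiveOneOne (by simp) fun c hc => ?_)
  rw [(horbit c hc).1]
  exact forall_maskSum_of_symmetry isTableSymmetry_symmFiveOneOne (Q := fun s => 86 ≤ s) hM
    (horbit c hc).2 hx hgoal

theorem isOptimalValue_fiveOneOne :
    IsOptimalValue (adjSwaps 7) (youngSubgroup 7 [5, 1, 1]) 716 := by
  -- The evaluations confirm that word `0` is the labelling of the subgroup, that the table
  -- describes exchanges of neighbouring letters, and that the explicit point has sum `716`.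
  -- Completeness of the list of words then follows from `42 · 120 = 7!`.
  refine isOptimalValue_of_table isLabelStabilizer_fiveOneOne isInvolutionTable_nextFiveOneOne
    wordFiveOneOne (by norm_num) (by decide +kernel) (by decide +kernel) ?_
    ⟨optimumFiveOneOne, ?_, by decide +kernel⟩ fun x hx => ?_
  · rw [card_youngSubgroup_fiveOneOne]
    rfl
  · rw [card_youngSubgroup_fiveOneOne]
    unfold RowsLE
    decide +kernel
  · rw [card_youngSubgroup_fiveOneOne] at hx
    exact Nat.lt_succ_iff.1 (sum_lt_fiveOneOne hx)

end FiveOneOne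

/-! ### The shape (2,2,2) -/

section TwoTwoTwo

/-- The index of the image of the `j`-th word of shape `[2, 2, 2]` under the `i`-th adjacent
transposition. -/
def nextTwoTwoTwo (i j : ℕ) : ℕ :=
  digit 7
    1230259326124075987695844567966561887714794893424230174711968715859803591308016090499615376760601506445630627858499362411972500684243134519101997656973742521681988662844068366379613342852853763674284206267866529236376064336441211090981010727853369833276101253240622703176792391649960792322455258993450992825188814175657897867890435529233323603073087306012216248856379227617062762747149605066950242916856843152202272767063395094096727446347895237144120234313006490681624775665837770814513602794105274835017873692259992521096703920659971551254074012827861290054572537146647507559628224096517813746239339748235843110952069968276749286659738301701737424226069842826554678982906715504758817206893145244793371904680139145878102751982160530010508634849265985546535661100552898195359714381645936872632883329872245931815428243815274429844534423783234594220853801228385438467090130356375261602074219177720237256817692273926090293215457990327022998622155341952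
    (Nat.add (Nat.mul 90 i) j)

/-- The `j`-th word of shape `[2, 2, 2]`, in lexicographic order. -/
def wordTwoTwoTwo (j : ℕ) (p : Fin 6) : Fin 3 :=
  Fin.ofNat 3 (digit 2
    284846099792355711587864957871419274305184025362009923758404954806512022502353214523609734430508454815258743723175327361970528587902605895395427731012576892987241006370752174425404149027461004971268923262279822483080316705775510817844118842474097216744343468855222422264734405216027506744822967856649242669736125186642086480
    (6 * j + p))

/-- An optimal point of the integer program of shape `[2, 2, 2]`. -/
def optimumTwoTwoTwo (j : ℕ) : ℕ :=
  digit 3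
    300720328383569045273808883834740286403398478106413212270721552241410414391919753 j

theorem isInvolutionTable_nextTwoTwoTwo : IsInvolutionTable 5 90 nextTwoTwoTwo := by
  unfold IsInvolutionTable
  decide +kernel

theorem isLabelStabilizer_twoTwoTwo :
    IsLabelStabilizer (youngSubgroup 6 [2, 2, 2]) (![0, 0, 1, 1, 2, 2] : Fin 6 → Fin 3) := by
  refine isLabelStabilizer_youngSubgroup fun k i => ?_
  rcases k with _ | _ | _ | k
  · fin_cases i <;> simp [youngBlock]
  · fin_cases i <;> simp [youngBlock]
  · fin_cases i <;> simp [youngBlock]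
  · fin_cases i <;> simp [youngBlock]

theorem card_youngSubgroup_twoTwoTwo : Nat.card (youngSubgroup 6 [2, 2, 2]) = 8 := by
  rw [isLabelStabilizer_twoTwoTwo.card_eq, Fin.prod_univ_three]
  rfl

/-- The action of the permutations of the labels on the words of shape `[2, 2, 2]`. -/
def symmTwoTwoTwo (k j : ℕ) : ℕ :=
  digit 7
    485038450613467957769380210901017445711635201858626477412073683230276155249248036150992706016852311031416460997671168258798394519237704592062390977567586887696792661864587148600838550313936939037842923765178595855089028662397048340189370487541087318682056978291614099044698201733945623160079514682832009383026763311058803977428760025510009018743723456123003898817350018295601606454145867569871989249523955357992349463856823759274158253007505105093721558645229546715100852237889954075119423623976420971163331652630623053004781179953585103886213247321174045176846965319677060064171915546702754975424748556636716390820600246304695720077744004982600016130236354541930034224392606948020051536519661038522227248151451979583102021955798226333844654018315010136112073822322417026915933209944151358047749673131983816760005591988202585654118717687770569094081932635807922799505735805472342185956308830086099040444525864829672727896485620824929365713510427805083001265805675296066641985971417270949193749873742151674180811250889658695542110506615999621496969242129175994044564061641539982417726492514752660268263500194837532065115869515614290048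
    (Nat.add (Nat.mul 90 k) j)

/-- The inverses of the permutations `symmTwoTwoTwo k`. -/
def symmInvTwoTwoTwo (k j : ℕ) : ℕ :=
  digit 7
    485038450613467957769380210901017445711635201858626477412073683230276155249248036150992706016852311031416460997671168258798394519237704592062390977567586887696792661864587148600838550313425175722948036714340395670500651423401950303261278981924624203398919368529557425146415752244047626044235484702928676761120126225028107655767198663850045662195117206216005965359579698608368027470907847996870657073293416912619812875028242034763845004493658245569463727439240912070371401072603533339217947882192473470567359628615606831896935621085178250871808706424720211339228216289305804502569259020306887798338794068077544355635615439118406217193461138640728594950081023233404831643098261604614301038169861995638762426291665389834627598632388590458479647604461723876117211707594148115771347901273034969818802867806424256565342319858576622281942407134705186432966627694095253319183188609857339427453845710564735354379697767295633260162713481830854522575518439862469504027861097115014655887443132012251987262119404369470965065538409367350372840094860986263499826850865229882212585253747663186882433900254745785196438013225935046285419160670522343552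
    (Nat.add (Nat.mul 90 k) j)

/-- The three blocks have equal size, so all six permutations of the labels act on the words. They
change letters and not positions, so the index of a transposition is kept. Two of them are
three-cycles, hence the separate table of inverses. -/
theorem isTableSymmetry_symmTwoTwoTwo : ∀ k < 6,
    IsTableSymmetry 5 90 nextTwoTwoTwo (fun i => i) (symmTwoTwoTwo k) (symmInvTwoTwoTwo k) := by
  have h : ∀ k < 6, (∀ j < 90, symmTwoTwoTwo k j < 90) ∧ (∀ j < 90, symmInvTwoTwoTwo k j < 90) ∧
      (∀ j < 90, symmInvTwoTwoTwo k (symmTwoTwoTwo k j) = j) ∧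
      (∀ j < 90, symmTwoTwoTwo k (symmInvTwoTwoTwo k j) = j) ∧
      (∀ i < 5, (fun i => i) i < 5) ∧ (∀ i < 5, (fun i => i) ((fun i => i) i) = i) ∧
      ∀ i < 5, ∀ j < 90, symmTwoTwoTwo k (nextTwoTwoTwo i j) = nextTwoTwoTwo ((fun i => i) i) (symmTwoTwoTwo k j) := by
    decide +kernel
  intro k hk
  obtain ⟨h1, h2, h3, h4, h5, h6, h7⟩ := h k hk
  exact ⟨h1, h2, h3, h4, h5, h6, h7⟩

/-- The words that arise from `001122` by permuting the labels, with the upper bound `1`. -/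
def blockCuts : List Cut :=
  [⟨618970019642690137449562112, 1⟩, ⟨19342813113834066795298816, 1⟩, ⟨140737488355328, 1⟩, ⟨4398046511104, 1⟩, ⟨32, 1⟩, ⟨1, 1⟩]

/-- The words that arise from `011220` by permuting the labels, with the upper bound `1`. -/
def cyclicCuts : List Cut :=
  [⟨302231454903657293676544, 1⟩, ⟨1152921504606846976, 1⟩, ⟨144115188075855872, 1⟩, ⟨4294967296, 1⟩, ⟨536870912, 1⟩, ⟨2048, 1⟩]

/-- Refutes that the value at `001122` is at least `2`. -/
noncomputable def blockTree : BranchTree :=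
  -- At the word `001122` three of the five transpositions act trivially and its row is `4 x` plus
  -- two neighbours, at most `8`. The assumed value `2` therefore fills the row and makes both
  -- neighbours vanish. The last lower multiplier of a full list belongs to this assumption.
  .node 6 2 (.node 1073741888 2 (.node 10 2 (.node 63 8 (.node 512 2 (.node 4407710188097 8
  (.node 277076930199552 8 (.node 19343408021330444063604768 8 (.node 618970019642690137449562112 1
  (.node 4398046511104 1 (.node 1218597226171546208103825408 7 (.node 1237940038132458770292277248 39
  (.node 32 1 (.node 140737488355328 1 (.node 246290604621824 4 (.node 277076930199552 7 (.node
  302231454903657293676544 1 (.node 536870912 1 (.node 7516192768 4 (.node 2048 1 (.node 8448 1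
  (.leaf 672 8
  686447735726893483653773820292780403206527368364990704956076282309825925049073831628280649140982092285990507586318975553969140862256621245735502652928236680642900487755573722109301463575662183615704161360292404733
  [384, 307, 161, 229, 272, 443, 0, 137, 389, 48, 388, 0, 143, 104, 0, 116, 0, 0, 0, 42] [750])
  (.node 1152921507828072448 4 (.leaf 1200 10
  129324533902309766429182259975235473299084755951167950303367429180471920156842030815961753736050465190252582057432660605922110278092250063174393717502370089783535775251431036834555188413015517580252260135040047689707418813518298075795496362962121892191840611081388803
  [216, 335, 351, 418, 604, 781, 0, 322, 603, 0, 769, 195, 294, 289, 0, 0, 0, 0, 5, 1, 185] [307,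
  1884]) (.leaf 1200 10
  433094111302130951412339423754621516151369565914869074174825729777000051534843608551467628124125045834332616123849940303293836900083295557347225196078133230848607666601248687279599846922181323109208873697508933162703620271913787590264329778877466896552171804820254
  [167, 306, 416, 525, 762, 1, 236, 468, 273, 599, 135, 193, 329, 0, 0, 419, 0, 441] [675, 0,
  1992]))) (.leaf 336 8
  1980266276198852450373838139591827047459846489818362374921589738263894204825301620917449345628387336693459819724441116668464871635497999095835737605926302157909188552479268265591737167739308613141664768506992073
  [151, 51, 79, 221, 0, 42, 144, 91, 166, 0, 40, 54, 0, 0, 30, 0, 1, 0, 76] [235, 535])) (.node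
  402653184 2 (.leaf 672 9
  1221546851641202503832011771790085290971094663164859014078957024979577282029503531428860746856980407569966986484404877386340443828011337773331793354213934702672971404261329088808483545085458482189652032418488270491839223861628403797983646
  [272, 143, 145, 431, 0, 91, 457, 222, 322, 76, 33, 0, 0, 0, 431, 0, 366, 1, 19] [532, 984])
  (.leaf 1200 10
  196805049554220234322077206910915630985003998088691499194945293108512748311469206392972162534232732628510287979009991368033117461313852955863076410351083914158345768290185733414052780529356882997394807897883614109211385625775605357131126148008872521139461930615534
  [0, 328, 751, 0, 151, 674, 268, 716, 172, 35, 0, 0, 0, 546, 0, 0, 1, 479] [749, 788, 1800])))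
  (.node 584115552256 2 (.leaf 336 8
  994066044113805992500578217085694441715874750734804234434681910998315374640342580275750888559239398240830834303235756212943760083586153236850266531466169813072344226533836051366601914667391478607943761878122940
  [93, 135, 162, 0, 82, 210, 13, 232, 0, 18, 9, 0, 0, 96, 0, 168] [303, 491]) (.leaf 384 8
  2644299645268688063782269302738234625351619298153233539943389153019271924345191822567631881663755188518580106561491568206635034536221076511519408562723162309604973676884875648370365366525736818416899126576873613
  [121, 266, 1, 33, 260, 0, 275, 11, 13, 0, 0, 0, 38, 0, 209, 23] [82, 432, 259]))) (.node
  9444733528689243848704 2 (.leaf 1200 10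
  56428574085474875140729455104421227392643309135102458482771395285805168208189180241023827027896192269165782229493199552581945587146972327735425210896975143547284310820152339031750308665897686895585131118509930934781329037089491632764182832613918733631208638757754416
  [448, 776, 63, 7, 594, 340, 596, 0, 32, 124, 0, 160, 210, 0, 24, 1] [1137, 1619]) (.node
  4835703566688892850536448 2 (.leaf 768 9
  565866063822292552140316589477947263396945294089723457049191915983901133209207209625437874257728352767258531863360724416950250037612980486505763198836954789812661301861610411838680088817363968809457486141980836265803279387626769189177214
  [132, 454, 54, 0, 362, 0, 495, 0, 117, 0, 0, 0, 158, 0, 226, 0, 1] [257, 1008, 929]) (.leaf 1200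
  10
  776757723698052877133944374897411406890914568576411681241988130317949834727747599741492155661399538956655328078618585450298321474007981358676953440237315315731900481556583331995453726020417322907156006853670307668775660588541195505972629529389981098064884007427
  [779, 0, 0, 543, 0, 784, 0, 64, 38, 0, 0, 91, 0, 802, 147, 12] [220, 300, 1447, 1081])))) (.node
  2048 1 (.node 302231454903657293676544 1 (.node 87960930222080 2 (.leaf 288 9
  78854405971454783281174698074730408326212415224893388460307089921838401986522160388459304286890390066490133786258881056159599316148202129376732946477456255619255832922893009595222590064017925502740508277364400586535117722652670655938167002
  [885, 173, 75, 0, 845, 86, 0, 176, 866, 36, 100, 0, 0, 288, 0, 128, 0, 2] [998, 584]) (.node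
  8589935104 2 (.leaf 336 8
  505959322033031052443836954189716478530444292398882725850922043698882777730698602094485434823806510139498933546390757430488259761876673828408705658805464320022983317887735323975914350717284826434111415287591536231
  [256, 154, 49, 109, 98, 221, 56, 216, 358, 21, 26, 0, 0, 0, 0, 153, 191] [150, 132, 103]) (.node
  7 3 (.node 63 7 (.leaf 480 9
  157301033750781137695431699012463269708060834431607494253856089833104198064731859678144801677354605687995852458461990702814286810231769256384327205628626657762360608993445254974888467265197228992642340118251437889737997278376097443274031335
  [297, 3, 231, 283, 401, 210, 38, 69, 274, 560, 89, 65, 0, 0, 0, 0, 5] [90, 253, 328, 744]) (.leaf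
  288 8
  84164793016769144640829313172059871710043741699648403452754754968879205950455944056453672133115304166378280088039570558155187434988770532220621378004667778716198952594977809721302332083204029760405252973791346832
  [288, 136, 119, 110, 332, 0, 72, 171, 374, 22, 0, 0, 0, 0, 1, 77] [218, 52, 111, 228, 360]))
  (.node 36028839968636928 3 (.node 65536 1 (.leaf 384 8
  170325152499539428272903878947794720463986945858427681429456154899555053855241503288682721363577925613417631302986870745384290134966361748990726940150285519992014458946021113560599102521787522302416938117002824570
  [166, 69, 138, 257, 185, 340, 283, 39, 251, 282, 42, 21, 0, 0, 1, 0, 210, 2] [138, 336, 159, 141,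
  18]) (.node 281545843671040 3 (.leaf 960 9
  442952936200940392323844091487760914880687855213177622534425907066006604719261009163549294198165123194993287533139317462013077661518664951542933585045691970254620539365959277203129148610535489212752402878624844405698884609415684093563850102
  [156, 420, 338, 442, 0, 340, 646, 370, 451, 160, 96, 0, 232, 0, 0, 0, 243] [426, 951, 1039, 256,
  0, 7]) (.leaf 336 8
  5924094019411370880349437477904378611210293627588275037967812873032115289747743800841139136260671925102739658167817098364227817308250748383953847048845832950986956910222668237934363280616906880837010153900998854
  [135, 177, 191, 0, 163, 222, 142, 136, 2, 58, 21, 0, 0, 0, 32, 179, 1, 1] [174, 66, 262, 247, 13,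
  19, 226]))) (.node 4294967556 4 (.node 14167099448608935641088 2 (.leaf 1200 11
  134094426354838141997668826268441412878058357415827045000148581677613301628365053604308126292993398718885220721274960227597722691424478097385717199998747753421823880569487260240396886867089301695931862211920488419068993083186785400497205026183495556978455366508232472423259916284410640769917
  [475, 426, 715, 514, 851, 198, 573, 0, 620, 1461, 465, 300, 0, 0, 0, 0, 4, 1] [764, 712, 0, 2287,
  684, 1808]) (.leaf 672 9
  390960620547491391424544409475999172005614344362638768057376765284664487918347893007399429483575127965484818374317891602778655582708834445342898150988467039165379796253382487257392914374623283795423030620699302874421690241145687974166978971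
  [380, 197, 345, 418, 0, 365, 171, 382, 521, 19, 6, 0, 0, 0, 197, 1] [356, 273, 335, 0, 840, 143,
  1008])) (.node 9444733533087290359808 3 (.leaf 168 8
  1767415941641940606661260295274803236803042482474610992852336213099563276956673260749592298999615223630569155151089625025350916198256097251581158632820449300021086210551212374676740592812905543289691873614071070796
  [96, 35, 69, 0, 72, 91, 29, 84, 2, 4, 36, 0, 83, 26, 0, 70] [194, 167, 47, 0, 365, 259, 172])
  (.leaf 1200 10
  72842084464410176119944051469817753652912833407852584959544803829172349737651882791184004697091698832446758042696708325719969584919053439178692768245639836782116690905754801853311120749562200297241963321970271794410745690946787344867915307307403241958361095056917170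
  [148, 237, 369, 137, 785, 325, 572, 1086, 227, 0, 0, 372, 0, 0, 765] [336, 595, 792, 934, 0,
  2225, 337, 998]))))))) (.node 260 3 (.node 110680464442257309696 3 (.node 162164770957426688 3
  (.node 537133064 4 (.leaf 1500 10
  691908009452089656730271506487100536889069060464333033429800610148797746934893236641702850390994214034937014533021413507736042589300647070691670789538714982262664771640005632895405289839617840562698573165739137095417555900217878657659301988020562467362133225152
  [166, 494, 303, 224, 921, 1132, 0, 701, 268, 836, 2041, 182, 74, 0, 0, 297, 0, 599, 0, 27] [1480,
  1220, 1561]) (.leaf 288 8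
  29551986880668458001228248451752526440880093894155829809826295098954772393712271513002274813958223612301416930068727541826524698451479862841795203060257863254398300441733266835368506620354204771852870249099650
  [125, 79, 63, 193, 192, 0, 144, 79, 137, 371, 41, 32, 1, 8, 63, 0, 0, 0, 41] [108, 233, 220,
  298])) (.leaf 1200 10
  153272287359202299563318516279220911872234866184309474381997551586358280593543314770107407216047613713050992441355912364720455244700450495232827564886803479992443637631262781766124982285467150788338548890234501139607505477076564450511570337101520840229084423895801245
  [328, 377, 572, 339, 1298, 589, 0, 882, 1468, 0, 0, 0, 0, 0, 0, 446, 42] [588, 1384, 828, 841]))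
  (.node 1152921507828072448 4 (.node 9223372114164187136 3 (.leaf 1200 10
  230998838919549465073594663378769943187123068023501784627712258383052177439811091603713002681123854036946014792058973465130227773347675338939584663067963675800141234086958742303583167032002186169318812855899260846666440845471161297251183999412391477013538885144
  [128, 672, 329, 871, 1357, 326, 1007, 0, 880, 1378, 0, 0, 0, 0, 1, 0, 0, 224] [730, 1521, 899,
  1457]) (.leaf 960 10
  244330693752403206167103890845382846954255952194771958708919623483057963943356394235387502761155938538452663088685142766910560401422965353807766491767020107915038925025875175638225192742040638504237066143169227126178554020124168524150318009146159004357880927524362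
  [152, 490, 687, 769, 76, 692, 0, 656, 834, 0, 83] [155, 972, 1196, 368, 1481])) (.leaf 336 8
  6951459303736779353047095274670063425339806264490506897097272571412494378700548836484423264875331273949969773990915730640633048822128734473278865853674774439183922629373515440665525814177214395330242782171234392
  [63, 213, 418, 230, 35, 0, 212, 511, 26, 0, 0, 0, 0, 197, 10, 4] [282, 130, 275, 401, 213])))
  (.node 537133064 4 (.leaf 1200 10
  515075715787602338957416186085795205480860527964615953654436547451237578910413177770344132919716079722629315617955129324703819573447960501552958674732947490887715680274415379016365669848449034550587018432321992936138869461073293658605379539492251491047671071280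
  [249, 680, 1000, 196, 656, 304, 644, 1429, 85, 31, 0, 0, 1, 0, 702] [617, 1063, 1048, 1040])
  (.leaf 672 9
  4373639114411355998920640109317158696221372713400482220543245420582182174177729016288108004815472924892636442554672389470056036278856715920158009659805652911976640019377291439418502302049254797810156113789721233693235543118703400583454
  [436, 749, 142, 546, 169, 362, 819, 50, 0, 0, 85, 0, 0, 246] [369, 397, 343, 628, 557])))) (.node
  4406636446208 4 (.node 9671407133518523189428224 3 (.node 19343408021330443928338432 3 (.node
  135266304 3 (.leaf 336 8
  5895352878949124968051027739714207435741927185442866874424276835233265586905942142815508763477025290243203087411934027305423495707482245323746697836368793579648441557421765945233092730792119385210891745702296158306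
  [208, 163, 164, 20, 0, 128, 204, 0, 65, 120, 201, 0, 1, 151, 20, 0, 173, 0, 72] [321, 87, 249])
  (.leaf 112 7
  4351085554358575777543832187073634974010888601565852800664400210241189833011149979992816855724383324375497973449789537580664268850700901260687942520756231966832644729180989351870584766531
  [13, 60, 36, 0, 5, 0, 19, 35, 24, 42, 0, 6, 0, 31, 37, 75, 9] [171, 80, 0, 204])) (.node
  1152921504606846976 1 (.leaf 768 9
  1328402045369737766379987982643104936341116052599912570745133980019826976734140262376710496156346778804432552073179307599529730081660349990195702384168764361944937080124262867895128077792250292331557100778010008320880600688845238695643628804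
  [192, 417, 126, 14, 242, 118, 14, 445, 135, 232, 286, 0, 486, 20, 41, 153, 0, 54] [317, 704, 223,
  897]) (.leaf 960 10
  596524529711652922927795995853498854349862550644944918690011331446583870929117031296571997139801203755260411762926409561053249383313870605542298463908153561693994214142314191741056101160386895010501008449515310745964173296386722151148369050148180015334431097840786770
  [534, 182, 0, 335, 226, 36, 568, 84, 282, 0, 0, 409, 0, 300, 101] [285, 314, 1520, 383, 1243])))
  (.node 1208925891672223212634112 2 (.node 13194139533312 3 (.leaf 768 10
  110687464757718341710539649940967846900818642199193600809124655252801053831703154537048734672974566866761074952910701492317895701985810605521319002311081092820761404363183216633721992980285520146172993735525228559150772172704645121751136140665242051163267113531716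
  [135, 292, 510, 0, 1091, 195, 191, 387, 174, 0, 0, 0, 0, 0, 249, 1, 159, 17] [128, 1138, 492,
  984]) (.leaf 576 9
  312568343321567744959130157549950576425188397175505926627133260711115669429261952810250056139320896168600400721688971917239104653808353322864104057001668842469756128731063719681790709675522616533023335414758311435399007037651876427628544763
  [259, 223, 0, 287, 226, 77, 332, 0, 2, 0, 247, 0, 289, 73, 0, 292, 41] [520, 27, 608, 0, 566]))
  (.node 302231472953240175247360 3 (.leaf 576 9
  3518182216456424081540778033884308696427846303275528555717062083528165274609160435573622550680577992547625638352878675633497194157419699147994245642851547915807400956590729432450192248457682987166057120854893535521199142933483219115576522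
  [280, 350, 95, 2, 214, 149, 157, 71, 53, 62, 0, 0, 0, 0, 0, 0, 220] [730, 587, 723, 128, 374])
  (.node 604462945906480350494720 3 (.leaf 288 8
  3652346607531226839510010621864922331098624425234385957024752885556477394391613350004566041819963060500605604966940419538229707579055505977005466407032819316754310353776802846673292261940695305765683420301631591
  [106, 129, 0, 543, 105, 23, 160, 160, 0, 0, 0, 0, 0, 49, 63, 129, 19] [58, 0, 151, 248, 149,
  233]) (.leaf 1500 10
  481280837799764371544044687748753667467168995006148131407183035464486804417845088039323526570177556798843754044004712541779514875082373471540254176280574938668637885948169368520012261870833425019356600083491571869923225548383976143647640223401268037006081589886418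
  [779, 1, 2653, 338, 226, 778, 1078, 4, 1, 0, 0, 0, 488, 1, 1, 84] [509, 935, 828, 979, 1459,
  1001, 1341]))))) (.leaf 240 8
  18004086005691132787087479656646075710224194366284369844245952827850092495178966296815449951671833557185504583144109568464132414345899571573920751874892150472593405730327186296115327939709439563927229833421376
  [21, 290, 124, 33, 143, 0, 12, 0, 0, 0, 1, 0, 30, 0, 43] [465, 157, 178, 50])))) (.leaf 480 9
  1041880235972243362980105654109035661143982416277357790786566459536733512467497612828909594504267288626518865122417065365101144920247641635243772559462810817668009968697494784141049876183094729061161045361295710479473639527370927871607963907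
  [0, 165, 179, 161, 335, 61, 115, 0, 0, 6, 1] [1013, 674])) (.node 92358976733184 2 (.leaf 480 8
  84178869198803529630911164284301658812713749371143441978030207739245577577459601985323997818693087844384693493368890892963001328167659430127323848155444185713162974938867955981229361924342373992283342572985057468
  [272, 237, 109, 264, 0, 18, 54, 0, 0, 23, 0, 29, 36, 134] [332, 329]) (.node
  2419622670776759895531568 14 (.leaf 480 9
  627009247038213366136974459599472773237554900572517477739532639048010705074807002433916297415936120424454105743766892444124175918631475911105520307616099462943888677043208817262204743825257150860112267092101013744230794559797322444475244866
  [88, 82, 18, 278, 372, 0, 2, 269, 0, 0, 169, 20, 114] [396, 1615, 1057]) (.leaf 1500 11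
  4164521497048709371720574641815559623116726588885269833930562505664002395250964405264129909699668825207646848703304301602061085116635339011295777253323529952918200018578768159800408237667074287797686263453390107382387962042090313593273977606297660132875481332736230357233398785925114877
  [702, 441, 798, 1028, 0, 1, 901, 0, 0, 421, 253, 317, 37] [77, 1167, 4842, 3226])))) (.node
  536870912 1 (.node 1208925891672223212634112 2 (.leaf 288 8
  12842134199657905827641271733492193028126687101460299764582509040242705954297237575447888991937423353908400549143357013682549802935346523836864268340643698070396783594339992275821692642355695455393353922773141
  [116, 99, 4, 199, 181, 13, 14, 0, 0, 100, 191, 0, 55, 1] [519, 541]) (.node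
  706052893135737227277533184 15 (.leaf 1200 10
  253694009089312639519375184915693635894222753002179525639526433647604878345426216909534463179925121393558741041487847840613804656534495977501969857991296242170099618224462716999073508528464672433823003640271578341660091709542545446203183491506601916052141134284
  [55, 504, 0, 848, 203, 240, 29, 0, 740, 8, 485, 241] [1073, 2007, 2013]) (.leaf 768 9
  26050110935559090051102966638378582331896770937272576554678042382121775895733657797881929310144541923363403228016461598007171180813472914882211229191826946894422561487713593926544355193317359947926386026037518095961021236583385834958366461
  [409, 0, 541, 217, 200, 51, 0, 327, 0, 253, 246, 34, 71] [67, 515, 1145, 920]))) (.leaf 288 8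
  4308574302900289435370276718157285966883906900254011288409875611118933939166489888065882017245810022635822586400694413731266724922580605637774237201882125852352969456276744341281790771848453808302049185178327414
  [66, 133, 116, 39, 0, 1, 28, 23, 138, 0, 0, 49] [313, 431, 435]))) (.node 32 1 (.node
  144036023435296 6 (.node 17592186044416 0 (.leaf 1500 10
  185406669599442644845288616587219790146880731812925251443497782596724045173010759846787702555323187146795260516507294286459503593435162122041960731678657600333173086448571620380890074304813090252541121609579090780190400303879159467232088103934402469219048854704358070
  [571, 990, 171, 1801, 611, 95, 104, 507, 0, 459, 0, 227, 0, 2] [973, 1481]) (.leaf 2000 11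
  47401207351453469785258393577442250675031362604302008901902940365203101066674760101902565039209545377288352544397720231908359031536915013265940709179729910068167581907415324358014032037925386410512820511667005543369218673062693674108621912244085652158797365718941053124959097091311303297567873
  [1553, 156, 2193, 1157, 12, 1, 0, 0, 0, 57, 0, 0, 120] [576, 878, 3046])) (.node 34816 2 (.leaf
  336 9
  208377140169293089238233852187617748585489947222837178231659611196480449740185088657987604817295445269825372307512187911232031113498902523372453546557439489456737227701177427031006278710537338302534689641811918184515006370512625739324202570
  [138, 10, 734, 144, 12, 10, 44, 124, 0, 91, 78, 24] [33, 712, 221]) (.leaf 1500 11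
  2494830127259641267176326056341711848050997638896506863111355351580517657139973747079769325875635118477795476721561219277436554921831571626526784957416415604756564588637622865382845535757741773443086413952814238216783426585493128364625916516466592512288486583643499392924706355659118955465224
  [809, 3604, 701, 109, 0, 1, 0, 40, 56, 491, 304] [354, 534, 3569, 831]))) (.leaf 60 6
  28320680580445949529487504477392205707151726070978295079916812372780874882865756940516249276212442093304234554353987412992186001173401717380753822532920934815
  [119, 36, 9, 7, 0, 0, 10, 34, 6, 20] [91, 114, 104]))) (.node 536870912 1 (.node
  19342813113834066795298816 1 (.node 48378511622144 4 (.node 32 1 (.node 140737488355328 1 (.node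
  302231454903657293676544 1 (.node 7516192768 4 (.node 38 2 (.node 25 5 (.leaf 288 8
  287285106757612732501936072341083391286889924765755198766219876931601320280650440745484061240953386276875981175458204721592505749936200223527410212063193511840722496926417016264098728067702283097275640516624330522818
  [217, 171, 120, 185, 258, 73, 69, 445, 214, 133, 368, 0, 0, 10, 50] [221, 742]) (.node 140521984
  8 (.leaf 672 9
  4857523404277695668943228806140737273753606725489761038209035744203511500048800829688843339518707455001527643390724636082305321105828663688708308706402105305700118320196096903875465495678001759857149454005991836827303645744350120232070676965
  [143, 91, 203, 493, 610, 0, 177, 938, 417, 322, 876, 0, 0, 0, 0, 0, 1, 2] [538, 414, 761]) (.leaf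
  960 10
  2292183305213147967155788984797207064079218337420268779514940770739232915637700218610753717828607720476399569840246419915548209555085473426406776507321480615607671820422383377798112238491868155116106505472499008529481674755991376424009921330282626336795808682397925903
  [363, 146, 547, 811, 2, 0, 1354, 740, 594, 1370, 0, 0, 0, 0, 0, 1, 1] [141, 282, 706, 866])))
  (.node 2048 1 (.node 281474976710656 1 (.leaf 672 9
  4546591236097428238004521597192598814977120416279308060263271500294779726840884312904657654819422688810417025647644544234597421227616842897263732027001827687080931174645924644091739857917500133554409745601172041043112675925108797044278020504
  [221, 358, 275, 403, 599, 1117, 99, 1023, 405, 414, 954, 0, 0, 0, 0, 144, 0, 102] [698, 468,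
  1332]) (.leaf 960 10
  513803612888352103949734335210075237562679962739206447038562708977558182111675905689039728046645741029044366448524004564526211073097935565119286341593995999410753829543142797304608674302220392962413757189599132134481925590305196941913816773300094125169642060360264923848
  [203, 738, 710, 868, 2213, 0, 1379, 721, 678, 1108, 0, 0, 0, 0, 0, 0, 30, 1] [244, 1375, 646,
  2352])) (.leaf 1500 10
  1037432937671587089402693157910873416503701267471006985005673799859703885736075938351796042798594623829342470348102760581496606094261130593373803392935360093952806742414885742546866488394938844895593992188180076482585915562744446625842608228174387127301757492861121682120
  [510, 847, 1129, 807, 248, 1087, 395, 504, 2073, 0, 1, 69, 31, 0, 0, 0, 372] [1426, 0, 1783,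
  1753]))) (.node 4294967556 4 (.leaf 480 9
  190125676191352024172981419633692610963123878529136441055510247325375243558249825922969451404769268998705788249965142456840455076167624347773905306282834365292759171655205131464406660976328280380957776108123907600450449075018976745719808917759
  [243, 263, 382, 327, 132, 644, 370, 213, 585, 0, 0, 0, 32, 0, 0, 0, 103] [433, 307, 540]) (.leaf
  576 9
  1059263250502129278231542032799777883609278337039075880500234447577289611803409221620674079538370834408746021711633687909841156505464216342326035612096532384682783482499640522522316980072066919143017484876835426379468863926194194638755709845648
  [268, 374, 353, 35, 868, 374, 290, 632, 0, 0, 0, 26, 0, 1, 1] [592, 622, 591]))) (.node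
  3221225472 3 (.node 19343408021330444063604768 7 (.node 17592186044416 0 (.leaf 336 8
  9123856475787415794660029455578679032076346406814917378529349343889316386373910711916645844654728431915000080146389411300991099671998329762989997029168806221312474627356993001556429234070236763540140451406326005924
  [151, 213, 122, 79, 0, 130, 228, 184, 111, 424, 0, 0, 0, 84, 0, 0, 0, 76] [238, 205, 406]) (.leaf
  960 10
  2598246461007987950270039537687611369944769312618376566366135242217715554948125439256299124348471480180233350071672503878725937077981987160050986584674666225608058276322148834243487102666106029156776373279651476895493290833901132582583685687595554661437336654346125841
  [393, 298, 626, 183, 449, 937, 593, 27, 1273, 0, 0, 151, 0, 0, 0, 0, 72] [184, 902, 685, 1638]))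
  (.node 228698418577408 3 (.leaf 168 7
  326759433956473721961096667242892183766642767364131797728109905535868587753469689479336349822595888003323182993297777108059752952491647507735441658761557099048360536640439090229189953163619
  [121, 78, 0, 184, 79, 237, 117, 25, 192, 1, 0, 19, 45, 1, 0, 0, 1] [104, 119, 135, 307]) (.node
  1048608 3 (.node 18926359419625999958016 1 (.leaf 768 9
  169662167044329809841621961137823363620215056807282393743042371167982416326390369954335269572951399830289617556429515710773787933211934690238457531429736420513438745418942552091679996850432557680485661646606799893635862140159208498448863855093
  [108, 314, 123, 973, 907, 47, 558, 712, 432, 1213, 0, 0, 44, 12, 0, 0, 0, 2] [407, 963, 238, 901,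
  1540]) (.leaf 480 9
  5767127012848577995659840816664283215696513796349219940480299888642266649610156960278303129544892723144830215523482457996321884511781953882650707412918031251603175917055237562256150686774730268058806741101625460168039721361106567982770290975
  [152, 54, 216, 629, 40, 613, 401, 218, 761, 1, 0, 0, 9, 0, 0, 26] [74, 336, 584, 427, 520, 812]))
  (.leaf 1500 10
  4809802556118015868455062306686934275330733211482701385669171914615699075610051287785135266303528892782310510165924445636623873928867257568354246341189541260252115724325092107418960336302825384218139095080673938341650320954665991447131074657762504546004689836115763014
  [593, 471, 1173, 0, 858, 1011, 414, 2297, 9, 0, 580, 146, 619, 618] [1045, 632, 0, 524, 1462,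
  3314])))) (.leaf 672 9
  7516451155473336705540436335422872924968118963982816673480355663042719357292636129381107939798009790809096039033855881892050458959338679315087170153784677275144039135692479359897112644329852975114155866622731746706752709489795593523234865564
  [331, 367, 416, 242, 433, 55, 1082, 0, 1, 0, 226, 0, 260] [559, 506, 712, 976]))) (.leaf 336 8
  8796100947175142030610833873261278838994148268093058621521902618686990345230157633433592978875890177709052803737999119356790433065004039069999689752272785285813769495112557745689650187061593833250845279264571798477
  [223, 184, 497, 207, 0, 455, 0, 0, 0, 0, 15, 76, 94, 22] [636, 260, 550])) (.node
  618970130323154579732037633 8 (.node 87960930222080 2 (.leaf 480 9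
  1176628837408691706623952419851082194552507394044461293537728159839501489021398160187486076741876268349299527002027010872152412843493928598356755691788035787378558851347109643559271494833601541926465227413595642656934213614565657977540296329112
  [295, 152, 316, 540, 249, 0, 285, 185, 0, 17, 169, 292, 0, 0, 2] [792, 427, 1648]) (.node
  310089472767181180331098112 4 (.leaf 1500 11
  377426626890152977735451709532534867394958494361940217033444253614655836621728346221187702194446516404317004566509263934189380392408484516903707685941494132263080240714108317245720239221506614859485957025436366935391786909553140188543059347551790133918655292909771634035924510936258154185360406
  [324, 507, 0, 1332, 915, 203, 1556, 359, 533, 194, 60, 831, 304, 58] [955, 2356, 778, 4292])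
  (.leaf 960 10
  348501652539616126007953915681653334922315521648557459314097293862782292121174532767717579485373938789359590877262041860787930353748954680122800829535979179853675242650338426008511570106871822722446272887414061061325569474779019438262543096262008488813090223813440949057
  [310, 1, 684, 507, 287, 769, 444, 340, 0, 297, 239, 174, 0, 159] [191, 797, 1614, 511, 3035])))
  (.node 302231454903657293678080 4 (.leaf 480 9
  6597928092710133178215507856591366636575057179301106462687010472964878051524040490084214883188545984493555100233312135124504321308529886372057168055697249022981742528080119352892526892092526461584121382942575602924351080345739272277710703858
  [186, 182, 664, 284, 65, 1166, 87, 0, 0, 0, 121, 0, 114, 56] [512, 1192, 476, 357]) (.leaf 384 8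
  464871915773032729733830528759323156617442511826046433829778287017368572853569083767666089872750030749393794266515552382767804567026125544941988039269456653363914003855467027164562907452154112018810722156091971508809
  [190, 341, 177, 1, 501, 208, 0, 150, 1, 42, 36, 87] [281, 76, 808, 305, 178])))) (.node 32 1
  (.node 302231454903657293676544 1 (.leaf 480 9
  1377374015633325636740564755950321989740413280705960623374985685513547035867645439107705516102964917575870487717320231492533722445609320291920044778737273924112970349862708957325287005707208712353009931671161905692786619087059589160968211416868
  [264, 270, 200, 198, 1114, 356, 0, 0, 11, 265, 0, 127, 1] [1103, 509, 734]) (.leaf 768 10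
  1945325975000860647781424521731652711592434100531518363405543709234150095701377628745148156690633834572587824150828811053787025507808593146139603714189003539310423171442755819637738184676326710615991248633660815982554155780395521854775215078797816360656860856814018061
  [412, 580, 402, 1474, 992, 0, 24, 61, 624, 0, 104] [256, 1883, 627, 1529])) (.leaf 1500 11
  2284596572115365977017403653479710818039437377016846866937973899303358184757188810169488138230348151286894580023296535653117346312759406560971255016614592395180035907168036589624956331937162878929752350737568869517301608312980036842965835802497836522991580837996611247126661649942315441227446082545
  [185, 520, 2247, 0, 934, 0, 232, 1036, 0, 473, 1, 559] [3062, 2906, 846, 3019]))) (.node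
  140737488355328 1 (.node 302231454903657293676544 1 (.node 277076930199552 7 (.leaf 1200 10
  2938066225251859025383419339396120317837948139633881284896913619412984802910964422270548300715738195270767817972175380779323938903786510564225793104168890510781052290076638656711150121707632024515834840573013923053255856098931532382116716859606254038068882856996804147
  [869, 411, 174, 513, 80, 1513, 213, 0, 0, 0, 524] [1369, 816, 1740]) (.leaf 480 9
  4124790394517481634003630133342277890166266316468972442673461651897647529593152706468643634044904182115969954095363661350492425973510645541928934952093266969809707455582015998152964504792532946096673907494765081450984019189259801662096146678
  [314, 733, 217, 653, 593, 92, 0, 53, 10, 195] [392, 598, 305, 767])) (.node 648518346341351424 2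
  (.leaf 960 10
  1685714730554728724619926755102507512481089014823375022343553271517228531343991895263140339623702838338022625478254876229272295590020644571331209317671625886978686818751429080584591276980914403159038285896475065320273050705627523103464478727302188921938464751002583610
  [430, 690, 370, 415, 617, 194, 0, 265, 0, 281, 2] [779, 1748, 0, 2011]) (.leaf 672 9
  5705859634966913365020925679150830234588204538830981711141023947384565173299777978490325927393872140267930804209892829048802126208974413939064413173099380672369027112075404055841242779142546441669593881680975879459650243181072782120835875721
  [0, 212, 310, 382, 138, 0, 143, 1, 189, 0, 0, 19] [417, 617, 1288, 0, 1394]))) (.leaf 336 8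
  6250429904232311619165343707509534470374550627679366034361792188511374408741222206208941252713411839628671994903443047188085020087647495558596720616163492462089501844907939549087402064027043293980566494250444793761
  [102, 188, 218, 93, 0, 0, 0, 114, 0, 108] [460, 464, 34, 461]))) (.node 19343403409644425635168256
  4 (.node 32 1 (.node 246290604621824 4 (.node 386856262276681335905976320 2 (.leaf 576 9
  486955611935999280434561075322373845909818410821907051318924504843072669629583493092393046490627566334758265016966640573875223047087338295361407538485017176237652993661560950419866555003441849507583030686314604994888286494546371310389606656
  [1076, 121, 290, 0, 275, 1323, 0, 0, 0, 2, 14, 0, 0, 1] [1109, 982, 657]) (.node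
  464227514732017603087171584 2 (.leaf 240 8
  336830596493890715952020126827430711436382035551765822791188769330627253182899674633671197609811110171263878725572142527826688993437298807735301723909331972814750883045474998617062866688217977662440304916314459028
  [379, 102, 72, 0, 106, 522, 0, 0, 0, 93, 71, 0, 1, 41] [5, 243, 346, 471]) (.node
  628641426776067923150635008 4 (.node 135266336 4 (.node 43980465111040 3 (.node 8589935104 2
  (.node 483570327845851669882470400 4 (.node 618970130323154579732037633 8 (.leaf 672 9
  5664719347894724930391276160668700396360157364634619262665957565576189097203866475513465429090840191203897953086657755443108958014553960908256310725657281585651975141482394806819778456410900723704238889885335286552163971167627858244270331764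
  [324, 110, 550, 2, 324, 22, 0, 72, 177, 411, 441, 0, 0, 0, 0, 0, 78, 371] [234, 2, 766, 333,
  1239]) (.leaf 960 10
  5112863781275525036781414426696207885580769239472823769590002362130257133483421724598525910955850575616938080385764933182735992743530686156361957052234347900278042720217301398951580319463802417595208508069230484938896535045883804499440176425369171896374692655743230240
  [972, 741, 1, 182, 0, 59, 432, 206, 620, 1473, 0, 0, 0, 0, 0, 0, 591] [652, 1227, 404, 396, 524,
  2])) (.leaf 192 7
  24906374259797217590963034747044135186134709409189785028462947538685460487991897677933331938535760115334597194186115353442798685367535712140488614784605809501861351206864752478224671398861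
  [153, 0, 74, 2, 0, 25, 33, 122, 91, 0, 0, 0, 0, 0, 0, 128, 1] [141, 1, 0, 202, 1, 173])) (.node
  19342813113834066795298816 1 (.node 2048 1 (.node 228698418577408 3 (.node 1152921504606846976 1
  (.leaf 960 10
  2767113587362464988997121377330839986883648313525989304055049163551767214274422041595201441041975144155103828056200859236365226337118606271644379763461787892809640577651755782535702014754527962032274522251723664553857250355115227774177476460947799405181281301770193640
  [439, 806, 361, 347, 627, 284, 8, 7, 318, 417, 655, 987, 0, 0, 0, 470, 0, 137] [200, 32, 427,
  673, 378, 2194]) (.leaf 672 9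
  5063961817293983016509084218092671641395244276717768838200720589628405513361126423077977235995103927801363636053453357167551578471882639112024983724277954683565976726670646978323203264135043283606286586582734307272787343039147977982971515258
  [438, 183, 735, 470, 269, 308, 1, 125, 19, 364, 514, 0, 0, 0, 136, 1, 208] [528, 269, 0, 0, 263,
  344, 990])) (.node 19343408021330443928338432 3 (.node 302231454903657293678080 4 (.leaf 1200 10
  4452110571758352970186199347468297634886301119604234212329316912322210034658452956505103264605759758669762363587235293763343197593274333685229574923286292803235632387752024888463971378811731342345633989030424392957257408342547063355162413785184193203317140804366019104
  [270, 998, 20, 202, 72, 858, 0, 177, 0, 0, 452, 1090, 0, 0, 0, 90, 0, 427, 0, 1] [9, 0, 252, 324,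
  1378, 442, 1332]) (.leaf 576 9
  6282726569639704796751598869884899278161380153937216055090690300116228086803438063320062822544067030383096335984980921152965727661727454094467009770128081140094591448800805004931448906333484569333363935683734272012235358215704792912356761742
  [502, 264, 44, 1, 401, 0, 192, 0, 13, 79, 473, 0, 214, 0, 0, 0, 147, 1, 2] [342, 0, 607, 0, 393,
  306, 138, 104])) (.node 603979776 2 (.node 8813272892416 4 (.node 215275742313752413855547392 15
  (.node 19352257847362756039147520 3 (.node 34359740420 4 (.leaf 576 9
  6334973319138559649347184495649684271033370507641267144916432311811597593196811489691658243972917338416001827859714671574051805767894249728207943000900436098185970967560669043206607227003403919567545533711854209628652425837823914185001590545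
  [58, 130, 187, 208, 175, 374, 500, 0, 253, 123, 150, 50, 56, 343, 389, 0, 0, 31, 0, 71, 0, 22]
  [118, 593, 0, 1, 208, 236, 179, 811]) (.leaf 1200 10
  4259534506166124488953253623822339272108781013628710923922132886475466403052608160219561586254058016194620411065615593079949836934076931034078846174507034970246289099189158507541811716965166702052308868349675894620041719773026117921452651414000562002778745938245965467
  [572, 201, 0, 574, 754, 16, 0, 255, 229, 421, 436, 205, 610, 1087, 0, 0, 0, 355, 54, 1] [160,
  822, 1342, 769, 0, 161, 633, 769, 2010])) (.leaf 960 10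
  2478495437169619157186166032444817246129002904171188395650767249459090790161675282095580143955832979034782725703240497658248188370982842529963425454586093372892893125783263329820126306307674233530052989528004522297994692833532061534834915396381712963973076895545854547
  [23, 395, 507, 551, 1664, 0, 314, 256, 137, 158, 59, 514, 1110, 0, 0, 63, 45, 0, 0, 0, 65] [337,
  797, 1248, 0, 75, 0, 137, 713, 1733])) (.leaf 960 10
  3134415277144761543526975706492860563273902616590185287608675213109295433324370398537584402859370833718119508079097425866803889384268781737278022792136421171985891949878956675152567871307702461593512535891184998788766738817530825362561215390781446209362941192135924180
  [127, 670, 611, 790, 0, 0, 166, 337, 482, 410, 408, 1237, 0, 0, 0, 1, 84, 0, 3, 108] [586, 1426,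
  1072, 765, 560, 0, 0, 832, 1205])) (.node 432345564361785344 3 (.leaf 960 10
  4268610378568163372272019386113544653439369259980507375138510803976642676303722408186994142033378727661957855671065171647654377736528599596978955159329504121161596979121399329131426464729216182771523617333157634760559765906242086959158864102783771896350665597615482231
  [205, 615, 2, 600, 0, 23, 300, 80, 501, 242, 20, 984, 0, 0, 0, 1, 0, 282] [644, 728, 133, 1332,
  329, 2, 1, 866, 677]) (.leaf 336 8
  3996889099238510757644370811402159752513225164479526958646993657045239450044615554462009469563780684930761884339269782904667364815648479059400613772510183121225161910069205115723283239828459992383368323845854475680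
  [168, 12, 480, 26, 33, 0, 0, 118, 327, 0, 341, 0, 13, 0, 0, 0, 52] [120, 245, 385, 0, 443, 0, 26,
  1, 87, 357]))) (.node 1008806316530991104 4 (.node 8070450532247928832 3 (.leaf 1200 10
  4227310579480111294559114766747360435421380325970207557350988269961335489941959017192242479946207035621035125261240248364808748488813348196664017990752049548592821566442058179007965521547669809918073657645736281875946419382498405829147030357692562005877898866080222177
  [544, 601, 916, 2, 0, 488, 383, 810, 208, 128, 654, 293, 165, 0, 0, 609, 0, 314, 1] [715, 0, 864,
  325, 819, 1, 1300, 0, 2902]) (.leaf 768 10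
  3315614701374965762704288939724944865321629551533723338613952628615440771726739933209915398124991086412464265816507661915425551789880617888233238535795327505279012700490268317628504508225338214710593664567186278452627700955545734804574911044015606558803285990015296046
  [402, 565, 435, 0, 0, 245, 158, 446, 334, 308, 112, 0, 0, 0, 246, 45, 195, 0, 78] [305, 547,
  1236, 744, 580, 684, 0, 560, 0, 1565])) (.leaf 336 9
  3023126148432218848744482459554211676763096431661351992388892204578081468016959182614430285249277703820740202251541058807576818253431952136638478841415505317789276609012714240052742026896643987042249185849607882185879112858042997749311355146
  [177, 0, 0, 0, 0, 29, 172, 230, 152, 205, 0, 0, 0, 199, 0, 122, 0, 96] [308, 126, 173, 75, 146,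
  0, 0, 544, 0, 756]))))) (.node 1218597226171823285034025023 23 (.leaf 480 9
  7484836807381783413225151889768553036610519782792581622528104636276087383257807133278389153926276848525420194241497018670120856058981929789665467788189692341168429628269817460112576275480767512497847293069576651295845673291685279065677508289
  [237, 188, 0, 1, 95, 0, 14, 287, 0, 252, 0, 0, 0, 86, 0, 72] [582, 1, 345, 0, 465, 405, 684])
  (.leaf 1500 11
  2373207018055271817851225681415335630718131699298079088582684289507994883720720495324080884644956201726167986189871604755316934117528243060116329737145327916512010016288082504455308443306737175864831379078440504801669971291785869042610894542222489351728854427604310074181356965668130339685423623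
  [985, 0, 504, 48, 0, 823, 631, 85, 1217, 0, 324, 918, 174, 0, 202, 0, 440] [716, 1418, 0, 940, 1,
  1955, 0, 1301]))) (.node 2048 1 (.node 195922868806869147713536000 7 (.leaf 672 9
  6619947985408850263177576752738793134230370272226998759184455745902065880893579231799457437678870375461828901727916854359106312754953641398601968178359104613726388413193528352606201789227555689386987606156847739774767962912336498006500843485
  [257, 407, 109, 434, 303, 0, 0, 51, 364, 104, 1, 0, 0, 0, 0, 1] [1088, 179, 124, 8, 714, 0,
  1400]) (.leaf 1200 10
  4082461602306028128461033294983181627691857131879312229700282796658809319296656080378299268477696982687585714304809375523697697822223159223555600402865328257919274785154849708494765569693016951727787293912535367026719278727407954698724821742796827386665682097110473309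
  [882, 147, 573, 200, 0, 0, 146, 492, 493, 0, 0, 0, 124, 0, 0, 1, 116] [180, 2001, 1099, 801, 0,
  1542, 0, 1505])) (.leaf 960 10
  4435466875894626395155445282801653206845740112923649229695538226272358551048959929394761677791686225060411670587227786856100883562430014275599868820881481317119575819537158761578416317322036804379178037762569901008021479362673949896369396037114029480522485694055069253
  [361, 396, 199, 1, 0, 258, 429, 546, 0, 0, 0, 0, 0, 0, 1, 222] [1002, 1364, 54, 423, 1, 680, 335,
  1674])))) (.leaf 480 9
  5869171415298953721318325555475457167102825358557446516503333823340809628667768061194627377434134987396244264227029582807086199583546993981034555274110448621727437169776042120353607196217129152013657866775562709456797995078265532264184595727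
  [73, 139, 0, 127, 227, 0, 330, 0, 0, 52, 266, 0, 100] [946, 165, 91, 439, 214, 754])) (.node
  4294967552 2 (.leaf 288 8
  9430487987624876541528615703123734976877152534989692666573084662108065899214145487567323402206034820727864028960072005900935168732878678301211676571576689147936375463154807563620829739199873681219805544444646878676
  [175, 30, 115, 548, 0, 146, 146, 51, 0, 0, 114, 62, 39, 1] [610, 0, 90, 79, 0, 731]) (.leaf 480 9
  6361562697074218780670398563213005511770185066996302491095236406578373991593185486282485706955427846022213528128485737144338018578798092986174722125623203710932761676248483604576270784753876565691835245689015691165776154350504652028158148809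
  [42, 2, 769, 0, 210, 340, 87, 0, 0, 1, 160, 120, 92] [231, 929, 150, 57, 453, 149, 484]))) (.leaf
  672 10
  2930385877988291576009533215610421378354620040553358478415506157617284989719871884834724446829914782186325551735386971357158382434415480781210220865201471591999933808942472176864862382059940469214337916684512753603767803992466485594459451058243694271278282384456051350806
  [1, 317, 0, 318, 2, 0, 0, 0, 177, 98, 0, 1] [1305, 184, 0, 695, 1, 752])))) (.node
  563091687342080 4 (.leaf 384 9
  297852674075326317191789536956030578104596693984472565151017010798305996517401705476845458142324599359767028654880048360728949108785943099965078980846963065357803180177671844668853732869709335575237721887464601532233280560804231040117107851527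
  [87, 185, 109, 242, 376, 0, 9, 0, 151] [768, 368, 286, 723]) (.leaf 336 9
  3940070062717093179639830300242692905296797607689899388819722110208647111081266182223894361314003691519602945663768952605924762030700330160373356276525635408185826977541831073753810633712677559383253072095660163280823922891579265846911990471
  [139, 0, 233, 537, 0, 3, 0, 121, 0, 1, 1, 86] [90, 690, 247, 357, 571]))) (.node
  649193760689215735625417313 23 (.leaf 768 9
  6362945928957983378741574656036782253915354977056651656059581754660905532609212091618054170133682487469303066653338398213922609947685563068321005181738106964551999947387927122688265113442490959317002793829118601871466640517378824764381055425
  [319, 87, 107, 479, 191, 0, 0, 192, 0, 31, 0, 185] [1330, 1037, 274, 1575]) (.node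
  77373613638577702540673024 4 (.leaf 1200 10
  1783582639014818419352779764414304895592661816950677129978001661163307123544747845871851102111235930139173261226562381149591202014066242346436153594282074214361001703582335101182290745041195489371200636295486214023997579389636233058226720624327270070968813132743586450
  [222, 79, 141, 1894, 1861, 422, 1072, 196, 0, 208, 0, 506] [1051, 2030, 1466, 229, 1854]) (.leaf
  240 8
  35725588605198198234698308104576572597405049778633176081247763621845611843391223922678868174264810566136680346959948889413184086590133234526149026235688918417450551646196160947110271577778983864485508357027808609
  [12, 139, 492, 484, 0, 286, 0, 0, 0, 85, 40] [273, 312, 350, 107, 98, 212])))) (.node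
  1813388729421943762059264 2 (.leaf 384 9
  2356202308574053857954979088191053743804761015929239941310421938470254278155586819154552069818034343656297962099974289692763569811440250777746863409146656736253137515811728270766997747052665880638167668682342279916504125573034572467310718640
  [103, 83, 656, 26, 0, 105, 0, 91, 0, 5, 15] [797, 0, 411, 596]) (.leaf 144 7
  16207344532974635865456803743235815621374120574528000191453977826606089065011903286196733349449489823806976828307719093297860362841514665156405343046765288223020732677169695312779365532865
  [12, 217, 0, 64, 0, 0, 57] [111, 305, 20, 147, 216]))))) (.node 19342813113834066795298816 1 (.node
  1218597226171546208103825408 7 (.node 1152921504606846976 1 (.node 1208925891672223212634112 2 (.leaf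
  1200 10
  54009078059337229405533206892895529884589013925367845286829841737856898666087153262530388934545687365232264739208550120400695128904833804255283824386516734601925163718762039841346383422775397413843026411374609502850313493281942589868871387179071813983529861487
  [655, 414, 838, 197, 84, 0, 613, 109, 250, 6, 485, 260, 479] [2115, 615]) (.node
  4611686018428436480 2 (.leaf 336 8
  2994784524017180782906793277499866463977866873945027269329066414601093165661432579463791892189062186633777857530914956690050512391249017451458079287590477323072378127229150778071839900934417105283235285957607571
  [180, 154, 207, 13, 109, 0, 200, 131, 0, 137, 53, 51, 1] [206, 741, 578]) (.leaf 480 8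
  5623628343988535951573623936581357556589656931570143779570714887227363178370130339228868804942601034973819821214464346091050377610769673143392492952223317594300244848343446363482072302732693349502212892877848985
  [253, 292, 6, 140, 152, 289, 215, 0, 167, 144, 47] [217, 259, 819, 575]))) (.leaf 576 9
  496773993965807766411091809151651905975685696332718893029344988001579147727880693302349306495434344638454070684993485552635255420912445733253166479957639893556089779272991379373240390727013420800970911375626532021223867022881653566506008760
  [376, 73, 31, 0, 4, 210, 107, 283, 108] [841, 1270, 801])) (.node 302231454903657293676544 1 (.node
  1208925891672223212634112 2 (.node 618970130323154579732037633 8 (.leaf 768 9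
  2564390634238435534207871897113784823922060836322677722711181632797751739478659278692677811285151342902573382677754407132070589313345423741880637432313607819967549303948399612628705144397908933670493252073835733417167726207176252255557110989279
  [257, 427, 263, 1062, 177, 0, 358, 0, 301, 444, 0, 169, 8] [649, 1413, 1909]) (.leaf 240 7
  1245163306835814477597953274530157884010211279514272053285831015362011489753423524261506648362811687277611370515803961180228920618890411005122130656827165682684876324072839778003128665770429
  [131, 73, 388, 351, 0, 105, 0, 13, 105, 0, 0, 36] [152, 243, 435, 73])) (.node
  19342817725520085223735296 3 (.leaf 288 8
  716765012910535645839392402332021154689789618690583771757706120188174114823683443818597981225465012003834324246474850297608173542413489853614125720754785353761947208469369681438773983107055963652529115150061236387971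
  [163, 126, 114, 299, 0, 191, 92, 0, 157] [169, 211, 508, 545]) (.leaf 1200 10
  2808954724692088032582227044735899863473756211410244684220275271853878679320353964197927228269326236170066039371457520568924139161675116549097379769011702408811104192326356592483349174087087685357728178247587862304786891289648924650958329374143293156579839756568619910716
  [762, 2472, 512, 0, 479, 187, 333, 788, 108, 149] [683, 672, 968, 1845, 2210]))) (.node
  1813388729421943762059264 2 (.leaf 1200 10
  2938082701581899454225719591793753853648014235496690065750069621359156634308225653398425833314991878734689385158434524065075800640793019794883504713128295259617787009957641484459253884168649589647033937318831570183666011028139728875583635659418034083798920732214296963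
  [274, 838, 1734, 319, 723, 0, 17, 0, 480, 256, 333] [891, 1035, 2165, 740]) (.leaf 384 8
  16886566491356692594945035452421017910162812203189222360525047523485240874694834403200191732934058461585659922773082878661969376242512066152791864893534393120578237284890780286448467772967901099082185827533790905261
  [208, 649, 0, 219, 0, 0, 191, 0, 33, 14] [236, 519, 465, 611, 633])))) (.node 140521984 10 (.leaf
  576 9
  2402481963342616262661120505820449612022298358363999174752178994831192199615075073809301076045380928098541396452815720988251326522109597202281771625738680283331126873485043989270579611668749020172248345846137417183280183316547360173139689789
  [70, 377, 73, 322, 61, 0, 248, 0, 124] [1042, 1352, 1161]) (.leaf 336 8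
  6830962493720826589748386226773404405947931434231601136643108928645463951643786332525948838753392550907665560507555193579825745691194042801476974346608004542957494452310861777488496971515668483456870282575636070539
  [209, 43, 77, 163, 69, 192] [95, 396, 603, 639])))) (.node 9671407133377785701072896 2 (.node
  1083197534374707740536733696 4 (.node 1208925819614629174706176 2 (.node 140737488355328 1 (.node
  4399120252992 3 (.node 483570327845851669882470400 3 (.node 32 1 (.node 1152921504606846976 1
  (.node 536870912 1 (.node 1813388729421943762061312 4 (.node 302231454903657293678080 4 (.node
  1218597226171823285034025023 23 (.node 1218597226171546208103825408 7 (.node 10 1 (.leaf 240 8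
  3813556481075387091775592069692781629178092451140922265130324654215260589963037610432084935271931890200277278399465472987939381769112842957058312827353972031803762070093279268345139925776490790544169197071948089917542
  [135, 102, 0, 78, 75, 118, 132, 86, 0, 0, 158, 88, 0, 24, 92, 0, 80, 0, 0, 0, 41] [576, 252])
  (.leaf 1200 10
  6686227660485284108935802972905351936820263817371017497786985393244921103104552399309719130185300565387895283085696907609700686465478533901863455559480542521745031537287141470575623892110509291818189099366363713909284007146759810180376161732955686816527419934753521927088
  [692, 0, 489, 455, 411, 488, 750, 1, 195, 2, 1, 0, 0, 10, 171, 0, 364, 0, 0, 1] [558, 2732,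
  2576])) (.node 19343403409644425500950528 3 (.leaf 768 10
  4746397771272755361676888557475325962943194392986911684818902433015545912131646592744642058048011261830808612987071944695023101347117126582792995008389009492297349257670036217242801561287421920874005185643679138943868204854150183213077598955142810101502152369790190092819
  [220, 318, 252, 228, 357, 370, 184, 298, 0, 195, 215, 0, 237, 0, 0, 96, 63] [1003, 867, 1770])
  (.leaf 576 9
  6467980332577555077276075722401962307289372153987816560891518387867018069855300253275794771551703458260281856860130809702989287345706814200787170990488911736236107178916224831380064378387411183115143033498504656645102109841623659283664202629579
  [326, 209, 250, 314, 119, 1, 175, 1, 24, 119, 1, 1, 150, 0, 0, 148, 0, 1] [430, 487, 1204,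
  1586]))) (.node 126100849695916032 7 (.leaf 240 8
  3188744475947238448390419200615892289695484605477127528302128836171999115459431440909323676084622139547432196664796942526243200505327697986830625304715459913608153979738522097853521477164400305309967710999018145710229
  [183, 181, 181, 111, 113, 146, 125, 8, 8, 26, 0, 5, 125, 350, 0, 26, 9, 0, 2, 119] [126, 241,
  251]) (.node 17592186044416 0 (.leaf 576 10
  4259376698789197389266927953649637647312701992250216316700497726222819482080757751991679339929260953446907093829799120954167975706806326918862721663150064701025155934995099058404827140529350080416536729710509985740391354798044642423907985255097858497097264528866216510011
  [498, 87, 108, 287, 406, 411, 1, 0, 109, 250, 130, 0, 332, 31, 0, 301, 0, 0, 1, 1] [468, 635,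
  983, 1073]) (.leaf 144 8
  2973300810705680287175791915170805176073436105260258165473274417137366455035918937010974599206918933965456505190729550772873063183950364899011962836608173788105635715523030427382997132579049594285113190620543226347917
  [44, 40, 79, 87, 230, 67, 0, 193, 0, 0, 0, 0, 0, 0, 0, 29, 53, 0, 62] [114, 106, 184, 224,
  266])))) (.node 302231454903657293676544 1 (.node 211106232532992 3 (.leaf 480 9
  5202067555484670127633171134036302672069587123847601351255367378341165757348835771337860563570532786543402409491629313814989271056318475236578640508886108134145215215587522085929631291594951854208290675396641878646864220110292652725368900306064
  [186, 495, 94, 83, 146, 173, 168, 288, 101, 0, 0, 0, 190, 0, 0, 0, 0, 0, 0, 166] [712, 1119,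
  130]) (.leaf 960 10
  3088068830879803844954892043035041142619550580560394821705082235098346120021656633234965599286779622551554320132834731732611895367095962679453823506397110810480245998776925455918288572104232988756200058482930040944081504545724720878930166930110678654589927176700884431188
  [764, 0, 336, 393, 1, 12, 590, 0, 1, 0, 0, 435, 370, 0, 1, 0, 1, 40, 340] [548, 1064, 691, 412]))
  (.node 1008806316530991104 4 (.node 618970130323154579732037633 9 (.leaf 768 10
  4680705992023509721255372506164953112512119712831966487694071250410881949309646919552555315309664359724139354846611175370583815664359391513114975117326236582261785677184301142191939719103905924748045836570090837722399002141759981984196955288182928940107605588738582836596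
  [273, 258, 0, 108, 91, 419, 232, 167, 0, 111, 0, 0, 7, 429, 20, 1, 0, 0, 1] [518, 484, 1854,
  1103]) (.leaf 1200 10
  6034783174220651123223844750840919519502896369385720511847673319402217423991313857579533022917300028411940646921048103923865830049141282212679159381789523174224004558394079019243303683735449188508672773049950765763706825474615700083382960620736588131378224062455117692447
  [416, 384, 601, 578, 460, 286, 529, 27, 0, 0, 1, 374, 354, 0, 283] [473, 941, 0, 1536, 674]))
  (.node 13194139533312 3 (.leaf 960 10
  4663850159705200755299590489892038124888073473859135259347390578786105224039913357814612279873933116167641942622363007167494399867807121006207060791792299764611441024537981965368963354401265281686384752971188675625196620741838255737582998729479881611191314298999517783610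
  [405, 249, 356, 544, 574, 431, 235, 3, 0, 0, 0, 0, 0, 0, 107, 0, 1, 2, 282] [379, 273, 138, 1300,
  1369]) (.node 5066549580791808 1 (.leaf 168 8
  2930194926616502480878295817336085946688847098422056252715598624142463256970138694647041676769233857241390039646353067793334009408377014759272626661719574674909578074323666989634505048737432278011561371585757813087290
  [61, 13, 71, 75, 78, 1, 0, 0, 94, 31, 0, 21, 108, 0, 1, 0, 0, 2, 4] [142, 34, 112, 35, 407, 126])
  (.leaf 384 8
  5408008974658314716641965920436327524404632481544982444447969631949593408621402039542647526620277465538308613420873893291726808381707426722344963843197122020167549502209133626862441620097901262796906289765483861115037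
  [56, 192, 186, 73, 0, 141, 15, 202, 175, 0, 179, 281, 0, 107, 0, 69, 0, 51] [90, 213, 249, 74,
  179, 796, 244])))))) (.node 1813388729421943762059264 3 (.node 7516192768 4 (.node
  321120920835135874531328 2 (.leaf 960 10
  2939452505636108317149096139248949146846053600016276855964126523004203756206029442926645853733410329890899278326044578908321723828702675735541444370677440373343498827277425399073958772122023790612521709996158018505312093070358417374936027058359658355996381947238421859025
  [290, 390, 934, 482, 316, 242, 197, 0, 781, 98, 0, 0, 417, 136, 133, 239, 0, 0, 1, 35] [1310,
  648, 2309]) (.leaf 672 10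
  5060159729817006250883548416038290988404228063982283221805794194149955883699761519116890483845971546544922284719685205081539256646540587744818843242835233960873164974132021955919557138769874055340062660101944438494327801936559652101427883522409183173809824106178923200903
  [178, 637, 187, 270, 139, 210, 55, 39, 382, 0, 1, 271, 187, 82, 0, 0, 1, 0, 218] [483, 731, 1791,
  974])) (.node 620756992 4 (.node 13510798882111488 3 (.leaf 960 10
  3724647341888406591538287275524592466308045622305204857327989066623293821100323832408768097941844697039938286108138504676649699133506810476983335234925015134411455246023101302549507623480025945378474375131788086235881945791114775386237463530048392725168250972016486646368
  [27, 444, 928, 224, 504, 337, 100, 0, 315, 65, 0, 0, 377, 448, 0, 630, 0, 279, 0, 427] [907,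
  1255, 1070, 1472]) (.leaf 672 9
  4724131956758770130521798419789000598484133150240547757504332297163008614969228573999278556033056656406464948788195829628570924989688969705330913814565163062591814528738411307492004406475226685768053228683973574109712718385996064313535576932794
  [276, 866, 0, 313, 92, 113, 0, 175, 66, 0, 109, 355, 293, 0, 454, 85, 0, 0, 257] [81, 604, 865,
  866, 1181])) (.node 432345564227567616 2 (.leaf 960 9
  6788039733132250821448207115158398688739554108456404120699593978373345087200608183032135680185850498609512302404952345834141210009325082781474503650123251459075051494102937355338643876750052857916313103650578714603940849407003743854355638387150
  [359, 529, 383, 338, 305, 199, 0, 199, 220, 1, 367, 276, 434, 274, 1, 0, 0, 0, 320] [374, 2, 438,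
  1185, 1162]) (.leaf 480 9
  4574283959932170088065146252730712052849336933783420251464617337263467479458422261221960592840760315659300154955060847052464637922880972577121539731889898989970163404035183133154417633728713911465559021544307112135063729767791903477907444465972
  [284, 404, 67, 111, 155, 0, 51, 120, 10, 0, 79, 321, 1, 79, 103, 0, 0, 115] [134, 179, 111, 437,
  903, 856])))) (.node 13194139533312 3 (.node 38685626227668133859557376 3 (.leaf 336 8
  2134941961138901674104874759972313883528790043385318222487592288974275443478866818520216707926336869215962300125832515416110085644598049344844235631159645075582878207988708713120548626552549000955025768627866758235634
  [104, 107, 82, 0, 226, 128, 1, 264, 0, 0, 161, 89, 72] [443, 94, 83, 701]) (.leaf 960 10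
  1792054759713635100728778881080374949444907437414344584487067654148760241188734066716864593748506967770850845007295924954916614098652679200877621785056752585826933113224673168785089992077321576762501133449705607195999113971307589303964153361017577332284252970746783067794
  [295, 272, 204, 541, 335, 0, 675, 1, 0, 581, 89, 101, 74, 0, 0, 0, 0, 331] [68, 988, 549, 8,
  1869])) (.leaf 672 9
  2734798391257990032555855425161692339092529849876378441095166575660693911363259336199026335184736645177831679868523077382314285765818796452259193922529492961960297323509678108608202574979789897964235951259060426589402150658129460019643414507273
  [263, 234, 214, 0, 0, 476, 0, 209, 432, 291, 196, 0, 0, 0, 1, 1] [397, 651, 162, 392, 518]))))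
  (.node 19343403409644425635168256 4 (.node 63 7 (.leaf 240 7
  3692982107179962559785088956170637844750279229085236999227819691453773413179117840981231971653851100921083135043009921073812775760042753214597337176751215462038464575364833965102043221721311
  [143, 104, 83, 15, 42, 36, 38, 29, 24, 85, 0, 107, 6] [203, 220, 313]) (.node
  302231454903657293676544 1 (.node 13194139533312 3 (.node 4294967296 1 (.leaf 960 10
  4078128127160742938877232799265388728028151110419363903171179384013851120862290539801888845584359379536336609829231695867178790394522617397477626979202982354338849662060812367609442245904846043677541345559362362145243296938275054317072087482682038805903871538031287690985
  [195, 583, 534, 364, 159, 605, 319, 0, 483, 0, 1, 244, 0, 0, 0, 29, 0, 120, 1, 297] [8, 614,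
  1062, 2101]) (.leaf 576 9
  3989217782657017091512369938324304440441651555657957838751951218234339143524905881186781093378796520371620698528172248449280635755581004420540722150714676031942557806864827862780952315486549537940225065039742728979871238484161414426385237184322
  [258, 213, 230, 246, 704, 141, 58, 251, 0, 0, 144, 0, 0, 0, 0, 0, 2, 78, 502] [175, 437, 492,
  687, 346])) (.node 939524096 3 (.leaf 672 9
  5002707496761748229514106248525222258885791120774680045166306780607653394472071849563728953990642785143962219879806168788137170766154584832556627992921272992517047189503251540860113192127681295690878786520670765264332561223625536269890942482841
  [250, 290, 359, 443, 973, 0, 77, 0, 1, 0, 127, 0, 460, 0, 516, 0, 188, 0, 211] [686, 689, 1022,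
  958, 431]) (.leaf 960 10
  4267896451484179987457246835242397832877809316538184286037389055275522048754182257706547316980393447866562199895382652136558944517477957559823049911182230511686258434370214975509751802250700897064748811117167379709854184158146743154491171911044738418638641601406115512949
  [322, 58, 465, 511, 1, 312, 453, 0, 0, 363, 644, 170, 98, 183, 0, 0, 0, 471] [552, 663, 669, 760,
  1141, 1052]))) (.node 72057594037927936 1 (.node 16924961474604808445886464 2 (.leaf 576 9
  2855446956597249106690116831417478694771500417467314630491477140171545868869814150624630624009394267028762838878984254689583837064581788316759517779469359658146685731522560662524984087419898451365057246651209498673419839566354965348786286639892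
  [94, 407, 345, 165, 500, 22, 236, 309, 111, 118, 375, 0, 17, 0, 208, 0, 224, 0, 342] [369, 272,
  423, 457, 285]) (.leaf 336 9
  3520737674471482624123477579697655965619935096817550592576187439627162460135034572491763779919852940027810944256799159530666017905211297518613825067107714138284687625920007072300653532330984324618035162786900269194298223857202848775769289659550
  [253, 140, 197, 166, 0, 125, 161, 46, 0, 73, 0, 0, 0, 79, 0, 0, 0, 332] [123, 379, 305, 282, 838,
  1])) (.leaf 480 9
  5628351175691362771968835090556282375152925614072926750597765113435321234316656912130322486993588890719861898230890741135662136657547961361458522663101527399905928885682874945984591268592660282709288920587200610267717098677564702088613100285666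
  [217, 349, 427, 12, 123, 0, 1, 53, 0, 0, 175, 0, 0, 0, 36, 0, 218] [351, 272, 233, 408, 1282,
  246])))) (.leaf 120 7
  1357538384388846508101774650193723494587934025381579954836599614287595802313345181103394240827690040536910634156196700604159338149505495659956187131794098493822057339400627408476316832580676
  [29, 89, 0, 0, 60, 0, 75, 40, 0, 25, 56, 0, 0, 1] [285, 1, 118, 222]))) (.node 4611686018428436512
  4 (.node 77373613638577702540673024 4 (.node 590295810358839869440 2 (.node 2417851639229258349412352
  1 (.leaf 576 9
  3987472635273058472611390388101383927789146659366128012245101644051472668101864245620855622221113627765063943303464230296641646916085806523690259814520045461042786582335730016846774376739907164494634818420326021495797918637316777792621449847573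
  [81, 323, 236, 318, 0, 234, 157, 153, 0, 0, 1, 0, 169, 0, 0, 0, 19, 1, 188] [472, 716, 549])
  (.leaf 288 8
  4804650239783122388552858734358294801369123363773457660861565296443286570698657179420456143917810275570481045697042982347644648375282327717570448122153455764397609713630851002542346808995895918774004761315678177263746
  [210, 74, 165, 0, 45, 57, 145, 54, 0, 0, 0, 3, 28, 14, 0, 0, 0, 99] [104, 287, 604, 268])) (.node
  1008806316530991104 4 (.node 2199023386624 2 (.node 12090438787767009158365184 2 (.leaf 576 9
  3617036886945886224943379306656046987131430507056638519386071400315489934384063115038031957024942175309152702906932960199261388769828467790641151450740549384535541528932772689043205566520269256926899385043586208094173054133649141014720113279239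
  [118, 197, 174, 308, 320, 0, 0, 6, 161, 78, 0, 76, 17, 190, 156, 0, 0, 256, 16, 126] [22, 767,
  622, 651]) (.leaf 384 9
  5161044851469559750514625236339409300531431109997872968583042321837494415479957611117045438852616577637210983243111789697180079015754004870715103939270838212018039391473034819564675666959794044164814981952681916134269817364491867572129413208253
  [127, 92, 201, 117, 0, 0, 0, 147, 116, 1, 0, 0, 90, 135, 0, 0, 201, 0, 104] [83, 284, 495, 1165,
  519])) (.node 19470524493070336 15 (.leaf 1200 10
  7200609270784112762271722583318775727787033341955399916804214661362325022817906375446720107059081914250347788159947159489544287950525989570889330950863671342594371498865546665481898211428716887578740466826215569668705414098617553806026966390374673267247623089347627367872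
  [164, 210, 463, 0, 222, 0, 0, 376, 572, 0, 243, 498, 179, 544, 0, 0, 101, 3, 85] [497, 1006,
  1386, 2610, 1439]) (.leaf 288 8
  3539872247193321209614532085133202998579212609552520053814265845706607807327901023200923362201757683835869349589624385573391904759415562571565357713015660730607368504580230862320540277833874494421768693296730141425834
  [73, 131, 121, 68, 1, 1, 45, 0, 0, 42, 0, 162, 89, 39, 0, 45] [207, 164, 228, 388, 454, 483])))
  (.node 19470524493070336 15 (.leaf 480 9
  3521388848452439994772003575553834221676673983322230832552860447417983286292801205673276562814850570065077822439100773178223310409371022339305941314251742034522546656809753768840066628397296827368704954775801139374795179335503587133575244614851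
  [109, 93, 58, 20, 0, 111, 234, 260, 201, 2, 205, 0, 51, 0, 0, 100, 0, 24] [366, 293, 539, 803,
  485]) (.leaf 672 9
  4640964453437230575873672132785571073830405764684698197159854250315855082485521416719414755718228154866051502198334675114009910078896952907923113446754269529723622412844075413764654176012499884411466103149649001453545243643860149849091910402282
  [293, 125, 9, 0, 264, 357, 15, 265, 0, 229, 105, 0, 1, 48, 314, 36, 94] [221, 645, 376, 715, 986,
  312])))) (.node 563091687342080 4 (.node 38 2 (.leaf 576 9
  2827785133135959404592011189111257229336431272242271994047304824162294114441837879777459489433066429912615819733881794821811605368313140263387972714293571856323835144581173424807087767409927980418795362966361612885565139832889583052765328834834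
  [206, 89, 41, 0, 340, 75, 108, 70, 0, 1, 70, 232, 0, 78] [592, 641, 444, 594]) (.node
  432345564227567616 2 (.leaf 768 10
  347233519400836274692955127179318261714955672941817100283361485217962620184276683622381202642386820983431449687850810775174470513538982071555545618185727001893730722598691168018510067994067453686284364275102030033130717255517818608844930297262849749062867084035572025986
  [130, 272, 65, 1393, 214, 184, 424, 0, 223, 0, 372, 0, 110, 179, 86] [1362, 1184, 1052, 12,
  2430]) (.leaf 240 8
  3578744137729753408576860428063306508395312327069131323853017709010800532199329145536832898056906807491012680340843916282683010596496884934743565438467292332912549352115766438680178214253090290139738166996331923525513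
  [72, 40, 163, 90, 79, 95, 58, 52, 0, 71, 30, 0, 0, 41, 4] [126, 184, 281, 338, 523, 428])))
  (.leaf 1200 10
  6545899427806782287397156216147291945798473646847538783228780284331757207755707964918127017664146508900525426824560727009541614699764130760550432725598307857378231224996662367815246572766633341459304841089874612964156765595307472671156073256738376303419743864486837663976
  [171, 0, 395, 301, 164, 366, 0, 162, 424, 478, 0, 197, 0, 0, 0, 12] [1288, 313, 1260, 2014,
  552]))) (.leaf 288 8
  2800917229513921687232127850581894487376901894569007514983685849648185991296495904500560253492785959736249638583515715218156612625658167673463688032865362242436956132610947089078638591852389718261201573215667807584378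
  [0, 108, 73, 43, 1, 0, 38, 23, 106, 0, 12, 0, 0, 0, 186] [568, 130, 267, 215]))) (.leaf 240 8
  3404191702106085486205331644481896692346978519893519622626450784826678830699678664695568085395685376302514260462730456726750227907605168317478557098400963675728437586709209801207403489813004955206715889758970778233519
  [27, 64, 159, 101, 55, 56, 109, 1, 0, 108, 19, 65, 0, 50] [426, 460, 521])) (.leaf 768 10
  4417114944104692731038226138787983091791583064959666136147363344204384115520797754779432764637641637369124937512242697117670255703420786014334115609353065915100369563632489991602336012172084482925478227025196174087638198753973493344730045169642674195082340204780894347805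
  [227, 490, 289, 1551, 199, 337, 0, 0, 375, 118, 0, 0, 114] [1354, 3035, 1570])) (.leaf 1500 10
  6175200081330128868521241088617876926076701660434833529057002411729904167710330968431811262233580964583200697455217912198710045783034375788417429529686625234525038295281642273319830558511747313500268855857384125861708670098920392850468822065456403713017938608618951865202
  [127, 0, 452, 452, 849, 727, 188, 569, 242, 369, 2910, 49] [2479, 2038, 2646])) (.leaf 1500 10
  6968681764048032585982964507922460275264149864796772897531061683544035890100832455425203767669649476864028092389416478652806218044514445981030599115600397822888185947854625982311561644638921062990627311006883597690588049576757037794394660555069230343547390646423054789368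
  [729, 235, 656, 810, 746, 143, 0, 327, 402, 327, 187] [3038, 2334, 2084])) (.leaf 42 7
  662452418800359402888440169352825095117295967622668059268792209275308567300403120388399920544968804849309869529401109046687112613464696995953416154967079109315130219629642920685053807689749
  [9, 27, 22, 1, 0, 0, 0, 0, 18, 12] [216, 47, 42])) (.leaf 48 8
  3233623843311287496191717931272923341702281603588683950272314236782859544448524018565466897056478808798056935052127153964724710226488852369845665410921215015864957359173933337952195798465421978152274555764047093956626
  [16, 18, 29, 7, 0, 0, 29, 11, 14] [238, 335, 35])) (.leaf 42 7
  4385906119066801430299144714263995736555356302536373949573730408994150979865159114777224417050458820268986633987646772295308097191254461825289967025980876514735793551196801758045001515810841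
  [26, 18, 0, 21, 0, 7, 9, 16] [210, 485, 62]))) (.node 4398046511104 1 (.node 277076930199552 7
  (.node 10485760 2 (.leaf 576 9
  1242340454747997358415359721603779136262895544580559462638105125753037243274270509640116164745602066916184171729210830313690361186250040980436047251745204647808081043066045082006433135703929466501032459635500070728400386495864249427496102527158
  [134, 386, 0, 0, 12, 50, 45, 0, 62, 135] [1088, 363]) (.leaf 576 9
  1268441158994045070696121745508718775345885212975106444517996628490304094755403053745333596282533158825088180913842051174398635933849145628926886812865904027220070065533149444049070414628712680194698247160748665483191532271388230047929332924648
  [384, 0, 0, 0, 91, 81, 0, 79, 268] [114, 1170, 548])) (.node 140737488355328 1 (.leaf 960 10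
  1231476745624143725582221055487299754321583515100690803132182847718457345034979810782574355203790756291311024497926985714510347807292770309667217684546576162578607641311136780297430210791653887023287833511273631161942505916701828711018680324734700182917649380263544923348
  [992, 1297, 0, 160, 10, 141, 0, 1] [974, 1922, 491]) (.leaf 144 7
  669580670950765119030625738353029588170064240872513415003035582612478082503252510289929683704303767382026998426145679005981109119984751213265336359272194498752623191118153819539376946992045
  [124, 0, 89, 0, 29, 0, 0, 1] [191, 147, 289, 193]))) (.leaf 384 8
  1381975889072032738355258107958873844822679089108010717061521256595563559261177991887412283896623580585687640026129643576535421536340987326336496934697464250237564910521179946713692973075423550320291291569476338385241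
  [231, 0, 26, 0, 0, 33, 151] [704, 800, 117]))) (.node 32 1 (.node 19343408021330444063604768 7
  (.node 8404992 2 (.leaf 576 9
  1243458382561117670254370889571392341590989051340348702703686437421602596128204530520372170984161639467887059340409834277146044269107629829975439432411698671031689505303940530673004204670401374690459080341090981406404273313910759636144775836854
  [134, 386, 0, 45, 0, 12, 50, 135, 62] [1088, 363]) (.leaf 576 9
  1270518703263178856125185401433151981394523173611575408089490839270683542579333372336082499914137916825927226010258247187978399999590359097272369400942131418401333509532882404087096825814834511394443002331405075024866507251699092332704822257293
  [385, 0, 81, 1, 0, 91, 268, 79] [115, 1170, 184])) (.node 19342813113834066795298816 1 (.leaf 1200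
  10
  1537107052447060018687707995380423950051682588365540836863306709215854525661164976689696108723203266221139938623772497860131430758749598239097032113430641949419156867452924079095125574781868134251377044723473028381984572848604945555380123955862859839005354017335038614777
  [1244, 1620, 176, 1, 200, 15] [1217, 2402, 550]) (.leaf 144 7
  672280796152172838966274278584708743248292935067927453728443800086591190652695700205240816438023306371699518651036018761497661885990769625776826115436212153122426290806523932018174549033005
  [124, 29, 0, 89, 0, 1] [191, 147, 289, 193]))) (.leaf 576 10
  776892380210832837016006425103458683744258992689257318776091829444840382921137872522001069379430684657526996705990418608672773804228507167939128369074094223064162704961669596044014603643122694324618286539774773772680643962859666135119835336053039764869713158440944362629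
  [0, 0, 0, 188, 229, 194] [1891, 1210, 173]))) (.leaf 48 10
  74315672802876393724478723506324537307899633479223709269883324938005361566212547711135265921257019435931579363192894238192689189436164192204208162722901487355400169890518396284976632241018044187625633257341716766912295814568746070550510189324267731826076976996595794418
  [566, 9, 0, 1256] [1965])) (.leaf 56 8
  237760456951913309919600524795505235076238610869634726670961074260165438423312264931472498609804054349708604176552439514746887682771927926359388617419795611766553033466836281200770847392610966517782867464027145699361
  [0, 0, 23] [443, 91])) (.leaf 56 9
  133569122762061675146594590267278340236620915417238199191738525961291699856235926768755313980734078347875980109518236211998070773437766015180861952318425895936948740346781932691298842192502629030375572546967457059123630287334779190508242862304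
  [442, 8, 516] [851])) (.leaf 84 9
  213533762986242885251777423337688063398634327869617142590767205212353626240763416274654306137615279397133528491507981443387660673144271140982275481584944583594946802765728928921775313249702195136801558480805721850713286034384992501548053442987
  [0, 35] [664, 1648])) (.leaf 72 9
  160397665672671340326461497046330340454010395431225282681597248015187527760091306234160545107515923688994541961517919552759376840375589655888081277585884714940631300850431187670694352164259467476742316220058982648405540503087396513998765293941
  [] [596, 1461])) (.leaf 72 9
  160319474700956844801911224258952206873918055731294822460715230728113485635396417735384987484021929959434488661787729217200533878129660951109128062476637348932730878524080363885264821754518072034409300841053459889665117489099676925915874743669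
  [] [597, 1462])

/-- Refutes the cuts `blockCuts` if the value at `011220` is at least `2`. -/
noncomputable def cyclicTree : BranchTree :=
  -- The six bounds `blockCuts` are available from the root on, so full lists of upper multipliers
  -- end with six entries for them, and full lists of lower multipliers with one for the assumption
  -- at `011220`.
  .node 629850352019221800021917696 4 (.node 4 2 (.node 1083197534374707740536733696 4 (.node
  110680464442257309696 2 (.node 2115620184325601055739392 8 (.node 8 2 (.node 8070450532247928832 4
  (.node 618970093429666432304545792 4 (.node 1005826281919371473355538432 4 (.node 939524096 4 (.node
  4407710188097 7 (.node 629850352667880883851624448 7 (.node 1099511693312 2 (.node 105553116266496 2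
  (.node 4294967296 1 (.leaf 576 9
  1908411284376999741669600405530369714190255338987136078002291936953608396372068858530990119484216812135439493491886799126093172947730485758052201724031993719394480833611651048882121928333873644087966234110888157763131793019750486737086092800
  [269, 298, 220, 340, 244, 1, 0, 1, 52, 0, 39, 210, 0, 0, 0, 121, 504, 194, 211, 417, 255] [53])
  (.leaf 672 9
  2066524997890350365886968078986515424391562406613628446758768257045670478044198784034024845598496433371698256710318909436868292330119356646753189651054125242579901325682714417888703506395615276693282808454369057866364148744763591674476173824
  [335, 294, 123, 493, 1, 0, 0, 0, 0, 135, 268, 0, 0, 0, 322, 546, 408, 0, 451, 29] [346, 324]))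
  (.node 649193760689215735625417313 21 (.leaf 672 8
  8701784456465685617083582498703389465790610877347312698369001381778900742503331432414726527690885847268785481720538773008698613607133562361469846852534005586040810380232557069186567363447112707074519251495856210176
  [302, 246, 121, 101, 0, 0, 0, 1, 0, 73, 288, 66, 0, 1, 48, 280, 25, 172, 162, 140] [294, 295])
  (.leaf 768 9
  2535577920841227227881738206641958444270724758793696407411370377059732590442347417763111280735261419364530907091625734079526067434147696387368619499992209296474495744470326754433656103411083635468130698962014912804936236165471972460890485248
  [259, 666, 759, 0, 0, 0, 0, 0, 245, 340, 0, 0, 0, 221, 800, 11, 130, 699, 142] [254, 501, 412])))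
  (.node 87960930222080 2 (.node 642241841670271749062656 2 (.leaf 960 10
  1009147180745134034376446085693120000097468403800086525480710953267826644516033169415854350005007133412769323359540169270415396280930528786934510897022873904647154885740431840100102827442918618901344913939237395486272608228442290929611741186611634327205877290482418688
  [217, 248, 441, 514, 1, 0, 70, 0, 0, 16, 396, 0, 0, 1, 237, 559, 41, 0, 487, 301] [329, 1314])
  (.leaf 1500 11
  431951481530939765699286504438674344630255916576468470260740566574417033497574896811752119441432764440832300058322285996382764482567816469047357630447973883022698880748214863035626465176406231466095005026156289678215943789498662684242686343305096757121756676201149034796351244607881821406423041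
  [760, 406, 790, 62, 0, 1, 1, 0, 0, 4, 0, 0, 0, 743, 725, 759, 0, 767, 421] [404, 779, 2308]))
  (.node 1218597226171546208103825408 7 (.node 70866960384 2 (.leaf 576 9
  82067154114672154078528355937845663354650767290118857663411976169813498077793018500802236376747589498291070657695359578579277538338981713690924359346033383108286257784933793478773652752799148489494956967970551454535465263879474706828311552
  [268, 224, 336, 365, 82, 1, 0, 71, 1, 93, 185, 0, 0, 0, 0, 130, 0, 0, 276, 29] [147, 255, 372])
  (.leaf 960 9
  579962545871124186290443241867504976555009041793529032763304493630329467932342169210359041849068525153920260036962477334766218733772994806301663206128338262298048550539257445712828043748238108564712067723381585197663080905438509494100557824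
  [372, 522, 467, 1, 0, 0, 0, 0, 156, 295, 1, 0, 0, 0, 203, 0, 127, 511, 493] [188, 305, 579,
  916])) (.node 536870912 1 (.leaf 480 8
  6026363369504094594865257413701424199384067022520011797683645089503778721277404421910059707186154292882281884866829049287270340690106126453426937842482636129796248958004880567957325071929324280404637785624053886720
  [139, 251, 301, 0, 1, 0, 0, 0, 80, 126, 52, 0, 0, 325, 474, 32, 0, 261, 132] [220, 59, 260, 436])
  (.leaf 2000 11
  1966663202456395409711629235295179887091486776306831785508931458057816969498585416707033909600187215231976345373428667367143533569566886692621036093237755950196585730346379877578192784975263288405582033248429890163990550312724582144467541365455192900155007372184504793179641725968471052792872960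
  [1126, 947, 0, 41, 0, 0, 1, 338, 0, 0, 0, 0, 1529, 155, 0, 0, 1001, 474] [1211, 1484, 553, 722,
  2554]))))) (.node 812398150781030805402550272 3 (.node 302231454903657293676544 1 (.node
  19343408021330444063604768 7 (.leaf 960 9
  6675778116521839673349285479087795908303334322588380754802561477135245061493659843002955979623582823041462909608178214808561113099643360938019752870300601871302531506906450220262465721057130852683262266768569661747795350140456406941780993
  [650, 695, 531, 518, 5, 396, 0, 0, 0, 0, 168, 0, 0, 160, 338, 248, 1159, 276, 106, 272] [745,
  144]) (.leaf 384 8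
  37953627069538940894892769327730435402585972517632358493001954315640415154904276898919342580667858063718356668660764549617470875163576752201471564907246348532940286932405158274222746871468070700777963646605150720
  [137, 40, 287, 0, 37, 0, 0, 0, 0, 80, 0, 2, 12, 438, 471, 494, 0, 421, 23] [212, 278, 234]))
  (.node 19352257847362756039147520 3 (.node 144036023435296 7 (.node 432345564361785344 2 (.leaf 480 8
  1957854431043687810538662396347281854518523915885949753211538975268541186479011100288625223858305781700570131412692993230767357666960543817418209090980071550008804226586457081522557996187455259891422693544528399104
  [123, 256, 62, 169, 374, 0, 208, 0, 0, 0, 57, 149, 0, 0, 0, 0, 345, 0, 13, 141, 31] [184, 28,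
  22]) (.leaf 1200 10
  851120336028798878551215992007522058570855933525471151210737108201503156407401485026797148834051549005430781310425477119916293423600618016495818733766620915882651528724546979151011787696480518803897247483395348615876225993093232584971565908445778471203080413431808
  [498, 371, 681, 894, 0, 707, 1, 0, 0, 17, 551, 0, 0, 202, 0, 666, 163, 129, 356] [73, 614, 746,
  112])) (.leaf 288 8
  8256204526973837825911271992512545179758385732422088541233770167931316218731994553210119818758524614343876521698940931042660841459855769609186209209633525546189239519267675656379042994235361987902648751278413569
  [146, 143, 190, 61, 171, 1, 0, 0, 10, 0, 0, 0, 125, 0, 77, 603, 57, 381] [239, 24, 249, 90]))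
  (.node 321120920835135874531328 2 (.leaf 1200 10
  276365027820768929600072758611601486463299563797852573885198876105803740108021124992985828217086134556568317672637422908122578364513069427968826658513803287937041837565301321963653519864356852482893267718631926189508496078771871730654252533826089326279783271877632
  [476, 881, 792, 15, 705, 0, 0, 2, 0, 0, 0, 0, 180, 0, 1211, 1778, 0, 640, 137] [448, 0, 926,
  796]) (.leaf 672 9
  1993681633558794915314992189253302741665200055504753681948664476775306340072808536760217623085989719950837580433416110132415500612348887772039943441951535490353392057342274759120413571986285495102555172072655915654829472399870290798621184
  [436, 339, 1, 276, 0, 0, 0, 78, 0, 0, 1, 15, 33, 854, 31, 0, 278, 244] [246, 451, 557, 290,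
  541])))) (.node 144036023435296 7 (.node 302231454903657293676544 1 (.leaf 672 9
  666945580495797423984081718706167841515023046503339792166032984291363366872276602127881286886592902525651174649282364485095189459265154862638450405977895854980913091844025726971666877811115218615693030925609759812646283992441788855054101466112
  [411, 0, 489, 0, 47, 0, 0, 0, 0, 0, 0, 1, 110, 1099, 415, 1122, 5, 438] [342, 742, 605]) (.node
  5066553875759104 4 (.leaf 960 9
  2284973241638405006353488484495229948842659626674611001166705669735873457856794748408943639857870264682541866707557609827125733008729394056277071507968803535317471948753751327547707938365569153001906623082151170576952846662050399477203081216
  [59, 505, 693, 1, 42, 1, 0, 0, 27, 444, 0, 0, 127, 1488, 309, 422, 32, 125] [423, 628, 399, 647])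
  (.leaf 1500 10
  263090992005784676096367733517237892526887921992603392872681334274186281340607287113969219555787832631698883011535912428386677561765425676017582830475280646642478351555942359129190702932176906138076493045155636121125873528173420592789000396182648854334017443113334784
  [707, 1081, 0, 223, 0, 2, 1, 0, 702, 1, 0, 138, 2457, 815, 525, 130, 235, 37] [104, 830, 954,
  961, 354]))) (.node 9444733533087290359808 3 (.leaf 1200 10
  4434250513055052751012116363499772347076034793603699093817278853221231518061207240163759956253085071932213832601365111305964191399000990778531825844663866215532108502728023847128507678019261826864364306306264225817400285178994325643562939101375345741781439820965888
  [242, 811, 10, 60, 5, 1, 1, 0, 367, 0, 0, 616, 2107, 890, 2556, 0, 1428, 27] [911, 772, 1262,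
  76]) (.leaf 1500 10
  5670173519043704069230541414688675640058686668953951049409900030609561676626896386244042956129501519260206270427109105254842895197688400982526810807862658610054482064869443622882346304958033429112318116216939003305988874058812079499149928351981532685782084183541760
  [1002, 0, 9, 0, 1, 0, 0, 221, 117, 0, 756, 3203, 788, 2557, 390, 1113, 96] [618, 445, 1416, 1762,
  1066]))))) (.node 48378511622144 4 (.node 30786325577728 4 (.node 1073741888 2 (.node
  87960930222080 2 (.node 70368744177664 0 (.leaf 672 10
  203049112532741425990482687473930884473212859556905482186401417958484748556583856159780647391440268683330831711365430454512952736088319883455423717792735818231826984466137776798736890240335566125200227644584311258933639957138859826728810772119088025202321924584145920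
  [228, 0, 1272, 0, 187, 87, 0, 0, 0, 0, 0, 349, 0, 299, 0, 511, 514, 457, 1111, 423, 2102] [1493,
  2]) (.leaf 336 10
  16957484237515466243561450212803298492795760944480202691387609736549388955308918240745505742976955376052265790117070920799159316521551749146292155591383430618236772180450484884886633315175782427258268144153288927971939013213197260544292906431834308743571676199927808
  [321, 1082, 0, 15, 62, 0, 35, 1, 0, 0, 196, 0, 167, 0, 230, 259, 224, 451, 209, 1638] [133, 1318,
  342])) (.node 812398150781030805402550272 3 (.leaf 576 9
  1720735638387281807165866062219729843098145380076211938007403160917047158855032665697323394359352626853235226323733614281574098181307263215140205415327916702519139211588385846634941752623061059205284916634910314692254122929688289943379805696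
  [307, 696, 0, 1, 28, 149, 1, 0, 0, 0, 212, 0, 0, 0, 16, 426, 270, 560, 353, 1083] [437, 574, 1])
  (.leaf 336 9
  788637979698948937081663327814663325443916356689404453004743330905754927420558261065138809997138086956999724121629836799315733563870675341996526502291790525290900447120694993740906316547204423637201632317432677927527555836171127802155251712
  [655, 0, 1, 0, 1, 0, 0, 0, 0, 119, 0, 0, 0, 513, 48, 179, 399, 206, 1043] [258, 302, 794, 1])))
  (.node 3584 4 (.node 7 4 (.node 212770944252174734748286976 4 (.node 10 3 (.node 87960930222080
  2 (.node 19352257847362756039147520 3 (.node 618970130323154579732037633 7 (.node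
  302231454903657293676544 1 (.node 4294967296 1 (.leaf 192 7
  4181950387207256802572838706418310315941761714724836692936172772260632765010264399706046788236850135917233065619148771460176940831549124871277488017006534528825931277034576233921074036736
  [148, 113, 42, 49, 87, 0, 0, 0, 0, 70, 1, 0, 0, 25, 1, 0, 0, 18, 0, 0, 0, 84, 107, 159, 129, 153,
  137] [94, 41, 116]) (.leaf 1200 10
  268641591089183160107938949189685028455795533393876220905787454167102920815394965778386496136814998903438029446839791767017375236789355715059060586491987334287097591366455219724041382687816120801975558467622345947012759061165599449712180057783487209300986711736582144
  [504, 882, 467, 574, 0, 47, 95, 0, 373, 0, 0, 0, 0, 0, 0, 1, 0, 1, 1, 0, 78, 360, 896, 603, 882,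
  54] [202, 228, 72, 861])) (.leaf 960 10
  156839047151470954825081944427964411304259825164528286706397245425156381370958868461296710860954771999507660480994978692507702066144591871254930251451928229072925492948643647604174389548588177581078450513044336900703293459794052573007914831006188919232168325411876372480
  [0, 351, 748, 223, 0, 62, 1, 0, 294, 0, 0, 0, 0, 0, 0, 563, 191, 1, 2, 380, 425, 520, 554, 564,
  491] [849, 669, 0, 310])) (.leaf 480 9
  2219952529468627282112926396461039389952195472596914847783632635856582119552466522772251679290017663751864258820711709303712346653765078261106134924636304619256987193916884419320319827473764482600343322959628174429684698201203826751788312576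
  [0, 246, 0, 0, 5, 139, 151, 0, 87, 1, 0, 0, 1, 0, 346, 0, 0, 0, 730, 386, 294, 251, 275, 684]
  [523, 326, 1, 212])) (.node 594907496377133039616 2 (.leaf 576 9
  2297427624998934311771101046082989735607054264515709734727825311054505603872527757198958558886440980655567397344193232286424087791235323022005998269968179023596163703344934737740723933314017879803458950446641400412086773781938504768578912256
  [227, 420, 71, 0, 1, 0, 0, 143, 0, 30, 0, 0, 0, 0, 277, 0, 0, 133, 252, 665, 373, 316, 289, 504]
  [261, 241, 80, 443]) (.leaf 576 9
  789819066167757419546353404045934309158337627542060202161302793469747706771529482930613054548313623883233127102928918139405107524008192219932616864953245892888110534925052203671821162932060042561605087560736030450653403099381189025406910464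
  [461, 0, 7, 32, 0, 0, 327, 0, 0, 51, 0, 0, 0, 53, 0, 1, 0, 326, 601, 356, 121, 275, 480] [346,
  349, 262, 136, 778]))) (.node 648659083829706752 4 (.node 144036023435296 7 (.node 20 3 (.node
  228698418577408 4 (.node 4294967296 2 (.node 4611686018428436512 4 (.node 1208925891812960700989440
  4 (.node 1813388729421943762061312 4 (.node 6917529031936049152 4 (.node 618970130323154579732037633 7
  (.node 576 3 (.node 20 2 (.node 4294967296 1 (.leaf 576 9
  1596306062248153633903369283660584772567044376272885743509874729065543442980947751995631735604790268443177001505610640407621605826592481181552908604102837070316328566615401193380254471412788721076056745064660536967308010732030999509506481664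
  [257, 291, 80, 1, 82, 52, 0, 0, 0, 175, 0, 226, 0, 0, 0, 21, 0, 122, 0, 0, 1, 0, 0, 0, 0, 340, 0,
  1, 101, 383, 453, 0, 580, 180, 700] [303, 58, 263, 251]) (.node 4224 2 (.leaf 240 7
  35791497548384886792250120396127097843458238078663654967874615333094111289144800573019921113325275022236609264094035875623462590528181662300609481154294236984089843161179814483326467571712
  [98, 134, 129, 1, 98, 92, 0, 0, 0, 69, 0, 83, 0, 81, 0, 63, 67, 18, 0, 1, 0, 0, 0, 0, 0, 64, 1,
  0, 0, 166, 164, 0, 190, 82, 190] [285, 41, 0, 27, 230]) (.leaf 168 7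
  111373257541201699352323604712162368918513225358464046268015576600876842057139723177614739920832789097481568000185486053852341492211480939506286828026249324942930199122399979646834707584
  [108, 0, 10, 7, 70, 10, 1, 1, 2, 0, 93, 1, 23, 0, 0, 16, 64, 1, 0, 0, 0, 0, 0, 0, 93, 10, 0, 2,
  105, 121, 0, 112, 10, 136] [83, 15, 3, 29, 71, 141]))) (.node 603979776 3 (.node 34816 2 (.node
  536870912 0 (.node 70918500024320 3 (.leaf 480 8
  47852339843611157298774820224745943447448335153014743041022750045231166723146720318534460659903290356867879046697647871400724406996635158324575956740135252165143582295391270980575131447879824982027670005099855872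
  [98, 330, 0, 37, 206, 0, 100, 117, 50, 110, 0, 108, 0, 163, 35, 0, 0, 95, 0, 0, 0, 1, 0, 0, 1, 1,
  1, 183, 35, 0, 0, 331, 444, 0, 529, 52, 470] [222, 228, 144, 204, 191]) (.leaf 576 9
  972401250777551665956202508788575653600746303985169948015641414920892290445808540551602277734732779465316792275364992243678769090564199204078612162099117951470937759357650206798244997771717063574001844307050471740613282726593071003927314432
  [308, 299, 186, 0, 175, 71, 121, 84, 148, 0, 108, 0, 277, 0, 0, 1, 87, 163, 1, 0, 1, 0, 0, 0, 0,
  1, 83, 0, 0, 0, 251, 539, 0, 561, 0, 197] [54, 196, 31, 118, 0, 239])) (.node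
  594907496377133039616 2 (.leaf 336 8
  2218575452626552853378327892507310303987113200329312545891961612835726248117956488950281764875122121672726224442724207742671549307601048988334311444222734641865144949044990129284569423052602874009364967027714883584
  [150, 221, 173, 0, 190, 105, 80, 22, 0, 0, 0, 0, 221, 0, 0, 0, 0, 80, 0, 0, 0, 0, 41, 0, 0, 0,
  43, 0, 0, 0, 16, 311, 0, 365, 0, 107] [179, 42, 0, 112, 57, 241]) (.leaf 384 8
  713895216755981133103726045424111103220876143432989619279172314535643237574410341166101446017063959883218601227314058270126037636700119855393396933842661301843874426899803081966352962573561828752751061820114468864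
  [213, 192, 0, 292, 0, 120, 0, 0, 0, 0, 0, 248, 2, 0, 0, 30, 70, 0, 0, 0, 1, 0, 1, 0, 0, 13, 0, 0,
  2, 0, 319, 0, 419, 5, 50] [119, 149, 161, 32, 67, 91, 319]))) (.node 19343403409644425635168256 3
  (.leaf 768 10
  243567343943588630237352080895647884697375314901301566853764582332018770058768780085355732993301418685092425256627752336690758378102412576582876611397885069053851484958708225358517960443168472057396310349823126590309122649376899378492887982977568643972006087576518656
  [526, 0, 715, 76, 272, 269, 0, 291, 0, 333, 0, 71, 2, 0, 1, 292, 0, 355, 1, 79, 13, 0, 0, 0, 0,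
  329, 1, 0, 45, 444, 165, 0, 515, 0, 705] [381, 291, 117, 396, 461, 1007]) (.node
  1152921504606846976 1 (.leaf 336 9
  109692532384185049998017228559627113165823124232065006366916544879687770967306603756313877521335589268718860055818620425501108625998527976109414721447325770934116761816240359531644159945868878789681052615878199367526847607371397536525058056
  [151, 82, 153, 0, 35, 96, 0, 0, 0, 142, 0, 49, 0, 0, 0, 0, 0, 213, 1, 0, 0, 0, 0, 0, 1, 155, 8,
  0, 17, 226, 378, 0, 119, 157, 325] [88, 206, 277, 59, 188, 171, 411]) (.node 19327352834 3 (.leaf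
  480 9
  632872648314171032715981177233209911528028278778197759553747187814714364479855310910105166952292810755670139485702855394585489728444613029968989283861189347920469848332607045807224368185341485064162905009791048087506538681994030390534472192
  [77, 258, 104, 277, 0, 142, 105, 119, 0, 0, 0, 152, 0, 24, 0, 0, 0, 314, 0, 0, 0, 0, 122, 0, 0,
  0, 0, 0, 0, 74, 483, 0, 0, 0, 16] [176, 80, 161, 314, 143, 220, 23, 754]) (.leaf 168 8
  1195096198927958858771306100010156816900236081604040901948441799963988671224544360804756810446401127898963485721746188442859164124769502320765808890368948271775205836451232289388368625486445465210683383408790342656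
  [100, 219, 48, 3, 22, 0, 1, 17, 6, 38, 88, 0, 0, 0, 95, 1, 122, 1, 1, 0, 0, 0, 1, 0, 0, 0, 0, 0,
  66, 209, 1, 168, 46, 277] [108, 98, 72, 45, 0, 1, 50, 302, 269]))))) (.node
  302231454903657293676544 1 (.node 1152921507828072448 3 (.leaf 1200 10
  614231096372655925279001894041255775717269277005500929951981008083393393183840044609679265007322291128059227823040739077644358922112281524206663779803959006445800560363227708788584790535810106219286424508667614737862599025888560050312481244954539598400464201317351424
  [377, 783, 424, 67, 255, 443, 283, 1, 0, 747, 0, 48, 0, 0, 386, 0, 293, 0, 0, 0, 0, 0, 0, 0, 0,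
  33, 0, 0, 0, 863, 150, 1, 898, 854, 1020] [861, 114, 668, 0, 0, 510]) (.leaf 336 9
  316234386576305324366578908599881365698716386808071098171875385044072428779234996169380498798428637261536482349262173825615287552762457960312300853711659357265268277564281404789567355650312609751158018298896509680481801861971403159811129344
  [210, 89, 22, 14, 201, 0, 4, 24, 211, 86, 0, 0, 0, 36, 0, 1, 168, 1, 1, 0, 0, 2, 0, 0, 31, 0, 0,
  0, 245, 68, 0, 384, 205, 571] [183, 260, 0, 179, 86, 297, 264])) (.node 25165824 2 (.leaf 96 6
  1269166352467911017996971115850578462151123775788157307460559825908133800079782342484405077745105929989213751691375672851617730126950655782781326415697634013184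
  [83, 50, 0, 26, 9, 48, 0, 1, 22, 0, 0, 0, 0, 0, 0, 0, 1, 7, 0, 0, 0, 0, 0, 3, 81, 0, 0, 0, 79,
  56, 0, 59, 55, 84] [23, 18, 31, 26, 55, 0, 65]) (.node 4722366768742668435456 4 (.node
  151415487043026427052032 3 (.leaf 672 10
  500996005683399320776239595205439849020118658256291335130984996067766258773569511192333272880322831912173360399016870007261587267221471548300528779357871686256716753384572867374362686150087095894028966229286897092856592782246450552566385661246012520668136310929620992
  [25, 361, 434, 4, 94, 172, 216, 0, 0, 42, 1, 1, 163, 0, 0, 253, 260, 0, 0, 0, 0, 0, 0, 0, 0, 0,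
  0, 0, 0, 427, 2, 0, 452, 195, 650] [909, 879, 862, 141, 0, 170, 364]) (.leaf 384 9
  238855203867103904677088130577869110333868287332015797807582354064369077567587897117087075697462764981413021619535626890457610605611269727165527082655433627791290076624839516310923060084458915313680023350295799562403070485656205023353241600
  [160, 297, 26, 0, 123, 37, 0, 3, 114, 0, 0, 74, 0, 0, 196, 103, 0, 0, 0, 54, 0, 0, 0, 0, 0, 0, 1,
  0, 197, 127, 0, 315, 133, 317] [47, 358, 431, 456, 71, 0, 86, 203])) (.leaf 96 6
  16026376446341232808406304173803005127462705199671364166378639633552334508776924779365039432359533216259846167628575712991063398011512332713764935238018889945088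
  [94, 10, 22, 6, 47, 0, 1, 27, 4, 8, 1, 0, 0, 46, 21, 0, 0, 0, 0, 0, 0, 0, 0, 50, 0, 0, 24, 36,
  37, 0, 209, 59, 115] [73, 1, 62, 36, 0, 32, 8, 96])))))) (.node 16809984 1 (.leaf 288 9
  1096826167809795100868954360705119227254102667064116024055882721507181999196964732504118360099686345871126683893294172377383919699957667262098421273766114060844450559335952068829188003061031298614058993631463841493299519476991480664088903680
  [68, 1, 60, 68, 85, 8, 0, 54, 146, 56, 0, 0, 0, 0, 0, 1, 0, 0, 24, 0, 0, 0, 0, 140, 0, 113, 130,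
  91, 202, 0, 225, 149, 16] [748, 203, 0, 42, 2]) (.leaf 288 9
  654434720347820081170120068560037474394149823576907622904848729965616042719781946387835919899805401087279106680179516781252686888109834005928168562656244499589838722847580353180038799491887801497508357853829705900996250106604838604718997504
  [0, 88, 93, 0, 49, 0, 107, 146, 51, 0, 0, 0, 0, 0, 0, 0, 0, 55, 0, 0, 0, 0, 108, 2, 64, 145, 60,
  200, 0, 203, 110] [57, 756, 207, 0, 0, 215]))) (.node 1083197534374707740536733696 3 (.leaf 384 8
  7037822622077291311320888835215271898424560776191038259261276608647802471062084353473263856546427720667202070263353522778522750075316999812063769890819917629657147531431929002440107604060621295642198480606534912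
  [191, 0, 144, 0, 164, 0, 98, 35, 129, 0, 0, 1, 45, 128, 94, 0, 1, 0, 0, 0, 0, 0, 162, 0, 0, 1,
  327, 231, 0, 205, 1, 444] [273, 165, 148, 32, 407]) (.leaf 768 9
  7513024557578636036818504467173627419344513345303990672478298021403712272362225741556528212124555644481042925739558642256402745294155736349915131316431987242028384296834659253368800529252433079147813106897433901856848330532757248787011649536
  [0, 252, 0, 82, 1, 259, 1, 218, 0, 0, 12, 0, 306, 34, 0, 0, 1, 0, 0, 0, 0, 502, 0, 0, 201, 1159,
  596, 0, 602, 222, 1166] [278, 745, 463, 294, 123, 428]))) (.node 1218597226171546208103825408 7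
  (.node 34816 2 (.leaf 480 8
  420811243351032368937751226057822450316244484651920466005632518709940270266606293751151562401722522262772251815906973228010275304048993278902820937040738164393926064567437539998933640830468517601435260521694625792
  [197, 254, 0, 142, 0, 93, 92, 1, 161, 1, 1, 0, 159, 62, 0, 1, 0, 0, 0, 0, 0, 0, 292, 75, 0, 0,
  24, 128, 0, 558, 225, 354] [402, 0, 0, 148, 78]) (.leaf 576 9
  3256674119935715636167251021313214566958618964530997993420538332693438861618205964815633638661557389913913228032453683236648970505714771271070321087992670011575141160150393802073249998569042853341000185072469543060576147165179623246397518
  [295, 0, 188, 0, 1, 189, 0, 60, 0, 0, 0, 86, 0, 259, 1, 0, 0, 0, 0, 0, 0, 367, 0, 0, 0, 155, 169,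
  0, 262, 417, 257] [314, 552, 0, 1, 305, 291])) (.leaf 576 9
  2151662202954261687611510986122385999814336953072475571964621805479733432375210079723767946394460531147942390905344558409057882597951250059511067270086271820445994790905891526857921251373701687989935885581725400879971465582025190832724968210432
  [264, 0, 0, 0, 237, 35, 60, 1, 0, 429, 247, 1, 152, 0, 1, 0, 0, 0, 0, 0, 241, 457, 0, 80, 241,
  800, 0, 328, 402, 277] [1021, 647, 109, 14, 152, 494]))) (.node 603979776 3 (.node
  629850352019221800021917696 3 (.node 4722366764344621924352 2 (.leaf 480 9
  3494418456842720183912497750300385794268938254391816160244616330876189372990569126448376209836907719737443828287071085218779009058498846342671616827305345279931013794078343656158230529694049716616860544593263063263071906012683021972547043328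
  [124, 346, 212, 0, 11, 0, 109, 165, 125, 68, 0, 0, 47, 0, 222, 0, 90, 0, 0, 0, 0, 39, 108, 0, 1,
  0, 0, 411, 0, 148, 198, 200] [128, 155, 373, 0, 516]) (.leaf 672 9
  4772299924408142676496000466058059108110014974723018310418356361834656125036008203146356521016694883202522112185562967739719261409362754945551109435864467420381521246581389660177230759860684316295751722465411624201214276578742805939343589376
  [480, 291, 0, 318, 193, 206, 154, 233, 52, 0, 0, 79, 0, 351, 1, 3, 3, 1, 15, 1, 48, 422, 0, 0, 0,
  5, 599, 1, 195, 1, 223] [91, 274, 0, 690, 0, 674])) (.node 1218597226171546208103825408 7 (.leaf 480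
  9
  4738036814924852058707868982288733368490506715895840437466674399589893161107086612391727206851547124941907217447923462148146034153580298074042447198860856068027202188859301019329329278460230820873754144084194186762459330604989341753409536
  [151, 20, 0, 178, 1, 246, 1, 155, 0, 0, 0, 47, 0, 198, 1, 0, 64, 1, 1, 1, 0, 285, 0, 0, 1, 432,
  227, 0, 291, 26, 358] [328, 390, 169, 261, 119, 24]) (.leaf 240 8
  32649938289870059640004799886588034760468618438789824082404084442144673198659960882799954360773033956595960811197911156350426525534522019899693938109341322809867484164396195576921023927071906746931270307351363597
  [103, 0, 1, 0, 79, 0, 89, 0, 0, 0, 38, 30, 147, 0, 0, 93, 0, 6, 0, 0, 147, 33, 0, 1, 336, 332, 0,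
  0, 56, 41] [114, 209, 198, 77, 136, 0, 135]))) (.node 24 2 (.leaf 1200 10
  3200531375101480137710613363966701114550080900777773659316509632222863716845887887451142612525571609661566995985832447275562413493961526784742283080663303076441379475885943354083015220752471530162558841909060108333881101874831097953719714677060522704940283048032731136
  [388, 0, 242, 0, 1166, 0, 0, 0, 1, 0, 241, 0, 448, 1, 0, 0, 0, 0, 0, 0, 403, 1, 20, 0, 795, 107,
  0, 439, 715, 833] [742, 1197, 648, 407, 270]) (.leaf 336 8
  8085867076995776747183685651436712596768474266713050879506179144393303704343835583140719360608595996035553288409756524690611104316051907001608341801419120720630963059243181000692540771319559663897262586952364851200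
  [0, 13, 30, 310, 217, 22, 0, 0, 0, 0, 4, 92, 20, 0, 10, 0, 0, 1, 12, 117, 0, 0, 0, 230, 0, 0,
  139, 192, 267] [142, 265, 308, 151, 131])))) (.leaf 84 6
  9052335157078012839384321055125838385112532089972741385838870803351701384200830645595140390358798261114538831655265492918087780418053081048743648924044693172224
  [0, 0, 22, 0, 0, 23, 0, 0, 0, 15, 6, 0, 0, 0, 0, 7, 0, 0, 38, 0, 0, 0, 72, 58, 1, 87, 47, 97]
  [139, 34, 9, 40, 40])) (.leaf 192 8
  943599868987793282768696357533699585627647999889385046335082105083584499766890488511067328215326129072745592726130411244699595313760618614471350347934004450230127707506657175892431946424386284618846634844037513216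
  [17, 0, 0, 0, 23, 0, 0, 7, 0, 0, 0, 0, 8, 0, 0, 0, 1, 114, 0, 0, 0, 132, 178, 95, 247, 109, 235]
  [380, 7, 0, 110, 23])) (.leaf 30 6
  4490878232912576308894987903203754338045764417968713506445028188892688659755599613891505347735423197546860824811080808706208480768017815581498178865472827293952
  [0, 10, 10, 0, 0, 0, 13, 8, 12, 0, 0, 0, 0, 1, 1, 0, 9, 0, 0, 0, 18, 20, 0, 7, 10] [76, 0, 1, 0,
  12])) (.leaf 240 8
  3551316175079852157335802168029619591854042234005047611980847277263841339962076183995367274816543989554998435837549504848938486882298746390886283159592354044857816371317876389459862964127321488069085999710015389696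
  [63, 1, 0, 0, 0, 0, 71, 0, 1, 0, 0, 1, 0, 0, 25, 83, 0, 0, 33, 155, 158, 476, 53, 156, 253] [436,
  0, 20, 96, 165])) (.leaf 192 8
  2033426656092101588292057149288804386386552075852392820377314963798142446169996419718466923066612860310167864692182642339326581161256156870290786178419983605366934240291837594283405318020267102200350954718436261908
  [1, 24, 0, 1, 0, 2, 39, 0, 4, 1, 0, 0, 0, 0, 79, 0, 0, 1, 129, 147, 101, 158, 2, 147] [394, 0, 0,
  104, 87])) (.node 52 3 (.node 144115188075855872 1 (.leaf 288 8
  3382681071799190124124006853529030738189803063090906773874495804068247989345814164388775079400983796544913483058357980132252174553572580160848345223459167131377648780977260329654840063026540668051809491933781295104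
  [195, 236, 0, 114, 1, 0, 92, 69, 1, 0, 0, 0, 0, 27, 0, 12, 0, 0, 0, 235, 175, 338, 179, 156, 272]
  [231, 305, 26, 57, 186]) (.leaf 336 8
  15243772274160291888422122801206074011304304397173495849766838284894628046243029699936079393024609838254784471899157358946219060711465475420948444181934729657330513607472288377651962143486282039514032967564656640
  [287, 0, 134, 0, 2, 1, 146, 0, 1, 1, 60, 0, 0, 0, 161, 144, 0, 10, 60, 210, 268, 126, 39, 244]
  [291, 147, 251, 149, 28, 71])) (.node 1208925891672223212634112 2 (.node 151415487043026427052032 4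
  (.leaf 672 9
  2556784291954932072555259985808843808979941270677379358638168819559724752836092009444818600451689544604789920549194814702118137079302657413755859960994330601190985930500475023559651614889512910064560911342880444244783272839634442443211669504
  [52, 361, 0, 0, 0, 80, 22, 179, 0, 0, 0, 0, 0, 0, 0, 62, 87, 0, 1, 321, 423, 892, 586, 1245, 701]
  [416, 585, 508, 1, 371, 310]) (.node 6917529027641081856 2 (.leaf 240 8
  3300145949932091597732716633812928952324371164432300672989203316619138962334698951165049742036807401106648376731193313507372436898858049853521310780014817939364994230852362838455217479783279464318452449038991819008
  [60, 129, 0, 0, 0, 23, 0, 25, 0, 1, 1, 0, 1, 0, 0, 23, 0, 0, 0, 137, 153, 285, 159, 352, 132] [1,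
  83, 185, 198, 140, 26, 138]) (.leaf 168 7
  124485802088502526315049580831125721991258330753433496747999708268555238952931960577387242389400931236249716137227224171164043579879821961349907659373465699825105466672889002231447552
  [88, 0, 0, 0, 19, 0, 34, 1, 15, 42, 0, 0, 0, 0, 46, 77, 0, 0, 7, 104, 172, 95, 270, 92] [110, 33,
  81, 86, 97, 104, 18, 103]))) (.node 1218597226171546208103825408 7 (.node 1237940038132458770292277248
  39 (.node 19356980213282675730939904 3 (.leaf 960 9
  1987918880461882597774468707029125659862737004563075189198282360825519268892716954363136523464215754651333481814749105054494083714754287844964979118929618849650146203248463167097006341128528347314673433269274221092541821841413788785967104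
  [75, 161, 524, 0, 1, 0, 50, 5, 75, 0, 21, 1, 0, 1, 1, 0, 81, 0, 1, 0, 76, 4, 1225, 1383, 1747,
  1399] [0, 528, 910, 456, 15, 861, 15]) (.leaf 1200 10
  126124368309012222237714683404773221517914548122729840455666503358010226063472488311584434343965087664249426338676563568737070114777007098498293271475745843774890340309662381279017311757546286445687933019951996961143707805302959668667679672297138793588066773630977
  [205, 729, 0, 57, 0, 0, 24, 17, 0, 83, 0, 0, 7, 1, 0, 0, 0, 0, 0, 3, 0, 1610, 1768, 2262, 1790]
  [19, 137, 659, 1212, 500, 0, 1083, 48])) (.leaf 112 7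
  10722348900793212316909799092802266955859783079317883556897885658753384816079519803879327713793019160493083066364308764330564730151648132761189784206676304498232869308457113365315452928
  [227, 0, 0, 0, 30, 35, 0, 1, 1, 0, 0, 1, 0, 0, 0, 0, 1, 6, 17, 22, 149, 80, 164, 41] [222, 16,
  35, 102, 0, 40, 0, 3])) (.node 2115620184325601055735808 3 (.leaf 240 8
  178947983314361960188529681038310952221647756969524583917456368296502801916447084968199233977407997274380793698541978371107108075635448307758252948565581052978133691646857624437448791805807259053283121782356996718610
  [127, 1, 0, 124, 9, 0, 0, 0, 0, 0, 0, 1, 1, 0, 0, 9, 0, 104, 207, 209, 252, 298, 423, 238] [190,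
  137, 154, 188, 1, 0, 159, 63]) (.leaf 1200 10
  3985022332598211462134808807789207790243304252531784458307075656027113645625753652520488456504342751101751626342925093313829381280732335723380050299764174241560795429591165756753214545796716229835243813568079748781180471643457686988416035595662007314936827085899956224
  [0, 0, 42, 246, 0, 1, 2, 0, 1, 0, 0, 0, 0, 0, 194, 1, 0, 1686, 1190, 1494, 1408, 2732, 1047]
  [250, 1175, 1160, 1198, 1278, 209, 361, 664, 34])))))) (.leaf 288 9
  122343199794512431412190518707610043920994317644990217208995466218985975941464060883365022778240349590388699639182615502151105319570763812543282141482108449156140863046840096632495423246643313022103741151328770673258031217014906696281543671808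
  [0, 0, 76, 51, 0, 3, 0, 65, 1, 0, 0, 0, 45, 2, 0, 0, 95, 195, 459, 183, 215, 95] [779, 201, 100,
  0, 113]))) (.leaf 336 9
  1123943813085192925611449576553307200116646592240011594871531736313012205061654151413822885126273513290840456277978973523046578617287233804736730830637692368557435854403788280895063111681114998041631137701651448675849569288370463711881766912
  [0, 0, 129, 102, 131, 0, 0, 37, 78, 1, 0, 129, 2, 0, 118, 136, 226, 204, 31, 205] [896, 72, 4,
  237])) (.node 157160356694016980787658752 2 (.leaf 144 9
  13342489775576380947145152550325864564585418492878033010008836589564147078587710492064516110550429962057799740112375216889785534362258115767965916250924604852371265714676045501043698830499792359599962618123353546646684173858266200323431074826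
  [99, 9, 57, 7, 0, 1, 0, 0, 80, 0, 0, 0, 0, 0, 25, 69, 372, 102, 111, 91, 41] [593, 50, 1, 79])
  (.leaf 144 8
  45369394778933528407580819611432444273128692599242658407134245511536220286243252263516175965042504238062170489108759538110947629147220409270011104162845468781105564829123394949608733393316033631089103501934070272
  [1, 31, 60, 15, 1, 0, 50, 0, 0, 0, 0, 0, 0, 31, 16, 297, 95, 22, 98, 106] [71, 349, 8, 27,
  181]))) (.leaf 96 7
  327513872718484639520804926868411489283573850447901984206894540922990242090225429623067447274403687160496719643487898723577964014217854163051933948386070939021930525539671156871333784400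
  [0, 20, 1, 0, 26, 0, 0, 0, 0, 56, 0, 0, 0, 45, 69, 55, 105, 62, 1] [248, 31, 63, 52])) (.leaf 42
  8
  508272214485885637034320145466757325077803745847343538024356730021180362258478629094106391244141155597259497939318296399417973388695218699627419387822252513886437406668117828149789835760155317611439192630504722432
  [24, 0, 0, 0, 0, 0, 0, 1, 17, 0, 0, 0, 27, 32, 23, 189, 21, 198] [215, 0, 173]))) (.leaf 288 9
  395189134897058534140563125437517085553224979021831189336682251970573257157333849591431209268722028938881003366610266672206924358190164132446532319550732008730071733465643192504317572646693155205606185168714124631251537261737274019445498368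
  [0, 0, 1, 0, 48, 0, 0, 140, 0, 0, 1, 199, 219, 200, 74, 155, 395] [675, 221, 123])) (.node
  826094379456877773323322368 37 (.leaf 768 10
  589810625399162033395758494452099931698235641315550454712081478692767441026697445421993456861041810889845220623213345219102395715995167162390964178870525463737354357730384591227553175431997726909052251917185507856472301511293118801941497939341158268021987432119529588
  [165, 159, 0, 0, 0, 0, 0, 12, 1, 0, 0, 350, 589, 356, 1258, 495, 543] [2163, 551, 544]) (.leaf
  672 10
  130727300516101916486891580907619090266456203662456842150028596546335575261205530391470559695317696248951320244534849292412945920844340337808998217160186281538199212912741334253508809856159858740960663408983694586511687071446528717069089182294176424909788044105707597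
  [78, 0, 0, 0, 0, 0, 410, 0, 0, 1, 495, 514, 186, 996, 331, 746] [58, 1760, 632, 752])))) (.node
  1073741888 2 (.node 116056878683004400771792896 3 (.node 101911974 13 (.leaf 576 9
  2923876456074871216771017812365821395027540967250742994856093117075257226855286141975417715087560492117130698599508530035005173677175358058585014759501350214818078443306120276784751982563161524268280705592229074352011334200414992519722250240
  [67, 234, 261, 0, 0, 27, 0, 0, 139, 0, 0, 0, 321, 546, 324, 332, 235, 424] [728, 527]) (.leaf 480
  9
  1648034271480516312296047454588148810691881858600017063869063291534977189756351382527557397748033188110390242024879341100629163045113812770127088787403924493356371454353774436984655465698145083498723282300014275450661599880741531899368657408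
  [228, 219, 0, 28, 1, 0, 101, 125, 0, 0, 1, 255, 480, 253, 294, 327, 310] [73, 780, 362])) (.leaf
  336 9
  18239370725434654624234852305332305698830299624795392621277016524497745973537936704697425865999148712124420469258505947218099625600797580138358221673808873283226111589938578619717481962865919093553348697493140855225837710460483554800128
  [158, 26, 25, 1, 0, 73, 89, 0, 1, 0, 221, 46, 195, 143, 216, 279] [529, 160, 323])) (.leaf 768 9
  3575617914999895077536352642618267413426317726147404833071811051569258049108658799972700193107736217425452185113381943161256016038065702842309299246760819886901033606089104706857750970785399876655127399850442228842864054814216325064277944832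
  [1, 0, 1, 1, 72, 100, 0, 0, 0, 412, 597, 347, 464, 458, 332] [570, 902, 937]))) (.node 1073741888
  2 (.node 144115188075855872 1 (.leaf 1200 10
  2476395727173658212049348297988828687783095397976382379420099276069706968074500010623624122703526169180745964250123703338882419237045950361808634737485286889966858449397384183097497337502903866524373246783886631595374999724727419020871012996605753021379732050163075072
  [604, 582, 0, 0, 0, 205, 201, 333, 0, 0, 1878, 864, 831, 758, 839, 1134] [1318, 478]) (.leaf 144
  7
  1853563043620459709318421032700572846856206419648887125920553260467361602786463913199790199892677660962407843090583908005261434598288432020027017643606989520625407344027567453578300827993088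
  [70, 7, 0, 0, 58, 64, 109, 0, 0, 20, 23, 71, 78, 70, 136] [159, 236, 81])) (.node 8388608 1
  (.leaf 1200 11
  997114334878233692769344336079573323769729293175832826964905478172090847806578554186927553260896378433124557699799137421501873097933812705696227574350024023708541054909242098402043288632631655235200353444667111997791573776727669582291315237868950909807804386077750363039257868645622361102294712320
  [360, 0, 0, 0, 0, 276, 1206, 85, 0, 1221, 677, 663, 765, 713, 884] [616, 2324, 889]) (.leaf 1200
  10
  482039746933092672994907516070624715103310994188891905416648645286025257927317215180417380395195455195879766740304351333543029225401610141520727745637505143555785926722437964805905981470531107118604110287463855912807959155527629138405793363142933260058796923192503959552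
  [1, 0, 0, 102, 161, 927, 1, 0, 1711, 594, 777, 753, 743, 707] [235, 853, 2077, 782])))) (.node
  406199075390515402701275136 3 (.node 10376293541461622784 3 (.leaf 1500 10
  2669838359907073027587680343399436760640272340665916790844432316325709845917901178821022019426851349505500486830850417544904938621325447948141841819820603875659023044523751389907212428855882462643885814086046892659251471207993156925285464345605456266523481654854656
  [261, 792, 257, 45, 40, 634, 0, 0, 174, 2180, 567, 687, 1314, 904, 920] [1331, 269]) (.leaf 1500
  10
  1905981518111554512883962874317850752553769172975804711938887964818317471224285555689252133492436037337649033796992654325224954274189119304403023103111740271427702133839995941325978774377110630094588098417069524809043209288749669659222960037905965611685243738544128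
  [806, 0, 1, 0, 640, 154, 0, 523, 1634, 495, 757, 1254, 610, 981] [477, 1134, 523])) (.node
  19343408021330444063604768 7 (.node 536870912 1 (.leaf 144 7
  148753826658890601297493998559918579902119834820824522496594571331539521171011873416502071537665341217755536531019785158984985053076917912770065821146526337297519364138893918171924114281216
  [89, 42, 0, 0, 0, 46, 66, 0, 1, 190, 212, 71, 118, 47, 93] [116, 181, 13]) (.leaf 240 7
  23968123079272452877357149382195085289375292106615371097141348863475114663935506492801405421377508226525492844060841116938041719480023635418269275329540276106342446384499765877628870142336
  [146, 21, 0, 0, 28, 1, 0, 1, 304, 136, 125, 182, 0, 127] [143, 96, 178, 58])) (.node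
  4407710188097 7 (.leaf 240 7
  22642829919538056025824405263406421557788269882847353391464181940437499072241929868774878512892492870284151009797637668639317677053754513052000575969627626311193824555668093335207322067200
  [167, 1, 0, 64, 72, 0, 0, 70, 288, 391, 113, 11, 198] [94, 127, 213, 210]) (.leaf 480 8
  15251317295975645814093314832936009640232938147901107337458942069688121283299791989906246274184165915560684439133094396604721475673812085347423417760354337748108983702140073939153247640275656355203277472655586982656
  [0, 0, 0, 89, 0, 0, 141, 585, 792, 220, 273, 442, 455] [239, 208, 223, 473, 123]))))) (.node
  648518346341351424 2 (.node 1360336776196993591674880 13 (.leaf 1200 10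
  1928115367422355332445730714983090252991198746319206623058630160315740219049526478795282524765452127446079693388884773212426175121913717689419718090743473410706515411132877000884200435470469234218997927034709408595886504912176523598913153351732781420006875621176260608
  [47, 807, 0, 249, 315, 0, 0, 443, 408, 812, 845, 622, 894, 825] [1207, 705]) (.leaf 576 9
  2687364741395810889494119691915137053863739407280823153225094323130111521818729206183696084997757789854936551636874158844628009836219499969019723976059802298063826207862658558576175565696133061601201961469963455833959969389721031464409932800
  [420, 0, 100, 99, 0, 0, 74, 327, 349, 445, 302, 442, 404] [62, 596, 329])) (.node
  19338090747351197150085120 16 (.leaf 576 9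
  5263413355902128870617864815911357911842581935257111526111105036771849044308735440950471597306731067275978687453319148432278893779828157264609541060488912762116949519178486220759402852170336844577552973140477625728586324762460499827639491584
  [156, 0, 141, 28, 0, 0, 37, 313, 324, 302, 261, 444, 345] [295, 599, 601]) (.leaf 960 9
  6774950168202725411681906332079703413587910296193384119235321976389635287921678959812047209023484011413950202242327517891331063413498293352918194788520116755261804856437714148147880468759369407338766367960071185743464342518937366869168937984
  [1, 326, 13, 0, 0, 2, 515, 518, 424, 467, 663, 589] [236, 750, 826, 868])))) (.leaf 36 6
  1896836110796256290895693292624571040854721114442846135019545168950759311365858095342734593871747130797888838319216101556288286773818555321607640962508226297856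
  [0, 19, 0, 29, 1, 29, 25, 22, 25, 20, 30] [141, 22])) (.node 4407710188097 7 (.node
  406199075390515402701275136 3 (.node 629850352019221800021917696 3 (.leaf 336 8
  5897270334170337418664415815828050182504397477412800862476010467833027000542877484814398703050154240573333078648751181071151154095185009078531234826913313714272828861118685997108871486643056704932645964430424566784
  [246, 161, 228, 108, 1, 0, 0, 19, 56, 225, 1, 99] [72, 478]) (.leaf 576 9
  5545471006616156343956911636730538562817197221387223694615258160840385293327992082703539040035598373136826568704589029089059025758632712922064968586267288048892780816939318613233070550364031069728634831860828821748447543713443668119635968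
  [385, 131, 188, 0, 0, 0, 727, 0, 395, 268, 303, 217] [382, 422, 501])) (.node
  19343408021330444063604768 7 (.node 1813388729421943762059264 2 (.node 157160356549901792711802880 2
  (.leaf 2000 11
  2190435201991026849337891959639273168101247152773222347153355237914039847349842826019076785147674196653619036298519251804435849819823860110360976321000808185956305442913550740235826600555645528907543475247564104290746762831461055844047435694537087046869783528754796058973885291300640356080013312
  [394, 1977, 740, 321, 302, 343, 0, 452, 327, 2198, 1073, 866, 405, 917] [1594, 1751, 1]) (.leaf
  480 9
  5423071995499768041289701443583147845103450184617690789371088989959401383209878607984274672852879846347938132439069366389911007850860666495712318214858941467456120649554982326039049186829400879362591430816517776724758410433635654325739033600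
  [465, 143, 0, 1, 1, 0, 0, 271, 541, 104, 314, 139, 278] [208, 385, 625, 2])) (.leaf 576 9
  5758316652895727927197574951313580049520583392960999199204775181149354248162098641518319973663487569494708108409937812098115227431695109087761808467242643744238646899937650780589074617353476367761609937388318504213889207694657161678309894144
  [317, 348, 305, 0, 0, 0, 355, 241, 417, 80, 59, 80] [423, 117, 201, 512])) (.node
  483570327845851669882470400 3 (.leaf 1200 10
  4232098830230220068153692412934243242485898916668663042397514019266203151150493876300606552744363179901236700862442106633155471258361850906697216700547394195399797139127185216271454200378706804431543069335836740594037883804547224965136981686541410852095681358106907649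
  [247, 402, 316, 0, 0, 1, 674, 1680, 845, 405, 1544, 357] [1001, 667, 1059, 583]) (.leaf 288 8
  15937640308278856237773294414645795840332960658407386722218790073483486932087143044817054742644611675531311890328980146031221236317910495540745909355444469520421504860236746112854141732728864301191770528529133694976
  [169, 54, 0, 0, 0, 99, 564, 203, 21, 266] [202, 380, 102, 212, 257])))) (.node 9663676416 3
  (.leaf 288 9
  3229822386178360512403553091447401668264262541415019677193921778019282193277807021544616001243983255368675693854301842874447271682920845136621004725506765901631883770094886040461163918365377895520149471950030917062281596545681025301037730854
  [316, 141, 0, 0, 0, 159, 173, 169, 768, 151, 541] [582, 392]) (.leaf 72 8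
  2440713422317750114578251405457155273384150639259210247636383855969155158741593737834669620089906863123368398294135228012852127333367658891168227778509068582073747167921546338004800542914007303859325952063036201987
  [31, 0, 0, 0, 41, 48, 54, 0, 34, 97] [298, 66, 84, 132])))) (.node 215275742462935393199792436 40
  (.node 63 8 (.node 154742504910672534362390528 2 (.node 4407710188097 8 (.node 11 4 (.node 7 4
  (.node 1073741889 4 (.node 302231454903657293678080 4 (.node 26388279066624 2 (.node
  629850352667880883851624448 7 (.node 4407710188097 7 (.node 212770944252174734748286976 3 (.leaf 768 9
  6068948055044698206434514297215383629109319097515382801373984762289224376640040041533003156312566546614112418735025401346137827649066825185416128401220125141779502433127792135111292755511138620442171642670095401899944105299794358873523565568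
  [185, 419, 520, 336, 1, 0, 0, 0, 0, 0, 0, 0, 0, 0, 0, 0, 246, 31, 103, 507, 109] [205, 957])
  (.leaf 384 9
  3284408645769727762621766932621355109625589038856004201339659577609213709911511069790526582599007139849035539247182734986812919241231770610312240700417777857733803735749501385134712945292711942433096915012655879830852336523573169410838160384
  [236, 226, 149, 12, 0, 0, 0, 0, 0, 0, 0, 0, 0, 0, 0, 261, 50, 9, 257] [178, 178, 580])) (.leaf
  960 10
  2571581644492670252762476731770746507552915782077119161803864899301114516225431485176374748321376569649787388051521107777364050915071810609336222709798873584839961264560278684406491625027869562609201744157707196794537107292619208319879608708354854174362136680239039488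
  [580, 627, 0, 0, 59, 28, 0, 0, 0, 56, 0, 0, 0, 0, 412, 106, 905, 627, 792] [375, 444, 1355]))
  (.node 603979776 3 (.node 10 2 (.leaf 336 9
  1642896913815950142591498038026444964420394628971146264505216344967848930935654954182016544902052598070141253579164490220073373322508515987106125410846908055488569364071745823676858572843391390563034194800441761213492463433522226396259430912
  [164, 146, 248, 0, 1, 0, 0, 0, 0, 0, 0, 20, 0, 0, 278, 235, 308, 170, 220, 170] [137, 169, 644])
  (.leaf 576 9
  758988304900928109115560544174732536294710241183029263044688197745727147938950888597261078124222363676248199706044647935710794371614165346658615760620242990000155170288840504012071979171141606996974577060282328387046527559016701905292858368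
  [240, 401, 136, 148, 101, 0, 27, 0, 1, 0, 134, 0, 0, 647, 378, 765, 291, 362] [371, 491, 383,
  767])) (.node 19343408021330444063604768 7 (.leaf 480 9
  3230689635010860586662720872494461912244259420233687372424453921383832686955742383342606108223441322914005092773432566429933044634910157713408234494225863600917628765693752442563472347850263917380767523721238029937983509298471097437930913792
  [164, 324, 13, 0, 254, 0, 72, 0, 1, 0, 0, 0, 0, 442, 0, 492, 235, 178, 20] [201, 173, 288, 550])
  (.leaf 576 9
  3675016338015551061588244866827829837801383863674695686052181481011026547232865483802811605919621103780348556964910950998725821497332398605569831640526837529741341268472385099966159660229189388507101316599127108610669555768487161228885229568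
  [412, 73, 0, 117, 1, 0, 0, 0, 0, 0, 0, 0, 574, 244, 409, 309, 693, 265] [298, 268, 308, 419,
  787])))) (.node 4407710187520 4 (.node 277076930199552 7 (.node 4294967296 1 (.node 38 3 (.node
  1218597226171546208103825408 7 (.leaf 576 9
  1771195027368394854996090994291178098388464687584199091472173543675189728057801706622831712716316369561427323343638573603270635039344306610129784140117670403713689507448860369119861450143924968059613469935672578745981025955683594702877097984
  [246, 277, 344, 364, 0, 0, 0, 0, 1, 0, 0, 0, 0, 0, 0, 1, 157, 129, 110, 0, 114, 444] [14, 225,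
  555]) (.leaf 1500 10
  4395202486439383675470805372113649600379089833878779185043840505145429752296709346528163155804376242503863164692816666939481620200672371700556696807863735016460774814084219622358616882976326333802048100616227105157270769756669270084589071025192298860146601276708225024
  [778, 604, 806, 0, 219, 0, 0, 0, 0, 0, 0, 0, 2, 0, 0, 1459, 1380, 442, 0, 293, 1069] [642, 0,
  818, 1650])) (.node 603979776 3 (.node 63 7 (.node 196608 2 (.leaf 240 8
  3535532025102322335197539404631968064297767118802022845987845250980478843402605005736836757072244022509748416484930253887323033831322815352452368822714765514828580801093736368286726358906206500627973851674339138304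
  [82, 62, 136, 190, 117, 0, 0, 0, 0, 0, 0, 0, 0, 1, 59, 0, 0, 82, 172, 81, 0, 342, 52] [186, 44,
  158, 333]) (.leaf 336 8
  7330069162738941680870292524124873044141927592883550925502824969299880017673384364555891984225009449763599727096674407730279486534321569512954607894371876037390992346284421745312445489432629434229766824000110765568
  [89, 4, 277, 224, 0, 0, 2, 1, 0, 0, 0, 0, 0, 0, 0, 0, 187, 196, 56, 3, 550, 40] [108, 345, 0,
  181, 376])) (.leaf 672 9
  2370284398578750871744037132446873162209355083879600249848070583482001790004625909265334744554471340009811339905798127117149427760129640738055869750108907005642518111954314543818046171294862053332520492980736035229970979597582706976401291776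
  [278, 570, 360, 0, 0, 0, 1, 0, 0, 0, 0, 0, 224, 0, 54, 135, 478, 154, 0, 1181, 735] [442, 272,
  159, 356, 861])) (.node 302231454903657293676544 1 (.leaf 384 8
  9595844886077575577830703489119830321346607341429825823152011104266371796708130009017401195720477707412336593440703666210181845379195234705241489945550941544094133705108512172476309860702728367484807139678191879424
  [154, 99, 116, 0, 1, 0, 117, 0, 0, 0, 0, 0, 0, 0, 0, 234, 83, 244, 101, 311, 178] [229, 0, 39,
  262, 307]) (.leaf 576 9
  2789726211544110081619337768364589474724367147297142708857943046204451434489854929966552031244215289742951892342894232023033563918825074207559408056009585583841606071951332715580695877075878179009772815267260630672261193507177101446161131008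
  [339, 461, 0, 1, 1, 0, 0, 0, 0, 0, 0, 0, 0, 0, 424, 157, 0, 0, 485, 474] [437, 474, 57, 73]))))
  (.node 594907496377133039616 2 (.node 628641426776067923150635008 3 (.node 73786976294838206464 1
  (.leaf 960 9
  8908050615261407690071662232142236809739684963558555859114739453410049364346025605622627908335578456243612882227633205453512268910073128015526131541792800963578462444452562176077208271372628320382711257547315296664391093908174073989930973184
  [346, 477, 529, 474, 0, 203, 22, 0, 0, 0, 0, 0, 0, 9, 0, 0, 132, 471, 267, 0, 778, 586] [65, 0,
  804, 935]) (.leaf 288 8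
  8084840975358507707593174376935721419468582113147212440723802322578396739973795721354435685216434926790995818659694795011035391046902710181795175840895645886345071177816831807323221905883629970244894936125459737088
  [118, 169, 198, 5, 0, 0, 0, 0, 0, 0, 50, 0, 0, 0, 0, 48, 181, 1, 0, 179, 94] [165, 362, 1, 50,
  42])) (.node 1008806316530991104 3 (.leaf 384 9
  2763009871430716429624345509155212685689089929077441046680351164033544493734243524847477632985671741242567297713939528286032102643382156904451424888650195473401227415083398143756955394329775898707304853342371457620994613117528366201651856896
  [88, 245, 164, 0, 0, 1, 211, 1, 0, 0, 0, 0, 0, 0, 0, 261, 221, 133, 59, 291] [128, 534, 1, 229,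
  37]) (.leaf 1200 10
  2474854986259176314310088578662095612126499294975636590232861356410972346246627389704369315051073716144224423974777929050655584067746645913765873228255176362899309371177518878241478747075796771108307505104550441186308857440902215836672918981691209359408180462023366656
  [765, 376, 0, 1, 340, 187, 0, 0, 0, 0, 0, 231, 0, 155, 1039, 578, 718, 0, 944, 122] [304, 1025,
  1506, 1045, 830, 2]))) (.node 63 7 (.leaf 768 9
  4902077444676998405760683459582583181308023965901457905666661117812841236752694591470160596080950449038435408402818852835551646774572468292355066595975743808959563259084833923886657189038240025041272197684083054642202379238731964700489222144
  [359, 439, 0, 0, 0, 0, 0, 0, 0, 0, 0, 0, 0, 0, 348, 264, 122, 0, 240] [534, 772, 0, 604, 550])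
  (.node 2199023386656 3 (.leaf 480 8
  8860129382775288045627865398517824318274309692278415035438264092667847007730256357342566609557280286697653987404078696712097410568925511357326038253502604156312201524009010228143742825340894842793221956996378825216
  [216, 262, 0, 0, 57, 81, 0, 0, 0, 0, 0, 0, 0, 2, 283, 183, 112, 0, 441, 471] [347, 219, 179, 0,
  269, 353]) (.leaf 576 9
  3728995757848847046877272654496528855855332721583219020088696294854136206391608045763353265330664416618380254186359061040728903821501996898526109744759676286451889641236817068141613121628043921253080179129540510598390032411687818320951240192
  [365, 0, 0, 113, 93, 0, 0, 0, 0, 0, 2, 0, 0, 215, 257, 9, 0, 803, 361] [229, 352, 440, 559, 0,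
  421, 317]))))) (.node 4406636446208 4 (.node 17626545784832 4 (.node 1208925891812960700989440 4
  (.node 4294967296 1 (.node 63 7 (.node 142936511741952 4 (.node 1099511693312 2 (.node
  536870912 1 (.node 144115188075855872 1 (.node 4399120252992 3 (.leaf 672 9
  2194064188201330132460377696913193713860452035397474345678186838575670200123452318148776688170088055687964623298905438836675327861942345738741942830011526105256393289557610608538408205222382510641313940048761247684559709299084221834338512384
  [408, 350, 299, 95, 1, 396, 290, 0, 2, 399, 1, 29, 0, 0, 0, 0, 0, 0, 0, 0, 0, 0, 561, 522, 856,
  0, 162, 253] [347, 0, 0, 385]) (.node 116056878683004400771792896 2 (.leaf 192 7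
  9545612007040606378385345068329383876908362630736176702672856147533457176736522219745951767804717458741265275953449811130585764551328662458351759572934773945506956354076351120226859876992
  [134, 80, 0, 15, 0, 115, 112, 7, 0, 0, 27, 0, 0, 0, 1, 0, 0, 0, 0, 59, 0, 0, 81, 146, 280, 131,
  36, 19] [58, 162, 3, 47, 151]) (.leaf 384 8
  5484146725152233665583890717249405938952589870544507290881070968485136942047392709689604408300237093268443680669025254857634842332111652273365727279074797686320510581747054269019010152312303875846846944284292415488
  [166, 235, 1, 0, 164, 263, 7, 1, 0, 24, 0, 1, 0, 0, 0, 1, 0, 0, 0, 1, 0, 299, 253, 493, 513, 169,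
  129] [62, 127, 201, 0, 147, 160]))) (.node 19343408021330444063604768 7 (.leaf 480 8
  6059792794903206593582128753993655286936410047246068627179106406418773056862292860634191946301628563672855032918431359260509546831120182948008310020909833298244343675785537396583435588728821457789159234919427216896
  [234, 195, 358, 336, 247, 139, 0, 0, 254, 35, 1, 1, 0, 0, 0, 0, 0, 0, 179, 0, 0, 155, 102, 255,
  202, 0, 78] [328, 185, 0, 51, 319]) (.leaf 672 9
  4745387769092160591173842325083799161357056241499502990552813838731950644308979814047274964096622007898776567748996827665095255416189112881395952547688010668721164477179897104938148811669428319397437828893247842424325801846470243225607354368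
  [267, 345, 304, 282, 190, 0, 48, 371, 1, 0, 0, 59, 0, 0, 0, 0, 0, 0, 1, 110, 311, 594, 481, 128,
  631, 109] [435, 288, 280, 0, 0, 655]))) (.node 4611686018428436512 3 (.leaf 480 9
  4115419961681646279154016809925457377851189957750512540969719014833837204990352351014446950673642742556916992384413724696204178387106093412355979610478873501802514174370522633738129842450200884251781983160351964325280737269733547679016062976
  [239, 5, 81, 166, 158, 1, 0, 203, 124, 71, 0, 1, 0, 0, 0, 0, 0, 0, 0, 0, 284, 58, 365, 0, 0, 103]
  [295, 108, 0, 236, 714]) (.leaf 576 9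
  4429460938280414038009132785002343171685095133701021128588582912017025944466206831967652412136390532979331925753794189624842915063941025789094694136373485956285051467367489597718652618834198756817177567931358911285135049820067110515952868864
  [41, 75, 351, 305, 159, 1, 343, 0, 4, 1, 0, 0, 0, 0, 0, 0, 0, 0, 1, 312, 153, 201, 0, 271] [268,
  635, 48, 0, 114, 848]))) (.leaf 1200 10
  2225456915444057925151789029489888997278046275215283524765172788322790470377270146278622938587525985310362127599830170932583090093996012207983592021170569800992629214786014574756699578853409884907265142446602314963897923494595971740358393422797477216935525288376270848
  [42, 601, 782, 42, 2, 681, 295, 95, 0, 0, 1, 0, 0, 0, 0, 0, 0, 0, 898, 309, 1272, 35, 209, 277]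
  [1170, 702, 0, 833, 1805])) (.node 135266336 3 (.leaf 672 9
  5991922989874412598435156251052005878742103433025147077705357851285940256866357466167517240760604165705803097482038306785892134072415131050505230170284691154648337777028427701401563125355630102377876632463830608093842421465883982672068404224
  [282, 251, 156, 1, 249, 293, 84, 164, 1, 0, 1, 0, 0, 0, 0, 0, 0, 92, 277, 434, 870, 0, 0, 126]
  [387, 15, 0, 340, 600]) (.leaf 384 8
  8332131513181263733856215546692418761457654075028924540222892808162361057592657841311795758205068257792361146358371705014170384365557967640113207824770694540932771647498558726483350494011985068855389122228963057152
  [222, 0, 0, 0, 178, 0, 48, 2, 0, 1, 0, 0, 0, 0, 63, 0, 1, 141, 280, 675, 222, 282, 7] [283, 321,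
  135, 0, 77, 208]))) (.node 386856262276681335905976320 2 (.node 6 2 (.leaf 72 7
  21248372639922771116640624117338956928861117761364969756318053397725703607241847030685086096112093259143400323819795060537905449793049240598229816473726096679800698164636178174384799872
  [141, 47, 54, 1, 1, 34, 28, 22, 1, 0, 0, 0, 0, 0, 0, 3, 0, 1, 51, 44, 77, 7, 134, 208] [154, 29,
  0, 50, 75]) (.leaf 288 8
  4274357056102184364443545549625340747382369941772666134558135442006262683103701517798954985152896488466018440432595576560159822037597644480802581642079608453414164492326840747963377533893833749503989455212290870
  [188, 274, 91, 1, 84, 0, 34, 0, 0, 25, 0, 4, 0, 0, 52, 1, 1, 145, 164, 228, 156, 401, 61] [270,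
  177, 80, 72, 138, 229])) (.node 603979776 3 (.node 19343408021330444063604768 7 (.leaf 960 10
  3651696962300453857205345430118104431160826028076938390234056357333451185162098293559122670347512526709440093724075135982944351141194855083485336919423461626405308251651662923604162256840064085518577647751265527438487307644695258274652115355560772734182324800411000832
  [183, 461, 749, 33, 1, 592, 0, 68, 0, 0, 0, 0, 0, 0, 0, 169, 0, 1, 309, 557, 866, 209, 1231,
  1224] [795, 807, 293, 0, 565, 1309]) (.leaf 960 10
  3579146095825246459271524770463338181618109651291562459248320614752024185408384176803563309233044558100214802870983382407282954520759164095890309802884921774764103658433798938789595899201234472370558275695521071202085047683541559182859892178607412163187204127202939904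
  [294, 772, 0, 59, 638, 0, 42, 0, 0, 1, 0, 0, 0, 1, 90, 0, 160, 266, 1153, 758, 31, 753, 1462]
  [663, 560, 1144, 129, 0, 376, 1453])) (.node 2251799813685248 1 (.leaf 1200 10
  2209468458340605848428215625200469381502848140004718067095374223372650406262686216511286437232959786180005864880661696574098187329217836794038935271625245869176255214970675713876234360275465458854293552339290656952524063405489682287652798877692105112515635854239338496
  [232, 944, 0, 0, 93, 0, 0, 0, 51, 238, 0, 0, 1, 0, 0, 0, 22, 904, 402, 1397, 1139, 1036, 1602]
  [789, 1, 952, 426, 242, 171, 208]) (.leaf 480 9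
  4245654725106266811774450648509478030414244224313811085882968188605528113766194248118078970685453726120703120723861059632442391916854914123393606686729783472266193130657420249076379463344821102463876598015697471740801298020834659403808160256
  [344, 0, 0, 106, 2, 0, 0, 0, 164, 0, 0, 1, 0, 0, 0, 0, 308, 141, 502, 245, 527, 650] [165, 336,
  45, 462, 74, 213, 80, 1]))))) (.node 406199075390515402701275136 3 (.node 9671407133377785701072896 2
  (.node 302231454903657293676544 1 (.node 2730118122909013639168 4 (.leaf 1500 10
  2830040866723239858650730518954340129367183816471947868378756131741364657099178687503604260431687385685032019255576765550440786344989991254446084699744956191301727827521258916340944088405296516178396027765106914614377741381348750424942658844820177455948306678384150528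
  [318, 869, 942, 569, 332, 0, 0, 512, 0, 0, 1, 1, 0, 0, 0, 0, 0, 0, 0, 1148, 45, 2048, 1661, 1160,
  996] [28, 1373, 0, 939, 689]) (.leaf 480 9
  4142124161676322276990423844724074709074194227805024915301857422078653911443844731694344146328855777604742032432467113944810683137187669180278304486970224844617906844797005471294571277591862065648245086516500770372963295205671303871837024768
  [327, 296, 88, 0, 0, 0, 307, 1, 0, 0, 1, 0, 0, 0, 0, 0, 0, 0, 321, 205, 586, 199, 370, 250] [155,
  352, 264, 1, 438, 302])) (.node 2199023386624 2 (.leaf 384 8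
  7830370563927476349259952694291618065811464796366487774345874442721963118228897709677583202823237705493167266158006319925574714185497317472406007649960823620863763054375110807777433883709251586035375981260082720256
  [143, 281, 124, 238, 0, 40, 0, 100, 0, 0, 0, 0, 0, 1, 0, 0, 0, 0, 290, 24, 167, 258, 312, 231]
  [326, 1, 131, 1, 265, 164]) (.leaf 1200 10
  2410444628337129062409738563259475718828443196053461041375319231352260268221113493349916260255603446799165354532069353543287168148043318656150698065097050389568793606372358176010884296466942150610578673836526365342176692400423441436721922280304430831825751080401333248
  [895, 507, 897, 1, 395, 12, 364, 0, 1, 244, 0, 0, 0, 0, 0, 0, 0, 786, 194, 647, 1127, 690, 360]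
  [481, 1275, 443, 868, 0, 366, 135]))) (.node 60129542144 3 (.leaf 672 9
  710491637431674133514386857294732765968639790834498053188475422472433234520264289902974103471102053638556485013501299582267307492630619588646717609013629622419025686021626839356738210312102009713130889861030445320150466218252692222538765824
  [258, 323, 0, 0, 0, 229, 180, 24, 0, 0, 0, 0, 0, 0, 0, 0, 0, 209, 1, 659, 347, 557, 254] [648,
  624, 136, 0, 506, 12]) (.leaf 288 8
  2707655406813687885259942525851084203915567785541174130956185120014337090090339227806710023674256616248225194225509419033206082629694762987602631441894496149547661155122055105886025273934853024376172219819529933824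
  [136, 1, 31, 146, 77, 0, 0, 49, 1, 0, 0, 14, 0, 0, 0, 0, 118, 0, 430, 0, 203, 95] [165, 185, 255,
  208, 367, 177, 137]))) (.node 590295810358839869472 3 (.node 60129542144 3 (.node
  77373613638577702003802112 2 (.leaf 1500 10
  7319510416090045719442317668969178285078930050919187402340182369771877927358730825336407011208037719963876945323870805068245336064507231631131320799863817133474933435897366046520661197461067143959147045564503881524149641761053352262020786681426360768634392058205208576
  [629, 690, 834, 0, 1, 0, 0, 42, 0, 158, 0, 0, 0, 0, 0, 0, 0, 0, 559, 1512, 1147, 1060, 317, 574]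
  [871, 1449, 109, 0, 1371, 1]) (.leaf 144 8
  7322292817395274293031080026941329146801199538327193631014121509114466997108793852844386204087850384649514115751781076867888365627009913501500881778869547792099416077623148052521221019435227182353551462132795575040
  [46, 32, 16, 0, 12, 0, 6, 0, 84, 0, 0, 0, 0, 0, 55, 0, 3, 0, 379, 131, 121, 65, 5] [131, 282,
  142, 47, 1, 96])) (.node 56 3 (.leaf 240 8
  10352003101800051566421956438198024036456171624522447590536874913269477698626148063683711825730828236003559877886834240399954674167980160281840092939568329746479728723893369308176491032126775175299579493299474464768
  [84, 99, 0, 0, 126, 22, 0, 0, 147, 0, 0, 1, 0, 0, 0, 16, 1, 106, 234, 351, 54, 0, 4] [104, 117,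
  201, 174, 271, 198, 89]) (.leaf 960 10
  4594848675820643522432067325932782931793174218478920702770682758570299648600473311915835805444074622634148689419780678896709390227291377919159369658072271216577861910873726823393610664797133825151521502395855387090696072537907595996406903071980387192800689657347086336
  [416, 0, 1, 480, 0, 0, 0, 248, 1, 0, 0, 0, 0, 5, 1, 9, 376, 1227, 1297, 140, 427, 324] [139, 418,
  741, 789, 529, 1249, 871]))) (.leaf 960 10
  5030592166260292913352333698283398839581858019737178713577320666601568057905516613231051068697271538828775456538880701264108606054917095236110752001707439104614733927899442878334341604671859256673885426445415852244582683891501217940969016773643129871812415719617940480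
  [0, 0, 257, 157, 129, 0, 380, 1, 0, 0, 0, 0, 0, 0, 0, 325, 850, 1194, 434, 1624, 63] [850, 1081,
  1370, 558, 258, 871, 214])))) (.leaf 144 8
  3955642991176620618629217793125899721909320291742064535172949028356128522326337569597949996092498699146009333391429281763370445323404149090958210315692175824130385595086511349624129290757032533991546691371951195648
  [0, 0, 61, 66, 0, 0, 0, 0, 0, 0, 0, 4, 0, 1, 92, 61, 34, 137, 106, 91] [387, 181, 0, 105, 89]))
  (.leaf 36 7
  1642412366074008026256051240573480864824710190030228481881973310538321555623399535190086635720668939303925718797853604868908388157199625557505020305535162836514252672171105342172990358656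
  [12, 0, 2, 0, 0, 0, 0, 1, 0, 0, 0, 0, 1, 19, 22, 164, 150, 23, 20] [157, 140, 31, 13])) (.leaf
  384 9
  2423744071467357448166403384245138954877392246571236728340459768777449898972204399087246405085403055380667801094255647860493065798248054058916342347901362467979012643223100556037098463431474795035903113902851706978434884366165488284643945984
  [105, 0, 0, 0, 0, 0, 1, 1, 0, 0, 50, 0, 225, 195, 448, 39, 258, 264] [772, 200, 1, 194, 256])))
  (.node 406199075390515402701275136 3 (.leaf 480 9
  940538441853081082127920736106621271834300232980118619775761414521528026984536736847727388300932084851286293028296265591709357162184745062566677467708899110466831727989900619666692760979343133465668914001565586919148837010177713917178245632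
  [258, 0, 87, 0, 1, 0, 0, 0, 1, 0, 0, 1, 280, 12, 328, 257, 308, 207] [1101, 166, 171, 846])
  (.leaf 192 8
  309464419581794920464033768947540356433064519988633731058016320763713883281626121014885348377970166794185327991851852465895735702272605948579658560250868790123178357141511243688921110492394940714695087711617927893520
  [0, 46, 0, 0, 0, 0, 0, 0, 35, 0, 1, 0, 300, 130, 155, 124] [192, 441, 29, 68, 136])))) (.node
  628641426776067923150635008 3 (.node 19343408021330444063604768 7 (.leaf 672 9
  6225526751419538888269256559813908313413740772701229133819019881802406273147845409056752236180813407833839190052116677199485741563087639843994331397479190178045460959070691355665553064245420717120943318430551653627671103321235741408395127296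
  [360, 350, 1, 0, 58, 0, 30, 0, 0, 0, 0, 27, 56, 39, 382, 507, 114, 308] [568, 318, 573]) (.leaf
  576 9
  5600096144380172889680704694714674507854955540460917043155259006131871448143105434211404983963264663991857355730615932729696274277545262513737112246665633672148631897936482467681459077771123769712207978014594253267365633111136500377171633664
  [342, 0, 0, 86, 0, 1, 0, 0, 0, 0, 1, 18, 524, 159, 303, 512, 204] [295, 523, 266, 1031])) (.node
  4407710188097 7 (.leaf 480 9
  1801623787169090106607550580399419976378013607241774785802713431965506825711893862718798523219632619123976223853693442664222143870829246220520354845482962972827593979610975563962715884663773137961632008695720385501525835228886759202227330048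
  [273, 0, 0, 0, 0, 0, 0, 1, 15, 0, 0, 510, 272, 288, 44, 293] [347, 360, 188, 702]) (.leaf 240 9
  5973313465320325624078628477389937536841129565842069759857032744225656682573546173067323806194264877662384590628063201058001273056543731831247333371522575129581152097378771598352484717797374794558513560859676181848899594367665713494016
  [1, 0, 14, 0, 0, 0, 0, 131, 0, 28, 133, 130, 9, 468, 130, 388] [281, 194, 462, 47, 279]))))
  (.node 277076930199552 7 (.leaf 672 10
  1507795101358015210030971730708445461965380132498644809629912344022666571849012731670873725992935931863095792801116193167690076467130472012816248253443217444556805403045951658411439440529444139700406591574883965294117445178463544374455488231673341072670962411215257762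
  [469, 0, 0, 0, 0, 0, 61, 0, 0, 139, 223, 291, 31, 0, 398, 601] [1155, 225, 1036]) (.leaf 576 10
  1418760327832382801394987314095934620561895910621519107190172675966230529852239372285040317297192111765862602955089987225764623138667337120101570701866584346145709644034844108593806248989666910796957824828467379438114352018146970160388025810170920755853840804412916012
  [0, 1, 0, 88, 0, 62, 1, 0, 0, 349, 271, 736, 737, 303, 83] [404, 1264, 145, 582]))) (.leaf 384 9
  3438351164086757152779371964385206000257415295988084687942828884416616336652391756262697953755052147780066005371061167767319238544264342830156844932198318086236075795491022974347770327450369375208036840857806035845017403389344917489022804653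
  [46, 0, 0, 0, 0, 1, 0, 0, 191, 166, 288, 188, 334] [627, 305, 271])) (.node 14167099453006982152192
  3 (.leaf 480 9
  2318847008976038189443125380027463350837143946874512062874161534628795289239581907135388216804052482237191337725812713918035453692830906827245973576631919073859718380689599230869861233247522403251905669237015031202461075258207348953255753736
  [227, 0, 0, 0, 2, 81, 0, 235, 75, 213, 308, 33, 14, 1015] [1043, 357, 492]) (.leaf 384 9
  3257193214163641663104091884901430465482720077869292846510711605709661000713944060342860316126030113815024856622853083438019510384116421106222419485061908595066247022304608547886596673234390192243308887867008319438173997756056546996417641984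
  [0, 0, 0, 0, 0, 0, 91, 111, 167, 299, 374, 294, 807] [224, 774, 89, 432]))) (.leaf 384 9
  1877625924172983371734600474449158807019884736970983629924785404939523157305326627976554269560411442598502559637582103177274722615834115705864400068104316318862664459238079524502385643513244132607490445854239705627582406125729343323788017845
  [1, 0, 72, 1, 0, 0, 208, 146, 245, 130, 160, 39] [625, 158, 322])) (.leaf 42 7
  1546873141660386520389411841826662938823195871347660419498142937784581326643467515596626556665256419839375269646470031226131435821502109587604639422699586300644763130347224396526260487168
  [0, 0, 0, 0, 1, 16, 22, 30, 22, 31, 21] [231, 33, 50])) (.leaf 120 7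
  11149738220272867432632272420846979795663220373069941695392008530140288904571382067220146324244327058621997016166304156432154125701773965081598542276228107033362364810611336449154488528436
  [0, 0, 0, 0, 64, 38, 84, 54, 7, 71] [252, 58, 115])) (.leaf 96 7
  4202390559350403449876315703382853930794275419645549778338229814903587647008574565133714454697409651743914841676591806059261123053144925731324828229857184853127378181145760516824877875208
  [3, 1, 53, 17, 21, 71, 62, 25, 37] [243, 25, 34]))) (.node 629850352667880883851624448 7 (.node
  20 2 (.node 2730118122909013639168 3 (.leaf 288 9
  6779324374343113418144850927380413096511348604458415373147838485721792761455277555843358335740305943914095348305555652396829679942995041971725658541489043196883085540501830224328672475151936284855487272386968450521056977092639240286977946625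
  [125, 164, 200, 0, 0, 261, 154, 0, 167, 191, 212] [433, 273]) (.leaf 480 9
  52499167253537937874564275204652299741552364301105995876726192168116502644178714005723123313093091821260012498341194465360935731974340080584230902532829246484777553952595175779733112090062072028505109546604430754517101720137806855851347078144
  [278, 303, 0, 19, 527, 429, 67, 311, 378, 310] [125, 860, 314])) (.leaf 1500 11
  2767519345105830546383485004566538247150428579965090572643214220518430986621142520721389129233299560202829298778082317080575419303962879228070989508688297050958469294268747780902643263074275449603127767308107645735335110110115892093390001970675846850063384049761503521390528626913899061940027392
  [607, 0, 0, 1573, 1118, 541, 922, 884, 911] [930, 1789, 997])) (.leaf 384 9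
  3449410180828605899149012525895148843234746486701065778843506675244603624484107503601137972418480585559286064198734431584715746541963789390199251909838922001715359808538180027331980598687725226394338585142931648734115682946513806397775100805120
  [1, 232, 135, 284, 724, 258, 246, 228] [511, 838, 96]))) (.leaf 48 7
  2734448808029364503652453067340331093184962021186114899481059951204125188576578164913569364536107343862398659538850194418551401975463410410386173011656344867642867464348281625989655134337
  [1, 30, 23, 30, 20, 26, 29] [282, 64])) (.node 277076930199552 7 (.node 77373613638577702003802112 3
  (.leaf 1500 11
  326998979583220836082337186458850863801216047657819770608304527251467377805423777470315322719296927463529585634120083179829634184769737676196500123281149772678494175992355704759961484593344800663104890195444249029043239393285326914511127594068107364060875503286270351972999563617265475447404609536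
  [396, 551, 2844, 871, 428, 395, 895, 1072] [2933, 995]) (.leaf 336 8
  34057325232761063728959205439606466612600237147354324991256794117147378060805297691672496973274988672135343551312027183185877556832443977668295019687598448319143417630806045336520129483457400514371967420541909760
  [222, 370, 276, 20, 10, 215, 223] [219, 175, 307])) (.node 1152921504606846976 0 (.leaf 288 8
  28377387175060077078584469531398116624607338747155506131168987612562959269058188289011501015273089641355370530035201947861451200395077542643680391804944417968339929797189998083235884676833310853074590428111779328
  [229, 555, 217, 320, 289, 231, 210] [179, 498, 1]) (.leaf 576 10
  1315849884507685263415235843410452973167600322597737224075895845146910777913685030930647580363083832645797706606091771288036091162528971880205338430365175392612291561423365873327763607606070212210256398967081103623597664184716625250147442064706134946424938600476672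
  [1224, 353, 353, 407, 306, 382] [166, 542, 1203, 495])))

/-- Refutes the cuts `blockCuts` together with `cyclicCuts`. -/
noncomputable def rootTree : BranchTree :=
  .leaf 144 6
  599597171384778873015940065826013456329966800666552390965792323680202306911642920311255398814692768612648776245620857284603730466934743911494871233972302426112
  -- The first six multipliers belong to `cyclicCuts`, the last six to `blockCuts`. The latter equal
  -- the scale `144`: each of these cuts alone pays for the objective coefficient of its word. With
  -- all twelve bounds the linear relaxation is below `117` and no branching is left.
  [95, 95, 98, 95, 95, 98, 144, 144, 144, 144, 144, 144] []

/-- The evaluation uses `b = 8 = |H|` and the objective bound `117`, one more than the claimed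
optimum; the only cut at the root is the value `2` or more at `001122`. -/
theorem refutes_blockTree :
    blockTree.refutes 5 90 8 117 nextTwoTwoTwo [] [⟨1, 2⟩] = true := by
  decide +kernel

/-- This tree may assume the bounds of `blockCuts`, which are already known at all points of
objective at least `117`. -/
theorem refutes_cyclicTree :
    cyclicTree.refutes 5 90 8 117 nextTwoTwoTwo blockCuts [⟨2048, 2⟩] = true := by
  decide +kernel

theorem refutes_rootTree :
    rootTree.refutes 5 90 8 117 nextTwoTwoTwo (cyclicCuts ++ blockCuts) [] = true := by
  decide +kernel

/-- Averaging gives `120`, with the value `8 / 6` at every word. The proof lowers the value to at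
most `1` at twelve words, in two orbits of six under the permutations of the labels; each orbit
needs a tree for one representative only. After that a single combination of inequalities suffices.
-/
theorem sum_lt_twoTwoTwo {x : ℕ → ℕ} (hx : RowsLE 5 90 8 nextTwoTwoTwo x) :
    ∑ j ∈ Finset.range 90, x j < 117 := by
  by_contra! hgoal
  -- The row at `001122` alone allows the value `2`, since its diagonal entry is `4` and the bound
  -- is `8`. The statement is made for all feasible points of objective at least `117`, because it
  -- is applied to relabelled copies of `x`.
  have hA : ∀ x, RowsLE 5 90 8 nextTwoTwoTwo x → 117 ≤ ∑ j ∈ Finset.range 90, x j →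
      maskSum 90 1 x ≤ 1 := by
    intro x hx hgoal
    by_contra! hlt
    exact hgoal.not_gt (blockTree.sum_lt_of_refutes isInvolutionTable_nextTwoTwoTwo hx
      refutes_blockTree (by simp)
      fun c hc => by rw [List.mem_singleton.1 hc]; exact hlt)
  have hA' : ∀ c ∈ blockCuts, c.bound = 1 ∧
      ∃ k < 6, ∀ j < 90, digit 1 c.mask (symmTwoTwoTwo k j) = digit 1 1 j := by
    simp only [blockCuts, List.forall_mem_cons]
    decide +kernel
  have hblock : ∀ x, RowsLE 5 90 8 nextTwoTwoTwo x → 117 ≤ ∑ j ∈ Finset.range 90, x j →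
      ∀ c ∈ blockCuts, maskSum 90 c.mask x ≤ c.bound := by
    intro x hx hgoal c hc
    rw [(hA' c hc).1]
    exact forall_maskSum_of_symmetry isTableSymmetry_symmTwoTwoTwo (Q := fun s => s ≤ 1) hA
      (hA' c hc).2 hx hgoal
  -- In `011220` two transpositions act trivially, so its row is `3 x` plus three neighbours, at
  -- most `8`, and again permits the value `2`. The second tree removes it with the help of the
  -- bounds on the first orbit.
  have hB : ∀ x, RowsLE 5 90 8 nextTwoTwoTwo x → 117 ≤ ∑ j ∈ Finset.range 90, x j →
      maskSum 90 2048 x ≤ 1 := by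
    intro x hx hgoal
    by_contra! hlt
    exact hgoal.not_gt (cyclicTree.sum_lt_of_refutes isInvolutionTable_nextTwoTwoTwo hx
      refutes_cyclicTree (hblock x hx hgoal)
      fun c hc => by rw [List.mem_singleton.1 hc]; exact hlt)
  have hB' : ∀ c ∈ cyclicCuts, c.bound = 1 ∧
      ∃ k < 6, ∀ j < 90, digit 1 c.mask (symmTwoTwoTwo k j) = digit 1 2048 j := by
    simp only [cyclicCuts, List.forall_mem_cons]
    decide +kernel
  -- The order of the concatenated cuts has to match the order of the multipliers in `rootTree`:
  -- second orbit before first.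
  refine hgoal.not_gt (rootTree.sum_lt_of_refutes isInvolutionTable_nextTwoTwoTwo hx
    refutes_rootTree (fun c hc => ?_) (by simp))
  rcases List.mem_append.1 hc with hc | hc
  · rw [(hB' c hc).1]
    exact forall_maskSum_of_symmetry isTableSymmetry_symmTwoTwoTwo (Q := fun s => s ≤ 1) hB
      (hB' c hc).2 hx hgoal
  · exact hblock x hx hgoal c hc

theorem isOptimalValue_twoTwoTwo :
    IsOptimalValue (adjSwaps 6) (youngSubgroup 6 [2, 2, 2]) 116 := by
  -- The words and their neighbours are checked by evaluation, as is the explicit point of objective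
  -- `116`. The list of `90` words is complete since `90 · 8 = 6!`.
  refine isOptimalValue_of_table isLabelStabilizer_twoTwoTwo isInvolutionTable_nextTwoTwoTwo
    wordTwoTwoTwo (by norm_num) (by decide +kernel) (by decide +kernel) ?_
    ⟨optimumTwoTwoTwo, ?_, by decide +kernel⟩ fun x hx => ?_
  · rw [card_youngSubgroup_twoTwoTwo]
    rfl
  · rw [card_youngSubgroup_twoTwoTwo]
    unfold RowsLE
    decide +kernel
  · rw [card_youngSubgroup_twoTwoTwo] at hx
    exact Nat.lt_succ_iff.1 (sum_lt_twoTwoTwo hx)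

end TwoTwoTwo

end KendallCode

/-! ### The five optimal values and the bounds they imply -/

open KendallCode in
theorem mainTheorem4 :
    (IsOptimalValue (adjSwaps 6) (youngSubgroup 6 [2, 2, 2]) 116 ∧
      P 6 3 ≤ 116) ∧
    (IsOptimalValue (adjSwaps 7) (youngSubgroup 7 [5, 1, 1]) 716 ∧
      P 7 3 ≤ 716) ∧
    (IsOptimalValue (adjSwaps 11) (youngSubgroup 11 [9, 2]) ((Nat.factorial 10 : ℤ) - 10) ∧
      (P 11 3 : ℤ) ≤ (Nat.factorial 10 : ℤ) - 10) ∧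
    (IsOptimalValue (adjSwaps 13) (youngSubgroup 13 [11, 2]) ((Nat.factorial 12 : ℤ) - 12) ∧
      (P 13 3 : ℤ) ≤ (Nat.factorial 12 : ℤ) - 12) ∧
    (IsOptimalValue (adjSwaps 17) (youngSubgroup 17 [16, 1]) ((Nat.factorial 16 : ℤ) - 5) ∧
      (P 17 3 : ℤ) ≤ (Nat.factorial 16 : ℤ) - 5) := by
  refine ⟨⟨isOptimalValue_twoTwoTwo, ?_⟩, ⟨isOptimalValue_fiveOneOne, ?_⟩,
    ⟨isOptimalValue_nine_two, P_le_of_isOptimalValue isOptimalValue_nine_two⟩,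
    ⟨isOptimalValue_eleven_two, P_le_of_isOptimalValue isOptimalValue_eleven_two⟩,
    ⟨isOptimalValue_sixteen_one, P_le_of_isOptimalValue isOptimalValue_sixteen_one⟩⟩
  · exact_mod_cast P_le_of_isOptimalValue isOptimalValue_twoTwoTwo
  · exact_mod_cast P_le_of_isOptimalValue isOptimalValue_fiveOneOne
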